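/- Let $(M,g)$ be a smooth Riemannian manifold (finite-dimensional, Hausdorff, $\sigma$-compact, without boundary) and $\phi:M\to\mathbb R$ a smooth function such that $d\phi\ne0$ at every point of $\Gamma=\{\phi=0\}$ and $\Gamma$ is compact. Put $\Omega=\{\phi>0\}$ and $G=g/\phi$ on $\Omega$. **Billiard map.** Let $\hat\Omega=\{(x,\xi)\in M\times\mathbb R:\xi^2=2\phi(x)\}$, with $\pi(x,\xi)=x$. The Hamiltonian $H(x,p)=\phi(x)\|p\|_g^2$ of the geodesic flow of $G$ lifts to $T^*\hat\Omega\setminus\{\xi=0\}$ by $(y,p_y)\mapsto H(\pi(y),p_y\circ d\pi(y)^{-1})$. The lift extends smoothly to $T^*\hat\Omega$ as $$\hat H(y,p_y)=\tfrac12\,\|v\mapsto p_y(\xi v,d\phi(v))\|_g^2,\qquad y=(x,\xi),\ v\in T_xM,$$ where $(\xi v,d\phi(v))\in T_y\hat\Omega$. Consider the Hamiltonian flow of $\hat H$ for the standard symplectic form. The section $\mathcal S=\{\xi=0,\hat H=1\}$ is the union of two components $\mathcal S^\pm$, on which the $\xi$-momentum is $\eta=\pm\sqrt2/\|d\phi(q)\|_g$;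 each of them is identified with $T^*\Gamma$ by restricting the momentum to $T_q\Gamma$. The billiard map $T$, partially defined on $T^*\Gamma$, is the first return map to $\mathcal S$ of the flow started on $\mathcal S^+\cong T^*\Gamma$. **Semigeodesic coordinates.** These are a smooth diffeomorphism $f$ of $\Gamma\times[0,\delta]$, $\delta>0$, onto a neighbourhood of $\Gamma$ in $\overline\Omega$ with $f(q,0)=q$, $\phi(f(q,s))>0$ for $s>0$, and $$f^*G=\frac{ds^2+\langle B(q,s)\,dq,dq\rangle}{s}\qquad(s>0),$$ where $B(q,s)$ is a positive definite quadratic form on $T_q\Gamma$ depending smoothly on $(q,s)\in\Gamma\times[0,\delta]$. With $C=B^{-1}$ put, for $(q,p)\in T^*\Gamma$, $$K_0(q,p)=\langle C(q,0)p,p\rangle,\qquad K_1(q,p)=\langle \partial_sC(q,0)p,p\rangle,\qquad N=-K_0^{-1/2}+\tfrac38\,K_1K_0^{-5/2},$$ and let $\Phi_N^\tau$ be the flow of the Hamiltonian system on $T^*\Gamma$ with Hamiltonian $N$. Let $\|p\|$ be the norm on $T_q^*\Gamma$ dual to the norm given by $g$ on $T_q\Gamma$. **Claim.** Semigeodesic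 coordinates exist, and for any choice of them the following holds. 1. There is $\varepsilon_0>0$ such that for every $0<\varepsilon\le\varepsilon_0$ the maps $T$ and $\Phi_N^\pi$ are well defined (the images exist and are unique) on $\{(q,p)\in T^*\Gamma:\|p\|\ge\varepsilon^{-1}\}$. 2. $N(q,p)=-K_0^{-1/2}(q,p)+O(\|p\|^{-3})$ as $\|p\|\to\infty$, uniformly in $q\in\Gamma$. 3. $T(q,p)=\Phi_N^\pi(q,p)+\big(O(\|p\|^{-4}),O(\|p\|^{-3})\big)$ as $\|p\|\to\infty$. That is, for any local coordinates on an open subset $V$ of $\Gamma$ and any compact $K\subset V$ there are $\varepsilon>0$ and a constant $c$ such that for all $q\in K$ and $p\in T_q^*\Gamma$ with $\|p\|\ge\varepsilon^{-1}$ the base points of $T(q,p)$ and $\Phi_N^\pi(q,p)$ lie in $V$, their coordinates differ by at most $c\|p\|^{-4}$, and the coordinates of the momenta (conjugate to the local coordinates) differ by at most $c\|p\|^{-3}$. -/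

import Mathlib

open scoped Manifold ContDiff Topology

noncomputable section

namespace Billiard

/-! ### Hamiltonian systems on the cotangent bundle of an embedded submanifold

A submanifold of a manifold `X` is given by its set of points `S` and its tangent spaces
`T x ⊆ T_x X` (only the values for `x ∈ S` matter). Its dimension is the `d` of its local
coordinates. -/

section Submanifold

variable {EX : Type*} [NormedAddCommGroup EX] [NormedSpace ℝ EX]
  {HX : Type*} [TopologicalSpace HX] (I : ModelWithCorners ℝ EX HX)
  {X : Type*} [TopologicalSpace X] [ChartedSpace HX X]

/-- Points of the cotangent bundle `T*S`: a point `x` (it has to lie in `S`) and a linear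
functional on the tangent space `T x` of `S` at `x`. -/
abbrev Cotangent (T : ∀ x : X, Submodule ℝ (TangentSpace I x)) : Type _ :=
  Σ x : X, (T x →L[ℝ] ℝ)

/-- `u : V → S` is a smooth local parametrization of the embedded submanifold `S`, i.e. the inverse
of a local coordinate system: an immersion that maps the open set `V ⊆ ℝ^d` homeomorphically onto
an open subset of `S`. -/
structure IsLocalCoord (S : Set X) (T : ∀ x : X, Submodule ℝ (TangentSpace I x)) {d : ℕ}
    (u : EuclideanSpace ℝ (Fin d) → X) (V : Set (EuclideanSpace ℝ (Fin d))) : Prop where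
  isOpen : IsOpen V
  smooth : ContMDiffOn 𝓘(ℝ, EuclideanSpace ℝ (Fin d)) I ∞ u V
  mapsTo : Set.MapsTo u V S
  injOn : Set.InjOn u V
  openMap : ∀ V' ⊆ V, IsOpen V' → ∃ O : Set X, IsOpen O ∧ u '' V' = S ∩ O
  immersion : ∀ z ∈ V, Function.Injective (mfderiv 𝓘(ℝ, EuclideanSpace ℝ (Fin d)) I u z)
  tangent : ∀ z ∈ V, ∀ v : TangentSpace I (u z),
    v ∈ T (u z) ↔ ∃ e, mfderiv 𝓘(ℝ, EuclideanSpace ℝ (Fin d)) I u z e = v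

open Classical in
/-- The differential of a local parametrization, with values in the tangent space of `S`. -/
def frame (T : ∀ x : X, Submodule ℝ (TangentSpace I x)) {d : ℕ}
    (u : EuclideanSpace ℝ (Fin d) → X) (z : EuclideanSpace ℝ (Fin d)) :
    EuclideanSpace ℝ (Fin d) →L[ℝ] T (u z) :=
  if h : ∀ e, mfderiv 𝓘(ℝ, EuclideanSpace ℝ (Fin d)) I u z e ∈ T (u z) then
    (mfderiv 𝓘(ℝ, EuclideanSpace ℝ (Fin d)) I u z).codRestrict (T (u z)) h
  else 0

/-- The point of `T*S` with canonical coordinates `(z, w)`, where `w` is a covector on `ℝ^d`. -/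
def ofCoords (T : ∀ x : X, Submodule ℝ (TangentSpace I x)) {d : ℕ}
    (u : EuclideanSpace ℝ (Fin d) → X)
    (zw : EuclideanSpace ℝ (Fin d) × (EuclideanSpace ℝ (Fin d) →L[ℝ] ℝ)) : Cotangent I T :=
  ⟨u zw.1, zw.2.comp (frame I T u zw.1).inverse⟩

/-- `c` is a trajectory, over the time interval `J`, of the Hamiltonian system on `T*S` with
Hamiltonian `h` and the standard symplectic form: in local coordinates `z` on `S` and the conjugate
momenta `w` it satisfies Hamilton's equations `ż = ∂h/∂w`, `ẇ = -∂h/∂z`. -/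
def IsHamiltonianTrajectory (S : Set X) (T : ∀ x : X, Submodule ℝ (TangentSpace I x))
    (h : Cotangent I T → ℝ) (J : Set ℝ) (c : ℝ → Cotangent I T) : Prop :=
  ∀ t ∈ J, ∃ (d : ℕ) (u : EuclideanSpace ℝ (Fin d) → X) (V : Set (EuclideanSpace ℝ (Fin d)))
    (z : ℝ → EuclideanSpace ℝ (Fin d)) (w : ℝ → (EuclideanSpace ℝ (Fin d) →L[ℝ] ℝ))
    (z' : EuclideanSpace ℝ (Fin d)) (w' : EuclideanSpace ℝ (Fin d) →L[ℝ] ℝ)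
    (D : EuclideanSpace ℝ (Fin d) × (EuclideanSpace ℝ (Fin d) →L[ℝ] ℝ) →L[ℝ] ℝ),
    IsLocalCoord I S T u V ∧ z t ∈ V ∧
    (∀ᶠ τ in 𝓝[J] t, c τ = ofCoords I T u (z τ, w τ)) ∧
    HasDerivWithinAt z z' J t ∧ HasDerivWithinAt w w' J t ∧
    HasFDerivAt (fun zw => h (ofCoords I T u zw)) D (z t, w t) ∧
    ∀ (v : EuclideanSpace ℝ (Fin d)) (α : EuclideanSpace ℝ (Fin d) →L[ℝ] ℝ),
      D (v, α) = α z' - w' v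

/-- `b = Φ^τ(a)` for the flow `Φ` of the Hamiltonian system on `T*S` with Hamiltonian `h`
(`τ ≥ 0`). -/
def IsFlow (S : Set X) (T : ∀ x : X, Submodule ℝ (TangentSpace I x))
    (h : Cotangent I T → ℝ) (τ : ℝ) (a b : Cotangent I T) : Prop :=
  ∃ c : ℝ → Cotangent I T,
    IsHamiltonianTrajectory I S T h (Set.Icc 0 τ) c ∧ c 0 = a ∧ c τ = b

end Submanifold

section Setting

variable {E : Type*} [NormedAddCommGroup E] [NormedSpace ℝ E]
  {M : Type*} [TopologicalSpace M] [ChartedSpace E M] (φ : M → ℝ)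

/-- The differential of `φ` at `x`. -/
def dPhi (x : M) : TangentSpace 𝓘(ℝ, E) x →L[ℝ] ℝ := mfderiv 𝓘(ℝ, E) 𝓘(ℝ, ℝ) φ x

/-- `dφ(x)` as a functional on the model space `E = T_x M`. -/
def dPhiE (x : M) : E →L[ℝ] ℝ := dPhi φ x

/-! ### The boundary `Γ = {φ = 0}` -/

/-- The hypersurface `Γ`. -/
def bdry : Set M := {x | φ x = 0}

/-- The tangent space of `Γ`. -/
def bdryT (x : M) : Submodule ℝ (TangentSpace 𝓘(ℝ, E) x) := LinearMap.ker (dPhi φ x).toLinearMap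

/-- `T*Γ`. -/
abbrev BdryCotangent : Type _ := Cotangent 𝓘(ℝ, E) (bdryT (E := E) φ)

/-! ### The regularized system on `T*Ω̂` -/

/-- The regularized configuration space `Ω̂ = {(x, ξ) : ξ² = 2 φ(x)}`, the double of the closure of
`Ω = {φ > 0}`. -/
def dbl : Set (M × ℝ) := {y | y.2 ^ 2 = 2 * φ y.1}

/-- The tangent space `{(v, ζ) : ξ ζ = dφ(v)}` of `Ω̂` at `(x, ξ)`. -/
def dblT (y : M × ℝ) : Submodule ℝ (TangentSpace (𝓘(ℝ, E).prod 𝓘(ℝ, ℝ)) y) :=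
  LinearMap.ker (y.2 • ContinuousLinearMap.snd ℝ E ℝ -
    (dPhiE φ y.1).comp (ContinuousLinearMap.fst ℝ E ℝ)).toLinearMap

/-- `T*Ω̂`. -/
abbrev DblCotangent : Type _ := Cotangent (𝓘(ℝ, E).prod 𝓘(ℝ, ℝ)) (dblT (E := E) φ)

theorem mem_dblT (y : M × ℝ) (v : TangentSpace (𝓘(ℝ, E).prod 𝓘(ℝ, ℝ)) y) :
    v ∈ dblT (E := E) φ y ↔ y.2 * Prod.snd (α := E) (β := ℝ) v =
      dPhiE φ y.1 (Prod.fst (α := E) (β := ℝ) v) :=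
  sub_eq_zero (G := ℝ)

/-- The projection `(v, ζ) ↦ v`, from `T_(x, ξ) (M × ℝ)` to `T_x M`. -/
def tangentFst (y : M × ℝ) :
    TangentSpace (𝓘(ℝ, E).prod 𝓘(ℝ, ℝ)) y →L[ℝ] TangentSpace 𝓘(ℝ, E) y.1 :=
  ContinuousLinearMap.fst ℝ E ℝ

/-- The projection `(v, ζ) ↦ ζ`, from `T_(x, ξ) (M × ℝ)` to `ℝ`. -/
def tangentSnd (y : M × ℝ) : TangentSpace (𝓘(ℝ, E).prod 𝓘(ℝ, ℝ)) y →L[ℝ] ℝ :=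
  ContinuousLinearMap.snd ℝ E ℝ

/-- The map `v ↦ (ξ v, dφ(v))` from `T_x M` to `T_(x, ξ) (M × ℝ)`. -/
def liftTAmbient (y : M × ℝ) :
    TangentSpace 𝓘(ℝ, E) y.1 →L[ℝ] TangentSpace (𝓘(ℝ, E).prod 𝓘(ℝ, ℝ)) y :=
  (y.2 • ContinuousLinearMap.id ℝ E).prod (dPhiE φ y.1)

/-- The differential at `(x, ξ) ∈ Ω̂` of the projection `π : Ω̂ → M`. -/
def dProj (y : M × ℝ) : dblT (E := E) φ y →L[ℝ] TangentSpace 𝓘(ℝ, E) y.1 :=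
  (tangentFst y).comp (dblT φ y).subtypeL

/-- The map `v ↦ (ξ v, dφ(v))` from `T_x M` to the tangent space of `Ω̂` at `(x, ξ)`. -/
def liftT (y : M × ℝ) : TangentSpace 𝓘(ℝ, E) y.1 →L[ℝ] dblT (E := E) φ y :=
  (liftTAmbient φ y).codRestrict (dblT φ y)
    (fun v => (mem_dblT φ y _).2 ((dPhiE (E := E) φ y.1).map_smul y.2 (v : E)).symm)

/-- For `ξ ≠ 0` the differential of the projection is invertible, with inverse `ξ⁻¹ liftT`. -/
theorem liftT_dProj (y : M × ℝ) (v : dblT (E := E) φ y)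
    (w : TangentSpace 𝓘(ℝ, E) y.1) :
    liftT φ y (dProj φ y v) = y.2 • v ∧ dProj φ y (liftT φ y w) = y.2 • w := by
  refine ⟨?_, rfl⟩
  apply Subtype.ext
  exact Prod.ext rfl ((mem_dblT φ y v.1).1 v.2).symm

variable [IsManifold 𝓘(ℝ, E) ∞ M]
  (g : Bundle.ContMDiffRiemannianMetric 𝓘(ℝ, E) ∞ E (fun x : M => TangentSpace 𝓘(ℝ, E) x))

/-- The squared norm `⟨A⁻¹(x) p, p⟩` of a covector, where `A(x) : T_x M → T_x* M` is the operator
of the metric `g`. -/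
def coNormSq (x : M) (p : TangentSpace 𝓘(ℝ, E) x →L[ℝ] ℝ) : ℝ := p ((g.inner x).inverse p)

/-- The Hamiltonian `H(x, p) = φ(x) ‖p‖²` of the geodesic flow of `G = g / φ`. -/
def geodesicH (x : M) (p : TangentSpace 𝓘(ℝ, E) x →L[ℝ] ℝ) : ℝ := φ x * coNormSq g x p

/-- The norm `‖p‖` of `(q, p) ∈ T*Γ`, dual to the norm on `T_q Γ` defined by the metric `g`. -/
def bdryNorm (a : BdryCotangent (E := E) φ) : ℝ :=
  sSup {r | ∃ v : bdryT φ a.1, g.inner a.1 (v : TangentSpace 𝓘(ℝ, E) a.1) v ≤ 1 ∧ r = a.2 v}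

/-- The regularized Hamiltonian on `T*Ω̂`. The map `liftT` at `(x, ξ)` is `ξ` times the inverse of
`dπ` if `ξ ≠ 0`, so that this is the extension to `T*Ω̂` of `H ∘ Π`, where
`Π (y, p_y) = (π(y), p_y ∘ dπ(y)⁻¹)`; see `regularizedH_eq`. -/
def regularizedH (c : DblCotangent (E := E) φ) : ℝ :=
  (1 / 2) * coNormSq g c.1.1 (c.2.comp (liftT φ c.1))

/-- Outside `ξ = 0` the regularized Hamiltonian is `H ∘ Π`: if `p_y = p ∘ dπ(y)`, then
`Ĥ(y, p_y) = H(π(y), p)`. -/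
theorem regularizedH_eq (y : M × ℝ) (hy : y ∈ dbl φ) (p : TangentSpace 𝓘(ℝ, E) y.1 →L[ℝ] ℝ) :
    regularizedH φ g ⟨y, p.comp (dProj φ y)⟩ = geodesicH φ g y.1 p := by
  have h1 : (p.comp (dProj φ y)).comp (liftT φ y) = y.2 • p := by
    ext v
    exact p.map_smul y.2 v
  have h2 : y.2 ^ 2 = 2 * φ y.1 := hy
  simp only [regularizedH, geodesicH, coNormSq, h1, map_smul, smul_apply,
    smul_eq_mul]
  linear_combination (1 / 2) * p ((g.inner y.1).inverse p) * h2

/-! ### The billiard map -/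

/-- The projection to `T_q Γ` of the tangent space `T_q Γ × ℝ` of `Ω̂` at `(q, 0)`. -/
def sectionProj (q : M) : dblT (E := E) φ (q, 0) →L[ℝ] bdryT (E := E) φ q :=
  (dProj φ (q, (0 : ℝ))).codRestrict (bdryT φ q) (fun v => by
    have h := (mem_dblT φ (q, (0 : ℝ)) v.1).1 v.2
    rw [zero_mul] at h
    exact h.symm)

/-- The `ξ`-component of the tangent vectors of `Ω̂` at `(q, 0)`. -/
def sectionXi (q : M) : dblT (E := E) φ (q, 0) →L[ℝ] ℝ :=
  (tangentSnd (q, (0 : ℝ))).comp (dblT φ (q, 0)).subtypeL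

/-- The point of `T*Ω̂` over `(q, 0)` with momentum `p` along `Γ` and `ξ`-momentum
`η = σ √2 / ‖dφ(q)‖`. For `σ = 1` and `σ = -1` this identifies `T*Γ` with the components `𝓢⁺` and
`𝓢⁻` of the Poincaré section `𝓢 = {ξ = 0, Ĥ = 1}`. -/
def sectionPoint (σ : ℝ) (a : BdryCotangent (E := E) φ) : DblCotangent (E := E) φ :=
  ⟨(a.1, 0), a.2.comp (sectionProj φ a.1) +
    (σ * √(2 / coNormSq g a.1 (dPhi φ a.1))) • sectionXi φ a.1⟩

/-- The Poincaré section `𝓢 = {(y, p_y) ∈ T*Ω̂ : ξ = 0, Ĥ = 1}`. -/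
def poincareSection : Set (DblCotangent (E := E) φ) :=
  {c | c.1 ∈ dbl φ ∧ c.1.2 = 0 ∧ regularizedH φ g c = 1}

/-- `T(a) = b` for the billiard map `T`, the first return map of the regularized flow to the
section `𝓢 = 𝓢⁺ ∪ 𝓢⁻`, started on `𝓢⁺`, where `𝓢⁺` and `𝓢⁻` are identified with `T*Γ`. -/
def IsBilliardMap (a b : BdryCotangent (E := E) φ) : Prop :=
  a.1 ∈ bdry φ ∧ b.1 ∈ bdry φ ∧ ∃ (τ : ℝ) (c : ℝ → DblCotangent (E := E) φ), 0 < τ ∧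
    IsHamiltonianTrajectory (𝓘(ℝ, E).prod 𝓘(ℝ, ℝ)) (dbl φ) (dblT φ) (regularizedH φ g)
      (Set.Icc 0 τ) c ∧
    c 0 = sectionPoint φ g 1 a ∧ (c τ = sectionPoint φ g 1 b ∨ c τ = sectionPoint φ g (-1) b) ∧
    ∀ t ∈ Set.Ioo 0 τ, c t ∉ poincareSection φ g

/-! ### Semigeodesic coordinates and the averaged Hamiltonian -/

/-- `f : Γ × [0, δ] → M`, `(q, s) ↦ f(q, s)` are semigeodesic coordinates near `Γ`: a smooth
diffeomorphism onto a neighbourhood of `Γ` in the closure of `Ω = {φ > 0}` such that `f(q, 0) = q`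
and `f* G = (ds² + ⟨B(q, s) dq, dq⟩) / s`, where `B(q, s)` is a positive definite quadratic form
on `T_q Γ` that depends smoothly on `(q, s) ∈ Γ × [0, δ]`. -/
structure IsSemigeodesic (δ : ℝ) (f : M → ℝ → M)
    (B : ∀ q : M, ℝ → (bdryT (E := E) φ q →L[ℝ] bdryT (E := E) φ q →L[ℝ] ℝ)) : Prop where
  pos : 0 < δ
  map_zero : ∀ q ∈ bdry φ, f q 0 = q
  map_pos : ∀ q ∈ bdry φ, ∀ s ∈ Set.Ioc 0 δ, 0 < φ (f q s)
  injOn : Set.InjOn (fun x : M × ℝ => f x.1 x.2) (bdry φ ×ˢ Set.Icc 0 δ)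
  nhd : ∃ O : Set M, IsOpen O ∧ bdry φ ⊆ O ∧
    ∀ x ∈ O, 0 ≤ φ x → ∃ q ∈ bdry φ, ∃ s ∈ Set.Icc 0 δ, f q s = x
  symm : ∀ q ∈ bdry φ, ∀ s ∈ Set.Icc 0 δ, ∀ v w, B q s v w = B q s w v
  posDef : ∀ q ∈ bdry φ, ∀ s ∈ Set.Icc 0 δ, ∀ v, v ≠ 0 → 0 < B q s v v
  smooth : ∀ (d : ℕ) (u : EuclideanSpace ℝ (Fin d) → M) (V : Set (EuclideanSpace ℝ (Fin d))),
    IsLocalCoord 𝓘(ℝ, E) (bdry φ) (bdryT φ) u V →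
      ContMDiffOn 𝓘(ℝ, EuclideanSpace ℝ (Fin d) × ℝ) 𝓘(ℝ, E) ∞
        (fun zs : EuclideanSpace ℝ (Fin d) × ℝ => f (u zs.1) zs.2) (V ×ˢ Set.Icc 0 δ)
  immersion : ∀ (d : ℕ) (u : EuclideanSpace ℝ (Fin d) → M) (V : Set (EuclideanSpace ℝ (Fin d))),
    IsLocalCoord 𝓘(ℝ, E) (bdry φ) (bdryT φ) u V → ∀ zs ∈ V ×ˢ Set.Icc 0 δ,
      Function.Injective (mfderivWithin 𝓘(ℝ, EuclideanSpace ℝ (Fin d) × ℝ) 𝓘(ℝ, E)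
        (fun zs : EuclideanSpace ℝ (Fin d) × ℝ => f (u zs.1) zs.2) (V ×ˢ Set.Icc 0 δ) zs)
  smooth_form : ∀ (d : ℕ) (u : EuclideanSpace ℝ (Fin d) → M)
    (V : Set (EuclideanSpace ℝ (Fin d))),
    IsLocalCoord 𝓘(ℝ, E) (bdry φ) (bdryT φ) u V → ∀ v w : EuclideanSpace ℝ (Fin d),
      ContDiffOn ℝ ∞ (fun zs : EuclideanSpace ℝ (Fin d) × ℝ =>
        B (u zs.1) zs.2 (frame 𝓘(ℝ, E) (bdryT φ) u zs.1 v) (frame 𝓘(ℝ, E) (bdryT φ) u zs.1 w))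
        (V ×ˢ Set.Icc 0 δ)
  metric : ∀ (d : ℕ) (u : EuclideanSpace ℝ (Fin d) → M) (V : Set (EuclideanSpace ℝ (Fin d))),
    IsLocalCoord 𝓘(ℝ, E) (bdry φ) (bdryT φ) u V → ∀ z ∈ V, ∀ s ∈ Set.Ioc 0 δ,
      ∀ (v : EuclideanSpace ℝ (Fin d)) (ζ : ℝ) (X : TangentSpace 𝓘(ℝ, E) (f (u z) s)),
        X = mfderivWithin 𝓘(ℝ, EuclideanSpace ℝ (Fin d) × ℝ) 𝓘(ℝ, E)
          (fun zs : EuclideanSpace ℝ (Fin d) × ℝ => f (u zs.1) zs.2) (V ×ˢ Set.Icc 0 δ) (z, s)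
          ((v, ζ) : EuclideanSpace ℝ (Fin d) × ℝ) →
        g.inner (f (u z) s) X X / φ (f (u z) s) =
          (ζ ^ 2 + B (u z) s (frame 𝓘(ℝ, E) (bdryT φ) u z v)
            (frame 𝓘(ℝ, E) (bdryT φ) u z v)) / s

variable {φ}

/-- `K(q, p, s) = ⟨C(q, s) p, p⟩` with `C = B⁻¹`. -/
def formK (B : ∀ q : M, ℝ → (bdryT (E := E) φ q →L[ℝ] bdryT (E := E) φ q →L[ℝ] ℝ))
    (a : BdryCotangent (E := E) φ) (s : ℝ) : ℝ :=
  a.2 ((B a.1 s).inverse a.2)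

/-- `K₀(q, p) = ⟨C(q, 0) p, p⟩`. -/
def formK0 (B : ∀ q : M, ℝ → (bdryT (E := E) φ q →L[ℝ] bdryT (E := E) φ q →L[ℝ] ℝ))
    (a : BdryCotangent (E := E) φ) : ℝ :=
  formK B a 0

/-- `K₁(q, p) = ⟨C₁(q) p, p⟩` with `C₁(q) = ∂C/∂s (q, 0)`. -/
def formK1 (B : ∀ q : M, ℝ → (bdryT (E := E) φ q →L[ℝ] bdryT (E := E) φ q →L[ℝ] ℝ))
    (a : BdryCotangent (E := E) φ) : ℝ :=
  derivWithin (formK B a) (Set.Ici 0) 0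

/-- The Hamiltonian `N = -K₀^(-1/2) + (3/8) K₁ K₀^(-5/2)` on `T*Γ`. -/
def averagedN (B : ∀ q : M, ℝ → (bdryT (E := E) φ q →L[ℝ] bdryT (E := E) φ q →L[ℝ] ℝ))
    (a : BdryCotangent (E := E) φ) : ℝ :=
  -formK0 B a ^ (-(1 / 2) : ℝ) + 3 / 8 * (formK1 B a * formK0 B a ^ (-(5 / 2) : ℝ))

end Setting

end Billiard

end

open scoped Manifold ContDiff Topology

noncomputable section

namespace Billiard

/-! ### Smooth maps: inverse function theorem, cutoff, composition operators -/

/-! Near `Γ` take coordinates `(z, r)` on `M` with `r = φ` and with the `r`-direction normal to `Γ`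
along `Γ`. On the double, `(z, ξ)` with `r = ξ² / 2` are coordinates, and the regularized
Hamiltonian becomes `K(z, ξ² / 2, ξ p, η)`, where `K(z, r, m, η)` is half the squared norm of the
covector `(m, η)`. It is smooth across `ξ = 0`, and for `r = 0` one has `K = (⟨k(z) m, m⟩ + l(z) η²)
/ 2` with `k` the dual metric of `Γ` and `l = ‖dφ‖²` (`IsStraightening.regularizedH_dblPoint`,
`IsAdapted.chartK_base`).

Semigeodesic coordinates are obtained by shooting trajectories from `𝓢⁺` with zero momentum along
`Γ`. The equations are invariant under `(t, ξ, p) ↦ (-t, -ξ, -p)`, so along these trajectories `z`,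
`η` are even and `ξ`, `p` odd in `t`, and the base point at time `√s` is a smooth function of `s`.
The coefficient functions satisfy averaged integral equations, which are solved with smooth
dependence on the starting point by the inverse function theorem in spaces of paths
(`exists_smooth_averaged`, `IsAdapted.exists_family`). Gauss's lemma (`IsStraightening.gauss`) makes
the `s`-direction orthogonal to the variations of the starting point, and conservation of energy
normalizes its length, so that `G` takes the required form. The shooting map `radialMap` involves no
coordinates, hence the local pieces fit together, and compactness of `Γ` yields a common `δ` and
injectivity (`exists_isSemigeodesic`).

For the billiard map let `p = ε⁻¹ P` with `‖P‖ = 1`, and put `ξ = ε X`, `t = ε s`, `μ = ε²`. In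
these variables `z` and `P` move at a rate proportional to `μ`. For `μ = 0` they are frozen and `(X,
η)` is a harmonic oscillator of frequency `ν = √(l ⟨k P, P⟩)`, which returns to `X = 0` after the
half period `π / ν`. A Grönwall estimate and a discussion of the first zero of a perturbed sine show
that the return exists, that its time is `π / ν + O(μ)`, and that `(z, P)` is displaced by `μ` times
the integral of its unperturbed rate over the half period, up to `O(μ²)` (`exists_perturbation`,
`exists_first_zero`, `IsQuadraticBase.exists_return_scaled`).

For the flow of `N`, the limit of the metric at `s = 0` gives `K₀ = l ⟨k p, p⟩` in all semigeodesic
coordinates (`IsSemigeodesic.form_zero`). So `N` is the sum of `-1/ν`, homogeneous of degree `-1` in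
`p`, and of a term of degree `-3`; the second assertion follows at once. In the variables `(z, ε p)`
the Hamiltonian field is `ε²` times the field of `-1/ν` plus `O(ε⁴)`, and the correction of degree
`-3` belongs to the `O(ε⁴)`. The displacement in time `π` has the same leading term as the billiard
map, because `π` times the field of `-1/ν` is the averaged displacement of the oscillator of energy
`1` (`IsQuadraticBase.pi_smul_hamField_leadN`, `IsQuadraticBase.exists_slowFlow`).

Hence both maps agree up to `O(ε⁴)` in `(z, ε p)`, that is up to `O(‖p‖⁻⁴)` in the base point and,
after division by `ε`, up to `O(‖p‖⁻³)` in the momentum. Uniqueness of the images rests on the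
invariance of Hamilton's equations under coordinate changes and on uniqueness of trajectories
(`IsHamiltonianTrajectory.exists_coord`, `eq_of_isHamiltonianTrajectory`). All estimates are local
over `Γ` and become uniform by compactness (`exists_pos_of_isCompact`). -/

/-- The inverse function theorem, with smoothness of the inverse and invertibility of the
derivative on the whole source. -/
theorem exists_openPartialHomeomorph_of_contDiffOn {A B : Type*} [NormedAddCommGroup A]
    [NormedSpace ℝ A] [CompleteSpace A] [NormedAddCommGroup B] [NormedSpace ℝ B]
    {f : A → B} {s : Set A} (hs : IsOpen s) (hf : ContDiffOn ℝ ∞ f s) {a : A} (ha : a ∈ s)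
    (f' : A ≃L[ℝ] B) (hf' : HasFDerivAt f (f' : A →L[ℝ] B) a) :
    ∃ P : OpenPartialHomeomorph A B, (P : A → B) = f ∧ a ∈ P.source ∧ P.source ⊆ s ∧
      ContDiffOn ℝ ∞ P.symm P.target ∧
      ∀ x ∈ P.source, ∃ e : A ≃L[ℝ] B, HasFDerivAt f (e : A →L[ℝ] B) x := by
  have hfa : ContDiffAt ℝ ∞ f a := hf.contDiffAt (hs.mem_nhds ha)
  have h1 : (∞ : WithTop ℕ∞) ≠ 0 := by simp
  set P₀ := hfa.toOpenPartialHomeomorph f hf' h1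
  have hopen : IsOpen (s ∩ {x | fderiv ℝ f x ∈ Set.range ((↑) : (A ≃L[ℝ] B) → A →L[ℝ] B)}) :=
    (hf.continuousOn_fderiv_of_isOpen hs (by simp)).isOpen_inter_preimage hs
      ContinuousLinearEquiv.isOpen
  have hd : ∀ x ∈ s, HasFDerivAt f (fderiv ℝ f x) x := fun x hx =>
    ((hf.contDiffAt (hs.mem_nhds hx)).differentiableAt h1).hasFDerivAt
  refine ⟨P₀.restrOpen _ hopen, rfl, ?_, ?_, ?_, ?_⟩
  · refine ⟨hfa.mem_toOpenPartialHomeomorph_source hf' h1, ha, f', ?_⟩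
    exact hf'.fderiv.symm
  · exact fun x hx => hx.2.1
  · intro y hy
    set P := P₀.restrOpen _ hopen
    have hx : P.symm y ∈ P.source := P.map_target hy
    obtain ⟨e, he⟩ := hx.2.2
    refine (P.contDiffAt_symm (f₀' := e) hy ?_ ?_).contDiffWithinAt
    · rw [he]
      exact hd _ hx.2.1
    · exact hf.contDiffAt (hs.mem_nhds hx.2.1)
  · rintro x hx
    obtain ⟨e, he⟩ := hx.2.2
    exact ⟨e, by rw [he]; exact hd _ hx.2.1⟩

/-- Multiplication by a bump function supported in `s`. Superposition operators on path spaces need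
functions defined everywhere, while the equations of motion are smooth only on a chart. -/
theorem exists_contDiff_eventuallyEq {A B : Type*} [NormedAddCommGroup A]
    [NormedSpace ℝ A] [FiniteDimensional ℝ A] [NormedAddCommGroup B] [NormedSpace ℝ B]
    {f : A → B} {s : Set A} (hs : IsOpen s) (hf : ContDiffOn ℝ ∞ f s) {a : A} (ha : a ∈ s) :
    ∃ g : A → B, ContDiff ℝ ∞ g ∧ g =ᶠ[𝓝 a] f := by
  obtain ⟨r, hr, hrs⟩ := Metric.isOpen_iff.1 hs a ha
  let χ : ContDiffBump a := ⟨r / 4, r / 2, by positivity, by linarith⟩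
  refine ⟨fun x => χ x • f x, ?_, ?_⟩
  · rw [contDiff_iff_contDiffAt]
    intro x
    by_cases hx : x ∈ s
    · exact χ.contDiff.contDiffAt.smul (hf.contDiffAt (hs.mem_nhds hx))
    · have : (fun y => χ y • f y) =ᶠ[𝓝 x] fun _ => 0 := by
        have h2 : x ∉ tsupport χ := by
          rw [χ.tsupport_eq]
          intro h
          exact hx (hrs (Metric.closedBall_subset_ball (by change r / 2 < r; linarith) h))
        filter_upwards [(isClosed_tsupport χ).isOpen_compl.mem_nhds h2] with y hy
        rw [image_eq_zero_of_notMem_tsupport hy, zero_smul]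
      exact contDiffAt_const.congr_of_eventuallyEq this
  · filter_upwards [χ.eventuallyEq_one] with x hx
    simp [hx]

/-! ### Vectors as elements of the bidual -/

section DualVec

variable {F : Type*} [NormedAddCommGroup F] [NormedSpace ℝ F] [FiniteDimensional ℝ F]

/-- The vector that represents an element of the bidual of a finite dimensional space. -/
def dualVec : ((F →L[ℝ] ℝ) →L[ℝ] ℝ) →L[ℝ] F :=
  ∑ i, (ContinuousLinearMap.apply ℝ ℝ
    (LinearMap.toContinuousLinearMap ((Module.finBasis ℝ F).coord i))).smulRight
      (Module.finBasis ℝ F i)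

theorem apply_dualVec (θ : (F →L[ℝ] ℝ) →L[ℝ] ℝ) (α : F →L[ℝ] ℝ) : α (dualVec θ) = θ α := by
  have h : α = ∑ i, α (Module.finBasis ℝ F i) •
      LinearMap.toContinuousLinearMap ((Module.finBasis ℝ F).coord i) := by
    ext v
    conv_lhs => rw [← (Module.finBasis ℝ F).sum_repr v]
    simp only [map_sum, map_smul, smul_eq_mul, sum_apply, smul_apply,
      LinearMap.coe_toContinuousLinearMap', Module.Basis.coord_apply]
    exact Finset.sum_congr rfl fun _ _ => mul_comm _ _
  conv_rhs => rw [h]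
  simp [dualVec, mul_comm]

theorem dualVec_eq {θ : (F →L[ℝ] ℝ) →L[ℝ] ℝ} {v : F} (h : ∀ α : F →L[ℝ] ℝ, θ α = α v) :
    dualVec θ = v := by
  refine (Module.finBasis ℝ F).ext_elem fun i => ?_
  have := apply_dualVec θ (LinearMap.toContinuousLinearMap ((Module.finBasis ℝ F).coord i))
  rw [h] at this
  simpa using this

end DualVec

/-! ### Superposition and averaging operators on continuous paths -/

section Nemytskii

open unitInterval

variable {A B : Type} [NormedAddCommGroup A] [NormedSpace ℝ A] [NormedAddCommGroup B]
  [NormedSpace ℝ B]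

/-- Pointwise application of operator valued functions. -/
def applyPointwise : C(I, A →L[ℝ] B) →L[ℝ] C(I, A) →L[ℝ] C(I, B) :=
  LinearMap.mkContinuous₂
    (LinearMap.mk₂ ℝ (fun (L : C(I, A →L[ℝ] B)) (h : C(I, A)) =>
      (⟨fun t => L t (h t), by fun_prop⟩ : C(I, B)))
      (fun _ _ _ => by ext; simp) (fun _ _ _ => by ext; simp)
      (fun _ _ _ => by ext; simp) (fun _ _ _ => by ext; simp)) 1
    (fun L h => by
      rw [one_mul, ContinuousMap.norm_le _ (by positivity)]
      intro t
      exact (ContinuousLinearMap.le_opNorm _ _).trans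
        (mul_le_mul (L.norm_coe_le_norm t) (h.norm_coe_le_norm t) (norm_nonneg _)
          (norm_nonneg L)))

/-- The range of `α` is compact, so `fderiv ℝ f` varies by at most `c` on balls of a fixed radius
around its points. The mean value inequality on the ball around each `α t` then bounds the remainder
uniformly in `t`. -/
theorem hasFDerivAt_comp_continuousMap {f : A → B} (hf : ContDiff ℝ 1 f) (α : C(I, A)) :
    HasFDerivAt (fun β : C(I, A) => (⟨f, hf.continuous⟩ : C(A, B)).comp β)
      (applyPointwise ((⟨fderiv ℝ f, hf.continuous_fderiv one_ne_zero⟩ : C(A, A →L[ℝ] B)).comp α))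
      α := by
  rw [hasFDerivAt_iff_isLittleO, Asymptotics.isLittleO_iff]
  intro c hc
  have h1 := (isCompact_range α.continuous).uniformContinuousAt_of_continuousAt (fderiv ℝ f)
    (fun a _ => (hf.continuous_fderiv one_ne_zero).continuousAt) (Metric.dist_mem_uniformity hc)
  obtain ⟨δ, hδ, h2⟩ := Metric.mem_uniformity_dist.1 h1
  filter_upwards [Metric.ball_mem_nhds α hδ] with β hβ
  rw [ContinuousMap.norm_le _ (by positivity)]
  intro t
  have hβt : dist (β t) (α t) < δ := lt_of_le_of_lt (ContinuousMap.dist_apply_le_dist t) hβ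
  have h3 := (convex_ball (α t) δ).norm_image_sub_le_of_norm_hasFDerivWithin_le'
    (f := f) (f' := fderiv ℝ f) (φ := fderiv ℝ f (α t)) (C := c)
    (fun x _ => ((hf.differentiable one_ne_zero) x).hasFDerivAt.hasFDerivWithinAt)
    (fun x hx => by
      have := h2 (a := α t) (b := x) (by rw [dist_comm]; exact hx) ⟨t, rfl⟩
      rw [← dist_eq_norm, dist_comm]
      exact this.le)
    (Metric.mem_ball_self hδ) hβt
  refine h3.trans (mul_le_mul_of_nonneg_left ?_ hc.le)
  exact (β - α).norm_coe_le_norm t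

/-- The derivative is the superposition operator of `fderiv ℝ f` followed by the continuous linear
map `applyPointwise`, so each order of differentiability follows from the previous one. The codomain
changes in the induction, hence the quantification over `B`. -/
theorem contDiff_comp_continuousMap_nat (n : ℕ) : ∀ {B : Type} [NormedAddCommGroup B]
    [NormedSpace ℝ B] {f : A → B} (hf : ContDiff ℝ ∞ f),
    ContDiff ℝ n (fun β : C(I, A) => (⟨f, hf.continuous⟩ : C(A, B)).comp β) := by
  induction n with
  | zero =>
    intro B _ _ f hf
    refine contDiff_zero.2 ?_
    exact (⟨f, hf.continuous⟩ : C(A, B)).continuous_postcomp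
  | succ n ih =>
    intro B _ _ f hf
    have h1 : ContDiff ℝ 1 f := hf.of_le (by simp)
    have h2 : ContDiff ℝ ∞ (fderiv ℝ f) := hf.fderiv_right (by simp)
    refine contDiff_succ_iff_hasFDerivAt.2 ⟨_, ?_, fun α => hasFDerivAt_comp_continuousMap h1 α⟩
    have h3 : ContDiff ℝ n (fun L : C(I, A →L[ℝ] B) => applyPointwise L) := by
      apply ContinuousLinearMap.contDiff
    exact h3.comp (ih h2)

theorem contDiff_comp_continuousMap {f : A → B} (hf : ContDiff ℝ ∞ f) :
    ContDiff ℝ ∞ (fun β : C(I, A) => (⟨f, hf.continuous⟩ : C(A, B)).comp β) :=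
  contDiff_infty.2 fun n => contDiff_comp_continuousMap_nat n hf

/-- The averaging operator `u ↦ (ρ ↦ ∫₀¹ u(ρ θᵏ) dθ)`. -/
def average (k : ℕ) : C(I, B) →L[ℝ] C(I, B) :=
  LinearMap.mkContinuous
    { toFun := fun u => ⟨fun ρ => ∫ θ : I, u (ρ * θ ^ k), by
        have := continuous_parametric_integral_of_continuous (μ := MeasureTheory.volume)
          (f := fun (ρ θ : I) => u (ρ * θ ^ k)) (by fun_prop) (s := Set.univ) isCompact_univ
        simpa using this⟩
      map_add' := fun u v => by
        ext ρ
        exact MeasureTheory.integral_add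
          (Continuous.integrable_of_hasCompactSupport (by fun_prop) (HasCompactSupport.of_compactSpace _))
          (Continuous.integrable_of_hasCompactSupport (by fun_prop) (HasCompactSupport.of_compactSpace _))
      map_smul' := fun c u => by
        ext ρ
        exact MeasureTheory.integral_smul c _ } 1
    (fun u => by
      rw [one_mul, ContinuousMap.norm_le _ (norm_nonneg _)]
      intro ρ
      refine (MeasureTheory.norm_integral_le_of_norm_le_const (C := ‖u‖)
        (Filter.Eventually.of_forall fun θ => u.norm_coe_le_norm _)).trans ?_
      simp)

theorem average_apply (k : ℕ) (u : C(I, B)) (ρ : I) :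
    average k u ρ = ∫ θ : I, u (ρ * θ ^ k) := rfl

theorem average_const [CompleteSpace B] (k : ℕ) (b : B) :
    average k (ContinuousMap.const I b) = ContinuousMap.const I b := by
  ext ρ
  simp [average_apply]

theorem integral_unitInterval_eq (u : ℝ → B) : ∫ θ : I, u θ = ∫ θ in (0 : ℝ)..1, u θ := by
  rw [intervalIntegral.integral_of_le zero_le_one, ← MeasureTheory.integral_Icc_eq_integral_Ioc]
  exact MeasureTheory.integral_subtype measurableSet_Icc u

end Nemytskii

/-! ### Averaged integral equations with smooth solutions -/

section Averaged

open unitInterval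

variable {X Y₁ Y₂ : Type} [NormedAddCommGroup X] [NormedSpace ℝ X] [NormedAddCommGroup Y₁]
  [NormedSpace ℝ Y₁] [NormedAddCommGroup Y₂] [NormedSpace ℝ Y₂]

/-- Collects a parameter `x`, a scale `s` and two paths into the path
`t ↦ (x, α₁ t, α₂ t, s t)`. -/
def joinPaths : (X × ℝ) × (C(I, Y₁) × C(I, Y₂)) →L[ℝ] C(I, X × Y₁ × Y₂ × ℝ) :=
  LinearMap.mkContinuous
    { toFun := fun p => ⟨fun t => (p.1.1, p.2.1 t, p.2.2 t, p.1.2 * t), by fun_prop⟩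
      map_add' := fun p q => by ext t <;> simp [add_mul]
      map_smul' := fun c p => by ext t <;> simp [mul_assoc] } 1
    (fun p => by
      rw [one_mul, ContinuousMap.norm_le _ (norm_nonneg _)]
      intro t
      have h1 : ‖p.1.1‖ ≤ ‖p‖ := (norm_fst_le p.1).trans (norm_fst_le p)
      have h2 : ‖p.1.2‖ ≤ ‖p‖ := (norm_snd_le p.1).trans (norm_fst_le p)
      have h3 : ‖p.2.1 t‖ ≤ ‖p‖ :=
        (p.2.1.norm_coe_le_norm t).trans ((norm_fst_le p.2).trans (norm_snd_le p))
      have h4 : ‖p.2.2 t‖ ≤ ‖p‖ :=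
        (p.2.2.norm_coe_le_norm t).trans ((norm_snd_le p.2).trans (norm_snd_le p))
      have h5 : ‖p.1.2 * (t : ℝ)‖ ≤ ‖p‖ := by
        rw [norm_mul]
        refine (mul_le_of_le_one_right (norm_nonneg _) ?_).trans h2
        rw [Real.norm_eq_abs, abs_of_nonneg t.2.1]
        exact t.2.2
      simp only [LinearMap.coe_mk, AddHom.coe_mk, ContinuousMap.coe_mk]
      exact norm_prod_le_iff.2 ⟨h1, norm_prod_le_iff.2 ⟨h3, norm_prod_le_iff.2 ⟨h4, h5⟩⟩⟩)

@[simp]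
theorem joinPaths_apply (p : (X × ℝ) × (C(I, Y₁) × C(I, Y₂))) (t : I) :
    joinPaths p t = (p.1.1, p.2.1 t, p.2.2 t, p.1.2 * t) := rfl

-- For fixed `(x, s)` the unknowns are the paths `t ↦ y₁ (x, s t)` and `t ↦ y₂ (x, s t)`. The
-- equations become `Θ = ((x, s), (0, 0))` in a space of paths, and `Θ` is smooth because its terms
-- are averages of superposition operators. By `h₁` and `h₂` the linearization at the constant paths
-- is, in the path variables, the identity plus a strictly triangular operator, so the inverse
-- function theorem applies. Evaluation at `t = 1` defines `y₁` and `y₂`, and local uniqueness shows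
-- that the whole path consists of such values.
set_option maxHeartbeats 1600000 in
theorem exists_smooth_averaged_global [CompleteSpace X] [CompleteSpace Y₁] [CompleteSpace Y₂]
    {f₁ : X × Y₁ × Y₂ × ℝ → Y₁} {f₂ : X × Y₁ × Y₂ × ℝ → Y₂} {x₀ : X} {a₁ : Y₁} {a₂ : Y₂}
    {U : Set (X × Y₁ × Y₂ × ℝ)} (hU : U ∈ 𝓝 (x₀, a₁, a₂, (0 : ℝ)))
    (hf₁ : ContDiff ℝ ∞ f₁) (hf₂ : ContDiff ℝ ∞ f₂)
    (ha₁ : f₁ (x₀, a₁, a₂, 0) = a₁) (ha₂ : f₂ (x₀, a₁, a₂, 0) = a₂)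
    (h₁ : ∀ v, fderiv ℝ f₁ (x₀, a₁, a₂, 0) (0, v, 0, 0) = 0)
    (h₂ : ∀ v w, fderiv ℝ f₂ (x₀, a₁, a₂, 0) (0, v, w, 0) = 0) :
    ∃ (W : Set X) (ε : ℝ) (y₁ : X × ℝ → Y₁) (y₂ : X × ℝ → Y₂), IsOpen W ∧ x₀ ∈ W ∧ 0 < ε ∧
      ContDiffOn ℝ ∞ y₁ (W ×ˢ Set.Ioo (-ε) ε) ∧ ContDiffOn ℝ ∞ y₂ (W ×ˢ Set.Ioo (-ε) ε) ∧
      y₁ (x₀, 0) = a₁ ∧ y₂ (x₀, 0) = a₂ ∧ ∀ x ∈ W, ∀ s ∈ Set.Ioo (-ε) ε,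
        (x, y₁ (x, s), y₂ (x, s), s) ∈ U ∧
        y₁ (x, s) = ∫ θ in (0 : ℝ)..1, f₁ (x, y₁ (x, s * θ), y₂ (x, s * θ), s * θ) ∧
        y₂ (x, s) = ∫ θ in (0 : ℝ)..1,
          f₂ (x, y₁ (x, s * θ ^ 2), y₂ (x, s * θ ^ 2), s * θ ^ 2) := by
  set b : X × Y₁ × Y₂ × ℝ := (x₀, a₁, a₂, 0) with hb
  set p₀ : (X × ℝ) × (C(I, Y₁) × C(I, Y₂)) :=
    ((x₀, 0), (ContinuousMap.const I a₁, ContinuousMap.const I a₂)) with hp₀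
  have hj₀ : joinPaths p₀ = ContinuousMap.const I b := by
    ext t <;> simp [hp₀, hb]
  set N₁ : C(I, X × Y₁ × Y₂ × ℝ) → C(I, Y₁) := fun β =>
    (⟨f₁, hf₁.continuous⟩ : C(X × Y₁ × Y₂ × ℝ, Y₁)).comp β with hN₁
  set N₂ : C(I, X × Y₁ × Y₂ × ℝ) → C(I, Y₂) := fun β =>
    (⟨f₂, hf₂.continuous⟩ : C(X × Y₁ × Y₂ × ℝ, Y₂)).comp β with hN₂
  have hN₁c : ContDiff ℝ ∞ N₁ := contDiff_comp_continuousMap hf₁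
  have hN₂c : ContDiff ℝ ∞ N₂ := contDiff_comp_continuousMap hf₂
  have hN₁d := hasFDerivAt_comp_continuousMap (hf₁.of_le (m := 1) (by simp)) (joinPaths p₀)
  have hN₂d := hasFDerivAt_comp_continuousMap (hf₂.of_le (m := 1) (by simp)) (joinPaths p₀)
  have hjc : ContDiff ℝ ∞ (joinPaths (X := X) (Y₁ := Y₁) (Y₂ := Y₂)) := by
    apply ContinuousLinearMap.contDiff
  have hjd : HasFDerivAt (joinPaths (X := X) (Y₁ := Y₁) (Y₂ := Y₂)) joinPaths p₀ := by
    apply ContinuousLinearMap.hasFDerivAt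
  have pf1 := hf₁.continuous_fderiv (by simp)
  have pf2 := hf₂.continuous_fderiv (by simp)
  set Θ : (X × ℝ) × (C(I, Y₁) × C(I, Y₂)) → (X × ℝ) × (C(I, Y₁) × C(I, Y₂)) := fun p =>
    (p.1, (p.2.1 - average 1 (N₁ (joinPaths p)), p.2.2 - average 2 (N₂ (joinPaths p)))) with hΘ
  have hΘc : ContDiff ℝ ∞ Θ := by
    have e1 : ContDiff ℝ ∞ (fun p : (X × ℝ) × (C(I, Y₁) × C(I, Y₂)) =>
        average 1 (N₁ (joinPaths p))) :=
      (average (B := Y₁) 1).contDiff.comp (hN₁c.comp hjc)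
    have e2 : ContDiff ℝ ∞ (fun p : (X × ℝ) × (C(I, Y₁) × C(I, Y₂)) =>
        average 2 (N₂ (joinPaths p))) :=
      (average (B := Y₂) 2).contDiff.comp (hN₂c.comp hjc)
    exact contDiff_fst.prodMk (((contDiff_fst.comp contDiff_snd).sub e1).prodMk
      ((contDiff_snd.comp contDiff_snd).sub e2))
  have hΘd : HasFDerivAt Θ ((ContinuousLinearMap.fst ℝ (X × ℝ) (C(I, Y₁) × C(I, Y₂))).prod
      (((ContinuousLinearMap.fst ℝ _ _).comp (ContinuousLinearMap.snd ℝ _ _) -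
        (average 1).comp ((applyPointwise ((⟨fderiv ℝ f₁, pf1⟩ :
          C(X × Y₁ × Y₂ × ℝ, _)).comp (joinPaths p₀))).comp joinPaths)).prod
      ((ContinuousLinearMap.snd ℝ _ _).comp (ContinuousLinearMap.snd ℝ _ _) -
        (average 2).comp ((applyPointwise ((⟨fderiv ℝ f₂, pf2⟩ :
          C(X × Y₁ × Y₂ × ℝ, _)).comp (joinPaths p₀))).comp joinPaths)))) p₀ :=
    hasFDerivAt_fst.prodMk
      ((((ContinuousLinearMap.fst ℝ _ _).comp (ContinuousLinearMap.snd ℝ _ _)).hasFDerivAt.sub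
        ((average (B := Y₁) 1).hasFDerivAt.comp p₀
          (hN₁d.comp p₀ hjd))).prodMk
      (((ContinuousLinearMap.snd ℝ _ _).comp (ContinuousLinearMap.snd ℝ _ _)).hasFDerivAt.sub
        ((average (B := Y₂) 2).hasFDerivAt.comp p₀
          (hN₂d.comp p₀ hjd))))
  set D := ((ContinuousLinearMap.fst ℝ (X × ℝ) (C(I, Y₁) × C(I, Y₂))).prod
      (((ContinuousLinearMap.fst ℝ _ _).comp (ContinuousLinearMap.snd ℝ _ _) -
        (average 1).comp ((applyPointwise ((⟨fderiv ℝ f₁, pf1⟩ :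
          C(X × Y₁ × Y₂ × ℝ, _)).comp (joinPaths p₀))).comp joinPaths)).prod
      ((ContinuousLinearMap.snd ℝ _ _).comp (ContinuousLinearMap.snd ℝ _ _) -
        (average 2).comp ((applyPointwise ((⟨fderiv ℝ f₂, pf2⟩ :
          C(X × Y₁ × Y₂ × ℝ, _)).comp (joinPaths p₀))).comp joinPaths)))) with hD
  -- At constant paths the superposition operators linearize to composition with one fixed linear
  -- map.
  let L₁ : C(I, X × Y₁ × Y₂ × ℝ) →L[ℝ] C(I, Y₁) :=
    ContinuousLinearMap.compLeftContinuous ℝ I (fderiv ℝ f₁ b)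
  let L₂ : C(I, X × Y₁ × Y₂ × ℝ) →L[ℝ] C(I, Y₂) :=
    ContinuousLinearMap.compLeftContinuous ℝ I (fderiv ℝ f₂ b)
  have hDapp : ∀ p, D p = (p.1, (p.2.1 - average 1 (L₁ (joinPaths p)),
      p.2.2 - average 2 (L₂ (joinPaths p)))) := by
    intro p
    have e1 : applyPointwise ((⟨fderiv ℝ f₁, pf1⟩ :
          C(X × Y₁ × Y₂ × ℝ, _)).comp (joinPaths p₀)) (joinPaths p) = L₁ (joinPaths p) := by
      ext t
      rw [hj₀]
      rfl
    have e2 : applyPointwise ((⟨fderiv ℝ f₂, pf2⟩ :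
          C(X × Y₁ × Y₂ × ℝ, _)).comp (joinPaths p₀)) (joinPaths p) = L₂ (joinPaths p) := by
      ext t
      rw [hj₀]
      rfl
    rw [← e1, ← e2]
    rfl
  have hL₁ : ∀ (c : X × ℝ) (u : C(I, Y₁)) (v : C(I, Y₂)),
      L₁ (joinPaths (c, (u, v))) = L₁ (joinPaths (c, ((0 : C(I, Y₁)), v))) := by
    intro c u v
    ext t
    have : ((c.1, u t, v t, c.2 * t) : X × Y₁ × Y₂ × ℝ) =
      (c.1, 0, v t, c.2 * t) + (0, u t, 0, 0) := by simp
    change fderiv ℝ f₁ b (c.1, u t, v t, c.2 * t) = fderiv ℝ f₁ b (c.1, 0, v t, c.2 * t)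
    rw [this, map_add, h₁, add_zero]
  have hL₂ : ∀ (c : X × ℝ) (u : C(I, Y₁)) (v : C(I, Y₂)),
      L₂ (joinPaths (c, (u, v))) = L₂ (joinPaths (c, ((0 : C(I, Y₁)), (0 : C(I, Y₂))))) := by
    intro c u v
    ext t
    have : ((c.1, u t, v t, c.2 * t) : X × Y₁ × Y₂ × ℝ) =
      (c.1, 0, 0, c.2 * t) + (0, u t, v t, 0) := by simp
    change fderiv ℝ f₂ b (c.1, u t, v t, c.2 * t) = fderiv ℝ f₂ b (c.1, 0, 0, c.2 * t)
    rw [this, map_add, h₂, add_zero]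
  have hker : D.toLinearMap.ker = ⊥ := by
    rw [LinearMap.ker_eq_bot']
    rintro ⟨c, u, v⟩ h
    have h : D (c, u, v) = 0 := h
    rw [hDapp] at h
    have hc : c = 0 := congrArg Prod.fst h
    have hv : v - average 2 (L₂ (joinPaths (c, (u, v)))) = 0 := congrArg (fun q => q.2.2) h
    have hu : u - average 1 (L₁ (joinPaths (c, (u, v)))) = 0 := congrArg (fun q => q.2.1) h
    have z : ((0 : X × ℝ), ((0 : C(I, Y₁)), (0 : C(I, Y₂)))) = 0 := rfl
    rw [hL₂, hc, z, map_zero, map_zero, map_zero, sub_zero] at hv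
    rw [hL₁, hc, hv, z, map_zero, map_zero, map_zero, sub_zero] at hu
    rw [hc, hu, hv]
    rfl
  have hrange : D.toLinearMap.range = ⊤ := by
    rw [LinearMap.range_eq_top]
    rintro ⟨c, u, v⟩
    -- Back substitution: the averaged term of the second equation contains neither path, that of
    -- the first only the second path.
    set v' := v + average 2 (L₂ (joinPaths (c, ((0 : C(I, Y₁)), (0 : C(I, Y₂)))))) with hv'
    set u' := u + average 1 (L₁ (joinPaths (c, ((0 : C(I, Y₁)), v')))) with hu'
    refine ⟨(c, u', v'), ?_⟩
    change D (c, u', v') = _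
    rw [hDapp]
    simp only [hL₂ c u' v', hL₁ c u' v']
    rw [hu', hv', add_sub_cancel_right, add_sub_cancel_right]
  set e := ContinuousLinearEquiv.ofBijective D hker hrange with he
  have hDe : (e : _ →L[ℝ] _) = D := ContinuousLinearEquiv.coe_ofBijective D hker hrange
  obtain ⟨P, hP, hp₀s, -, hPc, -⟩ := exists_openPartialHomeomorph_of_contDiffOn
    isOpen_univ hΘc.contDiffOn (Set.mem_univ p₀) e (by rw [hDe]; exact hΘd)
  have hΘp₀ : Θ p₀ = ((x₀, 0), (0, 0)) := by
    have e1 : N₁ (ContinuousMap.const I b) = ContinuousMap.const I a₁ := by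
      ext t; exact ha₁
    have e2 : N₂ (ContinuousMap.const I b) = ContinuousMap.const I a₂ := by
      ext t; exact ha₂
    have e3 : Θ p₀ = (p₀.1, (p₀.2.1 - average 1 (N₁ (joinPaths p₀)),
      p₀.2.2 - average 2 (N₂ (joinPaths p₀)))) := rfl
    rw [e3, hj₀, e1, e2, average_const, average_const]
    simp only [hp₀, sub_self]
  have hT : ((x₀, (0 : ℝ)), ((0 : C(I, Y₁)), (0 : C(I, Y₂)))) ∈ P.target := by
    rw [← hΘp₀, ← hP]
    exact P.map_source hp₀s
  have hsymm₀ : P.symm ((x₀, (0 : ℝ)), ((0 : C(I, Y₁)), (0 : C(I, Y₂)))) = p₀ := by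
    rw [← hΘp₀, ← hP, P.left_inv hp₀s]
  -- a ball on which everything is under control
  have hev : Continuous (fun p : (X × ℝ) × (C(I, Y₁) × C(I, Y₂)) =>
      ((p.1.1, p.2.1 1, p.2.2 1, p.1.2) : X × Y₁ × Y₂ × ℝ)) := by
    have e1 : Continuous (fun p : (X × ℝ) × (C(I, Y₁) × C(I, Y₂)) => p.2.1 1) :=
      (continuous_eval_const (1 : I)).comp (continuous_fst.comp continuous_snd)
    have e2 : Continuous (fun p : (X × ℝ) × (C(I, Y₁) × C(I, Y₂)) => p.2.2 1) :=
      (continuous_eval_const (1 : I)).comp (continuous_snd.comp continuous_snd)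
    fun_prop
  have hnb : P.source ∩ {p | ((p.1.1, p.2.1 1, p.2.2 1, p.1.2) : X × Y₁ × Y₂ × ℝ) ∈ U} ∈
      𝓝 p₀ := by
    refine Filter.inter_mem (P.open_source.mem_nhds hp₀s) (hev.continuousAt.preimage_mem_nhds ?_)
    exact hU
  obtain ⟨r, hr, hrs⟩ := Metric.mem_nhds_iff.1 hnb
  have hcont : ContinuousAt (fun q : X × ℝ => P.symm (q, ((0 : C(I, Y₁)), (0 : C(I, Y₂)))))
      (x₀, 0) := by
    have := (P.continuousAt_symm hT)
    exact ContinuousAt.comp (f := fun q : X × ℝ => (q, ((0 : C(I, Y₁)), (0 : C(I, Y₂))))) this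
      (by fun_prop)
  have hmem : ∀ᶠ q : X × ℝ in 𝓝 (x₀, 0), (q, ((0 : C(I, Y₁)), (0 : C(I, Y₂)))) ∈ P.target ∧
      P.symm (q, ((0 : C(I, Y₁)), (0 : C(I, Y₂)))) ∈ Metric.ball p₀ r := by
    refine Filter.Eventually.and ?_ ?_
    · have : ContinuousAt (fun q : X × ℝ => (q, ((0 : C(I, Y₁)), (0 : C(I, Y₂))))) (x₀, 0) := by
        fun_prop
      exact this.preimage_mem_nhds (P.open_target.mem_nhds hT)
    · refine hcont.preimage_mem_nhds ?_
      rw [hsymm₀]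
      exact Metric.ball_mem_nhds _ hr
  obtain ⟨ε, hε, hball⟩ := Metric.eventually_nhds_iff_ball.1 hmem
  have hbox : ∀ x ∈ Metric.ball x₀ ε, ∀ s ∈ Set.Ioo (-ε) ε, (x, s) ∈ Metric.ball (x₀, (0 : ℝ)) ε := by
    intro x hx s hs
    rw [← ball_prod_same]
    refine ⟨hx, ?_⟩
    rw [Metric.mem_ball, Real.dist_eq, sub_zero, abs_lt]
    exact hs
  set sol : X × ℝ → (X × ℝ) × (C(I, Y₁) × C(I, Y₂)) := fun q =>
    P.symm (q, ((0 : C(I, Y₁)), (0 : C(I, Y₂)))) with hsol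
  have hsolΘ : ∀ x ∈ Metric.ball x₀ ε, ∀ s ∈ Set.Ioo (-ε) ε,
      Θ (sol (x, s)) = ((x, s), (0, 0)) := by
    intro x hx s hs
    have := P.right_inv (hball _ (hbox x hx s hs)).1
    rw [hP] at this
    exact this
  have hsolc : ContDiffOn ℝ ∞ sol (Metric.ball x₀ ε ×ˢ Set.Ioo (-ε) ε) := by
    refine hPc.comp (f := fun q : X × ℝ => (q, ((0 : C(I, Y₁)), (0 : C(I, Y₂)))))
      (contDiff_id.prodMk contDiff_const).contDiffOn ?_
    rintro ⟨x, s⟩ ⟨hx, hs⟩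
    exact (hball _ (hbox x hx s hs)).1
  -- values of the solution along the path
  have hscale : ∀ x ∈ Metric.ball x₀ ε, ∀ s ∈ Set.Ioo (-ε) ε, ∀ t : I,
      (sol (x, s)).2.1 t = (sol (x, s * t)).2.1 1 ∧ (sol (x, s)).2.2 t = (sol (x, s * t)).2.2 1 := by
    intro x hx s hs t
    have hst : s * (t : ℝ) ∈ Set.Ioo (-ε) ε := by
      have h1 : |s * (t : ℝ)| ≤ |s| := by
        rw [abs_mul, abs_of_nonneg t.2.1]
        exact mul_le_of_le_one_right (abs_nonneg _) t.2.2
      exact abs_lt.1 (h1.trans_lt (abs_lt.2 hs))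
    set p := sol (x, s) with hp
    have hpb : p ∈ Metric.ball p₀ r := (hball _ (hbox x hx s hs)).2
    have hp1 : p.1 = (x, s) := by
      have := congrArg Prod.fst (hsolΘ x hx s hs)
      exact this
    -- Restricting the path at scale `s` to `[0, t]` and stretching it gives a solution at scale `s
    -- t`. It stays in the ball around `p₀` contained in the source of `P`, so it is the solution
    -- selected by the inverse.
    let m : C(I, I) := ⟨fun τ => τ * t, by fun_prop⟩
    set p' : (X × ℝ) × (C(I, Y₁) × C(I, Y₂)) := ((x, s * t), (p.2.1.comp m, p.2.2.comp m)) with hp'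
    have hp'b : p' ∈ Metric.ball p₀ r := by
      rw [Metric.mem_ball, Prod.dist_eq, max_lt_iff, Prod.dist_eq, Prod.dist_eq, max_lt_iff,
        max_lt_iff] at hpb ⊢
      rw [hp1] at hpb
      obtain ⟨⟨q1, q2⟩, q3, q4⟩ := hpb
      refine ⟨⟨q1, lt_of_le_of_lt ?_ q2⟩, lt_of_le_of_lt ?_ q3, lt_of_le_of_lt ?_ q4⟩
      · simp only [hp', hp₀, Real.dist_eq, sub_zero, abs_mul, abs_of_nonneg t.2.1]
        exact mul_le_of_le_one_right (abs_nonneg _) t.2.2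
      · rw [ContinuousMap.dist_le dist_nonneg]
        intro τ
        exact ContinuousMap.dist_apply_le_dist (f := p.2.1) (g := p₀.2.1) (m τ)
      · rw [ContinuousMap.dist_le dist_nonneg]
        intro τ
        exact ContinuousMap.dist_apply_le_dist (f := p.2.2) (g := p₀.2.2) (m τ)
    have hj' : joinPaths p' = (joinPaths p).comp m := by
      have q1 : p.1.1 = x := by rw [hp1]
      have q2 : p.1.2 = s := by rw [hp1]
      ext τ
      · simp [hp', q1]
      · simp [hp']
      · simp [hp']
      · simp [hp', q2, m]
        ring
    -- Averaging involves only the values at `ρ θᵏ` and therefore commutes with dilations of the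
    -- path.
    have hav : ∀ {B : Type} [NormedAddCommGroup B] [NormedSpace ℝ B] (k : ℕ) (u : C(I, B)),
        average k (u.comp m) = (average k u).comp m := by
      intro B _ _ k u
      ext τ
      simp only [average_apply, ContinuousMap.comp_apply, m, ContinuousMap.coe_mk]
      congr 1
      ext θ
      congr 1
      rw [mul_right_comm]
    have hΘ' : Θ p' = ((x, s * t), (0, 0)) := by
      have e1 : N₁ (joinPaths p') = (N₁ (joinPaths p)).comp m := by rw [hj']; rfl
      have e2 : N₂ (joinPaths p') = (N₂ (joinPaths p)).comp m := by rw [hj']; rfl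
      have q3 : p.2.1 - average 1 (N₁ (joinPaths p)) = 0 :=
        congrArg (fun q => q.2.1) (hsolΘ x hx s hs)
      have q4 : p.2.2 - average 2 (N₂ (joinPaths p)) = 0 :=
        congrArg (fun q => q.2.2) (hsolΘ x hx s hs)
      simp only [hΘ, e1, e2, hav]
      refine Prod.ext rfl (Prod.ext ?_ ?_)
      · change p.2.1.comp m - (average 1 (N₁ (joinPaths p))).comp m = 0
        rw [← sub_eq_zero.1 q3, sub_self]
      · change p.2.2.comp m - (average 2 (N₂ (joinPaths p))).comp m = 0
        rw [← sub_eq_zero.1 q4, sub_self]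
    have hpp : p' = sol (x, s * t) := by
      have := P.left_inv (hrs hp'b).1
      rw [hP, hΘ'] at this
      exact this.symm
    rw [← hpp]
    simp [hp', m]
  refine ⟨Metric.ball x₀ ε, ε, fun q => (sol q).2.1 1, fun q => (sol q).2.2 1,
    Metric.isOpen_ball, Metric.mem_ball_self hε, hε, ?_, ?_, ?_, ?_, ?_⟩
  · have : ContDiff ℝ ∞ (fun p : (X × ℝ) × (C(I, Y₁) × C(I, Y₂)) => p.2.1 1) :=
      ((ContinuousMap.evalCLM ℝ (1 : I)).contDiff (E := C(I, Y₁))).comp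
        (contDiff_fst.comp contDiff_snd)
    exact this.comp_contDiffOn hsolc
  · have : ContDiff ℝ ∞ (fun p : (X × ℝ) × (C(I, Y₁) × C(I, Y₂)) => p.2.2 1) :=
      ((ContinuousMap.evalCLM ℝ (1 : I)).contDiff (E := C(I, Y₂))).comp
        (contDiff_snd.comp contDiff_snd)
    exact this.comp_contDiffOn hsolc
  · simp only [hsol, hsymm₀, hp₀, ContinuousMap.const_apply]
  · simp only [hsol, hsymm₀, hp₀, ContinuousMap.const_apply]
  · intro x hx s hs
    have hp1 : (sol (x, s)).1 = (x, s) := congrArg Prod.fst (hsolΘ x hx s hs)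
    have q1 : (sol (x, s)).1.1 = x := by rw [hp1]
    have q2 : (sol (x, s)).1.2 = s := by rw [hp1]
    refine ⟨?_, ?_, ?_⟩
    · have := (hrs (hball _ (hbox x hx s hs)).2).2
      simp only [Set.mem_ofPred_eq] at this
      have e1 : (P.symm ((x, s), ((0 : C(I, Y₁)), (0 : C(I, Y₂))))).1 = (x, s) := hp1
      rw [e1] at this
      exact this
    · have q3 : (sol (x, s)).2.1 - average 1 (N₁ (joinPaths (sol (x, s)))) = 0 :=
        congrArg (fun q => q.2.1) (hsolΘ x hx s hs)
      rw [← integral_unitInterval_eq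
        (fun θ => f₁ (x, (sol (x, s * θ)).2.1 1, (sol (x, s * θ)).2.2 1, s * θ))]
      change (sol (x, s)).2.1 1 = _
      conv_lhs => rw [sub_eq_zero.1 q3, average_apply]
      congr 1
      ext θ
      rw [one_mul, pow_one]
      change f₁ (joinPaths (sol (x, s)) θ) = _
      rw [joinPaths_apply, q1, q2, (hscale x hx s hs θ).1, (hscale x hx s hs θ).2]
    · have q3 : (sol (x, s)).2.2 - average 2 (N₂ (joinPaths (sol (x, s)))) = 0 :=
        congrArg (fun q => q.2.2) (hsolΘ x hx s hs)
      rw [← integral_unitInterval_eq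
        (fun θ => f₂ (x, (sol (x, s * θ ^ 2)).2.1 1, (sol (x, s * θ ^ 2)).2.2 1, s * θ ^ 2))]
      change (sol (x, s)).2.2 1 = _
      conv_lhs => rw [sub_eq_zero.1 q3, average_apply]
      congr 1
      ext θ
      rw [one_mul]
      change f₂ (joinPaths (sol (x, s)) (θ ^ 2)) = _
      rw [joinPaths_apply, q1, q2, (hscale x hx s hs (θ ^ 2)).1, (hscale x hx s hs (θ ^ 2)).2]
      rfl

/-- Smooth solutions of a system of averaged integral equations, near a point where the system
is strictly triangular. -/
theorem exists_smooth_averaged [FiniteDimensional ℝ X] [FiniteDimensional ℝ Y₁]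
    [FiniteDimensional ℝ Y₂]
    {f₁ : X × Y₁ × Y₂ × ℝ → Y₁} {f₂ : X × Y₁ × Y₂ × ℝ → Y₂} {x₀ : X} {a₁ : Y₁} {a₂ : Y₂}
    {U : Set (X × Y₁ × Y₂ × ℝ)} (hU : IsOpen U) (h₀ : (x₀, a₁, a₂, (0 : ℝ)) ∈ U)
    (hf₁ : ContDiffOn ℝ ∞ f₁ U) (hf₂ : ContDiffOn ℝ ∞ f₂ U)
    (ha₁ : f₁ (x₀, a₁, a₂, 0) = a₁) (ha₂ : f₂ (x₀, a₁, a₂, 0) = a₂)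
    (h₁ : ∀ v, fderiv ℝ f₁ (x₀, a₁, a₂, 0) (0, v, 0, 0) = 0)
    (h₂ : ∀ v w, fderiv ℝ f₂ (x₀, a₁, a₂, 0) (0, v, w, 0) = 0) :
    ∃ (W : Set X) (ε : ℝ) (y₁ : X × ℝ → Y₁) (y₂ : X × ℝ → Y₂), IsOpen W ∧ x₀ ∈ W ∧ 0 < ε ∧
      ContDiffOn ℝ ∞ y₁ (W ×ˢ Set.Ioo (-ε) ε) ∧ ContDiffOn ℝ ∞ y₂ (W ×ˢ Set.Ioo (-ε) ε) ∧
      y₁ (x₀, 0) = a₁ ∧ y₂ (x₀, 0) = a₂ ∧ ∀ x ∈ W, ∀ s ∈ Set.Ioo (-ε) ε,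
        (x, y₁ (x, s), y₂ (x, s), s) ∈ U ∧
        y₁ (x, s) = ∫ θ in (0 : ℝ)..1, f₁ (x, y₁ (x, s * θ), y₂ (x, s * θ), s * θ) ∧
        y₂ (x, s) = ∫ θ in (0 : ℝ)..1,
          f₂ (x, y₁ (x, s * θ ^ 2), y₂ (x, s * θ ^ 2), s * θ ^ 2) := by
  have := FiniteDimensional.complete ℝ X
  have := FiniteDimensional.complete ℝ Y₁
  have := FiniteDimensional.complete ℝ Y₂
  -- The global version is applied to cut-off functions. The neighbourhood passed to it is the set
  -- where they coincide with the given ones, so the cutoff is invisible along the solution.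
  obtain ⟨g₁, hg₁, e₁⟩ := exists_contDiff_eventuallyEq hU hf₁ h₀
  obtain ⟨g₂, hg₂, e₂⟩ := exists_contDiff_eventuallyEq hU hf₂ h₀
  obtain ⟨W, ε, y₁, y₂, hW, hx₀, hε, c₁, c₂, i₁, i₂, h⟩ := exists_smooth_averaged_global
    (U := {q | q ∈ U ∧ g₁ q = f₁ q ∧ g₂ q = f₂ q}) (x₀ := x₀) (a₁ := a₁) (a₂ := a₂)
    (Filter.inter_mem (hU.mem_nhds h₀) (Filter.inter_mem e₁ e₂)) hg₁ hg₂ (by rw [e₁.eq_of_nhds, ha₁])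
    (by rw [e₂.eq_of_nhds, ha₂]) (by rw [e₁.fderiv_eq]; exact h₁) (by rw [e₂.fderiv_eq]; exact h₂)
  have hθ : ∀ s ∈ Set.Ioo (-ε) ε, ∀ θ ∈ Set.Icc (0 : ℝ) 1, s * θ ∈ Set.Ioo (-ε) ε := by
    intro s hs θ hθ
    have h1 : |s * θ| ≤ |s| := by
      rw [abs_mul, abs_of_nonneg hθ.1]
      exact mul_le_of_le_one_right (abs_nonneg _) hθ.2
    exact abs_lt.1 (h1.trans_lt (abs_lt.2 hs))
  refine ⟨W, ε, y₁, y₂, hW, hx₀, hε, c₁, c₂, i₁, i₂, fun x hx s hs => ?_⟩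
  obtain ⟨q1, q2, q3⟩ := h x hx s hs
  refine ⟨q1.1, q2.trans (intervalIntegral.integral_congr fun θ hθ' => ?_),
    q3.trans (intervalIntegral.integral_congr fun θ hθ' => ?_)⟩
  · rw [Set.uIcc_of_le zero_le_one] at hθ'
    exact (h x hx _ (hθ s hs θ hθ')).1.2.1
  · rw [Set.uIcc_of_le zero_le_one] at hθ'
    exact (h x hx _ (hθ s hs (θ ^ 2) ⟨by positivity, pow_le_one₀ hθ'.1 hθ'.2⟩)).1.2.2

end Averaged

/-! ### Local coordinates on embedded submanifolds -/

/-- The coordinate space `ℝ^d`. -/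
abbrev Coord (d : ℕ) : Type := EuclideanSpace ℝ (Fin d)

section Charts

variable {EX : Type*} [NormedAddCommGroup EX] [NormedSpace ℝ EX]
  {HX : Type*} [TopologicalSpace HX] {I : ModelWithCorners ℝ EX HX}
  {X : Type*} [TopologicalSpace X] [ChartedSpace HX X]
  {S : Set X} {T : ∀ x : X, Submodule ℝ (TangentSpace I x)}
  {d d' : ℕ} {u : Coord d → X} {V : Set (Coord d)} {u' : Coord d' → X} {V' : Set (Coord d')}

/-- The differential of a parametrization, with values in the model space. -/
def paramDeriv (I : ModelWithCorners ℝ EX HX) {A : Type*} [NormedAddCommGroup A] [NormedSpace ℝ A]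
    (u : A → X) (z : A) : A →L[ℝ] EX :=
  mfderiv 𝓘(ℝ, A) I u z

theorem IsLocalCoord.mono (hu : IsLocalCoord I S T u V) {N : Set (Coord d)} (hN : IsOpen N)
    (hNV : N ⊆ V) : IsLocalCoord I S T u N where
  isOpen := hN
  smooth := hu.smooth.mono hNV
  mapsTo := hu.mapsTo.mono_left hNV
  injOn := hu.injOn.mono hNV
  openMap := fun V' hV' => hu.openMap V' (hV'.trans hNV)
  immersion := fun z hz => hu.immersion z (hNV hz)
  tangent := fun z hz => hu.tangent z (hNV hz)

theorem IsLocalCoord.continuousOn (hu : IsLocalCoord I S T u V) : ContinuousOn u V :=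
  hu.smooth.continuousOn

theorem IsLocalCoord.contMDiffAt (hu : IsLocalCoord I S T u V) {z : Coord d} (hz : z ∈ V) :
    ContMDiffAt 𝓘(ℝ, Coord d) I ∞ u z :=
  hu.smooth.contMDiffAt (hu.isOpen.mem_nhds hz)

theorem IsLocalCoord.mdifferentiableAt (hu : IsLocalCoord I S T u V) {z : Coord d} (hz : z ∈ V) :
    MDifferentiableAt 𝓘(ℝ, Coord d) I u z :=
  (hu.contMDiffAt hz).mdifferentiableAt (by simp)

theorem frame_apply (hu : IsLocalCoord I S T u V) {z : Coord d} (hz : z ∈ V) (e : Coord d) :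
    ((frame I T u z e : T (u z)) : TangentSpace I (u z)) = paramDeriv I u z e := by
  have h : ∀ e, mfderiv 𝓘(ℝ, Coord d) I u z e ∈ T (u z) := fun e =>
    (hu.tangent z hz _).2 ⟨e, rfl⟩
  have h1 : frame I T u z = (mfderiv 𝓘(ℝ, Coord d) I u z).codRestrict (T (u z)) h := dif_pos h
  exact congrArg (fun L : Coord d →L[ℝ] T (u z) => ((L e : T (u z)) : TangentSpace I (u z))) h1

theorem exists_frameEquiv (hu : IsLocalCoord I S T u V) {z : Coord d} (hz : z ∈ V) :
    ∃ A : Coord d ≃L[ℝ] T (u z), (A : Coord d →L[ℝ] T (u z)) = frame I T u z := by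
  have hinj : Function.Injective (frame I T u z).toLinearMap := by
    intro e₁ e₂ h
    apply hu.immersion z hz
    have h1 : frame I T u z e₁ = frame I T u z e₂ := h
    have h2 := frame_apply hu hz e₁
    rw [h1, frame_apply hu hz e₂] at h2
    exact h2.symm
  have hsurj : Function.Surjective (frame I T u z).toLinearMap := by
    intro v
    obtain ⟨e, he⟩ := (hu.tangent z hz v.1).1 v.2
    refine ⟨e, Subtype.ext ?_⟩
    exact (frame_apply hu hz e).trans he
  let A₀ := LinearEquiv.ofBijective (frame I T u z).toLinearMap ⟨hinj, hsurj⟩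
  have : T2Space (TangentSpace I (u z)) := inferInstanceAs (T2Space EX)
  have : FiniteDimensional ℝ (T (u z)) := LinearEquiv.finiteDimensional A₀
  exact ⟨A₀.toContinuousLinearEquiv, by ext; rfl⟩

theorem frame_inverse_frame (hu : IsLocalCoord I S T u V) {z : Coord d} (hz : z ∈ V)
    (e : Coord d) : (frame I T u z).inverse (frame I T u z e) = e := by
  obtain ⟨A, hA⟩ := exists_frameEquiv hu hz
  rw [← hA, ContinuousLinearMap.inverse_equiv]
  exact A.symm_apply_apply e

theorem frame_surjective (hu : IsLocalCoord I S T u V) {z : Coord d} (hz : z ∈ V) :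
    Function.Surjective (frame I T u z) := by
  obtain ⟨A, hA⟩ := exists_frameEquiv hu hz
  rw [← hA]
  exact A.surjective

theorem frame_injective (hu : IsLocalCoord I S T u V) {z : Coord d} (hz : z ∈ V) :
    Function.Injective (frame I T u z) := by
  obtain ⟨A, hA⟩ := exists_frameEquiv hu hz
  rw [← hA]
  exact A.injective

/-- The two functionals live on different subspaces until the base points are identified. Comparing
them on vectors of the model space avoids transport along that equality. -/
theorem cotangent_ext {a b : Cotangent I T} (h₁ : a.1 = b.1)
    (h₂ : ∀ (v : EX) (h : v ∈ T a.1) (h' : v ∈ T b.1), a.2 ⟨v, h⟩ = b.2 ⟨v, h'⟩) : a = b := by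
  obtain ⟨x, p⟩ := a
  obtain ⟨y, q⟩ := b
  obtain rfl : x = y := h₁
  congr 1
  ext v
  exact h₂ v.1 v.2 v.2

theorem eq_ofCoords (hu : IsLocalCoord I S T u V) {z : Coord d} (hz : z ∈ V)
    {w : Coord d →L[ℝ] ℝ} {a : Cotangent I T} (h₁ : a.1 = u z)
    (h₂ : ∀ (e : Coord d) (h : paramDeriv I u z e ∈ T a.1), a.2 ⟨paramDeriv I u z e, h⟩ = w e) :
    a = ofCoords I T u (z, w) := by
  refine cotangent_ext h₁ fun v h h' => ?_
  obtain ⟨e, he⟩ := frame_surjective hu hz ⟨v, h'⟩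
  have hv : v = paramDeriv I u z e := by rw [← frame_apply hu hz, he]
  subst hv
  rw [h₂ e h]
  have : (⟨paramDeriv I u z e, h'⟩ : T (u z)) = frame I T u z e :=
    Subtype.ext (frame_apply hu hz e).symm
  change w e = w ((frame I T u z).inverse ⟨paramDeriv I u z e, h'⟩)
  rw [this, frame_inverse_frame hu hz]

theorem ofCoords_apply (hu : IsLocalCoord I S T u V) {z : Coord d} (hz : z ∈ V)
    (w : Coord d →L[ℝ] ℝ) (e : Coord d) (h : paramDeriv I u z e ∈ T (u z)) :
    (ofCoords I T u (z, w)).2 ⟨paramDeriv I u z e, h⟩ = w e := by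
  have : (⟨paramDeriv I u z e, h⟩ : T (u z)) = frame I T u z e :=
    Subtype.ext (frame_apply hu hz e).symm
  change w ((frame I T u z).inverse ⟨paramDeriv I u z e, h⟩) = w e
  rw [this, frame_inverse_frame hu hz]

theorem ofCoords_injOn (hu : IsLocalCoord I S T u V) {z z' : Coord d} (hz : z ∈ V) (hz' : z' ∈ V)
    {w w' : Coord d →L[ℝ] ℝ} (h : ofCoords I T u (z, w) = ofCoords I T u (z', w')) :
    z = z' ∧ w = w' := by
  have hzz : z = z' := hu.injOn hz hz' (congrArg Sigma.fst h)
  subst hzz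
  refine ⟨rfl, ?_⟩
  have h2 : w.comp (frame I T u z).inverse = w'.comp (frame I T u z).inverse :=
    eq_of_heq (Sigma.mk.inj h).2
  ext e
  have := congrArg (fun L => L (frame I T u z e)) h2
  simpa [frame_inverse_frame hu hz] using this

theorem exists_eq_ofCoords (hu : IsLocalCoord I S T u V) {z : Coord d} (a : Cotangent I T)
    (h : a.1 = u z) : ∃ w, a = ofCoords I T u (z, w) ∨ z ∉ V := by
  obtain ⟨x, p⟩ := a
  obtain rfl : x = u z := h
  by_cases hz : z ∈ V
  · refine ⟨p.comp (frame I T u z), Or.inl (eq_ofCoords hu hz rfl fun e h => ?_)⟩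
    have : (⟨paramDeriv I u z e, h⟩ : T (u z)) = frame I T u z e :=
      Subtype.ext (frame_apply hu hz e).symm
    exact congrArg p this
  · exact ⟨0, Or.inr hz⟩

theorem mfderiv_eq_fderiv_extChartAt {A : Type*} [NormedAddCommGroup A] [NormedSpace ℝ A]
    {u : A → X} {z : A} (hu : MDifferentiableAt 𝓘(ℝ, A) I u z) :
    paramDeriv I u z = fderiv ℝ (fun y => extChartAt I (u z) (u y)) z := by
  have h1 : fderivWithin ℝ (writtenInExtChartAt 𝓘(ℝ, A) I z u) (Set.range 𝓘(ℝ, A))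
      ((extChartAt 𝓘(ℝ, A) z) z) = fderiv ℝ (fun y => extChartAt I (u z) (u y)) z := by
    simp only [writtenInExtChartAt, extChartAt_model_space_eq_id, PartialEquiv.refl_symm,
      PartialEquiv.refl_coe, modelWithCornersSelf_coe, Set.range_id, fderivWithin_univ, id,
      Function.comp_def]
  rw [← h1]
  exact hu.mfderiv

theorem paramDeriv_comp {A A' : Type*} [NormedAddCommGroup A] [NormedSpace ℝ A]
    [NormedAddCommGroup A'] [NormedSpace ℝ A'] {u : A → X} {u' : A' → X} {τ : A → A'} {z : A}
    (hu' : MDifferentiableAt 𝓘(ℝ, A') I u' (τ z)) (hτ : DifferentiableAt ℝ τ z)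
    (h : ∀ᶠ y in 𝓝 z, u' (τ y) = u y) :
    paramDeriv I u z = (paramDeriv I u' (τ z)).comp (fderiv ℝ τ z) := by
  have h1 : (u' ∘ τ) =ᶠ[𝓝 z] u := h
  have h2 := mfderiv_comp z hu' hτ.mdifferentiableAt
  have h3 := h1.mfderiv_eq (I := 𝓘(ℝ, A)) (I' := I)
  rw [h2, mfderiv_eq_fderiv] at h3
  exact h3.symm

/-- The chain rule relates the two frames by `fderiv ℝ τ z`, so momenta transform by its transpose.
-/
theorem ofCoords_transition (hu : IsLocalCoord I S T u V) (hu' : IsLocalCoord I S T u' V')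
    {τ : Coord d → Coord d'} {z : Coord d} (hz : z ∈ V) (hτz : τ z ∈ V')
    (hτ : DifferentiableAt ℝ τ z) (h : ∀ᶠ y in 𝓝 z, u' (τ y) = u y) (w : Coord d' →L[ℝ] ℝ) :
    ofCoords I T u' (τ z, w) = ofCoords I T u (z, w.comp (fderiv ℝ τ z)) := by
  refine eq_ofCoords hu hz h.self_of_nhds fun e he => ?_
  have h1 : paramDeriv I u z e = paramDeriv I u' (τ z) (fderiv ℝ τ z e) := by
    rw [paramDeriv_comp (hu'.mdifferentiableAt hτz) hτ h]
    rfl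
  have he' : paramDeriv I u' (τ z) (fderiv ℝ τ z e) ∈ T (u' (τ z)) := by
    rw [← h1]; exact he
  have h2 := ofCoords_apply hu' hτz w (fderiv ℝ τ z e) he'
  rw [ContinuousLinearMap.comp_apply, ← h2]
  congr 2

variable [FiniteDimensional ℝ EX] [IsManifold I ∞ X]

/-- Local coordinates extend to a smooth map on a neighbourhood in the ambient manifold. -/
theorem IsLocalCoord.exists_retraction (hu : IsLocalCoord I S T u V) {z₀ : Coord d} (hz₀ : z₀ ∈ V) :
    ∃ (O : Set X) (ρ : X → Coord d), IsOpen O ∧ u z₀ ∈ O ∧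
      ContMDiffOn I 𝓘(ℝ, Coord d) ∞ ρ O ∧ ∀ x ∈ S ∩ O, ρ x ∈ V ∧ u (ρ x) = x := by
  set e := extChartAt I (u z₀) with he
  have hopen : IsOpen (V ∩ u ⁻¹' e.source) :=
    hu.continuousOn.isOpen_inter_preimage hu.isOpen (isOpen_extChartAt_source (u z₀))
  have hsm : ContDiffOn ℝ ∞ (fun z => e (u z)) (V ∩ u ⁻¹' e.source) := by
    rw [← contMDiffOn_iff_contDiffOn]
    have h := contMDiffOn_extChartAt (I := I) (n := ∞) (x := u z₀)
    refine h.comp (hu.smooth.mono Set.inter_subset_left) ?_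
    intro z hz
    have := hz.2
    rw [Set.mem_preimage, he, extChartAt_source] at this
    exact this
  have hz₀' : z₀ ∈ V ∩ u ⁻¹' e.source := ⟨hz₀, mem_extChartAt_source (u z₀)⟩
  have hd : HasFDerivAt (fun z => e (u z)) (paramDeriv I u z₀) z₀ := by
    rw [mfderiv_eq_fderiv_extChartAt (hu.mdifferentiableAt hz₀)]
    exact ((hsm.contDiffAt (hopen.mem_nhds hz₀')).differentiableAt (by simp)).hasFDerivAt
  have hinj : Function.Injective (paramDeriv I u z₀) := hu.immersion z₀ hz₀
  -- A left inverse of the injective differential. Composed with it, the immersion in the chart of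
  -- `X` has derivative the identity and is locally invertible.
  obtain ⟨L₀, hL₀⟩ := (paramDeriv I u z₀).toLinearMap.exists_leftInverse_of_injective
    (LinearMap.ker_eq_bot.2 hinj)
  set L : EX →L[ℝ] Coord d := LinearMap.toContinuousLinearMap L₀ with hL
  have hLd : L.comp (paramDeriv I u z₀) = (ContinuousLinearEquiv.refl ℝ (Coord d) : _ →L[ℝ] _) := by
    apply ContinuousLinearMap.coe_injective
    ext1 v
    exact congrArg (fun f => f v) hL₀
  obtain ⟨P, hP, hzP, hPs, hPc, -⟩ := exists_openPartialHomeomorph_of_contDiffOn hopen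
    (L.contDiff.comp_contDiffOn hsm) hz₀' (ContinuousLinearEquiv.refl ℝ (Coord d)) (by
      rw [← hLd]; exact L.hasFDerivAt.comp z₀ hd)
  -- An embedding is needed here, not only an immersion: other sheets of `S` have to stay away from
  -- the neighbourhood.
  obtain ⟨O₁, hO₁, hO₁S⟩ := hu.openMap P.source (hPs.trans Set.inter_subset_left) P.open_source
  have hLe : ContinuousOn (fun x => L (e x)) e.source :=
    L.continuous.comp_continuousOn (continuousOn_extChartAt (u z₀))
  refine ⟨O₁ ∩ (e.source ∩ (fun x => L (e x)) ⁻¹' P.target), fun x => P.symm (L (e x)),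
    hO₁.inter (hLe.isOpen_inter_preimage (isOpen_extChartAt_source (u z₀)) P.open_target), ?_, ?_, ?_⟩
  · refine ⟨?_, mem_extChartAt_source (u z₀), ?_⟩
    · have : u z₀ ∈ S ∩ O₁ := by rw [← hO₁S]; exact ⟨z₀, hzP, rfl⟩
      exact this.2
    · have := P.map_source hzP
      rw [hP] at this
      exact this
  · have h1 : ContMDiffOn I 𝓘(ℝ, EX) ∞ e e.source := by
      have h := contMDiffOn_extChartAt (I := I) (n := ∞) (x := u z₀)
      rw [he, extChartAt_source]
      exact h
    have h2 : ContMDiffOn I 𝓘(ℝ, Coord d) ∞ (fun x => L (e x)) e.source :=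
      L.contMDiff.comp_contMDiffOn h1
    refine hPc.contMDiffOn.comp (h2.mono ?_) ?_
    · exact fun x hx => hx.2.1
    · exact fun x hx => hx.2.2
  · rintro x ⟨hxS, hxO⟩
    have : x ∈ u '' P.source := by rw [hO₁S]; exact ⟨hxS, hxO.1⟩
    obtain ⟨z, hz, rfl⟩ := this
    have h3 : P.symm (L (e (u z))) = z := by
      have := P.left_inv hz
      rw [hP] at this
      exact this
    simp only [h3]
    exact ⟨(hPs hz).1, trivial⟩

/-- The transition is the ambient extension of the second coordinate system composed with the first
parametrization. This avoids an inverse function theorem between parameter spaces whose dimensions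
are not known to agree. -/
theorem exists_transition_aux (hu : IsLocalCoord I S T u V) (hu' : IsLocalCoord I S T u' V')
    {z₀ : Coord d} {z₀' : Coord d'} (hz₀ : z₀ ∈ V) (hz₀' : z₀' ∈ V') (h : u z₀ = u' z₀') :
    ∃ (N : Set (Coord d)) (τ : Coord d → Coord d'), IsOpen N ∧ z₀ ∈ N ∧ N ⊆ V ∧
      ContDiffOn ℝ ∞ τ N ∧ ∀ z ∈ N, τ z ∈ V' ∧ u' (τ z) = u z := by
  obtain ⟨O, ρ, hO, hO₀, hρ, hinv⟩ := hu'.exists_retraction hz₀'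
  refine ⟨V ∩ u ⁻¹' O, fun z => ρ (u z), hu.continuousOn.isOpen_inter_preimage hu.isOpen hO,
    ⟨hz₀, by rw [Set.mem_preimage, h]; exact hO₀⟩, Set.inter_subset_left, ?_, ?_⟩
  · rw [← contMDiffOn_iff_contDiffOn]
    exact hρ.comp (hu.smooth.mono Set.inter_subset_left) fun z hz => hz.2
  · exact fun z hz => hinv _ ⟨hu.mapsTo hz.1, hz.2⟩

theorem exists_transition (hu : IsLocalCoord I S T u V) (hu' : IsLocalCoord I S T u' V')
    {z₀ : Coord d} {z₀' : Coord d'} (hz₀ : z₀ ∈ V) (hz₀' : z₀' ∈ V') (h : u z₀ = u' z₀') :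
    ∃ (N : Set (Coord d)) (N' : Set (Coord d')) (τ : Coord d → Coord d') (τ' : Coord d' → Coord d),
      IsOpen N ∧ IsOpen N' ∧ z₀ ∈ N ∧ z₀' ∈ N' ∧ N ⊆ V ∧ N' ⊆ V' ∧
      ContDiffOn ℝ ∞ τ N ∧ ContDiffOn ℝ ∞ τ' N' ∧
      (∀ z ∈ N, τ z ∈ N' ∧ u' (τ z) = u z ∧ τ' (τ z) = z) ∧
      (∀ z ∈ N', τ' z ∈ N ∧ u (τ' z) = u' z ∧ τ (τ' z) = z) := by
  obtain ⟨N₁, τ, hN₁, h₁, hN₁V, hτ, hτu⟩ := exists_transition_aux hu hu' hz₀ hz₀' h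
  obtain ⟨N₂, τ', hN₂, h₂, hN₂V, hτ', hτu'⟩ := exists_transition_aux hu' hu hz₀' hz₀ h.symm
  have e1 : ∀ z ∈ N₁, τ z ∈ N₂ → τ' (τ z) = z := fun z hz hz2 =>
    hu.injOn (hτu' _ hz2).1 (hN₁V hz) ((hτu' _ hz2).2.trans (hτu z hz).2)
  have e2 : ∀ z ∈ N₂, τ' z ∈ N₁ → τ (τ' z) = z := fun z hz hz2 =>
    hu'.injOn (hτu _ hz2).1 (hN₂V hz) ((hτu _ hz2).2.trans (hτu' z hz).2)
  have i1 : τ z₀ = z₀' := hu'.injOn (hτu z₀ h₁).1 hz₀' ((hτu z₀ h₁).2.trans h)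
  have i2 : τ' z₀' = z₀ := hu.injOn (hτu' z₀' h₂).1 hz₀ ((hτu' z₀' h₂).2.trans h.symm)
  refine ⟨N₁ ∩ τ ⁻¹' N₂, N₂ ∩ τ' ⁻¹' N₁, τ, τ', hτ.continuousOn.isOpen_inter_preimage hN₁ hN₂,
    hτ'.continuousOn.isOpen_inter_preimage hN₂ hN₁, ⟨h₁, ?_⟩, ⟨h₂, ?_⟩,
    Set.inter_subset_left.trans hN₁V, Set.inter_subset_left.trans hN₂V,
    hτ.mono Set.inter_subset_left, hτ'.mono Set.inter_subset_left, ?_, ?_⟩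
  · rw [Set.mem_preimage, i1]; exact h₂
  · rw [Set.mem_preimage, i2]; exact h₁
  · rintro z ⟨hz, hz2⟩
    refine ⟨⟨hz2, ?_⟩, (hτu z hz).2, e1 z hz hz2⟩
    rw [Set.mem_preimage, e1 z hz hz2]; exact hz
  · rintro z ⟨hz, hz2⟩
    refine ⟨⟨hz2, ?_⟩, (hτu' z hz).2, e2 z hz hz2⟩
    rw [Set.mem_preimage, e2 z hz hz2]; exact hz

end Charts

/-! ### Hamilton's equations in coordinates: invariance and uniqueness -/

section Hamilton

/-- Hamilton's equations at time `t` for the curve `(z, w)` in `F × F*`, where the time derivatives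
are taken within `J`. -/
def HamiltonAt {F : Type*} [NormedAddCommGroup F] [NormedSpace ℝ F] (h : F × (F →L[ℝ] ℝ) → ℝ)
    (J : Set ℝ) (z : ℝ → F) (w : ℝ → F →L[ℝ] ℝ) (t : ℝ) : Prop :=
  ∃ (z' : F) (w' : F →L[ℝ] ℝ) (D : F × (F →L[ℝ] ℝ) →L[ℝ] ℝ),
    HasDerivWithinAt z z' J t ∧ HasDerivWithinAt w w' J t ∧ HasFDerivAt h D (z t, w t) ∧
    ∀ (v : F) (α : F →L[ℝ] ℝ), D (v, α) = α z' - w' v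

/-- The Hamiltonian vector field on `F × F*`. -/
def hamField {F : Type*} [NormedAddCommGroup F] [NormedSpace ℝ F] [FiniteDimensional ℝ F]
    (h : F × (F →L[ℝ] ℝ) → ℝ) (y : F × (F →L[ℝ] ℝ)) : F × (F →L[ℝ] ℝ) :=
  (dualVec ((fderiv ℝ h y).comp (ContinuousLinearMap.inr ℝ F (F →L[ℝ] ℝ))),
    -(fderiv ℝ h y).comp (ContinuousLinearMap.inl ℝ F (F →L[ℝ] ℝ)))

section

variable {F : Type*} [NormedAddCommGroup F] [NormedSpace ℝ F] {h : F × (F →L[ℝ] ℝ) → ℝ}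
  {J : Set ℝ} {z : ℝ → F} {w : ℝ → F →L[ℝ] ℝ} {t : ℝ}

theorem HamiltonAt.congr (H : HamiltonAt h J z w t) {z₁ : ℝ → F} {w₁ : ℝ → F →L[ℝ] ℝ}
    (hz : z₁ =ᶠ[𝓝[J] t] z) (hw : w₁ =ᶠ[𝓝[J] t] w) (ht : t ∈ J) : HamiltonAt h J z₁ w₁ t := by
  obtain ⟨z', w', D, h1, h2, h3, h4⟩ := H
  refine ⟨z', w', D, h1.congr_of_eventuallyEq hz (hz.self_of_nhdsWithin ht),
    h2.congr_of_eventuallyEq hw (hw.self_of_nhdsWithin ht), ?_, h4⟩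
  rw [hz.self_of_nhdsWithin ht, hw.self_of_nhdsWithin ht]
  exact h3

variable [FiniteDimensional ℝ F]

theorem HamiltonAt.hasDerivWithinAt (H : HamiltonAt h J z w t) :
    HasDerivWithinAt (fun τ => (z τ, w τ)) (hamField h (z t, w t)) J t := by
  obtain ⟨z', w', D, h1, h2, h3, h4⟩ := H
  have : hamField h (z t, w t) = (z', w') := by
    rw [hamField, h3.fderiv]
    refine Prod.ext (dualVec_eq fun α => ?_) (ContinuousLinearMap.ext fun v => ?_)
    · simp [h4]
    · simp [h4]
  rw [this]
  exact h1.prodMk h2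

theorem hamiltonAt_of_hasDerivWithinAt (hd : DifferentiableAt ℝ h (z t, w t))
    (H : HasDerivWithinAt (fun τ => (z τ, w τ)) (hamField h (z t, w t)) J t) :
    HamiltonAt h J z w t := by
  refine ⟨_, _, _, H.fst, H.snd, hd.hasFDerivAt, fun v α => ?_⟩
  simp only [hamField, apply_dualVec]
  have : ((v, α) : F × (F →L[ℝ] ℝ)) = (v, 0) + (0, α) := by simp
  rw [this, map_add]
  simp [add_comm]

theorem contDiffAt_hamField {y : F × (F →L[ℝ] ℝ)} (hh : ContDiffAt ℝ 2 h y) :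
    ContDiffAt ℝ 1 (hamField h) y := by
  have h1 : ContDiffAt ℝ 1 (fderiv ℝ h) y := hh.fderiv_right (by norm_num)
  refine ContDiffAt.prodMk ?_ ?_
  · exact (dualVec (F := F)).contDiff.contDiffAt.comp y (h1.clm_comp contDiffAt_const)
  · exact (h1.clm_comp contDiffAt_const).neg

end

variable {EX : Type*} [NormedAddCommGroup EX] [NormedSpace ℝ EX]
  {HX : Type*} [TopologicalSpace HX] {I : ModelWithCorners ℝ EX HX}
  {X : Type*} [TopologicalSpace X] [ChartedSpace HX X]
  {S : Set X} {T : ∀ x : X, Submodule ℝ (TangentSpace I x)}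
  {d d' : ℕ} {u : Coord d → X} {V : Set (Coord d)} {u' : Coord d' → X} {V' : Set (Coord d')}
  {h : Cotangent I T → ℝ} {J : Set ℝ} {c : ℝ → Cotangent I T}

theorem IsHamiltonianTrajectory.mono (hc : IsHamiltonianTrajectory I S T h J c) {J' : Set ℝ}
    (hJ : J' ⊆ J) : IsHamiltonianTrajectory I S T h J' c := by
  intro t ht
  obtain ⟨d, u, V, z, w, z', w', D, h1, h2, h3, h4, h5, h6⟩ := hc t (hJ ht)
  exact ⟨d, u, V, z, w, z', w', D, h1, h2, h3.filter_mono (nhdsWithin_mono t hJ), h4.mono hJ,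
    h5.mono hJ, h6⟩

theorem isHamiltonianTrajectory_of_hamiltonAt (hu : IsLocalCoord I S T u V) {z : ℝ → Coord d}
    {w : ℝ → Coord d →L[ℝ] ℝ} (hz : ∀ t ∈ J, z t ∈ V)
    (H : ∀ t ∈ J, HamiltonAt (fun zw => h (ofCoords I T u zw)) J z w t) :
    IsHamiltonianTrajectory I S T h J (fun t => ofCoords I T u (z t, w t)) := by
  intro t ht
  obtain ⟨z', w', D, h1, h2, h3, h4⟩ := H t ht
  exact ⟨d, u, V, z, w, z', w', D, hu, hz t ht, Filter.Eventually.of_forall fun _ => rfl,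
    h1, h2, h3, h4⟩

variable [FiniteDimensional ℝ EX] [IsManifold I ∞ X]

/-- Hamilton's equations are invariant under changes of coordinates. -/
theorem IsHamiltonianTrajectory.exists_coord (hc : IsHamiltonianTrajectory I S T h J c) {t : ℝ}
    (ht : t ∈ J) (hu' : IsLocalCoord I S T u' V') {z₀' : Coord d'} (hz₀' : z₀' ∈ V')
    (hct : u' z₀' = (c t).1) :
    ∃ (z : ℝ → Coord d') (w : ℝ → Coord d' →L[ℝ] ℝ),
      (∀ᶠ τ in 𝓝[J] t, z τ ∈ V' ∧ c τ = ofCoords I T u' (z τ, w τ)) ∧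
      HamiltonAt (fun zw => h (ofCoords I T u' zw)) J z w t := by
  obtain ⟨d, u, V, z, w, z', w', D, hu, hzV, hceq, hz, hw, hD, hHam⟩ := hc t ht
  have hct' : u (z t) = u' z₀' := by
    rw [hct, hceq.self_of_nhdsWithin ht]
    rfl
  obtain ⟨N, N', τ, τ', hN, hN', hzN, hz₀N', hNV, hNV', hτ, hτ', hτN, hτN'⟩ :=
    exists_transition hu hu' hzV hz₀' hct'
  have hτd : ∀ y ∈ N, ContDiffAt ℝ ∞ τ y := fun y hy => hτ.contDiffAt (hN.mem_nhds hy)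
  have hτd' : ∀ y ∈ N', ContDiffAt ℝ ∞ τ' y := fun y hy => hτ'.contDiffAt (hN'.mem_nhds hy)
  set zt := z t with hzt
  have hτz : τ zt ∈ N' := (hτN zt hzN).1
  have hττ : τ' (τ zt) = zt := (hτN zt hzN).2.2
  -- derivatives of the transition maps
  have d1 : HasFDerivAt τ (fderiv ℝ τ zt) zt := ((hτd _ hzN).differentiableAt (by simp)).hasFDerivAt
  have d1' : HasFDerivAt τ' (fderiv ℝ τ' (τ zt)) (τ zt) :=
    ((hτd' _ hτz).differentiableAt (by simp)).hasFDerivAt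
  have d2 : HasFDerivAt (fderiv ℝ τ) (fderiv ℝ (fderiv ℝ τ) zt) zt :=
    (((hτd _ hzN).fderiv_right (m := 1) (by norm_cast)).differentiableAt
      (by simp)).hasFDerivAt
  have d2' : HasFDerivAt (fderiv ℝ τ') (fderiv ℝ (fderiv ℝ τ') (τ zt)) (τ zt) :=
    (((hτd' _ hτz).fderiv_right (m := 1) (by norm_cast)).differentiableAt
      (by simp)).hasFDerivAt
  have hcomp : ∀ y ∈ N, (fderiv ℝ τ' (τ y)).comp (fderiv ℝ τ y) = ContinuousLinearMap.id ℝ _ := by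
    intro y hy
    have e1 : HasFDerivAt (fun y => τ' (τ y)) ((fderiv ℝ τ' (τ y)).comp (fderiv ℝ τ y)) y :=
      (((hτd' _ (hτN y hy).1).differentiableAt (by simp)).hasFDerivAt).comp y
        (((hτd _ hy).differentiableAt (by simp)).hasFDerivAt)
    have e2 : (fun y => τ' (τ y)) =ᶠ[𝓝 y] id := by
      filter_upwards [hN.mem_nhds hy] with x hx using (hτN x hx).2.2
    exact e1.unique ((hasFDerivAt_id y).congr_of_eventuallyEq e2)
  have hcomp' : (fderiv ℝ τ zt).comp (fderiv ℝ τ' (τ zt)) = ContinuousLinearMap.id ℝ _ := by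
    have e1 : HasFDerivAt (fun y => τ (τ' y)) ((fderiv ℝ τ zt).comp (fderiv ℝ τ' (τ zt))) (τ zt) := by
      refine HasFDerivAt.comp (τ zt) ?_ d1'
      rw [hττ]
      exact d1
    have e2 : (fun y => τ (τ' y)) =ᶠ[𝓝 (τ zt)] id := by
      filter_upwards [hN'.mem_nhds hτz] with x hx using (hτN' x hx).2.2
    exact e1.unique ((hasFDerivAt_id _).congr_of_eventuallyEq e2)
  -- Differentiate the identity `hcomp`.
  have hsecond : ∀ a b, fderiv ℝ (fderiv ℝ τ') (τ zt) (fderiv ℝ τ zt a) (fderiv ℝ τ zt b) =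
      -fderiv ℝ τ' (τ zt) (fderiv ℝ (fderiv ℝ τ) zt a b) := by
    intro a b
    have e1 : HasFDerivAt (fun y => (fderiv ℝ τ' (τ y)).comp (fderiv ℝ τ y)) _ zt :=
      (HasFDerivAt.comp zt d2' d1).clm_comp d2
    have e2 : (fun y => (fderiv ℝ τ' (τ y)).comp (fderiv ℝ τ y)) =ᶠ[𝓝 zt]
        fun _ => ContinuousLinearMap.id ℝ _ := by
      filter_upwards [hN.mem_nhds hzN] with x hx using hcomp x hx
    have e3 := e1.unique ((hasFDerivAt_const _ zt).congr_of_eventuallyEq e2)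
    have e4 := congrArg (fun L => L a b) e3
    simp only [add_apply, ContinuousLinearMap.comp_apply,
      ContinuousLinearMap.flip_apply, ContinuousLinearMap.compL_apply,
      zero_apply] at e4
    rw [eq_neg_iff_add_eq_zero, add_comm]
    exact e4
  have hsymm : ∀ a b, fderiv ℝ (fderiv ℝ τ) zt a b = fderiv ℝ (fderiv ℝ τ) zt b a := by
    have := (hτd _ hzN).isSymmSndFDerivAt (by
      rw [minSmoothness_of_isRCLikeNormedField]; exact WithTop.coe_le_coe.2 le_top)
    exact fun a b => this a b
  have hzc : Filter.Tendsto z (𝓝[J] t) (𝓝 zt) := hz.continuousWithinAt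
  refine ⟨fun s => τ (z s), fun s => (w s).comp (fderiv ℝ τ' (τ (z s))), ?_, ?_⟩
  · filter_upwards [hceq, hzc.eventually (hN.mem_nhds hzN)] with s hs hsN
    refine ⟨hNV' (hτN _ hsN).1, ?_⟩
    have hττs : τ' (τ (z s)) = z s := (hτN _ hsN).2.2
    have e := ofCoords_transition (z := τ (z s)) (τ := τ') hu' hu (hNV' (hτN _ hsN).1)
      (by rw [hττs]; exact hNV hsN)
      ((hτd' _ (hτN _ hsN).1).differentiableAt (by simp))
      (by filter_upwards [hN'.mem_nhds (hτN _ hsN).1] with x hx using (hτN' x hx).2.1) (w s)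
    rw [hs, ← e, hττs]
  · have k1 : HasDerivWithinAt (fun s => τ (z s)) (fderiv ℝ τ zt z') J t :=
      d1.comp_hasDerivWithinAt t hz
    have k2 : HasDerivWithinAt (fun s => fderiv ℝ τ' (τ (z s)))
        (fderiv ℝ (fderiv ℝ τ') (τ zt) (fderiv ℝ τ zt z')) J t :=
      HasFDerivAt.comp_hasDerivWithinAt (l := fderiv ℝ τ') (f := fun s => τ (z s)) t d2' k1
    have k3 := hw.clm_comp k2
    -- The lift of `τ'` to the cotangent bundles; the Hamiltonian in the new coordinates is the old
    -- one composed with it.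
    set g : Coord d' × (Coord d' →L[ℝ] ℝ) → Coord d × (Coord d →L[ℝ] ℝ) := fun y =>
      (τ' y.1, y.2.comp (fderiv ℝ τ (τ' y.1))) with hg
    set y₀ : Coord d' × (Coord d' →L[ℝ] ℝ) := (τ zt, (w t).comp (fderiv ℝ τ' (τ zt))) with hy₀
    have hgy₀ : g y₀ = (zt, w t) := by
      simp only [hg, hy₀, hττ]
      rw [ContinuousLinearMap.comp_assoc, hcomp zt hzN, ContinuousLinearMap.comp_id]
    have m1 : HasFDerivAt (fun y : Coord d' × (Coord d' →L[ℝ] ℝ) => τ' y.1)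
        ((fderiv ℝ τ' (τ zt)).comp (ContinuousLinearMap.fst ℝ _ _)) y₀ :=
      HasFDerivAt.comp y₀ d1' hasFDerivAt_fst
    have m2 : HasFDerivAt (fun y : Coord d' × (Coord d' →L[ℝ] ℝ) => fderiv ℝ τ (τ' y.1))
        ((fderiv ℝ (fderiv ℝ τ) zt).comp
          ((fderiv ℝ τ' (τ zt)).comp (ContinuousLinearMap.fst ℝ _ _))) y₀ := by
      refine HasFDerivAt.comp (g := fderiv ℝ τ) y₀ ?_ m1
      change HasFDerivAt _ _ (τ' (τ zt))
      rw [hττ]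
      exact d2
    have m3 := m1.prodMk (hasFDerivAt_snd.clm_comp m2)
    have m4 : HasFDerivAt (fun y => h (ofCoords I T u (g y))) (D.comp _) y₀ :=
      HasFDerivAt.comp (g := fun y => h (ofCoords I T u y)) y₀ (by
        change HasFDerivAt _ D (g y₀)
        rw [hgy₀]
        exact hD) m3
    have m5 : (fun y => h (ofCoords I T u' y)) =ᶠ[𝓝 y₀] fun y => h (ofCoords I T u (g y)) := by
      have : ∀ᶠ y : Coord d' × (Coord d' →L[ℝ] ℝ) in 𝓝 y₀, y.1 ∈ N' :=
        continuousAt_fst.preimage_mem_nhds (hN'.mem_nhds hτz)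
      filter_upwards [this] with y hy
      have hy2 : τ (τ' y.1) = y.1 := (hτN' _ hy).2.2
      have e := ofCoords_transition (z := τ' y.1) (τ := τ) hu hu' (hNV (hτN' _ hy).1)
        (by rw [hy2]; exact hNV' hy)
        ((hτd _ (hτN' _ hy).1).differentiableAt (by simp))
        (by filter_upwards [hN.mem_nhds (hτN' _ hy).1] with x hx using (hτN x hx).2.1) y.2
      rw [hy2] at e
      exact congrArg h e
    refine ⟨_, _, _, k1, k3, m4.congr_of_eventuallyEq m5, fun v α => ?_⟩
    simp only [ContinuousLinearMap.comp_apply, ContinuousLinearMap.prod_apply, hHam,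
      ContinuousLinearMap.coe_fst', ContinuousLinearMap.coe_snd',
      add_apply, ContinuousLinearMap.flip_apply,
      ContinuousLinearMap.compL_apply, hy₀, hττ]
    have r1 : v = fderiv ℝ τ zt (fderiv ℝ τ' (τ zt) v) := by
      conv_lhs => rw [← ContinuousLinearMap.id_apply (R₁ := ℝ) v, ← hcomp']
      rfl
    -- Second derivatives of `τ` enter through the new Hamiltonian and through the derivative of the
    -- new momentum. The two contributions cancel because the second derivative is symmetric.
    have r2 : fderiv ℝ (fderiv ℝ τ') (τ zt) (fderiv ℝ τ zt z') v =
        -fderiv ℝ τ' (τ zt) (fderiv ℝ (fderiv ℝ τ) zt z' (fderiv ℝ τ' (τ zt) v)) := by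
      conv_lhs => rw [r1]
      exact hsecond _ _
    rw [r2, map_neg, hsymm z']
    ring

variable [T2Space X]

/-- A Hamiltonian trajectory is determined by its initial point, as long as the reference solution
stays in one chart. -/
theorem eq_of_isHamiltonianTrajectory (hu : IsLocalCoord I S T u V)
    {R : Set (Coord d × (Coord d →L[ℝ] ℝ))} (hR : IsOpen R) (hRV : ∀ y ∈ R, y.1 ∈ V)
    (hh : ContDiffOn ℝ 2 (fun zw => h (ofCoords I T u zw)) R) {b : ℝ} (hb : 0 ≤ b)
    (hc : IsHamiltonianTrajectory I S T h (Set.Icc 0 b) c) {z : ℝ → Coord d}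
    {w : ℝ → Coord d →L[ℝ] ℝ} (hy : ∀ t ∈ Set.Icc 0 b, (z t, w t) ∈ R)
    (H : ∀ t ∈ Set.Icc 0 b, HamiltonAt (fun zw => h (ofCoords I T u zw)) (Set.Icc 0 b) z w t)
    (h0 : c 0 = ofCoords I T u (z 0, w 0)) :
    ∀ t ∈ Set.Icc 0 b, c t = ofCoords I T u (z t, w t) := by
  set J := Set.Icc 0 b with hJ
  set k := fun zw => h (ofCoords I T u zw) with hk
  have hyc : ∀ t ∈ J, ContinuousWithinAt (fun s => (z s, w s)) J t := fun t ht =>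
    (H t ht).hasDerivWithinAt.continuousWithinAt
  -- coordinates of `c` near a time when it is in the chart
  have hcoord : ∀ t ∈ J, (c t).1 ∈ u '' V → ∃ (z₁ : ℝ → Coord d) (w₁ : ℝ → Coord d →L[ℝ] ℝ),
      ContinuousWithinAt (fun s => (z₁ s, w₁ s)) J t ∧
      ∀ᶠ s in 𝓝[J] t, z₁ s ∈ V ∧ c s = ofCoords I T u (z₁ s, w₁ s) ∧ HamiltonAt k J z₁ w₁ s := by
    rintro t ht ⟨z₀, hz₀, hz₀c⟩
    obtain ⟨z₁, w₁, h1, h2⟩ := hc.exists_coord ht hu hz₀ hz₀c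
    refine ⟨z₁, w₁, h2.hasDerivWithinAt.continuousWithinAt, ?_⟩
    filter_upwards [h1, eventually_eventually_nhdsWithin.2 h1, self_mem_nhdsWithin] with s hs hs2 hsJ
    refine ⟨hs.1, hs.2, ?_⟩
    obtain ⟨z₂, w₂, h3, h4⟩ := hc.exists_coord hsJ hu hs.1 (by rw [hs.2]; rfl)
    have h5 : ∀ᶠ r in 𝓝[J] s, z₁ r = z₂ r ∧ w₁ r = w₂ r := by
      filter_upwards [hs2, h3] with r hr1 hr2
      exact ofCoords_injOn hu hr1.1 hr2.1 (hr1.2.symm.trans hr2.2)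
    exact h4.congr (h5.mono fun r hr => hr.1) (h5.mono fun r hr => hr.2) hsJ
  set A := {t | c t = ofCoords I T u (z t, w t)} with hA
  have hsub : J ⊆ A := by
    -- Continuous induction on `[0, b]`: the set of agreement is closed, and uniqueness for
    -- Lipschitz fields prolongs it to the right.
    refine IsClosed.Icc_subset_of_forall_mem_nhdsWithin ?_ h0 ?_
    · rw [← closure_subset_iff_isClosed]
      intro t ht
      have htJ : t ∈ J := isClosed_Icc.closure_subset (closure_mono Set.inter_subset_right ht)
      refine ⟨?_, htJ⟩
      have hne : (𝓝[A ∩ J] t).NeBot := mem_closure_iff_nhdsWithin_neBot.1 ht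
      have hle : 𝓝[A ∩ J] t ≤ 𝓝[J] t := nhdsWithin_mono t Set.inter_subset_right
      have hzt : Filter.Tendsto (fun s => (z s, w s)) (𝓝[A ∩ J] t) (𝓝 (z t, w t)) :=
        Filter.Tendsto.mono_left (hyc t htJ) hle
      have hztV : z t ∈ V := hRV _ (hy t htJ)
      -- The chart `u` can be used at time `t` only after `c t` is known to lie over it. So the base
      -- point is identified first, through the chart that comes with the trajectory and uniqueness
      -- of limits in the Hausdorff space `X`.
      have hbase : (c t).1 = u (z t) := by
        obtain ⟨d₂, u₂, V₂, z₂, w₂, z', w', D, hu₂, hz₂V, hceq, hz₂, -⟩ := hc t htJ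
        have l1 : Filter.Tendsto (fun s => u₂ (z₂ s)) (𝓝[A ∩ J] t) (𝓝 (u₂ (z₂ t))) :=
          ((hu₂.contMDiffAt hz₂V).continuousAt.tendsto.comp
            (Filter.Tendsto.mono_left hz₂.continuousWithinAt hle))
        have l2 : Filter.Tendsto (fun s => u (z s)) (𝓝[A ∩ J] t) (𝓝 (u (z t))) :=
          (hu.contMDiffAt hztV).continuousAt.tendsto.comp
            ((continuous_fst.tendsto _).comp hzt)
        have l3 : (fun s => u₂ (z₂ s)) =ᶠ[𝓝[A ∩ J] t] fun s => u (z s) := by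
          filter_upwards [hceq.filter_mono hle, self_mem_nhdsWithin] with s hs hsA
          have := hs.symm.trans hsA.1
          exact congrArg Sigma.fst this
        have l4 := tendsto_nhds_unique (l1.congr' l3) l2
        rw [hceq.self_of_nhdsWithin htJ]
        exact l4
      obtain ⟨z₁, w₁, h1, h2⟩ := hcoord t htJ ⟨z t, hztV, hbase.symm⟩
      have l5 : (fun s => (z₁ s, w₁ s)) =ᶠ[𝓝[A ∩ J] t] fun s => (z s, w s) := by
        filter_upwards [h2.filter_mono hle, self_mem_nhdsWithin] with s hs hsA
        have := ofCoords_injOn hu hs.1 (hRV _ (hy s hsA.2)) (hs.2.1.symm.trans hsA.1)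
        exact Prod.ext this.1 this.2
      have l6 : (z₁ t, w₁ t) = (z t, w t) :=
        tendsto_nhds_unique ((Filter.Tendsto.mono_left h1 hle).congr' l5) hzt
      change c t = ofCoords I T u (z t, w t)
      rw [(h2.self_of_nhdsWithin htJ).2.1, l6]
    · rintro t ⟨htA, ht0, htb⟩
      have htJ : t ∈ J := ⟨ht0, htb.le⟩
      obtain ⟨z₁, w₁, h1, h2⟩ := hcoord t htJ ⟨z t, hRV _ (hy t htJ), by rw [htA]; rfl⟩
      have h3 := h2.self_of_nhdsWithin htJ
      have h4 := ofCoords_injOn hu h3.1 (hRV _ (hy t htJ)) (h3.2.1.symm.trans htA)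
      have h4' : (z₁ t, w₁ t) = (z t, w t) := Prod.ext h4.1 h4.2
      obtain ⟨K, s, hs, hLip⟩ := (contDiffAt_hamField (hh.contDiffAt
        (hR.mem_nhds (hy t htJ)))).exists_lipschitzOnWith
      have hle : 𝓝[≥] t ≤ 𝓝[J] t := nhdsWithin_le_iff.2 (Icc_mem_nhdsGE_of_mem ⟨ht0, htb⟩)
      have ev : ∀ᶠ r in 𝓝[≥] t, (r ∈ J ∧ (z r, w r) ∈ s) ∧ (z₁ r, w₁ r) ∈ s ∧
          c r = ofCoords I T u (z₁ r, w₁ r) ∧ HamiltonAt k J z₁ w₁ r := by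
        have e1 : ∀ᶠ r in 𝓝[J] t, (z r, w r) ∈ s := (hyc t htJ) hs
        have e2 : ∀ᶠ r in 𝓝[J] t, (z₁ r, w₁ r) ∈ s := h1 (by
          change s ∈ 𝓝 (z₁ t, w₁ t)
          rw [h4']; exact hs)
        filter_upwards [hle e1, hle e2, hle h2, hle self_mem_nhdsWithin] with r q1 q2 q3 q4
        exact ⟨⟨q4, q1⟩, q2, q3.2⟩
      obtain ⟨t', ht', hI⟩ := (mem_nhdsGE_iff_exists_Icc_subset).1 ev
      have hder : ∀ {z₂ : ℝ → Coord d} {w₂ : ℝ → Coord d →L[ℝ] ℝ} {r : ℝ}, r ∈ Set.Ico t t' →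
          HamiltonAt k J z₂ w₂ r →
          HasDerivWithinAt (fun τ => (z₂ τ, w₂ τ)) (hamField k (z₂ r, w₂ r)) (Set.Ici r) r := by
        intro z₂ w₂ r hr hH
        refine hH.hasDerivWithinAt.mono_of_mem_nhdsWithin (Icc_mem_nhdsGE_of_mem ⟨?_, ?_⟩)
        · exact ht0.trans hr.1
        · exact hr.2.trans_le (hI ⟨ht'.le, le_rfl⟩).1.1.2
      have key := ODE_solution_unique_of_mem_Icc_right (v := fun _ => hamField k) (s := fun _ => s)
        (K := K) (f := fun τ => (z₁ τ, w₁ τ)) (g := fun τ => (z τ, w τ)) (a := t) (b := t')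
        (fun _ _ => hLip)
        (fun r hr => ((hI hr).2.2.2.hasDerivWithinAt.continuousWithinAt).mono
          (fun q hq => (hI hq).1.1))
        (fun r hr => hder hr (hI ⟨hr.1, hr.2.le⟩).2.2.2)
        (fun r hr => (hI ⟨hr.1, hr.2.le⟩).2.1)
        (fun r hr => (hyc r (hI hr).1.1).mono (fun q hq => (hI hq).1.1))
        (fun r hr => hder hr (H r (hI ⟨hr.1, hr.2.le⟩).1.1))
        (fun r hr => (hI ⟨hr.1, hr.2.le⟩).1.2)
        h4'
      filter_upwards [Ioc_mem_nhdsGT ht'] with r hr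
      have hr' : r ∈ Set.Icc t t' := ⟨hr.1.le, hr.2⟩
      have := key hr'
      change c r = ofCoords I T u (z r, w r)
      rw [(hI hr').2.2.1]
      exact congrArg _ this
  exact hsub

end Hamilton

/-! ### Positive definite forms and their inverses -/

section PosDef

variable {W : Type*} [AddCommGroup W] [Module ℝ W] [TopologicalSpace W] [IsTopologicalAddGroup W]
  [ContinuousSMul ℝ W] [T2Space W] [FiniteDimensional ℝ W]

theorem exists_equiv_of_posDef {β : W →L[ℝ] W →L[ℝ] ℝ} (h : ∀ v, v ≠ 0 → 0 < β v v) :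
    ∃ e : W ≃L[ℝ] (W →L[ℝ] ℝ), (e : W →L[ℝ] W →L[ℝ] ℝ) = β := by
  have hinj : Function.Injective β.toLinearMap := by
    rw [← LinearMap.ker_eq_bot, LinearMap.ker_eq_bot']
    intro v hv
    by_contra hne
    have h1 := h v hne
    have h2 : β v v = 0 := congrArg (fun α : W →L[ℝ] ℝ => α v) hv
    exact h1.ne' h2
  let e₀ : Module.Dual ℝ W ≃ₗ[ℝ] (W →L[ℝ] ℝ) := LinearMap.toContinuousLinearMap
  have hfin : Module.finrank ℝ W = Module.finrank ℝ (W →L[ℝ] ℝ) := by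
    rw [← e₀.finrank_eq]
    exact Subspace.dual_finrank_eq.symm
  have : FiniteDimensional ℝ (W →L[ℝ] ℝ) := e₀.finiteDimensional
  let e := LinearMap.linearEquivOfInjective β.toLinearMap hinj hfin
  refine ⟨e.toContinuousLinearEquiv, ?_⟩
  ext v
  rfl

theorem inverse_apply_of_posDef {β : W →L[ℝ] W →L[ℝ] ℝ} (h : ∀ v, v ≠ 0 → 0 < β v v) {a : W}
    {p : W →L[ℝ] ℝ} (hp : β a = p) : β.inverse p = a := by
  obtain ⟨e, rfl⟩ := exists_equiv_of_posDef h
  rw [ContinuousLinearMap.inverse_equiv, ← hp]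
  exact e.symm_apply_apply a

theorem apply_inverse_of_posDef {β : W →L[ℝ] W →L[ℝ] ℝ} (h : ∀ v, v ≠ 0 → 0 < β v v)
    (p : W →L[ℝ] ℝ) : β (β.inverse p) = p := by
  obtain ⟨e, rfl⟩ := exists_equiv_of_posDef h
  rw [ContinuousLinearMap.inverse_equiv]
  exact e.apply_symm_apply p

/-- The dual form of a positive definite form is natural under isomorphisms. -/
theorem dualForm_comp {W' : Type*} [AddCommGroup W'] [Module ℝ W'] [TopologicalSpace W']
    [IsTopologicalAddGroup W'] [ContinuousSMul ℝ W'] [T2Space W'] [FiniteDimensional ℝ W']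
    {β : W →L[ℝ] W →L[ℝ] ℝ} (h : ∀ v, v ≠ 0 → 0 < β v v) {β' : W' →L[ℝ] W' →L[ℝ] ℝ}
    {L : W' →L[ℝ] W} (hL : Function.Bijective L) (hβ : ∀ a b, β' a b = β (L a) (L b))
    (p : W →L[ℝ] ℝ) : p (β.inverse p) = p.comp L (β'.inverse (p.comp L)) := by
  have h' : ∀ v, v ≠ 0 → 0 < β' v v := by
    intro v hv
    rw [hβ]
    exact h _ fun h0 => hv (hL.1 (by rw [h0, map_zero]))
  obtain ⟨a, ha⟩ := hL.2 (β.inverse p)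
  have h1 : β' a = p.comp L := by
    ext b
    rw [hβ, ha, apply_inverse_of_posDef h]
    rfl
  rw [inverse_apply_of_posDef h' h1, ← ha]
  rfl

end PosDef

/-- Positive definiteness makes `β x` invertible, and inversion is smooth at invertible operators.
-/
theorem contDiffOn_inverse_of_posDef {A B : Type*} [NormedAddCommGroup A] [NormedSpace ℝ A]
    [FiniteDimensional ℝ A] [NormedAddCommGroup B] [NormedSpace ℝ B] {s : Set B} {n : ℕ∞ω}
    {β : B → A →L[ℝ] A →L[ℝ] ℝ} (hβ : ContDiffOn ℝ n β s)
    (h : ∀ x ∈ s, ∀ v, v ≠ 0 → 0 < β x v v) : ContDiffOn ℝ n (fun x => (β x).inverse) s := by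
  intro x hx
  obtain ⟨e, he⟩ := exists_equiv_of_posDef (h x hx)
  have := FiniteDimensional.complete ℝ A
  have h1 : ContDiffAt ℝ n (ContinuousLinearMap.inverse : (A →L[ℝ] A →L[ℝ] ℝ) → _) (β x) := by
    rw [← he]
    exact contDiffAt_map_inverse e
  exact h1.comp_contDiffWithinAt x (hβ x hx)

/-! ### The metric in coordinates -/

section Metric

variable {E : Type*} [NormedAddCommGroup E] [NormedSpace ℝ E]
  {M : Type*} [TopologicalSpace M] [ChartedSpace E M]
  [IsManifold 𝓘(ℝ, E) ∞ M]
  (g : Bundle.ContMDiffRiemannianMetric 𝓘(ℝ, E) ∞ E (fun x : M => TangentSpace 𝓘(ℝ, E) x))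
  {A : Type*} [NormedAddCommGroup A] [NormedSpace ℝ A]

/-- The metric at `x`, as a form on the model space. -/
def innerE (x : M) : E →L[ℝ] E →L[ℝ] ℝ := g.inner x

/-- The form induced on `A` by the metric at `x` and a linear map to the tangent space. -/
def pullForm (x : M) (L : A →L[ℝ] E) : A →L[ℝ] A →L[ℝ] ℝ := (innerE g x).bilinearComp L L

theorem pullForm_apply (x : M) (L : A →L[ℝ] E) (a b : A) :
    pullForm g x L a b = innerE g x (L a) (L b) := rfl

theorem innerE_symm (x : M) (a b : E) : innerE g x a b = innerE g x b a := g.symm x a b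

theorem innerE_pos (x : M) (a : E) (ha : a ≠ 0) : 0 < innerE g x a a := g.pos x a ha

/-- The derivative applied to a fixed vector is a smooth section along `f`, namely the tangent map
composed with a constant field, and the bundle metric can be applied to two such sections.
Derivatives within `s` are used because the semigeodesic domain `V × [0, δ]` has a boundary. -/
theorem contDiffOn_innerE {s : Set A} (hs : UniqueDiffOn ℝ s) {f : A → M}
    (hf : ContMDiffOn 𝓘(ℝ, A) 𝓘(ℝ, E) ∞ f s) (a b : A) :
    ContDiffOn ℝ ∞ (fun y => innerE g (f y) (mfderivWithin 𝓘(ℝ, A) 𝓘(ℝ, E) f s y a)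
      (mfderivWithin 𝓘(ℝ, A) 𝓘(ℝ, E) f s y b)) s := by
  have hsec (c : A) : ContMDiffOn 𝓘(ℝ, A) (𝓘(ℝ, E).prod 𝓘(ℝ, E)) ∞
      (fun y => (⟨f y, mfderivWithin 𝓘(ℝ, A) 𝓘(ℝ, E) f s y c⟩ : TangentBundle 𝓘(ℝ, E) M)) s := by
    have h1 : ContMDiffOn 𝓘(ℝ, A).tangent 𝓘(ℝ, E).tangent ∞ (tangentMapWithin 𝓘(ℝ, A) 𝓘(ℝ, E) f s)
        (Bundle.TotalSpace.proj ⁻¹' s) :=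
      hf.contMDiffOn_tangentMapWithin (le_refl _) hs.uniqueMDiffOn
    have h2 : ContMDiffOn 𝓘(ℝ, A) 𝓘(ℝ, A).tangent ∞
        (fun y : A => (⟨y, c⟩ : TangentBundle 𝓘(ℝ, A) A)) s :=
      contMDiffOn_vectorSpace_iff_contDiffOn.2 contDiffOn_const
    exact h1.comp h2 fun y hy => hy
  rw [← contMDiffOn_iff_contDiffOn]
  intro y hy
  have h : ContMDiffWithinAt 𝓘(ℝ, A) (𝓘(ℝ, E).prod 𝓘(ℝ, ℝ)) ∞
      (fun y => Bundle.TotalSpace.mk' ℝ (E := Bundle.Trivial M ℝ) (f y)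
        (g.inner (f y) (mfderivWithin 𝓘(ℝ, A) 𝓘(ℝ, E) f s y a)
          (mfderivWithin 𝓘(ℝ, A) 𝓘(ℝ, E) f s y b))) s y := by
    apply ContMDiffWithinAt.clm_bundle_apply₂ (F₁ := E) (F₂ := E)
    · exact ContMDiffAt.comp_contMDiffWithinAt y g.contMDiff.contMDiffAt (hf y hy)
    · exact hsec a y hy
    · exact hsec b y hy
  simp only [Bundle.contMDiffWithinAt_totalSpace] at h
  exact h.2

theorem contDiffOn_pullForm [FiniteDimensional ℝ A] {s : Set A} (hs : UniqueDiffOn ℝ s) {f : A → M}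
    (hf : ContMDiffOn 𝓘(ℝ, A) 𝓘(ℝ, E) ∞ f s) :
    ContDiffOn ℝ ∞ (fun y => pullForm g (f y) (mfderivWithin 𝓘(ℝ, A) 𝓘(ℝ, E) f s y)) s :=
  contDiffOn_clm_apply.2 fun a => contDiffOn_clm_apply.2 fun b => contDiffOn_innerE g hs hf a b

theorem contDiffOn_pullForm_paramDeriv [FiniteDimensional ℝ A] {s : Set A} (hs : IsOpen s)
    {f : A → M} (hf : ContMDiffOn 𝓘(ℝ, A) 𝓘(ℝ, E) ∞ f s) :
    ContDiffOn ℝ ∞ (fun y => pullForm g (f y) (paramDeriv 𝓘(ℝ, E) f y)) s :=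
  (contDiffOn_pullForm g hs.uniqueDiffOn hf).congr fun y hy => by
    rw [mfderivWithin_of_isOpen hs hy]
    rfl

theorem pullForm_pos {x : M} {L : A →L[ℝ] E} (hL : Function.Injective L) (a : A) (ha : a ≠ 0) :
    0 < pullForm g x L a a :=
  innerE_pos g x _ fun h => ha (hL (h.trans (map_zero L).symm))

theorem coNormSq_eq [FiniteDimensional ℝ A] [FiniteDimensional ℝ E] {x : M} {L : A →L[ℝ] E}
    (hL : Function.Bijective L) (p : E →L[ℝ] ℝ) :
    coNormSq g x p = p.comp L ((pullForm g x L).inverse (p.comp L)) :=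
  dualForm_comp (β := innerE g x) (innerE_pos g x) hL (fun _ _ => rfl) p

end Metric

/-! ### Coordinates in which `φ` is the last coordinate -/

section Straightening

variable {E : Type*} [NormedAddCommGroup E] [NormedSpace ℝ E] [FiniteDimensional ℝ E]
  {M : Type*} [TopologicalSpace M] [ChartedSpace E M] [IsManifold 𝓘(ℝ, E) ∞ M]
  {φ : M → ℝ} {d : ℕ}

/-- `Ψ : D → O` is a diffeomorphism, with inverse `Θ`, that turns `φ` into the last coordinate. -/
structure IsStraightening (φ : M → ℝ) (Ψ : Coord d × ℝ → M) (Θ : M → Coord d × ℝ)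
    (D : Set (Coord d × ℝ)) (O : Set M) : Prop where
  isOpen_source : IsOpen D
  isOpen_target : IsOpen O
  smooth : ContMDiffOn 𝓘(ℝ, Coord d × ℝ) 𝓘(ℝ, E) ∞ Ψ D
  smooth_symm : ContMDiffOn 𝓘(ℝ, E) 𝓘(ℝ, Coord d × ℝ) ∞ Θ O
  mapsTo : Set.MapsTo Ψ D O
  mapsTo_symm : Set.MapsTo Θ O D
  left_inv : ∀ y ∈ D, Θ (Ψ y) = y
  right_inv : ∀ x ∈ O, Ψ (Θ x) = x
  apply_eq : ∀ y ∈ D, φ (Ψ y) = y.2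

variable {Ψ : Coord d × ℝ → M} {Θ : M → Coord d × ℝ} {D : Set (Coord d × ℝ)} {O : Set M}

namespace IsStraightening

theorem mdifferentiableAt (h : IsStraightening (E := E) φ Ψ Θ D O) {y : Coord d × ℝ} (hy : y ∈ D) :
    MDifferentiableAt 𝓘(ℝ, Coord d × ℝ) 𝓘(ℝ, E) Ψ y :=
  (h.smooth.contMDiffAt (h.isOpen_source.mem_nhds hy)).mdifferentiableAt (by simp)

theorem bijective (h : IsStraightening (E := E) φ Ψ Θ D O) {y : Coord d × ℝ} (hy : y ∈ D) :
    Function.Bijective (paramDeriv 𝓘(ℝ, E) Ψ y) := by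
  have h1 := h.mdifferentiableAt hy
  have h2 : MDifferentiableAt 𝓘(ℝ, E) 𝓘(ℝ, Coord d × ℝ) Θ (Ψ y) :=
    (h.smooth_symm.contMDiffAt (h.isOpen_target.mem_nhds (h.mapsTo hy))).mdifferentiableAt (by simp)
  have h3 := mfderiv_comp y h2 h1
  have h4 : mfderiv 𝓘(ℝ, Coord d × ℝ) 𝓘(ℝ, Coord d × ℝ) (Θ ∘ Ψ) y = ContinuousLinearMap.id ℝ _ := by
    have : (Θ ∘ Ψ) =ᶠ[𝓝 y] id := by
      filter_upwards [h.isOpen_source.mem_nhds hy] with y' hy' using h.left_inv y' hy'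
    rw [this.mfderiv_eq]
    exact mfderiv_id
  have h1' : MDifferentiableAt 𝓘(ℝ, Coord d × ℝ) 𝓘(ℝ, E) Ψ (Θ (Ψ y)) := by rwa [h.left_inv y hy]
  have h5 := mfderiv_comp (Ψ y) h1' h2
  have h6 : mfderiv 𝓘(ℝ, E) 𝓘(ℝ, E) (Ψ ∘ Θ) (Ψ y) = ContinuousLinearMap.id ℝ _ := by
    have : (Ψ ∘ Θ) =ᶠ[𝓝 (Ψ y)] id := by
      filter_upwards [h.isOpen_target.mem_nhds (h.mapsTo hy)] with y' hy' using h.right_inv y' hy'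
    rw [this.mfderiv_eq]
    exact mfderiv_id
  constructor
  · intro v w hvw
    have hc : ∀ v : Coord d × ℝ,
        mfderiv 𝓘(ℝ, E) 𝓘(ℝ, Coord d × ℝ) Θ (Ψ y) (paramDeriv 𝓘(ℝ, E) Ψ y v) = v := fun v =>
      congrArg (fun L : (Coord d × ℝ) →L[ℝ] (Coord d × ℝ) => L v) (h3.symm.trans h4)
    rw [← hc v, hvw, hc w]
  · intro v
    refine ⟨mfderiv 𝓘(ℝ, E) 𝓘(ℝ, Coord d × ℝ) Θ (Ψ y) v, ?_⟩
    have := congrArg (fun L : E →L[ℝ] E => L v) (h5.symm.trans h6)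
    have e1 : ∀ y', y' = y → (mfderiv 𝓘(ℝ, Coord d × ℝ) 𝓘(ℝ, E) Ψ y' : (Coord d × ℝ) →L[ℝ] E) =
      paramDeriv 𝓘(ℝ, E) Ψ y := by rintro y' rfl; rfl
    refine Eq.trans ?_ this
    exact (congrArg (fun L : (Coord d × ℝ) →L[ℝ] E =>
      L (mfderiv 𝓘(ℝ, E) 𝓘(ℝ, Coord d × ℝ) Θ (Ψ y) v)) (e1 _ (h.left_inv y hy))).symm

theorem dPhiE_paramDeriv (h : IsStraightening (E := E) φ Ψ Θ D O)
    (hφ : ContMDiff 𝓘(ℝ, E) 𝓘(ℝ, ℝ) ∞ φ) {y : Coord d × ℝ} (hy : y ∈ D) (v : Coord d × ℝ) :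
    dPhiE (E := E) φ (Ψ y) (paramDeriv 𝓘(ℝ, E) Ψ y v) = v.2 := by
  have h1 := h.mdifferentiableAt hy
  have h3 := mfderiv_comp y (hφ.mdifferentiableAt (by simp) (x := Ψ y)) h1
  have h4 : mfderiv 𝓘(ℝ, Coord d × ℝ) 𝓘(ℝ, ℝ) (φ ∘ Ψ) y = ContinuousLinearMap.snd ℝ (Coord d) ℝ := by
    have : (φ ∘ Ψ) =ᶠ[𝓝 y] Prod.snd := by
      filter_upwards [h.isOpen_source.mem_nhds hy] with y' hy' using h.apply_eq y' hy'
    rw [this.mfderiv_eq, mfderiv_eq_fderiv]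
    exact fderiv_snd
  exact congrArg (fun L : (Coord d × ℝ) →L[ℝ] ℝ => L v) (h3.symm.trans h4)

/-- A straightening restricts to a local parametrization of the hypersurface. -/
theorem isLocalCoord (h : IsStraightening (E := E) φ Ψ Θ D O)
    (hφ : ContMDiff 𝓘(ℝ, E) 𝓘(ℝ, ℝ) ∞ φ) :
    IsLocalCoord 𝓘(ℝ, E) (bdry φ) (bdryT φ) (fun z : Coord d => Ψ (z, 0)) {z | (z, (0 : ℝ)) ∈ D} := by
  have hι : ContDiff ℝ ∞ (fun z : Coord d => (z, (0 : ℝ))) := by fun_prop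
  have hV : IsOpen {z : Coord d | (z, (0 : ℝ)) ∈ D} := h.isOpen_source.preimage hι.continuous
  have hs : ContMDiffOn 𝓘(ℝ, Coord d) 𝓘(ℝ, E) ∞ (fun z : Coord d => Ψ (z, 0))
      {z | (z, (0 : ℝ)) ∈ D} :=
    h.smooth.comp hι.contMDiff.contMDiffOn fun z hz => hz
  have hd : ∀ z : Coord d, (z, (0 : ℝ)) ∈ D → ∀ e : Coord d,
      mfderiv 𝓘(ℝ, Coord d) 𝓘(ℝ, E) (fun z : Coord d => Ψ (z, 0)) z e =
        paramDeriv 𝓘(ℝ, E) Ψ (z, 0) (e, 0) := by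
    intro z hz e
    have h1 := paramDeriv_comp (I := 𝓘(ℝ, E)) (u := fun z : Coord d => Ψ (z, 0)) (u' := Ψ)
      (τ := fun z : Coord d => (z, (0 : ℝ))) (z := z) (h.mdifferentiableAt hz)
      (hι.differentiable (by simp) z) (Filter.Eventually.of_forall fun _ => rfl)
    have h2 : fderiv ℝ (fun z : Coord d => (z, (0 : ℝ))) z = ContinuousLinearMap.inl ℝ (Coord d) ℝ :=
      (ContinuousLinearMap.inl ℝ (Coord d) ℝ).fderiv
    rw [h2] at h1
    exact congrArg (fun L : Coord d →L[ℝ] E => L e) h1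
  refine ⟨hV, hs, fun z hz => h.apply_eq _ hz, ?_, ?_, ?_, ?_⟩
  · intro z hz z' hz' hzz
    have := h.left_inv _ hz
    rw [show Ψ (z, 0) = Ψ (z', 0) from hzz, h.left_inv _ hz'] at this
    exact (congrArg Prod.fst this).symm
  · intro V' hV' hV'o
    refine ⟨O ∩ Θ ⁻¹' (Prod.fst ⁻¹' V'), h.smooth_symm.continuousOn.isOpen_inter_preimage
      h.isOpen_target (hV'o.preimage continuous_fst), ?_⟩
    ext x
    constructor
    · rintro ⟨z, hz, rfl⟩
      refine ⟨h.apply_eq _ (hV' hz), h.mapsTo (hV' hz), ?_⟩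
      change (Θ (Ψ (z, 0))).1 ∈ V'
      rwa [h.left_inv _ (hV' hz)]
    · rintro ⟨hx0, hxO, hx⟩
      have h0 : (Θ x).2 = 0 := by
        rw [← h.apply_eq _ (h.mapsTo_symm hxO), h.right_inv x hxO]
        exact hx0
      refine ⟨(Θ x).1, hx, ?_⟩
      change Ψ ((Θ x).1, 0) = x
      rw [← h0]
      exact h.right_inv x hxO
  · intro z hz v w hvw
    have := (h.bijective hz).1 (((hd z hz v).symm.trans hvw).trans (hd z hz w))
    exact congrArg Prod.fst this
  · intro z hz v
    constructor
    · intro hv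
      obtain ⟨a, ha⟩ := (h.bijective hz).2 v
      have h0 : a.2 = 0 := by
        rw [← h.dPhiE_paramDeriv hφ hz a, ha]
        exact hv
      refine ⟨a.1, (hd z hz a.1).trans (Eq.trans ?_ ha)⟩
      rw [← h0]
    · rintro ⟨e, rfl⟩
      exact (congrArg (dPhiE (E := E) φ (Ψ (z, 0))) (hd z hz e)).trans
        (h.dPhiE_paramDeriv hφ hz (e, 0))

/-- Precomposition with a diffeomorphism that preserves the last coordinate. -/
theorem comp (h : IsStraightening (E := E) φ Ψ Θ D O) {d' : ℕ}
    (P : OpenPartialHomeomorph (Coord d' × ℝ) (Coord d × ℝ)) (hP : ContDiffOn ℝ ∞ P P.source)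
    (hP' : ContDiffOn ℝ ∞ P.symm P.target) (hPD : ∀ y ∈ P.source, P y ∈ D)
    (hP₂ : ∀ y ∈ P.source, (P y).2 = y.2) :
    IsStraightening (E := E) φ (Ψ ∘ P) (P.symm ∘ Θ) P.source (O ∩ Θ ⁻¹' P.target) where
  isOpen_source := P.open_source
  isOpen_target := h.smooth_symm.continuousOn.isOpen_inter_preimage h.isOpen_target P.open_target
  smooth := h.smooth.comp hP.contMDiffOn hPD
  smooth_symm := hP'.contMDiffOn.comp (h.smooth_symm.mono Set.inter_subset_left) fun x hx => hx.2
  mapsTo := fun y hy => ⟨h.mapsTo (hPD y hy), by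
    change Θ (Ψ (P y)) ∈ P.target
    rw [h.left_inv _ (hPD y hy)]
    exact P.map_source hy⟩
  mapsTo_symm := fun x hx => P.map_target hx.2
  left_inv := fun y hy => by
    change P.symm (Θ (Ψ (P y))) = y
    rw [h.left_inv _ (hPD y hy), P.left_inv hy]
  right_inv := fun x hx => by
    change Ψ (P (P.symm (Θ x))) = x
    rw [P.right_inv hx.2, h.right_inv x hx.1]
  apply_eq := fun y hy => (h.apply_eq _ (hPD y hy)).trans (hP₂ y hy)

end IsStraightening

/-- In a chart, a projection to the kernel of `dφ(q)` together with `φ` itself has an invertible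
derivative at `q`, and the inverse function theorem provides the coordinates. -/
theorem exists_isStraightening (hφ : ContMDiff 𝓘(ℝ, E) 𝓘(ℝ, ℝ) ∞ φ) {q : M}
    (hq : dPhi (E := E) φ q ≠ 0) :
    ∃ (d : ℕ) (Ψ : Coord d × ℝ → M) (Θ : M → Coord d × ℝ) (D : Set (Coord d × ℝ)) (O : Set M),
      IsStraightening (E := E) φ Ψ Θ D O ∧ q ∈ O := by
  let e := extChartAt 𝓘(ℝ, E) q
  have hsymm : ContMDiffOn 𝓘(ℝ, E) 𝓘(ℝ, E) ∞ e.symm e.target := contMDiffOn_extChartAt_symm q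
  have hetarget : IsOpen e.target := isOpen_extChartAt_target q
  have hmem : e q ∈ e.target := mem_extChartAt_target q
  have hφe : ContDiffOn ℝ ∞ (φ ∘ e.symm) e.target := by
    rw [← contMDiffOn_iff_contDiffOn]
    exact hφ.comp_contMDiffOn hsymm
  let ℓ : E →L[ℝ] ℝ := fderiv ℝ (φ ∘ e.symm) (e q)
  have hℓ : HasFDerivAt (φ ∘ e.symm) ℓ (e q) :=
    ((hφe.contDiffAt (hetarget.mem_nhds hmem)).differentiableAt (by simp)).hasFDerivAt
  have hℓ0 : ℓ ≠ 0 := by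
    intro h0
    apply hq
    have h1 : MDifferentiableAt 𝓘(ℝ, E) 𝓘(ℝ, ℝ) φ q := hφ.mdifferentiableAt (by simp)
    have h2 := h1.mfderiv
    refine h2.trans ?_
    refine Eq.trans ?_ h0
    simp only [writtenInExtChartAt, mfld_simps, fderivWithin_univ]
    rfl
  obtain ⟨n₀, hn₀⟩ : ∃ n, ℓ n ≠ 0 := by
    by_contra hcon
    push Not at hcon
    exact hℓ0 (ContinuousLinearMap.ext hcon)
  let k := LinearMap.ker ℓ.toLinearMap
  let n : E := (ℓ n₀)⁻¹ • n₀
  have hn : ℓ n = 1 := by simp [n, hn₀]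
  let ι := toEuclidean (E := k)
  let L₀ : E →L[ℝ] k := (ContinuousLinearMap.id ℝ E - ℓ.smulRight n).codRestrict k fun v => by
    change ℓ (v - ℓ v • n) = 0
    simp [hn]
  let L : E →L[ℝ] Coord (Module.finrank ℝ k) := (ι : k →L[ℝ] _).comp L₀
  have hbij : Function.Bijective (L.prod ℓ) := by
    constructor
    · rw [injective_iff_map_eq_zero]
      intro v hv
      have h1 : ι (L₀ v) = 0 := congrArg Prod.fst hv
      have h2 : ℓ v = 0 := congrArg Prod.snd hv
      have h3 : L₀ v = 0 := by simpa using h1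
      have h4 : v - ℓ v • n = 0 := congrArg Subtype.val h3
      simpa [h2] using h4
    · rintro ⟨a, r⟩
      have h5 : ℓ (ι.symm a : E) = 0 := (ι.symm a).2
      refine ⟨(ι.symm a : E) + r • n, Prod.ext ?_ ?_⟩
      · change ι (L₀ _) = a
        rw [← ι.apply_symm_apply a]
        congr 1
        apply Subtype.ext
        change _ - ℓ _ • n = _
        simp [h5, hn]
      · change ℓ _ = r
        simp [h5, hn]
  let T : E ≃L[ℝ] Coord (Module.finrank ℝ k) × ℝ :=
    (LinearEquiv.ofBijective (L.prod ℓ).toLinearMap hbij).toContinuousLinearEquiv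
  have hT : (T : E →L[ℝ] _) = L.prod ℓ := by ext <;> rfl
  obtain ⟨P, hPf, hPmem, hPs, hPsymm, -⟩ := exists_openPartialHomeomorph_of_contDiffOn
    (f := fun y => (L y, (φ ∘ e.symm) y)) (s := e.target) (a := e q) hetarget
    (L.contDiff.contDiffOn.prodMk hφe) hmem T (by
      rw [hT]
      exact L.hasFDerivAt.prodMk hℓ)
  have hPs' : ContDiffOn ℝ ∞ P P.source := by
    rw [hPf]
    exact (L.contDiff.contDiffOn.prodMk hφe).mono hPs
  refine ⟨_, e.symm ∘ P.symm, P ∘ e, P.target, e.source ∩ e ⁻¹' P.source, ?_, ?_⟩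
  · refine ⟨P.open_target, (continuousOn_extChartAt q).isOpen_inter_preimage
      (isOpen_extChartAt_source q) P.open_source, ?_, ?_, ?_, ?_, ?_, ?_, ?_⟩
    · exact ContMDiffOn.comp (t := e.target) hsymm hPsymm.contMDiffOn
        fun y hy => hPs (P.map_target hy)
    · refine ContMDiffOn.comp (t := P.source) hPs'.contMDiffOn ((contMDiffOn_extChartAt (I := 𝓘(ℝ, E)) (x := q)).mono (by
        rw [← extChartAt_source 𝓘(ℝ, E)]
        exact Set.inter_subset_left)) ?_
      exact fun x hx => hx.2
    · intro y hy
      refine ⟨e.map_target (hPs (P.map_target hy)), ?_⟩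
      change e (e.symm (P.symm y)) ∈ P.source
      rw [e.right_inv (hPs (P.map_target hy))]
      exact P.map_target hy
    · exact fun x hx => P.map_source hx.2
    · intro y hy
      change P (e (e.symm (P.symm y))) = y
      rw [e.right_inv (hPs (P.map_target hy)), P.right_inv hy]
    · intro x hx
      change e.symm (P.symm (P (e x))) = x
      rw [P.left_inv hx.2, e.left_inv hx.1]
    · intro y hy
      have := congrArg Prod.snd (P.right_inv hy)
      rw [hPf] at this
      exact this
  · exact ⟨mem_extChartAt_source q, hPmem⟩

theorem exists_isLocalCoord (hφ : ContMDiff 𝓘(ℝ, E) 𝓘(ℝ, ℝ) ∞ φ) {q : M} (hq0 : q ∈ bdry φ)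
    (hq : dPhi (E := E) φ q ≠ 0) :
    ∃ (d : ℕ) (u : Coord d → M) (V : Set (Coord d)) (z : Coord d),
      IsLocalCoord 𝓘(ℝ, E) (bdry φ) (bdryT φ) u V ∧ z ∈ V ∧ u z = q := by
  obtain ⟨d, Ψ, Θ, D, O, h, hqO⟩ := exists_isStraightening hφ hq
  have h0 : ((Θ q).1, (0 : ℝ)) = Θ q := by
    refine Prod.ext rfl ?_
    rw [← h.apply_eq _ (h.mapsTo_symm hqO), h.right_inv q hqO]
    exact hq0.symm
  refine ⟨d, _, _, (Θ q).1, h.isLocalCoord hφ, ?_, ?_⟩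
  · change ((Θ q).1, (0 : ℝ)) ∈ D
    rw [h0]
    exact h.mapsTo_symm hqO
  · rw [h0]
    exact h.right_inv q hqO

end Straightening

/-! ### Coordinates whose last direction is normal to the hypersurface -/

section Adapted

variable {E : Type*} [NormedAddCommGroup E] [NormedSpace ℝ E] [FiniteDimensional ℝ E]
  {M : Type*} [TopologicalSpace M] [ChartedSpace E M] [IsManifold 𝓘(ℝ, E) ∞ M]
  {g : Bundle.ContMDiffRiemannianMetric 𝓘(ℝ, E) ∞ E (fun x : M => TangentSpace 𝓘(ℝ, E) x)}
  {φ : M → ℝ} {d : ℕ} {u : Coord d → M} {V : Set (Coord d)}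

/-- A straightening that extends the local parametrization `u` of the hypersurface and whose last
coordinate direction is normal to the hypersurface. -/
structure IsAdapted
    (g : Bundle.ContMDiffRiemannianMetric 𝓘(ℝ, E) ∞ E (fun x : M => TangentSpace 𝓘(ℝ, E) x))
    (φ : M → ℝ) (u : Coord d → M) (V : Set (Coord d)) (Ψ : Coord d × ℝ → M)
    (Θ : M → Coord d × ℝ) (D : Set (Coord d × ℝ)) (O : Set M) : Prop
    extends IsStraightening (E := E) φ Ψ Θ D O where
  coord : IsLocalCoord 𝓘(ℝ, E) (bdry φ) (bdryT φ) u V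
  smooth_phi : ContMDiff 𝓘(ℝ, E) 𝓘(ℝ, ℝ) ∞ φ
  base : ∀ z, (z, (0 : ℝ)) ∈ D → z ∈ V ∧ Ψ (z, 0) = u z
  orth : ∀ z, (z, (0 : ℝ)) ∈ D → ∀ a : Coord d,
    pullForm g (Ψ (z, 0)) (paramDeriv 𝓘(ℝ, E) Ψ (z, 0)) (0, 1) (a, 0) = 0

/-- Any straightening becomes adapted after precomposition with `(z, r) ↦ (τ z + r b(z), r)`. Here
`τ` passes from the coordinates `u` to those of the straightening on the hypersurface, and the shear
by `b` tilts the last direction into the normal one while fixing the points with `r = 0`. -/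
theorem IsLocalCoord.exists_isAdapted (hφ : ContMDiff 𝓘(ℝ, E) 𝓘(ℝ, ℝ) ∞ φ)
    (hu : IsLocalCoord 𝓘(ℝ, E) (bdry φ) (bdryT φ) u V) {z₀ : Coord d} (hz₀ : z₀ ∈ V)
    (hq : dPhi (E := E) φ (u z₀) ≠ 0) :
    ∃ (Ψ : Coord d × ℝ → M) (Θ : M → Coord d × ℝ) (D : Set (Coord d × ℝ)) (O : Set M),
      IsAdapted g φ u V Ψ Θ D O ∧ (z₀, (0 : ℝ)) ∈ D := by
  obtain ⟨d₁, Ψ, Θ, D, O, h, hqO⟩ := exists_isStraightening hφ hq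
  set N : Set (Coord d) := V ∩ u ⁻¹' O with hN
  have hNo : IsOpen N := hu.continuousOn.isOpen_inter_preimage hu.isOpen h.isOpen_target
  set τ : Coord d → Coord d₁ := fun z => (Θ (u z)).1 with hτdef
  have hΘu : ContDiffOn ℝ ∞ (fun z => Θ (u z)) N := by
    rw [← contMDiffOn_iff_contDiffOn]
    exact h.smooth_symm.comp (hu.smooth.mono Set.inter_subset_left) fun z hz => hz.2
  have hτ : ContDiffOn ℝ ∞ τ N := hΘu.fst
  have hτd : ∀ z ∈ N, DifferentiableAt ℝ τ z := fun z hz =>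
    (hτ.contDiffAt (hNo.mem_nhds hz)).differentiableAt (by simp)
  have hτu : ∀ z ∈ N, (τ z, (0 : ℝ)) ∈ D ∧ Ψ (τ z, 0) = u z := by
    intro z hz
    have h0 : (τ z, (0 : ℝ)) = Θ (u z) := by
      refine Prod.ext rfl ?_
      rw [← h.apply_eq _ (h.mapsTo_symm hz.2), h.right_inv _ hz.2]
      exact (hu.mapsTo hz.1).symm
    rw [h0]
    exact ⟨h.mapsTo_symm hz.2, h.right_inv _ hz.2⟩
  have hu₁ := h.isLocalCoord hφ
  have hDτ : ∀ z ∈ N, Function.Bijective (fderiv ℝ τ z) := by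
    intro z hz
    have h1 := paramDeriv_comp (I := 𝓘(ℝ, E)) (u := u) (u' := fun z => Ψ (z, 0)) (τ := τ) (z := z)
      (hu₁.mdifferentiableAt (hτu z hz).1) (hτd z hz)
      (Filter.eventually_of_mem (hNo.mem_nhds hz) fun y hy => (hτu y hy).2)
    have h2 : ∀ e, paramDeriv 𝓘(ℝ, E) u z e =
        paramDeriv 𝓘(ℝ, E) (fun z => Ψ (z, 0)) (τ z) (fderiv ℝ τ z e) := fun e =>
      congrArg (fun L : Coord d →L[ℝ] E => L e) h1
    constructor
    · intro v w hvw
      exact hu.immersion z hz.1 ((h2 v).trans ((congrArg _ hvw).trans (h2 w).symm))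
    · intro a
      have h3 : paramDeriv 𝓘(ℝ, E) (fun z => Ψ (z, 0)) (τ z) a ∈ bdryT (E := E) φ (Ψ (τ z, 0)) :=
        (hu₁.tangent _ (hτu z hz).1 _).2 ⟨a, rfl⟩
      rw [(hτu z hz).2] at h3
      obtain ⟨e, he⟩ := (hu.tangent z hz.1 _).1 h3
      exact ⟨e, hu₁.immersion _ (hτu z hz).1 ((h2 e).symm.trans he)⟩
  -- the pulled back metric and the normal correction
  set G : Coord d₁ × ℝ → (Coord d₁ × ℝ) →L[ℝ] (Coord d₁ × ℝ) →L[ℝ] ℝ := fun y =>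
    pullForm g (Ψ y) (paramDeriv 𝓘(ℝ, E) Ψ y) with hG
  have hGs : ContDiffOn ℝ ∞ G D := contDiffOn_pullForm_paramDeriv g h.isOpen_source h.smooth
  have hGpos : ∀ y ∈ D, ∀ a, a ≠ 0 → 0 < G y a a := fun y hy a ha =>
    pullForm_pos g (h.bijective hy).1 a ha
  set ι : Coord d₁ →L[ℝ] Coord d₁ × ℝ := ContinuousLinearMap.inl ℝ (Coord d₁) ℝ with hι
  have hGN : ContDiffOn ℝ ∞ (fun z => G (τ z, 0)) N :=
    hGs.comp (hτ.prodMk contDiffOn_const) fun z hz => (hτu z hz).1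
  set γ : Coord d → Coord d₁ →L[ℝ] Coord d₁ →L[ℝ] ℝ := fun z =>
    (G (τ z, 0)).bilinearComp ι ι with hγ
  have hγs : ContDiffOn ℝ ∞ γ N := contDiffOn_clm_apply.2 fun a => contDiffOn_clm_apply.2 fun b =>
    (hGN.clm_apply contDiffOn_const).clm_apply contDiffOn_const
  have hγpos : ∀ z ∈ N, ∀ a, a ≠ 0 → 0 < γ z a a := fun z hz a ha =>
    hGpos _ (hτu z hz).1 _ fun h0 => ha (congrArg Prod.fst h0)
  set ν : Coord d → Coord d₁ →L[ℝ] ℝ := fun z => (G (τ z, 0) (0, 1)).comp ι with hν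
  have hνs : ContDiffOn ℝ ∞ ν N := contDiffOn_clm_apply.2 fun a =>
    (hGN.clm_apply contDiffOn_const).clm_apply contDiffOn_const
  -- Chosen so that `(b z, 1)` is orthogonal to every `(a, 0)`: the tangential part of `(0, 1)` is
  -- removed.
  set b : Coord d → Coord d₁ := fun z => -((γ z).inverse (ν z)) with hb
  have hbs : ContDiffOn ℝ ∞ b N :=
    ((contDiffOn_inverse_of_posDef hγs hγpos).clm_apply hνs).neg
  have hγb : ∀ z ∈ N, ∀ a, γ z (b z) a = - ν z a := by
    intro z hz a
    simp only [hb, map_neg, neg_apply, apply_inverse_of_posDef (hγpos z hz)]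
  -- the modified straightening
  set T : Coord d × ℝ → Coord d₁ × ℝ := fun y => (τ y.1 + y.2 • b y.1, y.2) with hT
  have hTs : ContDiffOn ℝ ∞ T (N ×ˢ Set.univ) := by
    have h1 : ContDiffOn ℝ ∞ (Prod.fst : Coord d × ℝ → Coord d) (N ×ˢ Set.univ) :=
      contDiff_fst.contDiffOn
    have h2 : ContDiffOn ℝ ∞ (Prod.snd : Coord d × ℝ → ℝ) (N ×ˢ Set.univ) :=
      contDiff_snd.contDiffOn
    exact ((hτ.comp h1 fun y hy => hy.1).add (h2.smul (hbs.comp h1 fun y hy => hy.1))).prodMk h2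
  have hTd : ∀ z ∈ N, HasFDerivAt T (((fderiv ℝ τ z).coprod
      ((ContinuousLinearMap.id ℝ ℝ).smulRight (b z))).prod (ContinuousLinearMap.snd ℝ (Coord d) ℝ))
      (z, 0) := by
    intro z hz
    have h1 : HasFDerivAt (Prod.fst : Coord d × ℝ → Coord d) (ContinuousLinearMap.fst ℝ _ _)
      (z, (0 : ℝ)) := hasFDerivAt_fst
    have h2 : HasFDerivAt (Prod.snd : Coord d × ℝ → ℝ) (ContinuousLinearMap.snd ℝ _ _)
      (z, (0 : ℝ)) := hasFDerivAt_snd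
    have h3 : HasFDerivAt b (fderiv ℝ b z) z :=
      ((hbs.contDiffAt (hNo.mem_nhds hz)).differentiableAt (by simp)).hasFDerivAt
    have h4 := (((hτd z hz).hasFDerivAt.comp (z, (0 : ℝ)) h1).add
      (h2.smul (h3.comp (z, (0 : ℝ)) h1))).prodMk h2
    refine h4.congr_fderiv ?_
    ext v <;> simp
  have hz₀N : z₀ ∈ N := ⟨hz₀, hqO⟩
  set s : Set (Coord d × ℝ) := (N ×ˢ Set.univ) ∩ T ⁻¹' D with hs
  have hso : IsOpen s := hTs.continuousOn.isOpen_inter_preimage (hNo.prod isOpen_univ)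
    h.isOpen_source
  have hT0 : ∀ z, T (z, 0) = (τ z, 0) := fun z => by simp [hT]
  have hz₀s : (z₀, (0 : ℝ)) ∈ s := by
    refine ⟨⟨hz₀N, trivial⟩, ?_⟩
    rw [Set.mem_preimage, hT0]
    exact (hτu z₀ hz₀N).1
  have hbij : Function.Bijective (((fderiv ℝ τ z₀).coprod
      ((ContinuousLinearMap.id ℝ ℝ).smulRight (b z₀))).prod
      (ContinuousLinearMap.snd ℝ (Coord d) ℝ)) := by
    constructor
    · rw [injective_iff_map_eq_zero]
      rintro ⟨a, r⟩ h0
      have h1 : r = 0 := congrArg Prod.snd h0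
      have h2 : fderiv ℝ τ z₀ a + r • b z₀ = 0 := congrArg Prod.fst h0
      rw [h1, zero_smul, add_zero] at h2
      rw [h1, (injective_iff_map_eq_zero _).1 (hDτ z₀ hz₀N).1 a h2]
      rfl
    · rintro ⟨a, r⟩
      obtain ⟨e, he⟩ := (hDτ z₀ hz₀N).2 (a - r • b z₀)
      refine ⟨(e, r), Prod.ext ?_ rfl⟩
      change fderiv ℝ τ z₀ e + r • b z₀ = a
      rw [he]
      simp
  obtain ⟨P, hPf, hPmem, hPs, hPsymm, -⟩ := exists_openPartialHomeomorph_of_contDiffOn (f := T)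
    hso (hTs.mono Set.inter_subset_left) hz₀s
    (LinearEquiv.ofBijective (((fderiv ℝ τ z₀).coprod
      ((ContinuousLinearMap.id ℝ ℝ).smulRight (b z₀))).prod
      (ContinuousLinearMap.snd ℝ (Coord d) ℝ)).toLinearMap hbij).toContinuousLinearEquiv (by
      refine (hTd z₀ hz₀N).congr_fderiv ?_
      ext v <;> rfl)
  have hst := h.comp P (by rw [hPf]; exact (hTs.mono Set.inter_subset_left).mono hPs) hPsymm
    (by rw [hPf]; exact fun y hy => (hPs hy).2) (by rw [hPf]; exact fun y hy => rfl)
  refine ⟨_, _, _, _, ⟨hst, hu, hφ, ?_, ?_⟩, hPmem⟩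
  · intro z hz
    have hzN : z ∈ N := (hPs hz).1.1
    refine ⟨hzN.1, ?_⟩
    change Ψ (P (z, 0)) = u z
    rw [hPf, hT0]
    exact (hτu z hzN).2
  · intro z hz a
    have hzN : z ∈ N := (hPs hz).1.1
    have hPz : P (z, 0) = (τ z, 0) := by rw [hPf, hT0]
    have h1 := paramDeriv_comp (I := 𝓘(ℝ, E)) (u := Ψ ∘ P) (u' := Ψ) (τ := P) (z := (z, (0 : ℝ)))
      (h.mdifferentiableAt (by rw [hPz]; exact (hτu z hzN).1))
      (by rw [hPf]; exact (hTd z hzN).differentiableAt) (Filter.Eventually.of_forall fun _ => rfl)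
    have h2 : ∀ v : Coord d × ℝ, paramDeriv 𝓘(ℝ, E) (Ψ ∘ P) (z, 0) v =
        paramDeriv 𝓘(ℝ, E) Ψ (τ z, 0) (fderiv ℝ τ z v.1 + v.2 • b z, v.2) := by
      intro v
      rw [h1, hPz, hPf, (hTd z hzN).fderiv]
      rfl
    have hgo : pullForm g ((Ψ ∘ P) (z, 0)) (paramDeriv 𝓘(ℝ, E) (Ψ ∘ P) (z, 0)) (0, 1) (a, 0) =
        G (τ z, 0) (b z, 1) (fderiv ℝ τ z a, 0) := by
      rw [pullForm_apply, h2, h2, Function.comp_apply, hPz]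
      simp [hG, pullForm_apply]
    rw [hgo]
    have h3 : ((b z, 1) : Coord d₁ × ℝ) = ι (b z) + (0, 1) := by simp [hι]
    have h4 := hγb z hzN (fderiv ℝ τ z a)
    rw [h3, map_add, add_apply]
    change γ z (b z) (fderiv ℝ τ z a) + ν z (fderiv ℝ τ z a) = 0
    rw [h4, neg_add_cancel]

end Adapted

/-! ### Coordinates on the double and the regularized Hamiltonian -/

section Double

variable {E : Type*} [NormedAddCommGroup E] [NormedSpace ℝ E] [FiniteDimensional ℝ E]
  {M : Type*} [TopologicalSpace M] [ChartedSpace E M] [IsManifold 𝓘(ℝ, E) ∞ M]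
  (g : Bundle.ContMDiffRiemannianMetric 𝓘(ℝ, E) ∞ E (fun x : M => TangentSpace 𝓘(ℝ, E) x))
  (φ : M → ℝ) {d : ℕ} {u : Coord d → M} {V : Set (Coord d)}

/-- A linear isomorphism that splits off the last coordinate. -/
def splitLast (d : ℕ) : Coord (d + 1) ≃L[ℝ] Coord d × ℝ :=
  ContinuousLinearEquiv.ofFinrankEq (by simp)

/-- The folding map `(z, ξ) ↦ (z, ξ² / 2)`. -/
def fold (a : Coord (d + 1)) : Coord d × ℝ := ((splitLast d a).1, (splitLast d a).2 ^ 2 / 2)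

theorem contDiff_fold : ContDiff ℝ ∞ (fold (d := d)) := by
  unfold fold
  have := (splitLast d).contDiff (n := ∞)
  fun_prop

theorem fderiv_fold (a e : Coord (d + 1)) :
    fderiv ℝ fold a e = ((splitLast d e).1, (splitLast d a).2 * (splitLast d e).2) := by
  have h := (splitLast d).hasFDerivAt (x := a)
  have h1 : HasFDerivAt (fun a : Coord (d + 1) => ((splitLast d a).1, (splitLast d a).2 ^ 2 * 2⁻¹))
      _ a := h.fst.prodMk ((h.snd.pow 2).mul_const (2 : ℝ)⁻¹)
  change fderiv ℝ (fun a : Coord (d + 1) =>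
    ((splitLast d a).1, (splitLast d a).2 ^ 2 * 2⁻¹)) a e = _
  rw [h1.fderiv]
  refine Prod.ext rfl ?_
  simp
  ring

/-- The parametrization `(z, ξ) ↦ (Ψ(z, ξ² / 2), ξ)` of the double. -/
def dblParam (Ψ : Coord d × ℝ → M) (a : Coord (d + 1)) : M × ℝ := (Ψ (fold a), (splitLast d a).2)

variable {φ} {Ψ : Coord d × ℝ → M} {Θ : M → Coord d × ℝ} {D : Set (Coord d × ℝ)} {O : Set M}

theorem IsStraightening.paramDeriv_dblParam (h : IsStraightening (E := E) φ Ψ Θ D O)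
    {a : Coord (d + 1)} (ha : fold a ∈ D) (e : Coord (d + 1)) :
    paramDeriv (𝓘(ℝ, E).prod 𝓘(ℝ, ℝ)) (dblParam Ψ) a e =
      (paramDeriv 𝓘(ℝ, E) Ψ (fold a) ((splitLast d e).1, (splitLast d a).2 * (splitLast d e).2),
        (splitLast d e).2) := by
  have h1 : HasMFDerivAt 𝓘(ℝ, Coord (d + 1)) 𝓘(ℝ, E) (fun a => Ψ (fold a)) a
      (mfderiv 𝓘(ℝ, Coord (d + 1)) 𝓘(ℝ, E) (fun a => Ψ (fold a)) a) :=
    (MDifferentiableAt.comp a (h.mdifferentiableAt ha)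
      (contDiff_fold.contMDiff.mdifferentiableAt (by simp))).hasMFDerivAt
  have h2 : HasMFDerivAt 𝓘(ℝ, Coord (d + 1)) 𝓘(ℝ, ℝ) (fun a => (splitLast d a).2) a
      ((ContinuousLinearMap.snd ℝ _ _).comp (splitLast d : Coord (d + 1) →L[ℝ] Coord d × ℝ)) :=
    ((ContinuousLinearMap.snd ℝ _ _).comp
      (splitLast d : Coord (d + 1) →L[ℝ] Coord d × ℝ)).hasFDerivAt.hasMFDerivAt
  have h3 := (h1.prodMk h2).mfderiv
  have h4 := paramDeriv_comp (I := 𝓘(ℝ, E)) (u := fun a => Ψ (fold a)) (u' := Ψ)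
    (τ := fold) (z := a) (h.mdifferentiableAt ha)
    (contDiff_fold.differentiable (by simp) a) (Filter.Eventually.of_forall fun _ => rfl)
  refine (congrArg (fun L : Coord (d + 1) →L[ℝ] E × ℝ => L e) h3).trans ?_
  refine Prod.ext ?_ rfl
  refine (congrArg (fun L : Coord (d + 1) →L[ℝ] E => L e) h4).trans ?_
  exact congrArg _ (fderiv_fold a e)

/-- In straightened coordinates the equation `ξ² = 2 φ` reads `r = ξ² / 2`, so the double is a graph
over the space of `(z, ξ)`. This is why it has no singularity at `ξ = 0`. -/
theorem IsStraightening.isLocalCoord_dbl (h : IsStraightening (E := E) φ Ψ Θ D O)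
    (hφ : ContMDiff 𝓘(ℝ, E) 𝓘(ℝ, ℝ) ∞ φ) :
    IsLocalCoord (𝓘(ℝ, E).prod 𝓘(ℝ, ℝ)) (dbl φ) (dblT φ) (dblParam Ψ) (fold ⁻¹' D) := by
  have hsl : ContDiff ℝ ∞ (fun a : Coord (d + 1) => (splitLast d a).2) :=
    (splitLast d).contDiff.snd
  have hrec : ∀ a : Coord (d + 1), fold a ∈ D →
      (splitLast d).symm ((Θ (dblParam Ψ a).1).1, (dblParam Ψ a).2) = a := by
    intro a ha
    rw [ContinuousLinearEquiv.symm_apply_eq]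
    refine Prod.ext ?_ rfl
    change (Θ (Ψ (fold a))).1 = _
    rw [h.left_inv _ ha]
    rfl
  refine ⟨h.isOpen_source.preimage contDiff_fold.continuous, ?_, ?_, ?_, ?_, ?_, ?_⟩
  · exact (h.smooth.comp contDiff_fold.contMDiff.contMDiffOn fun a ha => ha).prodMk
      hsl.contMDiff.contMDiffOn
  · intro a ha
    change (splitLast d a).2 ^ 2 = 2 * φ (Ψ (fold a))
    rw [h.apply_eq _ ha]
    simp only [fold]
    ring
  · intro a ha b hb hab
    rw [← hrec a ha, hab, hrec b hb]
  · intro V' hV' hV'o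
    have hc : ContinuousOn (fun y : M × ℝ => (splitLast d).symm ((Θ y.1).1, y.2))
        (O ×ˢ Set.univ) := by
      have h1 : ContinuousOn (fun y : M × ℝ => Θ y.1) (O ×ˢ Set.univ) :=
        h.smooth_symm.continuousOn.comp continuousOn_fst fun y hy => hy.1
      exact (splitLast d).symm.continuous.comp_continuousOn (h1.fst.prodMk continuousOn_snd)
    refine ⟨_, hc.isOpen_inter_preimage (h.isOpen_target.prod isOpen_univ) hV'o, ?_⟩
    ext y
    constructor
    · rintro ⟨a, ha, rfl⟩
      refine ⟨?_, ⟨h.mapsTo (hV' ha), trivial⟩, ?_⟩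
      · change (splitLast d a).2 ^ 2 = 2 * φ (Ψ (fold a))
        rw [h.apply_eq _ (hV' ha)]
        simp only [fold]
        ring
      · rw [Set.mem_preimage, hrec a (hV' ha)]
        exact ha
    · rintro ⟨hy, hyO, hyV⟩
      refine ⟨_, hyV, ?_⟩
      have h1 : fold ((splitLast d).symm ((Θ y.1).1, y.2)) = Θ y.1 := by
        simp only [fold, ContinuousLinearEquiv.apply_symm_apply]
        refine Prod.ext rfl ?_
        have h2 : y.2 ^ 2 = 2 * φ y.1 := hy
        rw [← h.apply_eq _ (h.mapsTo_symm hyO.1), h.right_inv _ hyO.1]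
        change y.2 ^ 2 / 2 = _
        rw [h2]
        ring
      refine Prod.ext ?_ ?_
      · change Ψ (fold _) = y.1
        rw [h1, h.right_inv _ hyO.1]
      · simp [dblParam]
  · intro a ha v w hvw
    have h1 := (h.paramDeriv_dblParam ha v).symm.trans (hvw.trans (h.paramDeriv_dblParam ha w))
    have h2 : (splitLast d v).2 = (splitLast d w).2 := congrArg (fun x : E × ℝ => x.2) h1
    have h3 := (h.bijective ha).1 (congrArg (fun x : E × ℝ => x.1) h1)
    exact (splitLast d).injective (Prod.ext (Prod.mk.inj h3).1 h2)
  · intro a ha v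
    rw [mem_dblT]
    constructor
    · intro hv
      obtain ⟨b, hb⟩ := (h.bijective ha).2 (Prod.fst (α := E) (β := ℝ) v)
      refine ⟨(splitLast d).symm (b.1, Prod.snd (α := E) (β := ℝ) v),
        (h.paramDeriv_dblParam ha _).trans ?_⟩
      simp only [ContinuousLinearEquiv.apply_symm_apply]
      have h1 := h.dPhiE_paramDeriv hφ ha b
      rw [hb] at h1
      have h2 : ((b.1, (splitLast d a).2 * Prod.snd (α := E) (β := ℝ) v) : Coord d × ℝ) = b :=
        Prod.ext rfl (hv.trans h1)
      rw [h2, hb]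
      rfl
    · rintro ⟨e, rfl⟩
      have h1 := h.paramDeriv_dblParam ha e
      have h2 := h.dPhiE_paramDeriv hφ ha ((splitLast d e).1, (splitLast d a).2 * (splitLast d e).2)
      refine Eq.trans ?_ (h2.symm.trans ?_)
      · exact congrArg (fun x : E × ℝ => (splitLast d a).2 * x.2) h1
      · exact (congrArg (fun x : E × ℝ => dPhiE (E := E) φ (Ψ (fold a)) x.1) h1).symm

/-- Phase space coordinates `(z, r, m, η)`. -/
abbrev Phase (d : ℕ) : Type := Coord d × ℝ × (Coord d →L[ℝ] ℝ) × ℝ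

/-- The covector `(m, η)` on `ℝ^d × ℝ`. -/
def joinCovector (m : Coord d →L[ℝ] ℝ) (η : ℝ) : Coord d × ℝ →L[ℝ] ℝ :=
  m.coprod (η • ContinuousLinearMap.id ℝ ℝ)

@[simp] theorem joinCovector_apply (m : Coord d →L[ℝ] ℝ) (η : ℝ) (v : Coord d × ℝ) :
    joinCovector m η v = m v.1 + η * v.2 := by
  simp [joinCovector]

/-- The kinetic energy `½ ‖(m, η)‖²` at `Ψ(z, r)`. -/
def chartK (Ψ : Coord d × ℝ → M) (x : Phase d) : ℝ :=
  1 / 2 * joinCovector x.2.2.1 x.2.2.2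
    ((pullForm g (Ψ (x.1, x.2.1)) (paramDeriv 𝓘(ℝ, E) Ψ (x.1, x.2.1))).inverse
      (joinCovector x.2.2.1 x.2.2.2))

theorem contDiff_joinCovector :
    ContDiff ℝ ∞ (fun x : (Coord d →L[ℝ] ℝ) × ℝ => joinCovector x.1 x.2) := by
  refine contDiff_clm_apply_iff.2 fun v => ?_
  simp only [joinCovector_apply]
  exact ((contDiff_fst (E := Coord d →L[ℝ] ℝ) (F := ℝ)).clm_apply contDiff_const).add
    (contDiff_snd.mul contDiff_const)

theorem IsStraightening.contDiffOn_chartK (h : IsStraightening (E := E) φ Ψ Θ D O) :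
    ContDiffOn ℝ ∞ (chartK g Ψ) {x : Phase d | (x.1, x.2.1) ∈ D} := by
  have h1 := contDiffOn_inverse_of_posDef
    (contDiffOn_pullForm_paramDeriv g h.isOpen_source h.smooth)
    (fun y hy v hv => pullForm_pos g (h.bijective hy).1 v hv)
  have h2 : ContDiffOn ℝ ∞ (fun x : Phase d => (x.1, x.2.1)) {x : Phase d | (x.1, x.2.1) ∈ D} := by
    fun_prop
  have h3 : ContDiffOn ℝ ∞ (fun x : Phase d => joinCovector x.2.2.1 x.2.2.2)
      {x : Phase d | (x.1, x.2.1) ∈ D} :=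
    (contDiff_joinCovector.comp (contDiff_snd.comp contDiff_snd)).contDiffOn
  exact contDiffOn_const.mul (h3.clm_apply ((h1.comp h2 fun x hx => hx).clm_apply h3))

/-- The point of `T*Ω̂` with coordinates `(z, ξ)` and conjugate momenta `(p, η)`. -/
def dblPoint (φ : M → ℝ) (Ψ : Coord d × ℝ → M) (x : Phase d) : DblCotangent (E := E) φ :=
  ofCoords (𝓘(ℝ, E).prod 𝓘(ℝ, ℝ)) (dblT φ) (dblParam Ψ)
    ((splitLast d).symm (x.1, x.2.1),
      (joinCovector x.2.2.1 x.2.2.2).comp (splitLast d : Coord (d + 1) →L[ℝ] Coord d × ℝ))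

/-- The coordinates in which the regularized Hamiltonian is `chartK`. -/
def foldPhase (x : Phase d) : Phase d := (x.1, x.2.1 ^ 2 / 2, x.2.1 • x.2.2.1, x.2.2.2)

theorem fold_splitLast_symm (x : Coord d × ℝ) :
    fold ((splitLast d).symm x) = (x.1, x.2 ^ 2 / 2) := by
  simp [fold]

/-- If `v` has coordinates `(a, r)`, then its lift `(ξ v, dφ(v))` has coordinates `(ξ a, r)` on the
double. Hence the covector `(p, η)` pulls back to `(ξ p, η)`, and half the squared norm of the
latter at `(z, ξ² / 2)` is the Hamiltonian. -/
theorem IsStraightening.regularizedH_dblPoint (h : IsStraightening (E := E) φ Ψ Θ D O)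
    (hφ : ContMDiff 𝓘(ℝ, E) 𝓘(ℝ, ℝ) ∞ φ) {x : Phase d} (hx : (x.1, x.2.1 ^ 2 / 2) ∈ D) :
    regularizedH φ g (dblPoint φ Ψ x) = chartK g Ψ (foldPhase x) := by
  set a := (splitLast d).symm (x.1, x.2.1) with ha
  have hfold : fold a = (x.1, x.2.1 ^ 2 / 2) := fold_splitLast_symm _
  have haD : fold a ∈ D := by rwa [hfold]
  have hu := h.isLocalCoord_dbl hφ
  set c := dblPoint (E := E) φ Ψ x with hc
  have hL : ∀ v : Coord d × ℝ, ∀ hm,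
      c.2 ⟨paramDeriv (𝓘(ℝ, E).prod 𝓘(ℝ, ℝ)) (dblParam Ψ) a
        ((splitLast d).symm (x.2.1 • v.1, v.2)), hm⟩ = (x.2.1 • x.2.2.1) v.1 + x.2.2.2 * v.2 := by
    intro v hm
    refine (ofCoords_apply hu haD _ _ hm).trans ?_
    simp
  obtain ⟨p, hp⟩ : ∃ p : E →L[ℝ] ℝ, p = c.2.comp (liftT φ c.1) := ⟨_, rfl⟩
  have hcomp : p.comp (paramDeriv 𝓘(ℝ, E) Ψ (fold a)) =
      joinCovector (x.2.1 • x.2.2.1) x.2.2.2 := by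
    refine ContinuousLinearMap.ext fun v => ?_
    rw [joinCovector_apply]
    have hv : paramDeriv (𝓘(ℝ, E).prod 𝓘(ℝ, ℝ)) (dblParam Ψ) a
        ((splitLast d).symm (x.2.1 • v.1, v.2)) =
        ((x.2.1 • paramDeriv 𝓘(ℝ, E) Ψ (fold a) v, v.2) : E × ℝ) := by
      rw [h.paramDeriv_dblParam haD]
      simp only [ContinuousLinearEquiv.apply_symm_apply]
      refine Prod.ext ?_ rfl
      rw [← map_smul]
      simp only [ha, ContinuousLinearEquiv.apply_symm_apply]
      rfl
    have hm : paramDeriv (𝓘(ℝ, E).prod 𝓘(ℝ, ℝ)) (dblParam Ψ) a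
        ((splitLast d).symm (x.2.1 • v.1, v.2)) ∈ dblT (E := E) φ (dblParam Ψ a) :=
      (hu.tangent a haD _).2 ⟨_, rfl⟩
    rw [← hL v hm, hp]
    have hx2 : (splitLast d a).2 = x.2.1 := by simp [ha]
    refine congrArg c.2 (Subtype.ext ?_)
    refine Eq.trans ?_ hv.symm
    change ((splitLast d a).2 • paramDeriv 𝓘(ℝ, E) Ψ (fold a) v,
      dPhiE (E := E) φ (Ψ (fold a)) (paramDeriv 𝓘(ℝ, E) Ψ (fold a) v)) = _
    rw [hx2, h.dPhiE_paramDeriv hφ haD]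
  have h1 := coNormSq_eq g (x := Ψ (fold a)) (h.bijective haD) p
  rw [hcomp] at h1
  have h2 (ℓ : Coord d × ℝ →L[ℝ] ℝ) :
      ℓ ((pullForm g (Ψ (fold a)) (paramDeriv 𝓘(ℝ, E) Ψ (fold a))).inverse ℓ) =
      ℓ ((pullForm g (Ψ (x.1, x.2.1 ^ 2 / 2))
        (paramDeriv 𝓘(ℝ, E) Ψ (x.1, x.2.1 ^ 2 / 2))).inverse ℓ) := by
    rw [hfold]
  subst hp
  exact congrArg (1 / 2 * ·) (h1.trans (h2 _))

end Double

/-! ### Partial derivatives on phase space and the regularized vector field -/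

section PhaseSpace

variable {d : ℕ}

/-- The `z`-derivative. -/
def partZ (L : Phase d →L[ℝ] ℝ) : Coord d →L[ℝ] ℝ := L.comp (ContinuousLinearMap.inl ℝ _ _)

/-- The `r`-derivative. -/
def partR (L : Phase d →L[ℝ] ℝ) : ℝ := L (0, 1, 0, 0)

/-- The derivative in the momentum `m`, as a vector. -/
def partM (L : Phase d →L[ℝ] ℝ) : Coord d :=
  dualVec (L.comp ((ContinuousLinearMap.inr ℝ (Coord d) (ℝ × (Coord d →L[ℝ] ℝ) × ℝ)).comp
    ((ContinuousLinearMap.inr ℝ ℝ ((Coord d →L[ℝ] ℝ) × ℝ)).comp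
      (ContinuousLinearMap.inl ℝ (Coord d →L[ℝ] ℝ) ℝ))))

/-- The `η`-derivative. -/
def partEta (L : Phase d →L[ℝ] ℝ) : ℝ := L (0, 0, 0, 1)

theorem apply_partM (L : Phase d →L[ℝ] ℝ) (α : Coord d →L[ℝ] ℝ) : α (partM L) = L (0, 0, α, 0) := by
  simp [partM, apply_dualVec]

theorem apply_eq_parts (L : Phase d →L[ℝ] ℝ) (x : Phase d) :
    L x = partZ L x.1 + x.2.1 * partR L + x.2.2.1 (partM L) + x.2.2.2 * partEta L := by
  rw [apply_partM]
  have h : x = (x.1, 0, 0, 0) + x.2.1 • (0, 1, 0, 0) + (0, 0, x.2.2.1, 0) +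
      x.2.2.2 • (0, 0, 0, 1) := by
    simp
  conv_lhs => rw [h]
  rw [map_add, map_add, map_add, map_smul, map_smul]
  rfl

/-- The vector field of Hamilton's equations for `K(z, ξ² / 2, ξ p, η)`. -/
def dblField (K : Phase d → ℝ) (x : Phase d) : Phase d :=
  (x.2.1 • partM (fderiv ℝ K (foldPhase x)), partEta (fderiv ℝ K (foldPhase x)),
    -partZ (fderiv ℝ K (foldPhase x)),
    -(x.2.1 * partR (fderiv ℝ K (foldPhase x)) + x.2.2.1 (partM (fderiv ℝ K (foldPhase x)))))

theorem contDiff_foldPhase : ContDiff ℝ ∞ (foldPhase (d := d)) := by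
  unfold foldPhase
  fun_prop

theorem hasFDerivAt_foldPhase (x : Phase d) :
    ∃ L : Phase d →L[ℝ] Phase d, HasFDerivAt foldPhase L x ∧ ∀ v : Phase d,
      L v = (v.1, x.2.1 * v.2.1, v.2.1 • x.2.2.1 + x.2.1 • v.2.2.1, v.2.2.2) := by
  have h1 : HasFDerivAt (fun x : Phase d => x) (ContinuousLinearMap.id ℝ _) x := hasFDerivAt_id x
  have h2 : HasFDerivAt (fun x : Phase d =>
      (x.1, x.2.1 ^ 2 * 2⁻¹, x.2.1 • x.2.2.1, x.2.2.2)) _ x :=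
    h1.fst.prodMk (((h1.snd.fst.pow 2).mul_const (2 : ℝ)⁻¹).prodMk
      ((h1.snd.fst.smul h1.snd.snd.fst).prodMk h1.snd.snd.snd))
  refine ⟨_, h2, fun v => ?_⟩
  refine Prod.ext rfl (Prod.ext ?_ (Prod.ext ?_ rfl))
  · simp
    ring
  · simp [add_comm]

/-- The canonical coordinates `(z, ξ, p, η)` of a point of `T*ℝ^(d + 1)`. -/
def splitPhase (d : ℕ) : Coord (d + 1) × (Coord (d + 1) →L[ℝ] ℝ) →L[ℝ] Phase d :=
  let A := (splitLast d : Coord (d + 1) →L[ℝ] Coord d × ℝ)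
  let B := ((ContinuousLinearMap.compL ℝ (Coord d × ℝ) (Coord (d + 1)) ℝ).flip
    ((splitLast d).symm : Coord d × ℝ →L[ℝ] Coord (d + 1)))
  ((ContinuousLinearMap.fst ℝ _ _).comp (A.comp (ContinuousLinearMap.fst ℝ _ _))).prod
    (((ContinuousLinearMap.snd ℝ _ _).comp (A.comp (ContinuousLinearMap.fst ℝ _ _))).prod
      ((((ContinuousLinearMap.compL ℝ (Coord d) (Coord d × ℝ) ℝ).flip
        (ContinuousLinearMap.inl ℝ (Coord d) ℝ)).comp
          (B.comp (ContinuousLinearMap.snd ℝ _ _))).prod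
        ((ContinuousLinearMap.apply ℝ ℝ ((0, 1) : Coord d × ℝ)).comp
          (B.comp (ContinuousLinearMap.snd ℝ _ _)))))

theorem splitPhase_apply (y : Coord (d + 1) × (Coord (d + 1) →L[ℝ] ℝ)) :
    splitPhase d y = ((splitLast d y.1).1, (splitLast d y.1).2,
      (y.2.comp ((splitLast d).symm : Coord d × ℝ →L[ℝ] Coord (d + 1))).comp
        (ContinuousLinearMap.inl ℝ (Coord d) ℝ), y.2 ((splitLast d).symm (0, 1))) := rfl

theorem apply_eq_splitPhase (w : Coord (d + 1) →L[ℝ] ℝ) (y : Coord (d + 1)) (e : Coord (d + 1)) :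
    w e = (splitPhase d (y, w)).2.2.1 (splitLast d e).1 +
      (splitLast d e).2 * (splitPhase d (y, w)).2.2.2 := by
  have h : e = (splitLast d).symm ((splitLast d e).1, 0) +
      (splitLast d e).2 • (splitLast d).symm (0, 1) := by
    rw [← map_smul, ← map_add]
    simp
  conv_lhs => rw [h, map_add, map_smul]
  rfl

theorem joinCovector_splitPhase (y : Coord (d + 1) × (Coord (d + 1) →L[ℝ] ℝ)) :
    (joinCovector (splitPhase d y).2.2.1 (splitPhase d y).2.2.2).comp
      (splitLast d : Coord (d + 1) →L[ℝ] Coord d × ℝ) = y.2 := by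
  refine ContinuousLinearMap.ext fun e => ?_
  rw [apply_eq_splitPhase y.2 y.1 e]
  simp [mul_comm]

/-- The inverse of `splitPhase`. -/
def mergePhase (x : Phase d) : Coord (d + 1) × (Coord (d + 1) →L[ℝ] ℝ) :=
  ((splitLast d).symm (x.1, x.2.1),
      (joinCovector x.2.2.1 x.2.2.2).comp (splitLast d : Coord (d + 1) →L[ℝ] Coord d × ℝ))

theorem splitPhase_mergePhase (x : Phase d) : splitPhase d (mergePhase x) = x := by
  rw [splitPhase_apply]
  refine Prod.ext (by simp [mergePhase]) (Prod.ext (by simp [mergePhase]) (Prod.ext ?_ ?_))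
  · refine ContinuousLinearMap.ext fun v => ?_
    simp [mergePhase]
  · simp [mergePhase]

end PhaseSpace

/-! ### Trajectories of the regularized flow in coordinates -/

section Trajectories

variable {E : Type*} [NormedAddCommGroup E] [NormedSpace ℝ E] [FiniteDimensional ℝ E]
  {M : Type*} [TopologicalSpace M] [ChartedSpace E M] [IsManifold 𝓘(ℝ, E) ∞ M]
  {g : Bundle.ContMDiffRiemannianMetric 𝓘(ℝ, E) ∞ E (fun x : M => TangentSpace 𝓘(ℝ, E) x)}
  {φ : M → ℝ} {d : ℕ} {u : Coord d → M} {V : Set (Coord d)}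
  {Ψ : Coord d × ℝ → M} {Θ : M → Coord d × ℝ} {D : Set (Coord d × ℝ)} {O : Set M}

theorem dblPoint_splitPhase (y : Coord (d + 1) × (Coord (d + 1) →L[ℝ] ℝ)) :
    dblPoint (E := E) φ Ψ (splitPhase d y) =
      ofCoords (𝓘(ℝ, E).prod 𝓘(ℝ, ℝ)) (dblT φ) (dblParam Ψ) y := by
  rw [dblPoint, joinCovector_splitPhase]
  congr
  simp [splitPhase_apply]

theorem IsStraightening.eqOn_regularizedH (h : IsStraightening (E := E) φ Ψ Θ D O)
    (hφ : ContMDiff 𝓘(ℝ, E) 𝓘(ℝ, ℝ) ∞ φ) :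
    Set.EqOn (fun y => regularizedH φ g
      (ofCoords (𝓘(ℝ, E).prod 𝓘(ℝ, ℝ)) (dblT φ) (dblParam Ψ) y))
      (fun y => chartK g Ψ (foldPhase (splitPhase d y))) {y | fold y.1 ∈ D} := by
  intro y hy
  change regularizedH φ g _ = chartK g Ψ _
  rw [← dblPoint_splitPhase]
  exact h.regularizedH_dblPoint g hφ hy

/-- In canonical coordinates the Hamiltonian is `chartK` composed with `foldPhase` and the linear
map `splitPhase`; by the chain rule its Hamiltonian field is `dblField`. -/
theorem IsStraightening.hamiltonAt (h : IsStraightening (E := E) φ Ψ Θ D O)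
    (hφ : ContMDiff 𝓘(ℝ, E) 𝓘(ℝ, ℝ) ∞ φ) {J : Set ℝ} {y : ℝ → Phase d} {t : ℝ}
    (hD : ((y t).1, (y t).2.1 ^ 2 / 2) ∈ D)
    (hy : HasDerivWithinAt y (dblField (chartK g Ψ) (y t)) J t) :
    HamiltonAt (fun y => regularizedH φ g
      (ofCoords (𝓘(ℝ, E).prod 𝓘(ℝ, ℝ)) (dblT φ) (dblParam Ψ) y)) J
      (fun t => (mergePhase (y t)).1) (fun t => (mergePhase (y t)).2) t := by
  set K := chartK g Ψ with hK
  have hopen : IsOpen {x : Phase d | (x.1, x.2.1) ∈ D} :=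
    h.isOpen_source.preimage (by fun_prop)
  have hKd : HasFDerivAt K (fderiv ℝ K (foldPhase (y t))) (foldPhase (y t)) :=
    (((h.contDiffOn_chartK g).contDiffAt (hopen.mem_nhds hD)).differentiableAt
      (by simp)).hasFDerivAt
  obtain ⟨L, hL, hLv⟩ := hasFDerivAt_foldPhase (y t)
  have hfoldD : fold (mergePhase (y t)).1 ∈ D := by
    simp only [mergePhase, fold_splitLast_symm]
    exact hD
  have hev : (fun y => regularizedH φ g
      (ofCoords (𝓘(ℝ, E).prod 𝓘(ℝ, ℝ)) (dblT φ) (dblParam Ψ) y)) =ᶠ[𝓝 (mergePhase (y t))]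
      fun y => K (foldPhase (splitPhase d y)) :=
    (h.eqOn_regularizedH hφ).eventuallyEq_of_mem
      ((h.isOpen_source.preimage (contDiff_fold.continuous.comp continuous_fst)).mem_nhds hfoldD)
  have hsp : HasFDerivAt (fun y => splitPhase d y) (splitPhase d) (mergePhase (y t)) :=
    (splitPhase d).hasFDerivAt
  have hc : HasFDerivAt (fun y => K (foldPhase (splitPhase d y)))
      ((fderiv ℝ K (foldPhase (y t))).comp (L.comp (splitPhase d))) (mergePhase (y t)) := by
    refine HasFDerivAt.comp (g := K) _ ?_ (HasFDerivAt.comp (g := foldPhase) _ ?_ hsp)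
    · rw [splitPhase_mergePhase]
      exact hKd
    · rw [splitPhase_mergePhase]
      exact hL
  refine ⟨(splitLast d).symm ((dblField K (y t)).1, (dblField K (y t)).2.1),
    (joinCovector (dblField K (y t)).2.2.1 (dblField K (y t)).2.2.2).comp
      (splitLast d : Coord (d + 1) →L[ℝ] Coord d × ℝ), _, ?_, ?_, hc.congr_of_eventuallyEq hev, ?_⟩
  · exact ((splitLast d).symm : Coord d × ℝ →L[ℝ] Coord (d + 1)).hasFDerivAt.comp_hasDerivWithinAt t
      (hy.fst.prodMk hy.snd.fst)
  · have h1 : HasDerivWithinAt (fun t => joinCovector (y t).2.2.1 (y t).2.2.2)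
        (joinCovector (dblField K (y t)).2.2.1 (dblField K (y t)).2.2.2) J t := by
      have hlin : ∀ x : (Coord d →L[ℝ] ℝ) × ℝ, joinCovector x.1 x.2 =
        (((ContinuousLinearMap.compL ℝ (Coord d × ℝ) (Coord d) ℝ).flip
          (ContinuousLinearMap.fst ℝ (Coord d) ℝ)).coprod
          ((ContinuousLinearMap.id ℝ ℝ).smulRight (ContinuousLinearMap.snd ℝ (Coord d) ℝ))) x := by
        intro x
        refine ContinuousLinearMap.ext fun v => ?_
        simp
      simp only [fun a b => hlin (a, b)]
      exact (ContinuousLinearMap.hasFDerivAt _).comp_hasDerivWithinAt t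
        (hy.snd.snd.fst.prodMk hy.snd.snd.snd)
    exact ((ContinuousLinearMap.compL ℝ (Coord (d + 1)) (Coord d × ℝ) ℝ).flip
      (splitLast d : Coord (d + 1) →L[ℝ] Coord d × ℝ)).hasFDerivAt.comp_hasDerivWithinAt t h1
  · intro e α
    change fderiv ℝ K (foldPhase (y t)) (L (splitPhase d (e, α))) = _
    rw [hLv, apply_eq_parts, apply_eq_splitPhase α e]
    simp only [ContinuousLinearEquiv.apply_symm_apply, ContinuousLinearMap.comp_apply,
      ContinuousLinearEquiv.coe_coe, joinCovector_apply, dblField, add_apply, smul_apply, neg_apply,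
      map_smul, smul_eq_mul]
    have h1 : (splitPhase d (e, α)).1 = (splitLast d e).1 := rfl
    have h2 : (splitPhase d (e, α)).2.1 = (splitLast d e).2 := rfl
    rw [h1, h2]
    ring

theorem IsStraightening.isHamiltonianTrajectory (h : IsStraightening (E := E) φ Ψ Θ D O)
    (hφ : ContMDiff 𝓘(ℝ, E) 𝓘(ℝ, ℝ) ∞ φ) {J : Set ℝ} {y : ℝ → Phase d}
    (hD : ∀ t ∈ J, ((y t).1, (y t).2.1 ^ 2 / 2) ∈ D)
    (hy : ∀ t ∈ J, HasDerivWithinAt y (dblField (chartK g Ψ) (y t)) J t) :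
    IsHamiltonianTrajectory (𝓘(ℝ, E).prod 𝓘(ℝ, ℝ)) (dbl φ) (dblT φ) (regularizedH φ g) J
      (fun t => dblPoint φ Ψ (y t)) := by
  refine isHamiltonianTrajectory_of_hamiltonAt (h.isLocalCoord_dbl hφ) (fun t ht => ?_)
    fun t ht => h.hamiltonAt hφ (hD t ht) (hy t ht)
  change fold _ ∈ D
  simp only [fold_splitLast_symm]
  exact hD t ht

theorem IsStraightening.eq_dblPoint [T2Space M] (h : IsStraightening (E := E) φ Ψ Θ D O)
    (hφ : ContMDiff 𝓘(ℝ, E) 𝓘(ℝ, ℝ) ∞ φ) {b : ℝ} (hb : 0 ≤ b) {y : ℝ → Phase d}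
    (hD : ∀ t ∈ Set.Icc 0 b, ((y t).1, (y t).2.1 ^ 2 / 2) ∈ D)
    (hy : ∀ t ∈ Set.Icc 0 b, HasDerivWithinAt y (dblField (chartK g Ψ) (y t)) (Set.Icc 0 b) t)
    {c : ℝ → DblCotangent (E := E) φ}
    (hc : IsHamiltonianTrajectory (𝓘(ℝ, E).prod 𝓘(ℝ, ℝ)) (dbl φ) (dblT φ) (regularizedH φ g)
      (Set.Icc 0 b) c) (h0 : c 0 = dblPoint φ Ψ (y 0)) :
    ∀ t ∈ Set.Icc 0 b, c t = dblPoint φ Ψ (y t) := by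
  refine eq_of_isHamiltonianTrajectory (R := {y | fold y.1 ∈ D}) (h.isLocalCoord_dbl hφ)
    (h.isOpen_source.preimage (contDiff_fold.continuous.comp continuous_fst)) (fun y hy => hy)
    ?_ hb hc (fun t ht => ?_) (fun t ht => h.hamiltonAt hφ (hD t ht) (hy t ht)) h0
  · refine ContDiffOn.congr ?_ (h.eqOn_regularizedH hφ)
    refine ContDiffOn.of_le ?_ (WithTop.coe_le_coe.2 le_top)
    exact (h.contDiffOn_chartK g).comp (contDiff_foldPhase.comp (splitPhase d).contDiff).contDiffOn
      fun y hy => hy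
  · change fold _ ∈ D
    simp only [fold_splitLast_symm]
    exact hD t ht

theorem IsStraightening.dblPoint_injOn (h : IsStraightening (E := E) φ Ψ Θ D O)
    (hφ : ContMDiff 𝓘(ℝ, E) 𝓘(ℝ, ℝ) ∞ φ) {x x' : Phase d} (hx : (x.1, x.2.1 ^ 2 / 2) ∈ D)
    (hx' : (x'.1, x'.2.1 ^ 2 / 2) ∈ D)
    (he : dblPoint (E := E) φ Ψ x = dblPoint (E := E) φ Ψ x') : x = x' := by
  have h1 := ofCoords_injOn (h.isLocalCoord_dbl hφ) (by simpa [fold_splitLast_symm] using hx)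
    (by simpa [fold_splitLast_symm] using hx') he
  have h2 : mergePhase x = mergePhase x' := Prod.ext h1.1 h1.2
  rw [← splitPhase_mergePhase x, h2, splitPhase_mergePhase]

namespace IsAdapted

theorem mem_base (h : IsAdapted g φ u V Ψ Θ D O) {z : Coord d} (hz : (z, (0 : ℝ)) ∈ D) : z ∈ V :=
  (h.base z hz).1

theorem apply_base (h : IsAdapted g φ u V Ψ Θ D O) {z : Coord d} (hz : (z, (0 : ℝ)) ∈ D) :
    Ψ (z, 0) = u z :=
  (h.base z hz).2

theorem isOpen_base (h : IsAdapted g φ u V Ψ Θ D O) : IsOpen {z : Coord d | (z, (0 : ℝ)) ∈ D} :=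
  h.isOpen_source.preimage (by fun_prop)

theorem paramDeriv_base (h : IsAdapted g φ u V Ψ Θ D O) {z : Coord d} (hz : (z, (0 : ℝ)) ∈ D)
    (a : Coord d) : paramDeriv 𝓘(ℝ, E) u z a = paramDeriv 𝓘(ℝ, E) Ψ (z, 0) (a, 0) := by
  have h1 := paramDeriv_comp (I := 𝓘(ℝ, E)) (u := u) (u' := Ψ)
    (τ := ContinuousLinearMap.inl ℝ (Coord d) ℝ) (z := z) (h.mdifferentiableAt hz)
    (ContinuousLinearMap.differentiableAt _)
    (Filter.eventually_of_mem (h.isOpen_base.mem_nhds hz) fun y hy => h.apply_base hy)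
  rw [ContinuousLinearMap.fderiv] at h1
  exact congrArg (fun L : Coord d →L[ℝ] E => L a) h1

/-- In these coordinates `dφ` is the covector `(0, 1)`. -/
theorem coNormSq_dPhi (h : IsAdapted g φ u V Ψ Θ D O) {z : Coord d} (hz : (z, (0 : ℝ)) ∈ D) :
    coNormSq g (u z) (dPhi φ (u z)) = 2 * chartK g Ψ (z, 0, 0, 1) := by
  rw [← h.apply_base hz]
  have h1 := coNormSq_eq g (x := Ψ (z, 0)) (h.bijective hz) (dPhiE φ (Ψ (z, 0)))
  have h2 : (dPhiE (E := E) φ (Ψ (z, 0))).comp (paramDeriv 𝓘(ℝ, E) Ψ (z, 0)) =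
      joinCovector (0 : Coord d →L[ℝ] ℝ) 1 := by
    refine ContinuousLinearMap.ext fun v => ?_
    simp [h.dPhiE_paramDeriv h.smooth_phi hz]
  rw [h2] at h1
  refine h1.trans ?_
  simp only [chartK]
  ring

theorem sectionPoint_ofCoords (h : IsAdapted g φ u V Ψ Θ D O) {z : Coord d}
    (hz : (z, (0 : ℝ)) ∈ D) (σ : ℝ) (w : Coord d →L[ℝ] ℝ) :
    sectionPoint φ g σ (ofCoords 𝓘(ℝ, E) (bdryT φ) u (z, w)) =
      dblPoint φ Ψ (z, 0, w, σ * √(2 / (2 * chartK g Ψ (z, 0, 0, 1)))) := by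
  have hfold : fold ((splitLast d).symm (z, (0 : ℝ))) = (z, 0) := by simp [fold]
  have hD : fold ((splitLast d).symm (z, (0 : ℝ))) ∈ D := by rwa [hfold]
  refine eq_ofCoords (h.isLocalCoord_dbl h.smooth_phi) hD ?_ fun e hm => ?_
  · refine Prod.ext ?_ ?_
    · change u z = Ψ (fold _)
      rw [hfold, h.apply_base hz]
    · change (0 : ℝ) = _
      simp [dblParam]
  · have h1 := h.paramDeriv_dblParam hD e
    have h2 : paramDeriv (𝓘(ℝ, E).prod 𝓘(ℝ, ℝ)) (dblParam Ψ) ((splitLast d).symm (z, (0 : ℝ))) e =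
        ((paramDeriv 𝓘(ℝ, E) u z (splitLast d e).1, (splitLast d e).2) : E × ℝ) := by
      rw [h1, hfold, h.paramDeriv_base hz]
      simp
    have h3 : paramDeriv 𝓘(ℝ, E) u z (splitLast d e).1 ∈ bdryT (E := E) φ (u z) :=
      (h.coord.tangent z (h.mem_base hz) _).2 ⟨_, rfl⟩
    have h4 := ofCoords_apply h.coord (h.mem_base hz) w (splitLast d e).1 h3
    have h5 : (ofCoords 𝓘(ℝ, E) (bdryT φ) u (z, w)).2 (sectionProj φ (u z) ⟨_, hm⟩) =
        w (splitLast d e).1 := by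
      rw [← h4]
      exact congrArg _ (Subtype.ext (congrArg (fun x : E × ℝ => x.1) h2))
    have h6 : sectionXi φ (u z) ⟨_, hm⟩ = (splitLast d e).2 := congrArg (fun x : E × ℝ => x.2) h2
    rw [← h.coNormSq_dPhi hz]
    change (ofCoords 𝓘(ℝ, E) (bdryT φ) u (z, w)).2 (sectionProj φ (u z) ⟨_, hm⟩) +
      (σ * √(2 / coNormSq g (u z) (dPhi φ (u z)))) * sectionXi φ (u z) ⟨_, hm⟩ = _
    rw [h5, h6]
    simp

/-- On the hypersurface the kinetic energy splits. -/
theorem chartK_base (h : IsAdapted g φ u V Ψ Θ D O) {z : Coord d} (hz : (z, (0 : ℝ)) ∈ D)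
    (m : Coord d →L[ℝ] ℝ) (η : ℝ) :
    chartK g Ψ (z, 0, m, η) = 1 / 2 * (m ((pullForm g (u z) (paramDeriv 𝓘(ℝ, E) u z)).inverse m) +
      2 * chartK g Ψ (z, 0, 0, 1) * η ^ 2) ∧ 0 < chartK g Ψ (z, 0, 0, 1) := by
  set G := pullForm g (Ψ (z, 0)) (paramDeriv 𝓘(ℝ, E) Ψ (z, 0)) with hG
  set γ := pullForm g (u z) (paramDeriv 𝓘(ℝ, E) u z) with hγ
  have hGpos : ∀ v, v ≠ 0 → 0 < G v v := fun v hv => pullForm_pos g (h.bijective hz).1 v hv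
  have hγpos : ∀ v, v ≠ 0 → 0 < γ v v := fun v hv =>
    pullForm_pos g (h.coord.immersion z (h.mem_base hz)) v hv
  have hGγ : ∀ a b : Coord d, G (a, 0) (b, 0) = γ a b := by
    intro a b
    rw [hG, hγ, pullForm_apply, pullForm_apply, h.paramDeriv_base hz, h.paramDeriv_base hz,
      h.apply_base hz]
  set ν := G (0, 1) (0, 1) with hν
  have hνpos : 0 < ν := hGpos _ (by simp)
  have horth : ∀ a : Coord d, G (0, 1) (a, 0) = 0 := h.orth z hz
  have horth' : ∀ a : Coord d, G (a, 0) (0, 1) = 0 := fun a =>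
    (innerE_symm g _ _ _).trans (horth a)
  -- Orthogonality makes the metric block diagonal at points of the hypersurface, so it is inverted
  -- block by block.
  have hinv : ∀ (m : Coord d →L[ℝ] ℝ) (η : ℝ),
      G.inverse (joinCovector m η) = (γ.inverse m, η / ν) := by
    intro m η
    refine inverse_apply_of_posDef hGpos ?_
    refine ContinuousLinearMap.ext fun v => ?_
    have hs : ∀ (a : Coord d) (r : ℝ), ((a, r) : Coord d × ℝ) = (a, 0) + r • (0, 1) := by
      intro a r
      simp
    obtain ⟨b, s⟩ := v
    rw [hs (γ.inverse m), hs b]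
    simp only [map_add, map_smul, add_apply, smul_apply, hGγ, horth, horth',
      apply_inverse_of_posDef hγpos, joinCovector_apply, smul_eq_mul, ← hν]
    have h0 := hνpos.ne'
    simp only [map_zero, mul_zero, mul_one, add_zero, zero_add]
    field_simp
  have hK : ∀ (m : Coord d →L[ℝ] ℝ) (η : ℝ), chartK g Ψ (z, 0, m, η) =
      1 / 2 * (m (γ.inverse m) + η * (η / ν)) := by
    intro m η
    change 1 / 2 * joinCovector m η (G.inverse (joinCovector m η)) = _
    rw [hinv, joinCovector_apply]
  refine ⟨?_, ?_⟩
  · rw [hK, hK]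
    simp
    field_simp
  · rw [hK]
    simp
    exact hνpos

end IsAdapted

end Trajectories

/-! ### Trajectories that start with zero tangential momentum, as functions of `t²` -/

theorem fderiv_apply_eq_zero_of_const {A B : Type*} [NormedAddCommGroup A] [NormedSpace ℝ A]
    [NormedAddCommGroup B] [NormedSpace ℝ B] {f : A → B} {x v : A} (hd : DifferentiableAt ℝ f x)
    (h : ∀ t : ℝ, f (x + t • v) = f x) : fderiv ℝ f x v = 0 := by
  have h1 : HasDerivAt (fun t : ℝ => x + t • v) v 0 := by
    simpa using ((hasDerivAt_id (0 : ℝ)).smul_const v).const_add x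
  have h2 : HasDerivAt (fun t : ℝ => f (x + t • v)) (fderiv ℝ f x v) 0 := by
    refine HasFDerivAt.comp_hasDerivAt (l := f) 0 ?_ h1
    simpa using hd.hasFDerivAt
  simp only [h] at h2
  exact h2.unique (hasDerivAt_const _ _)

/-- A primitive written as an average. -/
theorem hasDerivAt_smul_average {B : Type*} [NormedAddCommGroup B] [NormedSpace ℝ B]
    [CompleteSpace B] {ε : ℝ} {h G : ℝ → B} (hh : ContinuousOn h (Set.Ioo (-ε) ε))
    (hG : ∀ S ∈ Set.Ioo (-ε) ε, G S = ∫ θ in (0 : ℝ)..1, h (S * θ)) {S : ℝ}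
    (hS : S ∈ Set.Ioo (-ε) ε) : HasDerivAt (fun S => S • G S) (h S) S := by
  have h0 : (0 : ℝ) ∈ Set.Ioo (-ε) ε := ⟨by linarith [hS.1, hS.2], by linarith [hS.1, hS.2]⟩
  have h1 : HasDerivAt (fun S => ∫ s in (0 : ℝ)..S, h s) (h S) S := by
    refine intervalIntegral.integral_hasDerivAt_right ?_
      (hh.stronglyMeasurableAtFilter isOpen_Ioo S hS) (hh.continuousAt (isOpen_Ioo.mem_nhds hS))
    exact (hh.mono ((Set.ordConnected_Ioo).uIcc_subset h0 hS)).intervalIntegrable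
  refine h1.congr_of_eventuallyEq ?_
  filter_upwards [isOpen_Ioo.mem_nhds hS] with s hs
  rw [hG s hs, intervalIntegral.smul_integral_comp_mul_left]
  simp

theorem contDiff_partM {d : ℕ} : ContDiff ℝ ∞ (partM (d := d)) := by
  have h : ContDiff ℝ ∞ (fun θ : (Coord d →L[ℝ] ℝ) →L[ℝ] ℝ => dualVec θ) := by
    apply ContinuousLinearMap.contDiff
  exact h.comp (contDiff_id.clm_comp contDiff_const)

theorem contDiff_partZ {d : ℕ} : ContDiff ℝ ∞ (partZ (d := d)) :=
  contDiff_id.clm_comp contDiff_const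

section Family

variable {E : Type*} [NormedAddCommGroup E] [NormedSpace ℝ E] [FiniteDimensional ℝ E]
  {M : Type*} [TopologicalSpace M] [ChartedSpace E M] [IsManifold 𝓘(ℝ, E) ∞ M]
  {g : Bundle.ContMDiffRiemannianMetric 𝓘(ℝ, E) ∞ E (fun x : M => TangentSpace 𝓘(ℝ, E) x)}
  {φ : M → ℝ} {d : ℕ} {u : Coord d → M} {V : Set (Coord d)}
  {Ψ : Coord d × ℝ → M} {Θ : M → Coord d × ℝ} {D : Set (Coord d × ℝ)} {O : Set M}

theorem IsStraightening.isOpen_phase (h : IsStraightening (E := E) φ Ψ Θ D O) :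
    IsOpen {x : Phase d | (x.1, x.2.1) ∈ D} :=
  h.isOpen_source.preimage (by fun_prop)

theorem IsStraightening.hasFDerivAt_chartK (h : IsStraightening (E := E) φ Ψ Θ D O)
    {x : Phase d} (hx : (x.1, x.2.1) ∈ D) :
    HasFDerivAt (chartK g Ψ) (fderiv ℝ (chartK g Ψ) x) x :=
  (((h.contDiffOn_chartK g).contDiffAt (h.isOpen_phase.mem_nhds hx)).differentiableAt
    (by simp)).hasFDerivAt

/-- The velocity `∂K/∂(m, η)` is dual to the momentum. -/
theorem IsStraightening.fderiv_chartK_momentum (h : IsStraightening (E := E) φ Ψ Θ D O)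
    {x : Phase d} (hx : (x.1, x.2.1) ∈ D) (α : Coord d →L[ℝ] ℝ) (β : ℝ) :
    fderiv ℝ (chartK g Ψ) x (0, 0, α, β) = joinCovector α β
      ((pullForm g (Ψ (x.1, x.2.1)) (paramDeriv 𝓘(ℝ, E) Ψ (x.1, x.2.1))).inverse
        (joinCovector x.2.2.1 x.2.2.2)) := by
  set G := pullForm g (Ψ (x.1, x.2.1)) (paramDeriv 𝓘(ℝ, E) Ψ (x.1, x.2.1)) with hG
  have hpos : ∀ v, v ≠ 0 → 0 < G v v := fun v hv => pullForm_pos g (h.bijective hx).1 v hv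
  set ℓ := joinCovector x.2.2.1 x.2.2.2 with hℓ
  set ℓ' := joinCovector α β with hℓ'
  have hsymm : ℓ (G.inverse ℓ') = ℓ' (G.inverse ℓ) := by
    have h1 := apply_inverse_of_posDef hpos ℓ
    have h2 := apply_inverse_of_posDef hpos ℓ'
    calc ℓ (G.inverse ℓ') = G (G.inverse ℓ) (G.inverse ℓ') := by rw [h1]
      _ = G (G.inverse ℓ') (G.inverse ℓ) := innerE_symm g _ _ _
      _ = ℓ' (G.inverse ℓ) := by rw [h2]
  have h1 : HasDerivAt (fun t : ℝ => x + t • ((0, 0, α, β) : Phase d)) (0, 0, α, β) 0 := by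
    simpa using ((hasDerivAt_id (0 : ℝ)).smul_const ((0, 0, α, β) : Phase d)).const_add x
  have h2 : HasDerivAt (fun t : ℝ => chartK g Ψ (x + t • ((0, 0, α, β) : Phase d)))
      (fderiv ℝ (chartK g Ψ) x (0, 0, α, β)) 0 := by
    refine HasFDerivAt.comp_hasDerivAt (l := chartK g Ψ) 0 ?_ h1
    simpa using h.hasFDerivAt_chartK hx
  have h3 : ∀ t : ℝ, chartK g Ψ (x + t • ((0, 0, α, β) : Phase d)) =
      1 / 2 * ((ℓ + t • ℓ') (G.inverse (ℓ + t • ℓ'))) := by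
    intro t
    have e1 : joinCovector (x + t • ((0, 0, α, β) : Phase d)).2.2.1
        (x + t • ((0, 0, α, β) : Phase d)).2.2.2 = ℓ + t • ℓ' := by
      refine ContinuousLinearMap.ext fun v => ?_
      simp [hℓ, hℓ']
      ring
    have e2 : (x + t • ((0, 0, α, β) : Phase d)).1 = x.1 := by simp
    have e3 : (x + t • ((0, 0, α, β) : Phase d)).2.1 = x.2.1 := by simp
    rw [chartK, e1, e2, e3]
  simp only [h3, map_add, map_smul, add_apply, smul_apply, smul_eq_mul, hsymm] at h2
  have h4 : HasDerivAt (fun t : ℝ => 1 / 2 * (ℓ (G.inverse ℓ) + t * ℓ' (G.inverse ℓ) +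
      t * (ℓ' (G.inverse ℓ) + t * ℓ' (G.inverse ℓ'))))
      (1 / 2 * (0 + 1 * ℓ' (G.inverse ℓ) + (1 * (ℓ' (G.inverse ℓ) + 0 * ℓ' (G.inverse ℓ')) +
        0 * (0 + 1 * ℓ' (G.inverse ℓ'))))) 0 :=
    ((((hasDerivAt_const (0 : ℝ) _).add ((hasDerivAt_id (0 : ℝ)).mul_const _)).add
      ((hasDerivAt_id (0 : ℝ)).mul ((hasDerivAt_const (0 : ℝ) _).add
        ((hasDerivAt_id (0 : ℝ)).mul_const _)))).const_mul _)
  have h5 : fderiv ℝ (chartK g Ψ) x (0, 0, α, β) = _ := h2.unique (by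
    refine h4.congr_of_eventuallyEq (Filter.Eventually.of_forall fun t => ?_)
    simp only)
  rw [h5]
  ring

theorem IsStraightening.parts_chartK (h : IsStraightening (E := E) φ Ψ Θ D O)
    {x : Phase d} (hx : (x.1, x.2.1) ∈ D) :
    (partM (fderiv ℝ (chartK g Ψ) x), partEta (fderiv ℝ (chartK g Ψ) x)) =
      (pullForm g (Ψ (x.1, x.2.1)) (paramDeriv 𝓘(ℝ, E) Ψ (x.1, x.2.1))).inverse
        (joinCovector x.2.2.1 x.2.2.2) := by
  refine Prod.ext (dualVec_eq fun α => ?_) ?_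
  · have := h.fderiv_chartK_momentum (g := g) hx α 0
    simpa using this
  · have := h.fderiv_chartK_momentum (g := g) hx 0 1
    simpa [partEta] using this

/-- Euler's identity for the kinetic energy. -/
theorem IsStraightening.euler_chartK (h : IsStraightening (E := E) φ Ψ Θ D O)
    {x : Phase d} (hx : (x.1, x.2.1) ∈ D) :
    x.2.2.1 (partM (fderiv ℝ (chartK g Ψ) x)) + x.2.2.2 * partEta (fderiv ℝ (chartK g Ψ) x) =
      2 * chartK g Ψ x := by
  have h1 := h.parts_chartK (g := g) hx
  have h2 : joinCovector x.2.2.1 x.2.2.2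
      (partM (fderiv ℝ (chartK g Ψ) x), partEta (fderiv ℝ (chartK g Ψ) x)) = 2 * chartK g Ψ x := by
    rw [h1, chartK]
    ring
  rw [← h2, joinCovector_apply]

set_option maxHeartbeats 1000000 in
/-- The smooth family of solutions of Hamilton's equations that start at `ξ = 0` with zero momentum
along the hypersurface. -/
theorem IsAdapted.exists_family (h : IsAdapted g φ u V Ψ Θ D O) {z₀ : Coord d}
    (hz₀ : (z₀, (0 : ℝ)) ∈ D) :
    ∃ (W : Set (Coord d)) (ε : ℝ) (Z : Coord d × ℝ → Coord d) (Ξ : Coord d × ℝ → ℝ)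
      (π : Coord d × ℝ → Coord d →L[ℝ] ℝ) (H : Coord d × ℝ → ℝ), IsOpen W ∧ z₀ ∈ W ∧ 0 < ε ∧
      ContDiffOn ℝ ∞ Z (W ×ˢ Set.Ioo (-ε) ε) ∧ ContDiffOn ℝ ∞ Ξ (W ×ˢ Set.Ioo (-ε) ε) ∧
      ContDiffOn ℝ ∞ π (W ×ˢ Set.Ioo (-ε) ε) ∧ ContDiffOn ℝ ∞ H (W ×ˢ Set.Ioo (-ε) ε) ∧
      (∀ x ∈ W, (x, (0 : ℝ)) ∈ D ∧ Z (x, 0) = x ∧ Ξ (x, 0) = √(2 * (2 * chartK g Ψ (x, 0, 0, 1))) ∧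
        H (x, 0) = √(2 / (2 * chartK g Ψ (x, 0, 0, 1)))) ∧
      (∀ x ∈ W, ∀ s ∈ Set.Ioo (-ε) ε, (Z (x, s), s * Ξ (x, s) ^ 2 / 2) ∈ D) ∧
      ∀ x ∈ W, ∀ t : ℝ, t ^ 2 < ε → HasDerivAt (fun t => ((Z (x, t ^ 2), t * Ξ (x, t ^ 2), t • π (x, t ^ 2), H (x, t ^ 2)) :
          Phase d)) (dblField (chartK g Ψ)
            (Z (x, t ^ 2), t * Ξ (x, t ^ 2), t • π (x, t ^ 2), H (x, t ^ 2))) t := by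
  set K := chartK g Ψ with hK
  have hKs : ContDiffOn ℝ ∞ K {x : Phase d | (x.1, x.2.1) ∈ D} := h.contDiffOn_chartK g
  have hKf : ContDiffOn ℝ ∞ (fderiv ℝ K) {x : Phase d | (x.1, x.2.1) ∈ D} :=
    hKs.fderiv_of_isOpen h.isOpen_phase (by simp)
  set N : Set (Coord d) := {x | (x, (0 : ℝ)) ∈ D} with hN
  set η₀ : Coord d → ℝ := fun x => √(2 / (2 * K (x, 0, 0, 1))) with hη₀
  have hKpos : ∀ x ∈ N, 0 < K (x, 0, 0, 1) := fun x hx => (h.chartK_base hx 0 0).2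
  have hη₀s : ContDiffOn ℝ ∞ η₀ N := by
    have h1 : ContDiffOn ℝ ∞ (fun x : Coord d => K (x, 0, 0, 1)) N :=
      hKs.comp (f := fun x : Coord d => ((x, 0, 0, 1) : Phase d)) (by fun_prop) fun x hx => hx
    refine ContDiffOn.sqrt (contDiffOn_const.div (contDiffOn_const.mul h1) fun x hx => ?_)
      fun x hx => ?_
    · have := hKpos x hx; positivity
    · have := hKpos x hx; positivity
  -- Euler's identity gives this after division by `η`. For `η = 0` the velocity vanishes because it
  -- is linear in the momentum.
  have hKη : ∀ x ∈ N, ∀ η, partEta (fderiv ℝ K (x, 0, 0, η)) = 2 * K (x, 0, 0, 1) * η := by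
    intro x hx η
    by_cases h0 : η = 0
    · subst h0
      have := h.fderiv_chartK_momentum (g := g) (x := (x, 0, 0, 0)) hx 0 1
      have hz : joinCovector (0 : Coord d →L[ℝ] ℝ) 0 = 0 := by
        refine ContinuousLinearMap.ext fun v => ?_
        simp
      rw [hz, map_zero, map_zero] at this
      rw [partEta, this, mul_zero]
    · have h1 := h.euler_chartK (g := g) (x := (x, 0, 0, η)) hx
      rw [(h.chartK_base hx 0 η).1] at h1
      simp only [zero_apply, zero_add] at h1
      have h2 : η * partEta (fderiv ℝ K (x, 0, 0, η)) = η * (2 * K (x, 0, 0, 1) * η) := by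
        rw [hK]
        linarith
      exact mul_left_cancel₀ h0 h2
  -- the domain
  set arg : Coord d × (Coord d × ℝ) × (ℝ × (Coord d →L[ℝ] ℝ)) × ℝ → Phase d := fun q =>
    (q.1 + q.2.2.2 • q.2.1.1, q.2.2.2 * q.2.2.1.1 ^ 2 / 2,
      (q.2.2.2 * q.2.2.1.1) • q.2.2.1.2, η₀ q.1 + q.2.2.2 * q.2.1.2) with harg
  set U : Set (Coord d × (Coord d × ℝ) × (ℝ × (Coord d →L[ℝ] ℝ)) × ℝ) :=
    {q | q.1 ∈ N ∧ (q.1 + q.2.2.2 • q.2.1.1, q.2.2.2 * q.2.2.1.1 ^ 2 / 2) ∈ D} with hU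
  have hUo : IsOpen U := by
    refine (h.isOpen_base.preimage continuous_fst).inter (h.isOpen_source.preimage ?_)
    fun_prop
  have hargs : ContDiffOn ℝ ∞ arg U := by
    have h1 : ContDiffOn ℝ ∞ (fun q : Coord d × (Coord d × ℝ) × (ℝ × (Coord d →L[ℝ] ℝ)) × ℝ =>
        η₀ q.1) U := hη₀s.comp contDiff_fst.contDiffOn fun q hq => hq.1
    have h2 : ContDiffOn ℝ ∞ (fun q : Coord d × (Coord d × ℝ) × (ℝ × (Coord d →L[ℝ] ℝ)) × ℝ =>
        q.1 + q.2.2.2 • q.2.1.1) U := by fun_prop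
    have h3 : ContDiffOn ℝ ∞ (fun q : Coord d × (Coord d × ℝ) × (ℝ × (Coord d →L[ℝ] ℝ)) × ℝ =>
        q.2.2.2 * q.2.2.1.1 ^ 2 / 2) U := by fun_prop
    have h4 : ContDiffOn ℝ ∞ (fun q : Coord d × (Coord d × ℝ) × (ℝ × (Coord d →L[ℝ] ℝ)) × ℝ =>
        (q.2.2.2 * q.2.2.1.1) • q.2.2.1.2) U := by fun_prop
    have h5 : ContDiffOn ℝ ∞ (fun q : Coord d × (Coord d × ℝ) × (ℝ × (Coord d →L[ℝ] ℝ)) × ℝ =>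
        q.2.2.2 * q.2.1.2) U := by fun_prop
    exact h2.prodMk (h3.prodMk (h4.prodMk (h1.add h5)))
  set L : Coord d × (Coord d × ℝ) × (ℝ × (Coord d →L[ℝ] ℝ)) × ℝ → Phase d →L[ℝ] ℝ := fun q =>
    fderiv ℝ K (arg q) with hL
  have hLs : ContDiffOn ℝ ∞ L U := hKf.comp hargs fun q hq => hq.2
  have hMs : ContDiffOn ℝ ∞ (fun q => partM (L q)) U := contDiff_partM.comp_contDiffOn hLs
  have hEs : ContDiffOn ℝ ∞ (fun q => partEta (L q)) U := hLs.clm_apply contDiffOn_const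
  have hRs : ContDiffOn ℝ ∞ (fun q => partR (L q)) U := hLs.clm_apply contDiffOn_const
  have hZs : ContDiffOn ℝ ∞ (fun q => partZ (L q)) U := contDiff_partZ.comp_contDiffOn hLs
  -- With `s = t²` write `z = x + s v`, `η = η₀ + s e`, `(ξ, p) = t • (X, Q)`, as the reversal
  -- symmetry suggests. Then `f₁` is the derivative of `s • (v, e)` in `s`, and `f₂` is the
  -- derivative of `t • (X, Q)` in `t`. Only `ξ²` and `ξ p` enter the argument of `K`, so both
  -- depend smoothly on `s`.
  set f₁ : Coord d × (Coord d × ℝ) × (ℝ × (Coord d →L[ℝ] ℝ)) × ℝ → Coord d × ℝ := fun q =>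
    ((q.2.2.1.1 / 2) • partM (L q),
      -(q.2.2.1.1 * partR (L q) + q.2.2.1.2 (partM (L q))) / 2) with hf₁
  set f₂ : Coord d × (Coord d × ℝ) × (ℝ × (Coord d →L[ℝ] ℝ)) × ℝ → ℝ × (Coord d →L[ℝ] ℝ) := fun q =>
    (partEta (L q), -partZ (L q)) with hf₂
  have hf₁s : ContDiffOn ℝ ∞ f₁ U := by
    have h1 : ContDiffOn ℝ ∞ (fun q : Coord d × (Coord d × ℝ) × (ℝ × (Coord d →L[ℝ] ℝ)) × ℝ =>
        q.2.2.1.1) U := by fun_prop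
    have h2 : ContDiffOn ℝ ∞ (fun q : Coord d × (Coord d × ℝ) × (ℝ × (Coord d →L[ℝ] ℝ)) × ℝ =>
        q.2.2.1.2) U := by fun_prop
    exact ((h1.div_const 2).smul hMs).prodMk (((h1.mul hRs).add (h2.clm_apply hMs)).neg.div_const 2)
  have hf₂s : ContDiffOn ℝ ∞ f₂ U := hEs.prodMk hZs.neg
  have harg0 : ∀ x v w, arg (x, v, w, 0) = (x, 0, 0, η₀ x) := by
    intro x v w
    simp [harg]
  set a₂ : ℝ × (Coord d →L[ℝ] ℝ) :=
    (partEta (fderiv ℝ K (z₀, 0, 0, η₀ z₀)), -partZ (fderiv ℝ K (z₀, 0, 0, η₀ z₀))) with ha₂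
  set a₁ : Coord d × ℝ := f₁ (z₀, 0, a₂, 0) with ha₁
  have hbase : (z₀, a₁, a₂, (0 : ℝ)) ∈ U := by
    refine ⟨hz₀, ?_⟩
    simpa using hz₀
  -- At `s = 0` the argument `arg` no longer contains the unknowns. This is the triangular structure
  -- that the averaged equations require.
  have hf₂v : ∀ x v w, f₂ (x, v, w, 0) =
      (partEta (fderiv ℝ K (x, 0, 0, η₀ x)), -partZ (fderiv ℝ K (x, 0, 0, η₀ x))) := by
    intro x v w
    simp only [hf₂, hL, harg0]
  have hf₁v : ∀ x v v' w, f₁ (x, v, w, 0) = f₁ (x, v', w, 0) := by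
    intro x v v' w
    simp only [hf₁, hL, harg0]
  have hd₁ : DifferentiableAt ℝ f₁ (z₀, a₁, a₂, (0 : ℝ)) :=
    (hf₁s.contDiffAt (hUo.mem_nhds hbase)).differentiableAt (by simp)
  have hd₂ : DifferentiableAt ℝ f₂ (z₀, a₁, a₂, (0 : ℝ)) :=
    (hf₂s.contDiffAt (hUo.mem_nhds hbase)).differentiableAt (by simp)
  obtain ⟨W, ε, y₁, y₂, hW, hzW, hε, hy₁, hy₂, -, -, hy⟩ := exists_smooth_averaged hUo hbase
    hf₁s hf₂s (hf₁v _ _ _ _) (hf₂v _ _ _)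
    (fun v => fderiv_apply_eq_zero_of_const hd₁ fun t => by
      simp only [Prod.smul_mk, Prod.mk_add_mk, smul_zero, add_zero]
      exact hf₁v _ _ _ _)
    (fun v w => fderiv_apply_eq_zero_of_const hd₂ fun t => by
      simp only [Prod.smul_mk, Prod.mk_add_mk, smul_zero, add_zero]
      rw [hf₂v, hf₂v])
  have hBs : ContDiffOn ℝ ∞ (Prod.fst : Coord d × ℝ → Coord d) (W ×ˢ Set.Ioo (-ε) ε) :=
    contDiff_fst.contDiffOn
  have hBs' : ContDiffOn ℝ ∞ (Prod.snd : Coord d × ℝ → ℝ) (W ×ˢ Set.Ioo (-ε) ε) :=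
    contDiff_snd.contDiffOn
  have h0ε : (0 : ℝ) ∈ Set.Ioo (-ε) ε := ⟨by linarith, hε⟩
  refine ⟨W, ε, fun y => y.1 + y.2 • (y₁ y).1, fun y => (y₂ y).1, fun y => (y₂ y).2,
    fun y => η₀ y.1 + y.2 * (y₁ y).2, hW, hzW, hε, hBs.add (hBs'.smul hy₁.fst), hy₂.fst, hy₂.snd,
    (hη₀s.comp hBs fun y hy' => (hy y.1 hy'.1 0 h0ε).1.1).add (hBs'.mul hy₁.snd), ?_,
    fun x hx s hs => (hy x hx s hs).1.2, ?_⟩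
  · intro x hx
    have hxN : x ∈ N := (hy x hx 0 h0ε).1.1
    refine ⟨hxN, by simp, ?_, by simp [hη₀]⟩
    have h1 := (hy x hx 0 h0ε).2.2
    simp only [zero_mul, hf₂v] at h1
    rw [intervalIntegral.integral_const] at h1
    simp only [sub_zero, one_smul] at h1
    change (y₂ (x, 0)).1 = _
    rw [h1]
    change partEta (fderiv ℝ K (x, 0, 0, η₀ x)) = _
    rw [hKη x hxN]
    have hk := hKpos x hxN
    rw [hη₀]
    have e1 : 2 * (2 * K (x, 0, 0, 1)) = (2 * K (x, 0, 0, 1)) ^ 2 * (2 / (2 * K (x, 0, 0, 1))) := by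
      field_simp
    rw [e1, Real.sqrt_mul (by positivity), Real.sqrt_sq (by positivity)]
  · intro x hx t ht
    have htε : t ^ 2 ∈ Set.Ioo (-ε) ε := ⟨by nlinarith [sq_nonneg t], ht⟩
    have hfold : foldPhase (((fun y : Coord d × ℝ => y.1 + y.2 • (y₁ y).1) (x, t ^ 2),
        t * (fun y => (y₂ y).1) (x, t ^ 2), t • (fun y => (y₂ y).2) (x, t ^ 2),
        (fun y : Coord d × ℝ => η₀ y.1 + y.2 * (y₁ y).2) (x, t ^ 2)) : Phase d) =
        arg (x, y₁ (x, t ^ 2), y₂ (x, t ^ 2), t ^ 2) := by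
      refine Prod.ext rfl (Prod.ext ?_ (Prod.ext ?_ rfl))
      · simp only [foldPhase, harg]
        ring
      · simp only [foldPhase, harg, smul_smul]
        congr 1
        ring
    have hq : ContinuousOn (fun s : ℝ => ((x, y₁ (x, s), y₂ (x, s), s) :
        Coord d × (Coord d × ℝ) × (ℝ × (Coord d →L[ℝ] ℝ)) × ℝ)) (Set.Ioo (-ε) ε) := by
      have e1 : ContinuousOn (fun s : ℝ => (x, s)) (Set.Ioo (-ε) ε) := by fun_prop
      have e2 : Set.MapsTo (fun s : ℝ => (x, s)) (Set.Ioo (-ε) ε) (W ×ˢ Set.Ioo (-ε) ε) :=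
        fun s hs => ⟨hx, hs⟩
      exact continuousOn_const.prodMk ((hy₁.continuousOn.comp e1 e2).prodMk
        ((hy₂.continuousOn.comp e1 e2).prodMk continuousOn_id))
    have hD₁ : HasDerivAt (fun s : ℝ => s • y₁ (x, s)) (f₁ (x, y₁ (x, t ^ 2), y₂ (x, t ^ 2), t ^ 2))
        (t ^ 2) :=
      hasDerivAt_smul_average (h := fun s => f₁ (x, y₁ (x, s), y₂ (x, s), s))
        (hf₁s.continuousOn.comp hq fun s hs => (hy x hx s hs).1)
        (fun s hs => (hy x hx s hs).2.1) htε
    have hD₁' : HasDerivAt (fun t : ℝ => t ^ 2 • y₁ (x, t ^ 2))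
        ((2 * t) • f₁ (x, y₁ (x, t ^ 2), y₂ (x, t ^ 2), t ^ 2)) t := by
      have := HasDerivAt.scomp (h := fun t : ℝ => t ^ 2) t hD₁ (hasDerivAt_pow 2 t)
      exact this.congr_deriv (by simp)
    have hD₂ : HasDerivAt (fun t : ℝ => t • y₂ (x, t ^ 2))
        (f₂ (x, y₁ (x, t ^ 2), y₂ (x, t ^ 2), t ^ 2)) t := by
      have hsq : ∀ s ∈ Set.Ioo (-√ε) √ε, s ^ 2 ∈ Set.Ioo (-ε) ε := by
        intro s hs
        refine ⟨by nlinarith [sq_nonneg s], ?_⟩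
        rw [← Real.sq_sqrt hε.le]
        exact sq_lt_sq.2 (by rw [abs_of_nonneg (Real.sqrt_nonneg ε)]; exact abs_lt.2 hs)
      refine hasDerivAt_smul_average (ε := √ε)
        (h := fun s => f₂ (x, y₁ (x, s ^ 2), y₂ (x, s ^ 2), s ^ 2)) ?_ ?_ ?_
      · exact (hf₂s.continuousOn.comp hq fun s hs => (hy x hx s hs).1).comp
          (f := fun s : ℝ => s ^ 2) (by fun_prop) hsq
      · intro s hs
        have := (hy x hx (s ^ 2) (hsq s hs)).2.2
        simpa only [mul_pow] using this
      · refine abs_lt.1 ((Real.lt_sqrt (abs_nonneg t)).2 ?_)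
        rwa [sq_abs]
    have hfst₁ := (ContinuousLinearMap.fst ℝ (Coord d) ℝ).hasFDerivAt.comp_hasDerivAt t hD₁'
    have hsnd₁ := (ContinuousLinearMap.snd ℝ (Coord d) ℝ).hasFDerivAt.comp_hasDerivAt t hD₁'
    have hfst₂ := (ContinuousLinearMap.fst ℝ ℝ (Coord d →L[ℝ] ℝ)).hasFDerivAt.comp_hasDerivAt t hD₂
    have hsnd₂ := (ContinuousLinearMap.snd ℝ ℝ (Coord d →L[ℝ] ℝ)).hasFDerivAt.comp_hasDerivAt t hD₂
    have hfin := ((hfst₁.const_add x).prodMk (hfst₂.prodMk (hsnd₂.prodMk (hsnd₁.const_add (η₀ x)))))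
    refine HasDerivAt.congr_deriv hfin ?_
    rw [dblField, hfold]
    refine Prod.ext ?_ (Prod.ext rfl (Prod.ext rfl ?_))
    · change (2 * t) • (((y₂ (x, t ^ 2)).1 / 2) • partM (L (x, y₁ (x, t ^ 2), y₂ (x, t ^ 2), t ^ 2))) =
        (t * (y₂ (x, t ^ 2)).1) • partM (L (x, y₁ (x, t ^ 2), y₂ (x, t ^ 2), t ^ 2))
      rw [smul_smul]
      congr 1
      ring
    · set q : Coord d × (Coord d × ℝ) × (ℝ × (Coord d →L[ℝ] ℝ)) × ℝ :=
        (x, y₁ (x, t ^ 2), y₂ (x, t ^ 2), t ^ 2)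
      change 2 * t * (-((y₂ (x, t ^ 2)).1 * partR (L q) + (y₂ (x, t ^ 2)).2 (partM (L q))) / 2) =
        -(t * (y₂ (x, t ^ 2)).1 * partR (L q) + t * (y₂ (x, t ^ 2)).2 (partM (L q)))
      ring

end Family

/-! ### Gauss's lemma for the regularized flow -/

section Gauss

variable {E : Type*} [NormedAddCommGroup E] [NormedSpace ℝ E] [FiniteDimensional ℝ E]
  {M : Type*} [TopologicalSpace M] [ChartedSpace E M] [IsManifold 𝓘(ℝ, E) ∞ M]
  {g : Bundle.ContMDiffRiemannianMetric 𝓘(ℝ, E) ∞ E (fun x : M => TangentSpace 𝓘(ℝ, E) x)}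
  {φ : M → ℝ} {d : ℕ} {u : Coord d → M} {V : Set (Coord d)}
  {Ψ : Coord d × ℝ → M} {Θ : M → Coord d × ℝ} {D : Set (Coord d × ℝ)} {O : Set M}

/-- The pairing of the momentum of `x` with the variation `v`. -/
def pairing (x v : Phase d) : ℝ := x.2.2.1 v.1 + x.2.2.2 * v.2.1

theorem hasFDerivAt_pairing {Y : Coord d × ℝ → Phase d} {y : Coord d × ℝ} (hY : ContDiffAt ℝ 2 Y y)
    (a b : Coord d × ℝ) :
    DifferentiableAt ℝ (fun y => pairing (Y y) (fderiv ℝ Y y a)) y ∧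
    fderiv ℝ (fun y => pairing (Y y) (fderiv ℝ Y y a)) y b =
      pairing (fderiv ℝ Y y b) (fderiv ℝ Y y a) + pairing (Y y) (fderiv ℝ (fderiv ℝ Y) y b a) := by
  have h1 : HasFDerivAt Y (fderiv ℝ Y y) y := (hY.differentiableAt (by norm_num)).hasFDerivAt
  have h2 : HasFDerivAt (fderiv ℝ Y) (fderiv ℝ (fderiv ℝ Y) y) y :=
    ((hY.fderiv_right (m := 1) (by norm_num)).differentiableAt (by norm_num)).hasFDerivAt
  have h3 : HasFDerivAt (fun y => fderiv ℝ Y y a) ((fderiv ℝ (fderiv ℝ Y) y).flip a) y :=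
    (h2.clm_apply (hasFDerivAt_const a y)).congr_fderiv (by ext <;> simp)
  have h4 : HasFDerivAt (fun y => pairing (Y y) (fderiv ℝ Y y a)) _ y :=
    (h1.snd.snd.fst.clm_apply h3.fst).add (h1.snd.snd.snd.mul h3.snd.fst)
  refine ⟨h4.differentiableAt, ?_⟩
  rw [h4.fderiv]
  simp [pairing]
  ring

/-- The difference of the two pairings is the symplectic form of the variation and the Hamiltonian
field, which is the differential of the Hamiltonian on the variation. -/
theorem fderiv_chartK_foldPhase (h : IsStraightening (E := E) φ Ψ Θ D O)
    {Y : Coord d × ℝ → Phase d} {y : Coord d × ℝ} (hY : DifferentiableAt ℝ Y y)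
    (hD : ((Y y).1, (Y y).2.1 ^ 2 / 2) ∈ D) (v : Coord d × ℝ) :
    DifferentiableAt ℝ (fun y => chartK g Ψ (foldPhase (Y y))) y ∧
    fderiv ℝ (fun y => chartK g Ψ (foldPhase (Y y))) y v =
      pairing (fderiv ℝ Y y v) (dblField (chartK g Ψ) (Y y)) -
        pairing (dblField (chartK g Ψ) (Y y)) (fderiv ℝ Y y v) := by
  obtain ⟨L, hL, hLv⟩ := hasFDerivAt_foldPhase (Y y)
  have h1 : HasFDerivAt (fun y => chartK g Ψ (foldPhase (Y y))) _ y :=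
    HasFDerivAt.comp (g := chartK g Ψ) y (h.hasFDerivAt_chartK (x := foldPhase (Y y)) hD)
      (HasFDerivAt.comp (g := foldPhase) y hL hY.hasFDerivAt)
  refine ⟨h1.differentiableAt, ?_⟩
  rw [h1.fderiv, ContinuousLinearMap.comp_apply, ContinuousLinearMap.comp_apply, hLv,
    apply_eq_parts]
  simp only [pairing, dblField, add_apply, smul_apply, neg_apply, map_smul, smul_eq_mul]
  ring

theorem eq_of_fderiv_snd_eq_zero {W : Set (Coord d)} {ρ : ℝ} {e : Coord d × ℝ → ℝ}
    (he : ∀ y ∈ W ×ˢ Set.Ioo (-ρ) ρ, DifferentiableAt ℝ e y ∧ fderiv ℝ e y (0, 1) = 0)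
    {x : Coord d} (hx : x ∈ W) {t : ℝ} (ht : t ∈ Set.Ioo (-ρ) ρ) : e (x, t) = e (x, 0) := by
  have h0 : (0 : ℝ) ∈ Set.Ioo (-ρ) ρ := ⟨by linarith [ht.1, ht.2], by linarith [ht.1, ht.2]⟩
  have hd : ∀ t ∈ Set.Ioo (-ρ) ρ, HasDerivAt (fun t => e (x, t)) 0 t := by
    intro t ht
    have h1 : HasDerivAt (fun t : ℝ => (x, t)) (0, 1) t :=
      (hasDerivAt_const t x).prodMk (hasDerivAt_id t)
    have h2 := (he (x, t) ⟨hx, ht⟩).1.hasFDerivAt.comp_hasDerivAt t h1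
    rwa [(he (x, t) ⟨hx, ht⟩).2] at h2
  exact isOpen_Ioo.is_const_of_deriv_eq_zero isPreconnected_Ioo
    (fun t ht => (hd t ht).differentiableAt.differentiableWithinAt)
    (fun t ht => (hd t ht).deriv) ht h0

/-- Gauss's lemma: the trajectories stay normal to the family of their end points. -/
theorem IsStraightening.gauss (h : IsStraightening (E := E) φ Ψ Θ D O) {W : Set (Coord d)}
    (hW : IsOpen W) {ρ : ℝ} {Y : Coord d × ℝ → Phase d}
    (hY : ContDiffOn ℝ ∞ Y (W ×ˢ Set.Ioo (-ρ) ρ))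
    (hD : ∀ y ∈ W ×ˢ Set.Ioo (-ρ) ρ, ((Y y).1, (Y y).2.1 ^ 2 / 2) ∈ D)
    (hT : ∀ y ∈ W ×ˢ Set.Ioo (-ρ) ρ, fderiv ℝ Y y (0, 1) = dblField (chartK g Ψ) (Y y))
    (h0 : ∀ x ∈ W, (Y (x, 0)).2.1 = 0 ∧ (Y (x, 0)).2.2.1 = 0 ∧
      chartK g Ψ (foldPhase (Y (x, 0))) = 1) {y : Coord d × ℝ} (hy : y ∈ W ×ˢ Set.Ioo (-ρ) ρ) :
    chartK g Ψ (foldPhase (Y y)) = 1 ∧ ∀ v, pairing (Y y) (fderiv ℝ Y y (v, 0)) = 0 := by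
  set B := W ×ˢ Set.Ioo (-ρ) ρ with hB
  have hBo : IsOpen B := hW.prod isOpen_Ioo
  have hYd : ∀ y ∈ B, ContDiffAt ℝ ∞ Y y := fun y hy => hY.contDiffAt (hBo.mem_nhds hy)
  have hY2 : ∀ y ∈ B, ContDiffAt ℝ 2 Y y := fun y hy =>
    (hYd y hy).of_le (WithTop.coe_le_coe.2 le_top)
  have hY1 : ∀ y ∈ B, DifferentiableAt ℝ Y y := fun y hy =>
    (hYd y hy).differentiableAt (by simp)
  have hE : ∀ y ∈ B, chartK g Ψ (foldPhase (Y y)) = 1 := by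
    rintro ⟨x, t⟩ hy
    rw [← (h0 x hy.1).2.2]
    refine eq_of_fderiv_snd_eq_zero (e := fun y => chartK g Ψ (foldPhase (Y y))) (fun y hy => ?_)
      hy.1 hy.2
    have h1 := fderiv_chartK_foldPhase (g := g) h (hY1 y hy) (hD y hy) (0, 1)
    refine ⟨h1.1, ?_⟩
    rw [h1.2, hT y hy, sub_self]
  refine ⟨hE y hy, fun v => ?_⟩
  obtain ⟨x, t⟩ := y
  have h00 : (0 : ℝ) ∈ Set.Ioo (-ρ) ρ :=
    ⟨by linarith [hy.2.1, hy.2.2], by linarith [hy.2.1, hy.2.2]⟩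
  have hx0 : (x, (0 : ℝ)) ∈ B := ⟨hy.1, h00⟩
  -- At time `0` the momentum along the hypersurface vanishes and `ξ = 0` for all `x`, so both
  -- summands of the pairing are zero.
  have hstart : pairing (Y (x, 0)) (fderiv ℝ Y (x, 0) (v, 0)) = 0 := by
    have h1 : HasDerivAt (fun r : ℝ => (x + r • v, (0 : ℝ))) (v, 0) 0 := by
      have : HasDerivAt (fun r : ℝ => x + r • v) v 0 := by
        simpa using ((hasDerivAt_id (0 : ℝ)).smul_const v).const_add x
      exact this.prodMk (hasDerivAt_const _ _)
    have h2 : HasDerivAt (fun r : ℝ => Y (x + r • v, 0)) (fderiv ℝ Y (x, 0) (v, 0)) 0 := by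
      refine HasFDerivAt.comp_hasDerivAt (l := Y) 0 ?_ h1
      simpa using (hY1 _ hx0).hasFDerivAt
    have h3 : HasDerivAt (fun r : ℝ => (Y (x + r • v, 0)).2.1) (fderiv ℝ Y (x, 0) (v, 0)).2.1 0 := by
      let L : Phase d →L[ℝ] ℝ := (ContinuousLinearMap.fst ℝ ℝ ((Coord d →L[ℝ] ℝ) × ℝ)).comp
        (ContinuousLinearMap.snd ℝ (Coord d) (ℝ × (Coord d →L[ℝ] ℝ) × ℝ))
      exact L.hasFDerivAt.comp_hasDerivAt 0 h2
    have h4 : (fun r : ℝ => (Y (x + r • v, 0)).2.1) =ᶠ[𝓝 0] fun _ => 0 := by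
      have hc : Filter.Tendsto (fun r : ℝ => x + r • v) (𝓝 0) (𝓝 x) := by
        have : Continuous fun r : ℝ => x + r • v := by fun_prop
        simpa using this.tendsto 0
      filter_upwards [hc (hW.mem_nhds hy.1)] with r hr using (h0 _ hr).1
    have h5 : (fderiv ℝ Y (x, 0) (v, 0)).2.1 = 0 :=
      h3.unique ((hasDerivAt_const (0 : ℝ) (0 : ℝ)).congr_of_eventuallyEq h4)
    simp [pairing, (h0 x hy.1).2.1, h5]
  refine Eq.trans ?_ hstart
  refine eq_of_fderiv_snd_eq_zero (e := fun y => pairing (Y y) (fderiv ℝ Y y (v, 0)))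
    (fun y hy => ?_) hy.1 hy.2
  have h1 := hasFDerivAt_pairing (hY2 y hy) (v, 0) (0, 1)
  have h2 := hasFDerivAt_pairing (hY2 y hy) (0, 1) (v, 0)
  -- By Euler's identity the momentum paired with the velocity is twice the energy, here the
  -- constant `2`.
  have h3 : fderiv ℝ (fun y => pairing (Y y) (fderiv ℝ Y y (0, 1))) y (v, 0) = 0 := by
    have he : (fun y => pairing (Y y) (fderiv ℝ Y y (0, 1))) =ᶠ[𝓝 y] fun _ => 2 := by
      filter_upwards [hBo.mem_nhds hy] with y' hy'
      have h4 := h.euler_chartK (g := g) (x := foldPhase (Y y')) (hD y' hy')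
      rw [hT y' hy', ← mul_one (2 : ℝ), ← hE y' hy', ← h4]
      simp [pairing, dblField, foldPhase]
    rw [he.fderiv_eq]
    simp
  -- The energy is the same for all starting points, so the symplectic form of variation and
  -- velocity vanishes. Together with `h3` and the symmetry of second derivatives this makes the
  -- pairing constant in time.
  have h4 : fderiv ℝ (fun y => chartK g Ψ (foldPhase (Y y))) y (v, 0) = 0 := by
    have he : (fun y => chartK g Ψ (foldPhase (Y y))) =ᶠ[𝓝 y] fun _ => 1 := by
      filter_upwards [hBo.mem_nhds hy] with y' hy' using hE y' hy'
    rw [he.fderiv_eq]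
    simp
  rw [(fderiv_chartK_foldPhase (g := g) h (hY1 y hy) (hD y hy) (v, 0)).2, ← hT y hy] at h4
  have hsymm : fderiv ℝ (fderiv ℝ Y) y (0, 1) (v, 0) = fderiv ℝ (fderiv ℝ Y) y (v, 0) (0, 1) :=
    ((hY2 y hy).isSymmSndFDerivAt (by simp)) _ _
  refine ⟨h1.1, ?_⟩
  rw [h1.2, hsymm]
  rw [h2.2] at h3
  linarith

end Gauss

/-! ### Local semigeodesic coordinates -/

section NormalForm

variable {E : Type*} [NormedAddCommGroup E] [NormedSpace ℝ E] [FiniteDimensional ℝ E]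
  {M : Type*} [TopologicalSpace M] [ChartedSpace E M] [IsManifold 𝓘(ℝ, E) ∞ M]
  {g : Bundle.ContMDiffRiemannianMetric 𝓘(ℝ, E) ∞ E (fun x : M => TangentSpace 𝓘(ℝ, E) x)}
  {φ : M → ℝ} {d : ℕ} {u : Coord d → M} {V : Set (Coord d)}
  {Ψ : Coord d × ℝ → M} {Θ : M → Coord d × ℝ} {D : Set (Coord d × ℝ)} {O : Set M}

open Classical in
/-- The base point, at time `√s`, of the trajectory of the regularized system that starts at
`(q, 0)` with zero momentum along the hypersurface. -/
def radialMap
    (g : Bundle.ContMDiffRiemannianMetric 𝓘(ℝ, E) ∞ E (fun x : M => TangentSpace 𝓘(ℝ, E) x))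
    (φ : M → ℝ) (q : M) (s : ℝ) : M :=
  if h : ∃ c : ℝ → DblCotangent (E := E) φ,
    IsHamiltonianTrajectory (𝓘(ℝ, E).prod 𝓘(ℝ, ℝ)) (dbl φ) (dblT φ) (regularizedH φ g)
      (Set.Icc 0 (√s)) c ∧ c 0 = sectionPoint φ g 1 ⟨q, 0⟩ then (h.choose (√s)).1.1 else q

/-- Semigeodesic coordinates `F` over the local parametrization `u` of the hypersurface,
where `φ(F(x, s)) = s κ(x, s)`. -/
structure IsNormalForm
    (g : Bundle.ContMDiffRiemannianMetric 𝓘(ℝ, E) ∞ E (fun x : M => TangentSpace 𝓘(ℝ, E) x))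
    (φ : M → ℝ) (u : Coord d → M) (W : Set (Coord d)) (ε : ℝ) (F : Coord d × ℝ → M)
    (Θ : M → Coord d × ℝ) (O : Set M) (κ : Coord d × ℝ → ℝ) : Prop where
  coord : IsLocalCoord 𝓘(ℝ, E) (bdry φ) (bdryT φ) u W
  pos : 0 < ε
  isOpen_target : IsOpen O
  smooth : ContMDiffOn 𝓘(ℝ, Coord d × ℝ) 𝓘(ℝ, E) ∞ F (W ×ˢ Set.Ioo (-ε) ε)
  smooth_symm : ContMDiffOn 𝓘(ℝ, E) 𝓘(ℝ, Coord d × ℝ) ∞ Θ O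
  mapsTo : Set.MapsTo F (W ×ˢ Set.Ioo (-ε) ε) O
  mapsTo_symm : Set.MapsTo Θ O (W ×ˢ Set.Ioo (-ε) ε)
  left_inv : ∀ y ∈ W ×ˢ Set.Ioo (-ε) ε, Θ (F y) = y
  right_inv : ∀ x ∈ O, F (Θ x) = x
  base : ∀ x ∈ W, F (x, 0) = u x
  smooth_factor : ContDiffOn ℝ ∞ κ (W ×ˢ Set.Ioo (-ε) ε)
  factor_pos : ∀ y ∈ W ×ˢ Set.Ioo (-ε) ε, 0 < κ y
  apply_eq : ∀ y ∈ W ×ˢ Set.Ioo (-ε) ε, φ (F y) = y.2 * κ y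
  factor_zero : ∀ x ∈ W, κ (x, 0) = coNormSq g (u x) (dPhi φ (u x))
  radial : ∀ x ∈ W, ∀ s ∈ Set.Ico 0 ε, radialMap g φ (u x) s = F (x, s)
  injective : ∀ y ∈ W ×ˢ Set.Ioo (-ε) ε, Function.Injective (paramDeriv 𝓘(ℝ, E) F y)
  metric : ∀ x ∈ W, ∀ s ∈ Set.Ioo 0 ε, ∀ v ζ,
    pullForm g (F (x, s)) (paramDeriv 𝓘(ℝ, E) F (x, s)) (v, ζ) (v, ζ) =
      κ (x, s) * ζ ^ 2 + pullForm g (F (x, s)) (paramDeriv 𝓘(ℝ, E) F (x, s)) (v, 0) (v, 0)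

theorem sectionPoint_zero (h : IsAdapted g φ u V Ψ Θ D O) {z : Coord d} (hz : (z, (0 : ℝ)) ∈ D) :
    sectionPoint φ g 1 ⟨u z, 0⟩ =
      dblPoint (E := E) φ Ψ (z, 0, 0, √(2 / (2 * chartK g Ψ (z, 0, 0, 1)))) := by
  have h1 := h.sectionPoint_ofCoords hz 1 0
  rw [one_mul] at h1
  rw [← h1]
  congr 1

-- Gauss's lemma in the variable `s = t²`, projected from the double to `M`. Since `ds = 2 t dt`,
-- the derivative of the base point in `s` is `ξ / (2 t) = Ξ / 2` times the vector dual to the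
-- covector `(ξ p, η)`. This covector annihilates the variations of the starting point, and its
-- squared norm is `2` because the energy is `1`; so the squared length is `Ξ² / 2`. Division by `t`
-- requires `s > 0`.
set_option maxHeartbeats 1000000 in
theorem radial_metric (h : IsAdapted g φ u V Ψ Θ D O) {W : Set (Coord d)} {ε : ℝ}
    {Z : Coord d × ℝ → Coord d} {Ξ : Coord d × ℝ → ℝ} {π : Coord d × ℝ → Coord d →L[ℝ] ℝ}
    {H : Coord d × ℝ → ℝ} (hW : IsOpen W)
    (hZ : ContDiffOn ℝ ∞ Z (W ×ˢ Set.Ioo (-ε) ε)) (hΞ : ContDiffOn ℝ ∞ Ξ (W ×ˢ Set.Ioo (-ε) ε))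
    (hπ : ContDiffOn ℝ ∞ π (W ×ˢ Set.Ioo (-ε) ε)) (hH : ContDiffOn ℝ ∞ H (W ×ˢ Set.Ioo (-ε) ε))
    (hinit : ∀ x ∈ W, (x, (0 : ℝ)) ∈ D ∧ Z (x, 0) = x ∧
      Ξ (x, 0) = √(2 * (2 * chartK g Ψ (x, 0, 0, 1))) ∧
      H (x, 0) = √(2 / (2 * chartK g Ψ (x, 0, 0, 1))))
    (hdom : ∀ x ∈ W, ∀ s ∈ Set.Ioo (-ε) ε, (Z (x, s), s * Ξ (x, s) ^ 2 / 2) ∈ D)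
    (hsol : ∀ x ∈ W, ∀ t : ℝ, t ^ 2 < ε → HasDerivAt (fun t =>
        ((Z (x, t ^ 2), t * Ξ (x, t ^ 2), t • π (x, t ^ 2), H (x, t ^ 2)) : Phase d))
        (dblField (chartK g Ψ) (Z (x, t ^ 2), t * Ξ (x, t ^ 2), t • π (x, t ^ 2), H (x, t ^ 2))) t)
    {x : Coord d} (hx : x ∈ W) {s : ℝ} (hs : s ∈ Set.Ioo 0 ε) (v : Coord d) (ζ : ℝ) :
    pullForm g (Ψ (Z (x, s), s * Ξ (x, s) ^ 2 / 2))
      ((paramDeriv 𝓘(ℝ, E) Ψ (Z (x, s), s * Ξ (x, s) ^ 2 / 2)).comp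
        (fderiv ℝ (fun y => (Z y, y.2 * Ξ y ^ 2 / 2)) (x, s))) (v, ζ) (v, ζ) =
    Ξ (x, s) ^ 2 / 2 * ζ ^ 2 + pullForm g (Ψ (Z (x, s), s * Ξ (x, s) ^ 2 / 2))
      ((paramDeriv 𝓘(ℝ, E) Ψ (Z (x, s), s * Ξ (x, s) ^ 2 / 2)).comp
        (fderiv ℝ (fun y => (Z y, y.2 * Ξ y ^ 2 / 2)) (x, s))) (v, 0) (v, 0) := by
  set t := √s with htdef
  have ht : 0 < t := Real.sqrt_pos.2 hs.1
  have hts : t ^ 2 = s := Real.sq_sqrt hs.1.le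
  have hε : 0 < ε := hs.1.trans hs.2
  set χ : Coord d × ℝ → Coord d × ℝ := fun y => (Z y, y.2 * Ξ y ^ 2 / 2) with hχ
  have hsnd : ContDiffOn ℝ ∞ (Prod.snd : Coord d × ℝ → ℝ) (W ×ˢ Set.Ioo (-ε) ε) :=
    contDiff_snd.contDiffOn
  have hχs : ContDiffOn ℝ ∞ χ (W ×ˢ Set.Ioo (-ε) ε) := hZ.prodMk ((hsnd.mul (hΞ.pow 2)).div_const 2)
  -- the family as a function of `(x, t)`
  set sq : Coord d × ℝ → Coord d × ℝ := fun y => (y.1, y.2 ^ 2) with hsqdef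
  set B := W ×ˢ Set.Ioo (-√ε) √ε with hB
  have hBo : IsOpen B := hW.prod isOpen_Ioo
  have hsqε : ∀ t ∈ Set.Ioo (-√ε) √ε, t ^ 2 < ε := by
    intro t ht
    rw [← Real.sq_sqrt hε.le]
    exact sq_lt_sq.2 (by rw [abs_of_nonneg (Real.sqrt_nonneg ε)]; exact abs_lt.2 ht)
  have hsqm : Set.MapsTo sq B (W ×ˢ Set.Ioo (-ε) ε) := fun y hy =>
    ⟨hy.1, by nlinarith [sq_nonneg y.2], hsqε _ hy.2⟩
  have hsqs : ContDiff ℝ ∞ sq := by fun_prop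
  set Y : Coord d × ℝ → Phase d := fun y => (Z (sq y), y.2 * Ξ (sq y), y.2 • π (sq y), H (sq y))
    with hY
  have hYs : ContDiffOn ℝ ∞ Y B := by
    have h2 : ContDiffOn ℝ ∞ (Prod.snd : Coord d × ℝ → ℝ) B := contDiff_snd.contDiffOn
    exact (hZ.comp hsqs.contDiffOn hsqm).prodMk ((h2.mul (hΞ.comp hsqs.contDiffOn hsqm)).prodMk
      ((h2.smul (hπ.comp hsqs.contDiffOn hsqm)).prodMk (hH.comp hsqs.contDiffOn hsqm)))
  have hYd : ∀ y ∈ B, DifferentiableAt ℝ Y y := fun y hy =>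
    (hYs.contDiffAt (hBo.mem_nhds hy)).differentiableAt (by simp)
  have hYχ : ∀ y, χ (sq y) = ((Y y).1, (Y y).2.1 ^ 2 / 2) := fun y => by
    simp only [hχ, hY, hsqdef, mul_pow]
  have hYD : ∀ y ∈ B, ((Y y).1, (Y y).2.1 ^ 2 / 2) ∈ D := by
    intro y hy
    rw [← hYχ]
    exact hdom y.1 hy.1 (y.2 ^ 2) (hsqm hy).2
  have hYT : ∀ y ∈ B, fderiv ℝ Y y (0, 1) = dblField (chartK g Ψ) (Y y) := by
    rintro ⟨x, t⟩ hy
    have h1 : HasDerivAt (fun t : ℝ => (x, t)) (0, 1) t :=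
      (hasDerivAt_const t x).prodMk (hasDerivAt_id t)
    have h2 := (hYd _ hy).hasFDerivAt.comp_hasDerivAt t h1
    exact h2.unique (hsol x hy.1 t (hsqε t hy.2))
  have hY0 : ∀ x ∈ W, (Y (x, 0)).2.1 = 0 ∧ (Y (x, 0)).2.2.1 = 0 ∧
      chartK g Ψ (foldPhase (Y (x, 0))) = 1 := by
    intro x hx
    obtain ⟨h1, h2, h3, h4⟩ := hinit x hx
    refine ⟨by simp [hY], by simp [hY], ?_⟩
    have h5 : foldPhase (Y (x, 0)) = (x, 0, 0, √(2 / (2 * chartK g Ψ (x, 0, 0, 1)))) := by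
      simp [foldPhase, hY, hsqdef, h2, h4]
    have h6 := h.chartK_base (g := g) h1 0 (√(2 / (2 * chartK g Ψ (x, 0, 0, 1))))
    have h7 := h6.2
    rw [h5, h6.1, Real.sq_sqrt (by positivity)]
    simp
    field_simp
  have hyB : (x, t) ∈ B := ⟨hx, by linarith [Real.sqrt_nonneg ε], Real.sqrt_lt_sqrt hs.1.le hs.2⟩
  obtain ⟨hK, hgauss⟩ := h.gauss hW hYs hYD hYT hY0 hyB
  -- the derivative of `χ` in terms of `Y`
  have hsqxt : sq (x, t) = (x, s) := by simp [hsqdef, hts]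
  have hχd : HasFDerivAt χ (fderiv ℝ χ (x, s)) (sq (x, t)) := by
    rw [hsqxt]
    exact ((hχs.contDiffAt ((hW.prod isOpen_Ioo).mem_nhds
      ⟨hx, by linarith [hs.1], hs.2⟩)).differentiableAt (by simp)).hasFDerivAt
  have hsqd : HasFDerivAt sq ((ContinuousLinearMap.fst ℝ (Coord d) ℝ).prod
      ((2 * t) • ContinuousLinearMap.snd ℝ (Coord d) ℝ)) (x, t) := by
    have h1 : HasFDerivAt (Prod.snd : Coord d × ℝ → ℝ) (ContinuousLinearMap.snd ℝ _ _)
      (x, t) := hasFDerivAt_snd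
    exact hasFDerivAt_fst.prodMk ((h1.pow 2).congr_fderiv (by ext <;> simp))
  -- The chain rule for `χ ∘ sq`: a variation `ζ` of `t` is a variation `2 t ζ` of `s`.
  have hA : ∀ (v : Coord d) (ζ : ℝ), fderiv ℝ χ (x, s) (v, 2 * t * ζ) =
      ((fderiv ℝ Y (x, t) (v, ζ)).1, (Y (x, t)).2.1 * (fderiv ℝ Y (x, t) (v, ζ)).2.1) := by
    intro v ζ
    have h1 : HasFDerivAt (fun y => χ (sq y)) _ (x, t) := hχd.comp (x, t) hsqd
    have h2 := (hYd _ hyB).hasFDerivAt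
    have h3 : HasFDerivAt (fun y => ((Y y).1, (Y y).2.1 ^ 2 * (2 : ℝ)⁻¹)) _ (x, t) :=
      h2.fst.prodMk ((h2.snd.fst.pow 2).mul_const (2 : ℝ)⁻¹)
    have h4 := h1.unique (h3.congr_of_eventuallyEq (Filter.Eventually.of_forall fun y => by
      change χ (sq y) = ((Y y).1, (Y y).2.1 ^ 2 * 2⁻¹)
      rw [hYχ, div_eq_mul_inv]))
    have h5 := congrArg (fun L : Coord d × ℝ →L[ℝ] Coord d × ℝ => L (v, ζ)) h4
    refine Eq.trans ?_ (h5.trans ?_)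
    · simp
    · refine Prod.ext rfl ?_
      simp
      ring
  set A := fderiv ℝ χ (x, s) with hAdef
  have hχxs : χ (x, s) = ((Y (x, t)).1, (Y (x, t)).2.1 ^ 2 / 2) := by rw [← hYχ, hsqxt]
  have hχxsD : χ (x, s) ∈ D := hdom x hx s ⟨by linarith [hs.1], hs.2⟩
  set G := pullForm g (Ψ (χ (x, s))) (paramDeriv 𝓘(ℝ, E) Ψ (χ (x, s))) with hG
  set X := foldPhase (Y (x, t)) with hX
  have hXχ : (X.1, X.2.1) = χ (x, s) := hχxs.symm
  have hGc : G (partM (fderiv ℝ (chartK g Ψ) X), partEta (fderiv ℝ (chartK g Ψ) X)) =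
      joinCovector X.2.2.1 X.2.2.2 := by
    rw [h.parts_chartK (by rw [hXχ]; exact hχxsD), hXχ]
    exact apply_inverse_of_posDef (fun v hv => pullForm_pos g (h.bijective hχxsD).1 v hv) _
  set ξ := (Y (x, t)).2.1 with hξ
  have hA1 : (2 * t) • A (0, 1) =
      ξ • (partM (fderiv ℝ (chartK g Ψ) X), partEta (fderiv ℝ (chartK g Ψ) X)) := by
    have h1 := hA 0 1
    rw [hYT _ hyB, mul_one] at h1
    rw [← map_smul, Prod.smul_mk, smul_zero, smul_eq_mul, mul_one, h1]
    rfl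
  have hGA : ∀ b : Coord d × ℝ, 2 * t * G (A (0, 1)) b =
      ξ * (ξ * (Y (x, t)).2.2.1 b.1 + (Y (x, t)).2.2.2 * b.2) := by
    intro b
    have h1 : G ((2 * t) • A (0, 1)) b = ξ * joinCovector X.2.2.1 X.2.2.2 b := by
      rw [hA1, map_smul, hGc]
      rfl
    rw [map_smul] at h1
    refine h1.trans ?_
    rw [joinCovector_apply]
    rfl
  have hcross : G (A (0, 1)) (A (v, 0)) = 0 := by
    have h1 := hGA (A (v, 0))
    have h2 := hA v 0
    rw [mul_zero] at h2
    rw [h2] at h1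
    have h3 : ξ * (ξ * (Y (x, t)).2.2.1 (fderiv ℝ Y (x, t) (v, 0)).1 +
        (Y (x, t)).2.2.2 * (ξ * (fderiv ℝ Y (x, t) (v, 0)).2.1)) = 0 := by
      have := hgauss v
      rw [pairing] at this
      linear_combination ξ ^ 2 * this
    rw [h2]
    rw [h3] at h1
    exact (mul_eq_zero.1 h1).resolve_left (by positivity)
  have hdiag : G (A (0, 1)) (A (0, 1)) = Ξ (x, s) ^ 2 / 2 := by
    have h1 := hGA ((2 * t) • A (0, 1))
    rw [hA1] at h1
    have h2 := h.euler_chartK (g := g) (x := X) (by rw [hXχ]; exact hχxsD)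
    have h3 : G (A (0, 1)) (ξ • (partM (fderiv ℝ (chartK g Ψ) X),
        partEta (fderiv ℝ (chartK g Ψ) X))) = 2 * t * G (A (0, 1)) (A (0, 1)) := by
      rw [← hA1, map_smul, smul_eq_mul]
    rw [h3] at h1
    have h4 : ξ = t * Ξ (x, s) := by
      rw [hξ, ← hsqxt]
    have h5 : X.2.2.1 (partM (fderiv ℝ (chartK g Ψ) X)) =
      ξ * (Y (x, t)).2.2.1 (partM (fderiv ℝ (chartK g Ψ) X)) := rfl
    have h6 : X.2.2.2 = (Y (x, t)).2.2.2 := rfl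
    rw [h5, h6, hK] at h2
    simp only [Prod.smul_mk, map_smul, smul_eq_mul] at h1
    have h7 : (2 * t) * (2 * t) * G (A (0, 1)) (A (0, 1)) = (2 * t) * (2 * t) *
        (Ξ (x, s) ^ 2 / 2) := by
      have e : ξ * ξ = t * t * Ξ (x, s) ^ 2 := by rw [h4]; ring
      linear_combination h1 + ξ * ξ * h2 + 2 * e
    exact mul_left_cancel₀ (by positivity) h7
  have hdec : A (v, ζ) = A (v, 0) + ζ • A (0, 1) := by
    rw [← map_smul, ← map_add]
    simp
  have hsymm : G (A (v, 0)) (A (0, 1)) = 0 := (innerE_symm g _ _ _).trans hcross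
  change G (A (v, ζ)) (A (v, ζ)) = Ξ (x, s) ^ 2 / 2 * ζ ^ 2 + G (A (v, 0)) (A (v, 0))
  rw [hdec]
  simp only [map_add, map_smul, add_apply, smul_apply, smul_eq_mul, hcross, hsymm, hdiag]
  ring

-- The coordinates are `Ψ ∘ χ` with `χ = (Z, s Ξ² / 2)`. At `s = 0` the derivative of `χ` is the
-- identity in the directions of `x`, and its last component multiplies the `s`-direction by `Ξ² / 2
-- > 0`, so `χ` is a local diffeomorphism, restricted here to a box. Uniqueness of trajectories
-- identifies the result with `radialMap`, which does not depend on the chart.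
set_option maxHeartbeats 1000000 in
theorem IsAdapted.exists_isNormalForm [T2Space M] (h : IsAdapted g φ u V Ψ Θ D O) {z₀ : Coord d}
    (hz₀ : (z₀, (0 : ℝ)) ∈ D) :
    ∃ (W : Set (Coord d)) (ε : ℝ) (F : Coord d × ℝ → M) (Θ' : M → Coord d × ℝ) (O' : Set M)
      (κ : Coord d × ℝ → ℝ), z₀ ∈ W ∧ IsNormalForm g φ u W ε F Θ' O' κ := by
  obtain ⟨W₁, ε₁, Z, Ξ, π, H, hW₁, hz₁, hε₁, hZ, hΞ, hπ, hH, hinit, hdom, hsol⟩ := h.exists_family hz₀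
  set B₁ := W₁ ×ˢ Set.Ioo (-ε₁) ε₁ with hB₁
  have hB₁o : IsOpen B₁ := hW₁.prod isOpen_Ioo
  have h0ε : (0 : ℝ) ∈ Set.Ioo (-ε₁) ε₁ := ⟨by linarith, hε₁⟩
  have hsnd : ContDiffOn ℝ ∞ (Prod.snd : Coord d × ℝ → ℝ) B₁ := contDiff_snd.contDiffOn
  have hKpos : ∀ x ∈ W₁, 0 < chartK g Ψ (x, 0, 0, 1) := fun x hx =>
    (h.chartK_base (hinit x hx).1 0 0).2
  set χ : Coord d × ℝ → Coord d × ℝ := fun y => (Z y, y.2 * Ξ y ^ 2 / 2) with hχ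
  have hχs : ContDiffOn ℝ ∞ χ B₁ := hZ.prodMk ((hsnd.mul (hΞ.pow 2)).div_const 2)
  -- the derivative of `χ` at the base point
  have hy₀ : (z₀, (0 : ℝ)) ∈ B₁ := ⟨hz₁, h0ε⟩
  have hχd : DifferentiableAt ℝ χ (z₀, 0) :=
    (hχs.contDiffAt (hB₁o.mem_nhds hy₀)).differentiableAt (by simp)
  have hΞ₀ : 0 < Ξ (z₀, 0) := by
    rw [(hinit z₀ hz₁).2.2.1]
    have := hKpos z₀ hz₁
    positivity
  have hχinj : Function.Injective (fderiv ℝ χ (z₀, 0)) := by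
    have e1 : ∀ a : Coord d, fderiv ℝ χ (z₀, 0) (a, 0) = (a, 0) := by
      intro a
      have h1 : HasDerivAt (fun r : ℝ => (z₀ + r • a, (0 : ℝ))) (a, 0) 0 := by
        have : HasDerivAt (fun r : ℝ => z₀ + r • a) a 0 := by
          simpa using ((hasDerivAt_id (0 : ℝ)).smul_const a).const_add z₀
        exact this.prodMk (hasDerivAt_const _ _)
      have h2 : HasDerivAt (fun r : ℝ => χ (z₀ + r • a, 0)) (fderiv ℝ χ (z₀, 0) (a, 0)) 0 := by
        refine HasFDerivAt.comp_hasDerivAt (l := χ) 0 ?_ h1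
        simpa using hχd.hasFDerivAt
      have h4 : (fun r : ℝ => χ (z₀ + r • a, 0)) =ᶠ[𝓝 0] fun r => (z₀ + r • a, (0 : ℝ)) := by
        have hc : Filter.Tendsto (fun r : ℝ => z₀ + r • a) (𝓝 0) (𝓝 z₀) := by
          have : Continuous fun r : ℝ => z₀ + r • a := by fun_prop
          simpa using this.tendsto 0
        filter_upwards [hc (hW₁.mem_nhds hz₁)] with r hr
        simp only [hχ, (hinit _ hr).2.1, zero_mul, zero_div]
      exact h2.unique (h1.congr_of_eventuallyEq h4)
    have e2 : ∀ v : Coord d × ℝ, (fderiv ℝ χ (z₀, 0) v).2 = v.2 * (Ξ (z₀, 0) ^ 2 / 2) := by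
      intro v
      have h1 : HasFDerivAt Ξ (fderiv ℝ Ξ (z₀, 0)) (z₀, 0) :=
        ((hΞ.contDiffAt (hB₁o.mem_nhds hy₀)).differentiableAt (by simp)).hasFDerivAt
      have h2 : HasFDerivAt (fun y : Coord d × ℝ => y.2 * (Ξ y ^ 2 * 2⁻¹)) _ (z₀, (0 : ℝ)) :=
        (hasFDerivAt_snd (𝕜 := ℝ) (E := Coord d) (F := ℝ)).mul ((h1.pow 2).mul_const (2 : ℝ)⁻¹)
      have h3 : HasFDerivAt (fun y : Coord d × ℝ => y.2 * (Ξ y ^ 2 * 2⁻¹))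
          ((ContinuousLinearMap.snd ℝ (Coord d) ℝ).comp (fderiv ℝ χ (z₀, 0))) (z₀, (0 : ℝ)) := by
        refine hχd.hasFDerivAt.snd.congr_of_eventuallyEq (Filter.Eventually.of_forall fun y => ?_)
        simp only [hχ]
        ring
      have h4 := congrArg (fun L : Coord d × ℝ →L[ℝ] ℝ => L v) (h3.unique h2)
      refine Eq.trans h4 ?_
      simp
      ring
    rw [injective_iff_map_eq_zero]
    rintro ⟨a, r⟩ hv
    have hr : r = 0 := by
      have := e2 (a, r)
      rw [hv] at this
      rcases mul_eq_zero.1 this.symm with h1 | h1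
      · exact h1
      · exact absurd h1 (by positivity)
    subst hr
    rw [e1] at hv
    exact hv
  have hχbij : Function.Bijective (fderiv ℝ χ (z₀, 0)).toLinearMap :=
    ⟨hχinj, LinearMap.injective_iff_surjective.1 hχinj⟩
  obtain ⟨P, hPf, hPmem, hPs, hPsymm, hPd⟩ := exists_openPartialHomeomorph_of_contDiffOn (f := χ)
    hB₁o hχs hy₀ (LinearEquiv.ofBijective _ hχbij).toContinuousLinearEquiv (by
      refine hχd.hasFDerivAt.congr_fderiv ?_
      ext v <;> rfl)
  -- shrink to a box
  have hΞopen : IsOpen (B₁ ∩ Ξ ⁻¹' Set.Ioi 0) :=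
    hΞ.continuousOn.isOpen_inter_preimage hB₁o isOpen_Ioi
  have hnh : P.source ∩ (B₁ ∩ Ξ ⁻¹' Set.Ioi 0) ∈ 𝓝 (z₀, (0 : ℝ)) :=
    (P.open_source.inter hΞopen).mem_nhds ⟨hPmem, hy₀, hΞ₀⟩
  obtain ⟨W, hWn, J, hJn, hWJ⟩ := mem_nhds_prod_iff.1 hnh
  obtain ⟨W₂, hW₂W, hW₂, hz₂⟩ := mem_nhds_iff.1 hWn
  obtain ⟨ε, hε, hεJ⟩ := Metric.mem_nhds_iff.1 hJn
  have hball : Metric.ball (0 : ℝ) ε = Set.Ioo (-ε) ε := by simp [Real.ball_eq_Ioo]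
  set B := W₂ ×ˢ Set.Ioo (-ε) ε with hB
  have hBo : IsOpen B := hW₂.prod isOpen_Ioo
  have hBsub : B ⊆ P.source ∩ (B₁ ∩ Ξ ⁻¹' Set.Ioi 0) := by
    rintro ⟨x, s⟩ ⟨hx, hs⟩
    exact hWJ ⟨hW₂W hx, hεJ (by rw [hball]; exact hs)⟩
  -- A longer box would contain the point `(z₀, ε₁)`, which is outside the domain of the family.
  have hεε : ε ≤ ε₁ := by
    by_contra hcon
    push Not at hcon
    have : (z₀, ε₁) ∈ B := ⟨hz₂, by constructor <;> linarith⟩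
    exact lt_irrefl _ (hBsub this).2.1.2.2
  have hW₂₁ : ∀ x ∈ W₂, x ∈ W₁ := fun x hx =>
    (hBsub (⟨hx, by constructor <;> simp [hε]⟩ : (x, (0 : ℝ)) ∈ B)).2.1.1
  set Q := P.restrOpen B hBo with hQ
  have hQs : Q.source = B := by
    rw [hQ, OpenPartialHomeomorph.restrOpen_source]
    exact Set.inter_eq_right.2 fun y hy => (hBsub hy).1
  have hQf : (Q : Coord d × ℝ → Coord d × ℝ) = χ := hPf
  have hχD : ∀ y ∈ B, χ y ∈ D := by
    rintro ⟨x, s⟩ hy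
    have hy1 := (hBsub hy).2.1
    exact hdom x hy1.1 s hy1.2
  have hQsymm : ContDiffOn ℝ ∞ Q.symm Q.target := by
    have h1 : Q.target ⊆ P.target := by
      intro y hy
      have h2 := Q.map_target hy
      rw [hQs] at h2
      have h3 := P.map_source (hBsub h2).1
      rw [hPf, ← hQf, Q.right_inv hy] at h3
      exact h3
    exact (hPsymm.mono h1).congr fun y hy => rfl
  have hh0 : ∀ x ∈ W₂, (x, (0 : ℝ)) ∈ B := fun x hx => ⟨hx, by constructor <;> simp [hε]⟩
  have hFd : ∀ y ∈ B, paramDeriv 𝓘(ℝ, E) (Ψ ∘ χ) y =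
      (paramDeriv 𝓘(ℝ, E) Ψ (χ y)).comp (fderiv ℝ χ y) := fun y hy =>
    paramDeriv_comp (h.mdifferentiableAt (hχD y hy))
      ((hχs.contDiffAt (hB₁o.mem_nhds (hBsub hy).2.1)).differentiableAt (by simp))
      (Filter.Eventually.of_forall fun _ => rfl)
  refine ⟨W₂, ε, Ψ ∘ χ, Q.symm ∘ Θ, O ∩ Θ ⁻¹' Q.target, fun y => Ξ y ^ 2 / 2, hz₂, ?_⟩
  refine {
    coord := h.coord.mono hW₂ fun x hx => h.mem_base (hinit x (hW₂₁ x hx)).1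
    pos := hε
    isOpen_target := h.smooth_symm.continuousOn.isOpen_inter_preimage h.isOpen_target Q.open_target
    smooth := ?_
    smooth_symm := ?_
    mapsTo := ?_
    mapsTo_symm := ?_
    left_inv := ?_
    right_inv := ?_
    base := ?_
    smooth_factor := ((hΞ.mono fun y hy => (hBsub hy).2.1).pow 2).div_const 2
    factor_pos := ?_
    apply_eq := ?_
    factor_zero := ?_
    radial := ?_
    injective := ?_
    metric := ?_ }
  · exact h.smooth.comp (hχs.mono fun y hy => (hBsub hy).2.1).contMDiffOn hχD
  · exact ContMDiffOn.comp (t := Q.target) hQsymm.contMDiffOn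
      (h.smooth_symm.mono Set.inter_subset_left) fun x hx => hx.2
  · intro y hy
    refine ⟨h.mapsTo (hχD y hy), ?_⟩
    change Θ (Ψ (χ y)) ∈ Q.target
    rw [h.left_inv _ (hχD y hy), ← hQf]
    exact Q.map_source (by rw [hQs]; exact hy)
  · intro x hx
    rw [← hB, ← hQs]
    exact Q.map_target hx.2
  · intro y hy
    change Q.symm (Θ (Ψ (χ y))) = y
    rw [h.left_inv _ (hχD y hy), ← hQf, Q.left_inv (by rw [hQs]; exact hy)]
  · intro x hx
    change Ψ (χ (Q.symm (Θ x))) = x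
    rw [← hQf, Q.right_inv hx.2, h.right_inv x hx.1]
  · intro x hx
    have h1 := hinit x (hW₂₁ x hx)
    change Ψ (Z (x, 0), 0 * Ξ (x, 0) ^ 2 / 2) = u x
    rw [h1.2.1, zero_mul, zero_div, h.apply_base h1.1]
  · intro y hy
    have h1 : 0 < Ξ y := (hBsub hy).2.2
    positivity
  · intro y hy
    refine (h.apply_eq _ (hχD y hy)).trans ?_
    simp only [hχ]
    ring
  · intro x hx
    have h1 := hinit x (hW₂₁ x hx)
    have h2 := hKpos x (hW₂₁ x hx)
    change Ξ (x, 0) ^ 2 / 2 = _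
    rw [h.coNormSq_dPhi h1.1, h1.2.2.1, Real.sq_sqrt (by positivity)]
    ring
  · intro x hx s hs
    have hx1 := hW₂₁ x hx
    have hsq : ∀ t ∈ Set.Icc 0 (√s), t ^ 2 < ε₁ := by
      intro t ht
      have h1 : t ^ 2 ≤ s := by
        rw [← Real.sq_sqrt hs.1]
        exact pow_le_pow_left₀ ht.1 ht.2 2
      linarith [hs.2]
    set Y : ℝ → Phase d := fun t => (Z (x, t ^ 2), t * Ξ (x, t ^ 2), t • π (x, t ^ 2), H (x, t ^ 2))
      with hY
    have hYD : ∀ t ∈ Set.Icc 0 (√s), ((Y t).1, (Y t).2.1 ^ 2 / 2) ∈ D := by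
      intro t ht
      have h1 := hdom x hx1 (t ^ 2) ⟨by nlinarith [sq_nonneg t], hsq t ht⟩
      simpa only [hY, mul_pow] using h1
    have hYd : ∀ t ∈ Set.Icc 0 (√s), HasDerivWithinAt Y (dblField (chartK g Ψ) (Y t))
        (Set.Icc 0 (√s)) t := fun t ht => (hsol x hx1 t (hsq t ht)).hasDerivWithinAt
    have hY0 : sectionPoint φ g 1 ⟨u x, 0⟩ = dblPoint (E := E) φ Ψ (Y 0) := by
      rw [sectionPoint_zero h (hinit x hx1).1]
      simp only [hY, ne_eq, OfNat.ofNat_ne_zero, not_false_eq_true, zero_pow, (hinit x hx1).2.1,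
        (hinit x hx1).2.2.2, zero_mul, zero_smul]
    have hex : ∃ c : ℝ → DblCotangent (E := E) φ,
        IsHamiltonianTrajectory (𝓘(ℝ, E).prod 𝓘(ℝ, ℝ)) (dbl φ) (dblT φ) (regularizedH φ g)
          (Set.Icc 0 (√s)) c ∧ c 0 = sectionPoint φ g 1 ⟨u x, 0⟩ :=
      ⟨_, h.isHamiltonianTrajectory h.smooth_phi hYD hYd, hY0.symm⟩
    -- The trajectory chosen in `radialMap` is arbitrary, but uniqueness forces it to be the one of
    -- the family.
    have h1 := h.eq_dblPoint h.smooth_phi (Real.sqrt_nonneg s) hYD hYd hex.choose_spec.1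
      (hex.choose_spec.2.trans hY0) (√s) ⟨Real.sqrt_nonneg s, le_refl _⟩
    rw [radialMap, dif_pos hex, h1]
    change Ψ (fold ((splitLast d).symm _)) = _
    rw [fold_splitLast_symm]
    simp only [hY, hχ, mul_pow, Real.sq_sqrt hs.1, Function.comp_apply]
  · intro y hy
    rw [hFd y hy]
    obtain ⟨e, he⟩ := hPd y (hBsub hy).1
    rw [he.fderiv]
    exact (h.bijective (hχD y hy)).1.comp e.injective
  · intro x hx s hs v ζ
    have hy : (x, s) ∈ B := ⟨hx, by linarith [hs.1], hs.2⟩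
    rw [hFd _ hy]
    exact radial_metric h hW₁ hZ hΞ hπ hH hinit hdom hsol (hW₂₁ x hx)
      ⟨hs.1, lt_of_lt_of_le hs.2 hεε⟩ v ζ

end NormalForm

/-! ### From local normal forms to uniform size and injectivity -/

section Existence

variable {E : Type*} [NormedAddCommGroup E] [NormedSpace ℝ E] [FiniteDimensional ℝ E]
  {M : Type*} [TopologicalSpace M] [ChartedSpace E M] [IsManifold 𝓘(ℝ, E) ∞ M]
  {g : Bundle.ContMDiffRiemannianMetric 𝓘(ℝ, E) ∞ E (fun x : M => TangentSpace 𝓘(ℝ, E) x)}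
  {φ : M → ℝ} {d d' : ℕ} {u : Coord d → M} {W : Set (Coord d)} {ε : ℝ} {F : Coord d × ℝ → M}
  {Θ : M → Coord d × ℝ} {O : Set M} {κ : Coord d × ℝ → ℝ}

namespace IsNormalForm

theorem isOpen_source (h : IsNormalForm g φ u W ε F Θ O κ) : IsOpen (W ×ˢ Set.Ioo (-ε) ε) :=
  h.coord.isOpen.prod isOpen_Ioo

theorem mdifferentiableAt (h : IsNormalForm g φ u W ε F Θ O κ) {y : Coord d × ℝ}
    (hy : y ∈ W ×ˢ Set.Ioo (-ε) ε) : MDifferentiableAt 𝓘(ℝ, Coord d × ℝ) 𝓘(ℝ, E) F y :=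
  (h.smooth.contMDiffAt (h.isOpen_source.mem_nhds hy)).mdifferentiableAt (by simp)

theorem mem_of_mem_Ico (h : IsNormalForm g φ u W ε F Θ O κ) {x : Coord d} (hx : x ∈ W) {s : ℝ}
    (hs : s ∈ Set.Ico 0 ε) : (x, s) ∈ W ×ˢ Set.Ioo (-ε) ε :=
  ⟨hx, by linarith [h.pos, hs.1], hs.2⟩

theorem mem_target (h : IsNormalForm g φ u W ε F Θ O κ) {x : Coord d} (hx : x ∈ W) : u x ∈ O := by
  rw [← h.base x hx]
  exact h.mapsTo (h.mem_of_mem_Ico hx ⟨le_refl _, h.pos⟩)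

theorem symm_base (h : IsNormalForm g φ u W ε F Θ O κ) {x : Coord d} (hx : x ∈ W) :
    Θ (u x) = (x, 0) := by
  rw [← h.base x hx]
  exact h.left_inv _ (h.mem_of_mem_Ico hx ⟨le_refl _, h.pos⟩)

theorem apply_symm_fst (h : IsNormalForm g φ u W ε F Θ O κ) {a : M} (ha : a ∈ O)
    (ha' : a ∈ bdry φ) : (Θ a).1 ∈ W ∧ u (Θ a).1 = a := by
  have h1 := h.mapsTo_symm ha
  refine ⟨h1.1, ?_⟩
  have h2 := h.apply_eq _ h1
  rw [h.right_inv a ha] at h2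
  have h3 : (Θ a).2 = 0 := by
    rcases mul_eq_zero.1 (h2.symm.trans ha') with h3 | h3
    · exact h3
    · exact absurd h3 (h.factor_pos _ h1).ne'
  rw [← h.base _ h1.1]
  have h4 : ((Θ a).1, (0 : ℝ)) = Θ a := Prod.ext rfl h3.symm
  rw [h4, h.right_inv a ha]

theorem radial_eq (h : IsNormalForm g φ u W ε F Θ O κ) {a : M} (ha : a ∈ O) (ha' : a ∈ bdry φ)
    {s : ℝ} (hs : s ∈ Set.Ico 0 ε) : radialMap g φ a s = F ((Θ a).1, s) := by
  have h1 := h.apply_symm_fst ha ha'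
  have h2 := h.radial _ h1.1 s hs
  rwa [h1.2] at h2

/-- The normal form in other local coordinates of the hypersurface. -/
theorem exists_transition (h : IsNormalForm g φ u W ε F Θ O κ) {u' : Coord d' → M}
    {V' : Set (Coord d')} (hu' : IsLocalCoord 𝓘(ℝ, E) (bdry φ) (bdryT φ) u' V') {z' : Coord d'}
    (hz' : z' ∈ V') {x : Coord d} (hx : x ∈ W) (hxz : u x = u' z') :
    ∃ (N : Set (Coord d')) (τ : Coord d' → Coord d), IsOpen N ∧ z' ∈ N ∧ N ⊆ V' ∧ τ z' = x ∧
      ContDiffOn ℝ ∞ τ N ∧ ∀ y ∈ N, τ y ∈ W ∧ u (τ y) = u' y ∧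
        (∀ e, paramDeriv 𝓘(ℝ, E) u' y e = paramDeriv 𝓘(ℝ, E) u (τ y) (fderiv ℝ τ y e)) ∧
        Function.Injective (fderiv ℝ τ y) ∧
        ∀ s ∈ Set.Ico 0 ε, radialMap g φ (u' y) s = F (τ y, s) := by
  obtain ⟨N, N', τ, τ', hN, -, hzN, -, hNV, hN'W, hτ, -, h1, -⟩ :=
    Billiard.exists_transition hu' h.coord hz' hx hxz.symm
  have hd : ∀ y ∈ N, ∀ e, paramDeriv 𝓘(ℝ, E) u' y e =
      paramDeriv 𝓘(ℝ, E) u (τ y) (fderiv ℝ τ y e) := by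
    intro y hy e
    have h2 := paramDeriv_comp (I := 𝓘(ℝ, E)) (u := u') (u' := u) (τ := τ) (z := y)
      (h.coord.mdifferentiableAt (hN'W (h1 y hy).1))
      ((hτ.contDiffAt (hN.mem_nhds hy)).differentiableAt (by simp))
      (Filter.eventually_of_mem (hN.mem_nhds hy) fun y hy => (h1 y hy).2.1)
    exact congrArg (fun L : Coord d' →L[ℝ] E => L e) h2
  refine ⟨N, τ, hN, hzN, hNV, ?_, hτ, fun y hy => ⟨hN'W (h1 y hy).1, (h1 y hy).2.1, hd y hy, ?_, ?_⟩⟩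
  · exact h.coord.injOn (hN'W (h1 z' hzN).1) hx ((h1 z' hzN).2.1.trans hxz.symm)
  · intro a b hab
    exact hu'.immersion y (hNV hy) ((hd y hy a).trans ((congrArg _ hab).trans (hd y hy b).symm))
  · intro s hs
    rw [← (h1 y hy).2.1]
    exact h.radial _ (hN'W (h1 y hy).1) s hs

/-- The quadratic form along the hypersurface does not depend on the choice of coordinates. -/
theorem form_eq (h : IsNormalForm g φ u W ε F Θ O κ) {u' : Coord d' → M} {W' : Set (Coord d')}
    {ε' : ℝ} {F' : Coord d' × ℝ → M} {Θ' : M → Coord d' × ℝ} {O' : Set M} {κ' : Coord d' × ℝ → ℝ}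
    (h' : IsNormalForm g φ u' W' ε' F' Θ' O' κ') {x : Coord d} {x' : Coord d'} (hx : x ∈ W)
    (hx' : x' ∈ W') (hxx : u x = u' x') {s : ℝ} (hs : s ∈ Set.Ico 0 ε) (hs' : s ∈ Set.Ico 0 ε')
    {a b : Coord d} {a' b' : Coord d'}
    (ha : paramDeriv 𝓘(ℝ, E) u x a = paramDeriv 𝓘(ℝ, E) u' x' a')
    (hb : paramDeriv 𝓘(ℝ, E) u x b = paramDeriv 𝓘(ℝ, E) u' x' b') :
    (κ (x, s))⁻¹ * pullForm g (F (x, s)) (paramDeriv 𝓘(ℝ, E) F (x, s)) (a, 0) (b, 0) =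
      (κ' (x', s))⁻¹ * pullForm g (F' (x', s)) (paramDeriv 𝓘(ℝ, E) F' (x', s)) (a', 0) (b', 0) := by
  obtain ⟨N, τ, hN, hxN, hNW, hτx, hτ, hT⟩ := h.exists_transition h'.coord hx' hx hxx
  have hxs := h.mem_of_mem_Ico hx hs
  have hxs' := h'.mem_of_mem_Ico hx' hs'
  have hFF : F (x, s) = F' (x', s) := by
    rw [← h.radial x hx s hs, ← h'.radial x' hx' s hs', hxx]
  -- For `s > 0` divide `φ = s κ` by `s`; for `s = 0` the common value is the squared norm of `dφ`.
  have hκ : κ (x, s) = κ' (x', s) := by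
    rcases eq_or_lt_of_le hs.1 with h0 | h0
    · rw [← h0, h.factor_zero x hx, h'.factor_zero x' hx', hxx]
    · have h1 := h.apply_eq _ hxs
      rw [hFF, h'.apply_eq _ hxs'] at h1
      exact (mul_left_cancel₀ h0.ne' h1).symm
  -- As functions of the boundary point, `F(τ y, s)` and `F'(y, s)` are both `radialMap` at fixed
  -- `s`, so their derivatives coincide.
  have hD : ∀ {a : Coord d} {a' : Coord d'},
      paramDeriv 𝓘(ℝ, E) u x a = paramDeriv 𝓘(ℝ, E) u' x' a' →
      paramDeriv 𝓘(ℝ, E) F (x, s) (a, 0) = paramDeriv 𝓘(ℝ, E) F' (x', s) (a', 0) := by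
    intro a a' haa
    have e1 : a = fderiv ℝ τ x' a' := by
      rw [(hT x' hxN).2.2.1 a', hτx] at haa
      exact h.coord.immersion x hx haa
    have hτd : DifferentiableAt ℝ τ x' := (hτ.contDiffAt (hN.mem_nhds hxN)).differentiableAt (by simp)
    have h1 := paramDeriv_comp (I := 𝓘(ℝ, E)) (u := fun y => F' (y, s)) (u' := F')
      (τ := fun y : Coord d' => (y, s)) (z := x') (h'.mdifferentiableAt hxs') (by fun_prop)
      (Filter.Eventually.of_forall fun _ => rfl)
    have h2 := paramDeriv_comp (I := 𝓘(ℝ, E)) (u := fun y => F' (y, s)) (u' := F)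
      (τ := fun y : Coord d' => (τ y, s)) (z := x') (by rw [hτx]; exact h.mdifferentiableAt hxs)
      (hτd.prodMk (differentiableAt_const s))
      (Filter.eventually_of_mem (hN.mem_nhds hxN) fun y hy => by
        rw [← (hT y hy).2.2.2.2 s hs, ← h'.radial y (hNW hy) s hs'])
    have e2 : fderiv ℝ (fun y : Coord d' => (y, s)) x' a' = (a', 0) := by
      have : HasFDerivAt (fun y : Coord d' => (y, s)) _ x' :=
        (hasFDerivAt_id (𝕜 := ℝ) x').prodMk (hasFDerivAt_const s x')
      rw [this.fderiv]
      rfl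
    have e3 : fderiv ℝ (fun y : Coord d' => (τ y, s)) x' a' = (a, 0) := by
      have : HasFDerivAt (fun y : Coord d' => (τ y, s)) _ x' :=
        hτd.hasFDerivAt.prodMk (hasFDerivAt_const s x')
      rw [this.fderiv, e1]
      rfl
    have h3 := congrArg (fun L : Coord d' →L[ℝ] E => L a') (h2.symm.trans h1)
    simp only [ContinuousLinearMap.comp_apply, e2, e3, hτx] at h3
    exact h3
  rw [pullForm_apply, pullForm_apply, hD ha, hD hb, hFF, hκ]

end IsNormalForm

/-- The point `q` has a normal form of size larger than `δ`. -/
def HasNormalForm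
    (g : Bundle.ContMDiffRiemannianMetric 𝓘(ℝ, E) ∞ E (fun x : M => TangentSpace 𝓘(ℝ, E) x))
    (φ : M → ℝ) (δ : ℝ) (q : M) : Prop :=
  ∃ (d : ℕ) (u : Coord d → M) (W : Set (Coord d)) (ε : ℝ) (F : Coord d × ℝ → M)
    (Θ : M → Coord d × ℝ) (O : Set M) (κ : Coord d × ℝ → ℝ) (x : Coord d),
    IsNormalForm g φ u W ε F Θ O κ ∧ δ < ε ∧ x ∈ W ∧ u x = q

theorem HasNormalForm.mono {δ δ' : ℝ} {q : M} (h : HasNormalForm g φ δ q) (hδ : δ' ≤ δ) :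
    HasNormalForm g φ δ' q := by
  obtain ⟨d, u, W, ε, F, Θ, O, κ, x, h1, h2, h3⟩ := h
  exact ⟨d, u, W, ε, F, Θ, O, κ, x, h1, hδ.trans_lt h2, h3⟩

/-- A statement about small positive parameters that holds locally on a compact set, holds
uniformly. -/
theorem exists_pos_of_isCompact {X : Type*} [TopologicalSpace X] {K : Set X} (hK : IsCompact K)
    {p : ℝ → X → Prop} (hp : ∀ δ δ' x, p δ x → δ' ≤ δ → p δ' x)
    (h : ∀ x ∈ K, ∃ δ > 0, ∀ᶠ y in 𝓝[K] x, p δ y) : ∃ δ > 0, ∀ x ∈ K, p δ x := by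
  refine hK.induction_on (p := fun S => ∃ δ > 0, ∀ x ∈ S, p δ x) ⟨1, one_pos, by simp⟩ ?_ ?_ ?_
  · rintro S T hST ⟨δ, hδ, h1⟩
    exact ⟨δ, hδ, fun x hx => h1 x (hST hx)⟩
  · rintro S T ⟨δ, hδ, h1⟩ ⟨δ', hδ', h2⟩
    refine ⟨min δ δ', lt_min hδ hδ', fun x hx => ?_⟩
    rcases hx with hx | hx
    · exact hp _ _ _ (h1 x hx) (min_le_left _ _)
    · exact hp _ _ _ (h2 x hx) (min_le_right _ _)
  · intro x hx
    obtain ⟨δ, hδ, h1⟩ := h x hx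
    exact ⟨_, h1, δ, hδ, fun y hy => hy⟩

theorem exists_hasNormalForm [T2Space M] (hφ : ContMDiff 𝓘(ℝ, E) 𝓘(ℝ, ℝ) ∞ φ)
    (hreg : ∀ q ∈ bdry φ, dPhi (E := E) φ q ≠ 0) (hcomp : IsCompact (bdry φ)) :
    ∃ δ > 0, ∀ q ∈ bdry φ, HasNormalForm g φ δ q := by
  refine exists_pos_of_isCompact hcomp (fun δ δ' q h hδ => h.mono hδ) fun q hq => ?_
  obtain ⟨d, u, V, z, hu, hz, rfl⟩ := exists_isLocalCoord hφ hq (hreg q hq)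
  obtain ⟨Ψ, Θ, D, O, hA, hzD⟩ := hu.exists_isAdapted (g := g) hφ hz (hreg _ hq)
  obtain ⟨W, ε, F, Θ', O', κ, hzW, hnf⟩ := hA.exists_isNormalForm hzD
  refine ⟨ε / 2, half_pos hnf.pos, ?_⟩
  filter_upwards [mem_nhdsWithin_of_mem_nhds (hnf.isOpen_target.mem_nhds (hnf.mem_target hzW)),
    self_mem_nhdsWithin] with a ha ha'
  exact ⟨d, u, W, ε, F, Θ', O', κ, (Θ' a).1, hnf, half_lt_self hnf.pos, hnf.apply_symm_fst ha ha'⟩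

/-- Compactness of `Γ × Γ`: near a diagonal pair both base points lie in one normal form, where the
map is injective. Near a pair of distinct points the images for small `s` stay in disjoint
neighbourhoods. -/
theorem exists_injOn_radialMap [T2Space M] (hφ : ContMDiff 𝓘(ℝ, E) 𝓘(ℝ, ℝ) ∞ φ)
    (hreg : ∀ q ∈ bdry φ, dPhi (E := E) φ q ≠ 0) (hcomp : IsCompact (bdry φ)) :
    ∃ δ > 0, Set.InjOn (fun x : M × ℝ => radialMap g φ x.1 x.2) (bdry φ ×ˢ Set.Icc 0 δ) := by
  obtain ⟨δ₀, hδ₀, hnf⟩ := exists_hasNormalForm (g := g) hφ hreg hcomp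
  have key : ∃ δ > 0, ∀ x ∈ bdry φ ×ˢ bdry φ, x ∈ bdry φ ×ˢ bdry φ → ∀ s ∈ Set.Icc 0 δ,
      ∀ s' ∈ Set.Icc 0 δ, radialMap g φ x.1 s = radialMap g φ x.2 s' → x.1 = x.2 ∧ s = s' := by
    refine exists_pos_of_isCompact (hcomp.prod hcomp)
      (p := fun δ x => x ∈ bdry φ ×ˢ bdry φ → ∀ s ∈ Set.Icc 0 δ,
        ∀ s' ∈ Set.Icc 0 δ, radialMap g φ x.1 s = radialMap g φ x.2 s' → x.1 = x.2 ∧ s = s')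
      (fun δ δ' x h hδ hx s hs s' hs' => h hx s ⟨hs.1, hs.2.trans hδ⟩ s' ⟨hs'.1, hs'.2.trans hδ⟩) ?_
    have hcont : ∀ q ∈ bdry φ, ∀ A ∈ 𝓝 q, ∃ δ > 0, ∀ᶠ a in 𝓝[bdry φ] q, ∀ s ∈ Set.Icc 0 δ,
        radialMap g φ a s ∈ A := by
      intro q hq A hA
      obtain ⟨d, u, W, ε, F, Θ, O, κ, x, h, hε, hx, rfl⟩ := hnf q hq
      have hx0 := h.mem_of_mem_Ico hx ⟨le_refl 0, h.pos⟩
      have hFc : ContinuousAt F (x, 0) := (h.mdifferentiableAt hx0).continuousAt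
      have hA' : F ⁻¹' A ∈ 𝓝 (x, (0 : ℝ)) := hFc.preimage_mem_nhds (by rw [h.base x hx]; exact hA)
      obtain ⟨A₁, hA₁, A₂, hA₂, hAA⟩ := mem_nhds_prod_iff.1 hA'
      obtain ⟨r, hr, hrA⟩ := Metric.mem_nhds_iff.1 hA₂
      have hΘc : ContinuousAt (fun a => (Θ a).1) (u x) :=
        (h.smooth_symm.continuousOn.continuousAt
          (h.isOpen_target.mem_nhds (h.mem_target hx))).fst
      have hB : (fun a => (Θ a).1) ⁻¹' A₁ ∈ 𝓝 (u x) :=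
        hΘc.preimage_mem_nhds (by rw [h.symm_base hx]; exact hA₁)
      refine ⟨min (r / 2) (ε / 2), lt_min (half_pos hr) (half_pos h.pos), ?_⟩
      filter_upwards [mem_nhdsWithin_of_mem_nhds hB, self_mem_nhdsWithin,
        mem_nhdsWithin_of_mem_nhds (h.isOpen_target.mem_nhds (h.mem_target hx))] with a h1 h2 h3 s hs
      have hsr : s ≤ r / 2 := hs.2.trans (min_le_left _ _)
      have hsε : s ≤ ε / 2 := hs.2.trans (min_le_right _ _)
      rw [h.radial_eq h3 h2 ⟨hs.1, by linarith [h.pos]⟩]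
      refine hAA ⟨h1, hrA ?_⟩
      rw [Metric.mem_ball, Real.dist_eq, sub_zero, abs_of_nonneg hs.1]
      linarith
    rintro ⟨q, q'⟩ ⟨hq, hq'⟩
    by_cases hqq : q = q'
    · subst hqq
      obtain ⟨d, u, W, ε, F, Θ, O, κ, x, h, hε, hx, rfl⟩ := hnf q hq
      refine ⟨ε / 2, half_pos h.pos, ?_⟩
      have hO := h.isOpen_target.mem_nhds (h.mem_target hx)
      filter_upwards [mem_nhdsWithin_of_mem_nhds (prod_mem_nhds hO hO)] with a ha ha' s hs s' hs' he
      have hs1 : s ∈ Set.Ico 0 ε := ⟨hs.1, by linarith [hs.2, h.pos]⟩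
      have hs1' : s' ∈ Set.Ico 0 ε := ⟨hs'.1, by linarith [hs'.2, h.pos]⟩
      rw [h.radial_eq ha.1 ha'.1 hs1, h.radial_eq ha.2 ha'.2 hs1'] at he
      have h1 := h.apply_symm_fst ha.1 ha'.1
      have h2 := h.apply_symm_fst ha.2 ha'.2
      have h3 := h.left_inv _ (h.mem_of_mem_Ico h1.1 hs1)
      rw [he, h.left_inv _ (h.mem_of_mem_Ico h2.1 hs1')] at h3
      obtain ⟨h4, h5⟩ := Prod.mk.inj h3
      exact ⟨by rw [← h1.2, ← h2.2, h4], h5.symm⟩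
    · obtain ⟨A, A', hA, hA', hqA, hqA', hdisj⟩ := t2_separation hqq
      obtain ⟨δ, hδ, h1⟩ := hcont q hq A (hA.mem_nhds hqA)
      obtain ⟨δ', hδ', h2⟩ := hcont q' hq' A' (hA'.mem_nhds hqA')
      refine ⟨min δ δ', lt_min hδ hδ', ?_⟩
      rw [nhdsWithin_prod_eq]
      filter_upwards [h1.prod_mk h2] with a ha ha' s hs s' hs' he
      have h3 := ha.1 s ⟨hs.1, hs.2.trans (min_le_left _ _)⟩
      have h4 := ha.2 s' ⟨hs'.1, hs'.2.trans (min_le_right _ _)⟩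
      rw [he] at h3
      exact absurd rfl (hdisj.ne_of_mem h3 h4)
  obtain ⟨δ, hδ, h⟩ := key
  refine ⟨δ, hδ, ?_⟩
  rintro ⟨q, s⟩ ⟨hq, hs⟩ ⟨q', s'⟩ ⟨hq', hs'⟩ he
  have := h (q, q') ⟨hq, hq'⟩ ⟨hq, hq'⟩ s hs s' hs' he
  exact Prod.ext this.1 this.2

/-- For `s > 0` a normal form has `F* g = κ ds² + β` and `φ = s κ`, so `F* G = (ds² + κ⁻¹ β) / s`
and the form has to be `κ⁻¹ β`. By `form_eq` all normal forms give the same value; this is part of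
the conclusion, so that smoothness can be checked in any of them. -/
theorem exists_radialForm {δ : ℝ} {q : M} (hq : HasNormalForm g φ δ q) {s : ℝ}
    (hs : s ∈ Set.Icc 0 δ) :
    ∃ b : bdryT (E := E) φ q →L[ℝ] bdryT (E := E) φ q →L[ℝ] ℝ,
      ∀ (d : ℕ) (u : Coord d → M) (W : Set (Coord d)) (ε : ℝ) (F : Coord d × ℝ → M)
        (Θ : M → Coord d × ℝ) (O : Set M) (κ : Coord d × ℝ → ℝ) (x : Coord d),
        IsNormalForm g φ u W ε F Θ O κ → δ < ε → x ∈ W → u x = q → ∀ (v w : bdryT (E := E) φ q)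
        (e e' : Coord d), (v.1 : E) = paramDeriv 𝓘(ℝ, E) u x e →
        (w.1 : E) = paramDeriv 𝓘(ℝ, E) u x e' →
        b v w = (κ (x, s))⁻¹ *
          pullForm g (F (x, s)) (paramDeriv 𝓘(ℝ, E) F (x, s)) (e, 0) (e', 0) := by
  obtain ⟨d, u, W, ε, F, Θ, O, κ, x, h, hε, hx, rfl⟩ := hq
  obtain ⟨e, he⟩ := exists_frameEquiv h.coord hx
  set β := pullForm g (F (x, s)) (paramDeriv 𝓘(ℝ, E) F (x, s))
  set ι := ContinuousLinearMap.inl ℝ (Coord d) ℝ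
  have hfr : ∀ v : bdryT (E := E) φ (u x), (v.1 : E) = paramDeriv 𝓘(ℝ, E) u x (e.symm v) := by
    intro v
    rw [← frame_apply h.coord hx, ← he]
    simp
  refine ⟨(ContinuousLinearMap.precomp ℝ (e.symm : bdryT (E := E) φ (u x) →L[ℝ] Coord d)).comp
    (((κ (x, s))⁻¹ • β.bilinearComp ι ι).comp
      (e.symm : bdryT (E := E) φ (u x) →L[ℝ] Coord d)), ?_⟩
  intro d' u' W' ε' F' Θ' O' κ' x' h' hε' hx' hxx v w a a' ha ha'
  rw [← h.form_eq h' hx hx' hxx.symm ⟨hs.1, hs.2.trans_lt hε⟩ ⟨hs.1, hs.2.trans_lt hε'⟩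
    ((hfr v).symm.trans ha) ((hfr w).symm.trans ha')]
  rfl

end Existence

/-! ### Global existence of semigeodesic coordinates -/

section Existence

variable {E : Type*} [NormedAddCommGroup E] [NormedSpace ℝ E] [FiniteDimensional ℝ E]
  {M : Type*} [TopologicalSpace M] [ChartedSpace E M] [IsManifold 𝓘(ℝ, E) ∞ M]
  {g : Bundle.ContMDiffRiemannianMetric 𝓘(ℝ, E) ∞ E (fun x : M => TangentSpace 𝓘(ℝ, E) x)}
  {φ : M → ℝ} {d d' : ℕ} {u : Coord d → M} {W : Set (Coord d)} {ε : ℝ} {F : Coord d × ℝ → M}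
  {Θ : M → Coord d × ℝ} {O : Set M} {κ : Coord d × ℝ → ℝ}

theorem uniqueDiffOn_prod_Icc {A : Type*} [NormedAddCommGroup A] [NormedSpace ℝ A] {V : Set A}
    (hV : IsOpen V) {δ : ℝ} (hδ : 0 < δ) : UniqueDiffOn ℝ (V ×ˢ Set.Icc (0 : ℝ) δ) :=
  hV.uniqueDiffOn.prod (uniqueDiffOn_Icc hδ)

/-- Near the point the map equals `F(τ y, s)`, which is smooth also for negative `s`. On a set with
unique derivatives the derivative within the set is the derivative of this extension. -/
theorem IsNormalForm.mfderivWithin_radialMap (h : IsNormalForm g φ u W ε F Θ O κ)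
    {u' : Coord d' → M} {V' N : Set (Coord d')} {τ : Coord d' → Coord d} (hV' : IsOpen V')
    (hN : IsOpen N) {z' : Coord d'} (hz' : z' ∈ N) (hNV : N ⊆ V') (hτ : ContDiffOn ℝ ∞ τ N)
    (hW : τ z' ∈ W) (hr : ∀ y ∈ N, ∀ s ∈ Set.Ico 0 ε, radialMap g φ (u' y) s = F (τ y, s))
    {δ : ℝ} (hδ : 0 < δ) (hδε : δ < ε) {s : ℝ} (hs : s ∈ Set.Icc 0 δ) (a : Coord d' × ℝ) :
    (mfderivWithin 𝓘(ℝ, Coord d' × ℝ) 𝓘(ℝ, E)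
      (fun zs : Coord d' × ℝ => radialMap g φ (u' zs.1) zs.2) (V' ×ˢ Set.Icc 0 δ) (z', s) a : E) =
      paramDeriv 𝓘(ℝ, E) F (τ z', s) (fderiv ℝ τ z' a.1, a.2) := by
  have hs' : s ∈ Set.Ico 0 ε := ⟨hs.1, hs.2.trans_lt hδε⟩
  set T : Coord d' × ℝ → Coord d × ℝ := fun y => (τ y.1, y.2)
  have hτd : DifferentiableAt ℝ τ z' := (hτ.contDiffAt (hN.mem_nhds hz')).differentiableAt (by simp)
  have hT : HasFDerivAt T ((fderiv ℝ τ z').prodMap (ContinuousLinearMap.id ℝ ℝ)) (z', s) :=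
    HasFDerivAt.prodMap (z', s) (f := τ) (f₂ := fun t : ℝ => t) hτd.hasFDerivAt (hasFDerivAt_id (𝕜 := ℝ) s)
  have hFd := h.mdifferentiableAt (h.mem_of_mem_Ico hW hs')
  have hcd : MDifferentiableAt 𝓘(ℝ, Coord d' × ℝ) 𝓘(ℝ, E) (fun y => F (T y)) (z', s) :=
    MDifferentiableAt.comp (z', s) hFd hT.differentiableAt.mdifferentiableAt
  have huniq : UniqueMDiffWithinAt 𝓘(ℝ, Coord d' × ℝ) (V' ×ˢ Set.Icc 0 δ) (z', s) :=
    (uniqueDiffOn_prod_Icc hV' hδ).uniqueMDiffOn _ ⟨hNV hz', hs⟩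
  have hev : (fun zs : Coord d' × ℝ => radialMap g φ (u' zs.1) zs.2)
      =ᶠ[𝓝[V' ×ˢ Set.Icc 0 δ] (z', s)] fun y => F (T y) := by
    filter_upwards [self_mem_nhdsWithin,
      mem_nhdsWithin_of_mem_nhds ((hN.prod isOpen_univ).mem_nhds ⟨hz', Set.mem_univ s⟩)] with y h1 h2
    exact hr y.1 h2.1 y.2 ⟨h1.2.1, h1.2.2.trans_lt hδε⟩
  have h1 : MDifferentiableWithinAt 𝓘(ℝ, Coord d' × ℝ) 𝓘(ℝ, E) (fun y => F (T y))
      (V' ×ˢ Set.Icc 0 δ) (z', s) := hcd.mdifferentiableWithinAt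
  have h2 : HasMFDerivWithinAt 𝓘(ℝ, Coord d' × ℝ) 𝓘(ℝ, E)
      (fun zs : Coord d' × ℝ => radialMap g φ (u' zs.1) zs.2) (V' ×ˢ Set.Icc 0 δ) (z', s)
      (mfderiv 𝓘(ℝ, Coord d' × ℝ) 𝓘(ℝ, E) (fun y => F (T y)) (z', s)) :=
    hcd.hasMFDerivAt.hasMFDerivWithinAt.congr_of_eventuallyEq hev (hr z' hz' s hs')
  have h3 := huniq.eq h2.mdifferentiableWithinAt.hasMFDerivWithinAt h2
  have h4 := paramDeriv_comp (I := 𝓘(ℝ, E)) (u := fun y => F (T y)) (u' := F) (τ := T)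
    (z := (z', s)) hFd hT.differentiableAt (Filter.Eventually.of_forall fun _ => rfl)
  rw [hT.fderiv] at h4
  exact (congrArg (fun L : Coord d' × ℝ →L[ℝ] E => L a) h3).trans
    (congrArg (fun L : Coord d' × ℝ →L[ℝ] E => L a) h4)

set_option maxHeartbeats 1000000 in
/-- Semigeodesic coordinates exist. -/
theorem exists_isSemigeodesic [T2Space M] (hφ : ContMDiff 𝓘(ℝ, E) 𝓘(ℝ, ℝ) ∞ φ)
    (hreg : ∀ q ∈ bdry φ, dPhi (E := E) φ q ≠ 0) (hcomp : IsCompact (bdry φ)) :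
    ∃ δ f B, IsSemigeodesic φ g δ f B := by
  obtain ⟨δ₁, hδ₁, hnf₁⟩ := exists_hasNormalForm (g := g) hφ hreg hcomp
  obtain ⟨δ₂, hδ₂, hinj⟩ := exists_injOn_radialMap (g := g) hφ hreg hcomp
  set δ := min δ₁ δ₂
  have hδ : 0 < δ := lt_min hδ₁ hδ₂
  have hnf : ∀ q ∈ bdry φ, HasNormalForm g φ δ q := fun q hq => (hnf₁ q hq).mono (min_le_left _ _)
  -- The formula in all normal forms is carried along in the choice of `B`. Away from `Γ × [0, δ]`
  -- the value `0` is a dummy.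
  have hB : ∀ (q : M) (s : ℝ), ∃ b : bdryT (E := E) φ q →L[ℝ] bdryT (E := E) φ q →L[ℝ] ℝ,
      q ∈ bdry φ → s ∈ Set.Icc 0 δ →
      ∀ (d : ℕ) (u : Coord d → M) (W : Set (Coord d)) (ε : ℝ) (F : Coord d × ℝ → M)
        (Θ : M → Coord d × ℝ) (O : Set M) (κ : Coord d × ℝ → ℝ) (x : Coord d),
        IsNormalForm g φ u W ε F Θ O κ → δ < ε → x ∈ W → u x = q → ∀ (v w : bdryT (E := E) φ q)
        (e e' : Coord d), (v.1 : E) = paramDeriv 𝓘(ℝ, E) u x e →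
        (w.1 : E) = paramDeriv 𝓘(ℝ, E) u x e' →
        b v w = (κ (x, s))⁻¹ *
          pullForm g (F (x, s)) (paramDeriv 𝓘(ℝ, E) F (x, s)) (e, 0) (e', 0) := by
    intro q s
    by_cases hqs : q ∈ bdry φ ∧ s ∈ Set.Icc 0 δ
    · obtain ⟨b, hb⟩ := exists_radialForm (hnf q hqs.1) hqs.2
      exact ⟨b, fun _ _ => hb⟩
    · exact ⟨0, fun h1 h2 => absurd ⟨h1, h2⟩ hqs⟩
  choose B hB using hB
  -- vectors of the tangent space in coordinates
  have hvec : ∀ {d : ℕ} {u : Coord d → M} {W : Set (Coord d)} {x : Coord d},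
      IsLocalCoord 𝓘(ℝ, E) (bdry φ) (bdryT φ) u W → x ∈ W → ∀ v : bdryT (E := E) φ (u x),
      ∃ e : Coord d, (v.1 : E) = paramDeriv 𝓘(ℝ, E) u x e := by
    intro d u W x hu hx v
    obtain ⟨e, he⟩ := (hu.tangent x hx v.1).1 v.2
    exact ⟨e, he.symm⟩
  have hform : ∀ {d' : ℕ} {u' : Coord d' → M} {V' : Set (Coord d')},
      IsLocalCoord 𝓘(ℝ, E) (bdry φ) (bdryT φ) u' V' → ∀ {d : ℕ} {u : Coord d → M}
      {W : Set (Coord d)} {ε : ℝ} {F : Coord d × ℝ → M} {Θ : M → Coord d × ℝ} {O : Set M}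
      {κ : Coord d × ℝ → ℝ}, IsNormalForm g φ u W ε F Θ O κ → δ < ε → ∀ {y : Coord d'}, y ∈ V' →
      ∀ {x : Coord d}, x ∈ W → u x = u' y → ∀ {L : Coord d' →L[ℝ] Coord d},
      (∀ e, paramDeriv 𝓘(ℝ, E) u' y e = paramDeriv 𝓘(ℝ, E) u x (L e)) → ∀ {s : ℝ},
      s ∈ Set.Icc 0 δ → ∀ v w, B (u' y) s (frame 𝓘(ℝ, E) (bdryT φ) u' y v)
        (frame 𝓘(ℝ, E) (bdryT φ) u' y w) = (κ (x, s))⁻¹ *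
          pullForm g (F (x, s)) (paramDeriv 𝓘(ℝ, E) F (x, s)) (L v, 0) (L w, 0) := by
    intro d' u' V' hu' d u W ε F Θ O κ h hε y hy x hx hxy L hL s hs v w
    refine hB (u' y) s (hu'.mapsTo hy) hs d u W ε F Θ O κ x h hε hx hxy _ _ _ _ ?_ ?_
    · exact (frame_apply hu' hy v).trans (hL v)
    · exact (frame_apply hu' hy w).trans (hL w)
  refine ⟨δ, radialMap g φ, B, hδ, ?_, ?_, ?_, ?_, ?_, ?_, ?_, ?_, ?_, ?_⟩
  · intro q hq
    obtain ⟨d, u, W, ε, F, Θ, O, κ, x, h, hε, hx, rfl⟩ := hnf q hq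
    rw [h.radial x hx 0 ⟨le_refl _, h.pos⟩, h.base x hx]
  · intro q hq s hs
    obtain ⟨d, u, W, ε, F, Θ, O, κ, x, h, hε, hx, rfl⟩ := hnf q hq
    have hs' : s ∈ Set.Ico 0 ε := ⟨hs.1.le, hs.2.trans_lt hε⟩
    rw [h.radial x hx s hs', h.apply_eq _ (h.mem_of_mem_Ico hx hs')]
    exact mul_pos hs.1 (h.factor_pos _ (h.mem_of_mem_Ico hx hs'))
  · exact hinj.mono (Set.prod_mono_right (Set.Icc_subset_Icc_right (min_le_right _ _)))
  -- The covering condition holds near every point of `Γ`, so the interior of the set where it holds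
  -- serves as the open set.
  · refine ⟨interior {x | 0 ≤ φ x → ∃ q ∈ bdry φ, ∃ s ∈ Set.Icc 0 δ, radialMap g φ q s = x},
      isOpen_interior, ?_, fun x hx => interior_subset hx⟩
    intro q hq
    rw [mem_interior_iff_mem_nhds]
    obtain ⟨d, u, W, ε, F, Θ, O, κ, x, h, hε, hx, rfl⟩ := hnf q hq
    have hΘc : ContinuousAt (fun a => (Θ a).2) (u x) :=
      (h.smooth_symm.continuousOn.continuousAt (h.isOpen_target.mem_nhds (h.mem_target hx))).snd
    have h1 : ∀ᶠ a in 𝓝 (u x), (Θ a).2 < δ :=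
      hΘc.eventually_lt continuousAt_const (by rw [h.symm_base hx]; exact hδ)
    filter_upwards [h1, h.isOpen_target.mem_nhds (h.mem_target hx)] with a ha haO hφa
    have h2 := h.mapsTo_symm haO
    have h3 := h.apply_eq _ h2
    rw [h.right_inv a haO] at h3
    have h4 : 0 ≤ (Θ a).2 := by
      rw [h3] at hφa
      exact nonneg_of_mul_nonneg_left hφa (h.factor_pos _ h2)
    refine ⟨u (Θ a).1, h.coord.mapsTo h2.1, (Θ a).2, ⟨h4, ha.le⟩, ?_⟩
    rw [h.radial _ h2.1 _ ⟨h4, h2.2.2⟩]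
    exact h.right_inv a haO
  · intro q hq s hs v w
    obtain ⟨d, u, W, ε, F, Θ, O, κ, x, h, hε, hx, rfl⟩ := hnf q hq
    obtain ⟨e, he⟩ := hvec h.coord hx v
    obtain ⟨e', he'⟩ := hvec h.coord hx w
    rw [hB _ s hq hs d u W ε F Θ O κ x h hε hx rfl v w e e' he he',
      hB _ s hq hs d u W ε F Θ O κ x h hε hx rfl w v e' e he' he, pullForm_apply, pullForm_apply,
      innerE_symm]
  · intro q hq s hs v hv
    obtain ⟨d, u, W, ε, F, Θ, O, κ, x, h, hε, hx, rfl⟩ := hnf q hq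
    have hs' : s ∈ Set.Ico 0 ε := ⟨hs.1, hs.2.trans_lt hε⟩
    obtain ⟨e, he⟩ := hvec h.coord hx v
    rw [hB _ s hq hs d u W ε F Θ O κ x h hε hx rfl v v e e he he]
    refine mul_pos (inv_pos.2 (h.factor_pos _ (h.mem_of_mem_Ico hx hs')))
      (pullForm_pos g (h.injective _ (h.mem_of_mem_Ico hx hs')) _ ?_)
    intro h0
    apply hv
    rw [Prod.mk_eq_zero] at h0
    rw [h0.1] at he
    exact Subtype.ext (he.trans (map_zero _))
  · rintro d' u' V' hu' ⟨z', s⟩ ⟨hz', hs⟩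
    obtain ⟨d, u, W, ε, F, Θ, O, κ, x, h, hε, hx, hxz⟩ := hnf _ (hu'.mapsTo hz')
    obtain ⟨N, τ, hN, hzN, hNV, hτx, hτ, hT⟩ := h.exists_transition hu' hz' hx hxz
    have hs' : s ∈ Set.Ico 0 ε := ⟨hs.1, hs.2.trans_lt hε⟩
    have h1 : ContMDiffAt 𝓘(ℝ, Coord d' × ℝ) 𝓘(ℝ, E) ∞
        (fun y : Coord d' × ℝ => F (τ y.1, y.2)) (z', s) := by
      refine ContMDiffAt.comp (z', s) (I' := 𝓘(ℝ, Coord d × ℝ)) (g := F) (f := fun y : Coord d' × ℝ => (τ y.1, y.2)) ?_ ?_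
      · rw [hτx]
        exact h.smooth.contMDiffAt (h.isOpen_source.mem_nhds (h.mem_of_mem_Ico hx hs'))
      · exact ((ContDiffAt.comp (z', s) (hτ.contDiffAt (hN.mem_nhds hzN)) contDiffAt_fst).prodMk
          contDiffAt_snd).contMDiffAt
    refine h1.contMDiffWithinAt.congr_of_eventuallyEq ?_ ((hT z' hzN).2.2.2.2 s hs')
    filter_upwards [self_mem_nhdsWithin,
      mem_nhdsWithin_of_mem_nhds ((hN.prod isOpen_univ).mem_nhds ⟨hzN, Set.mem_univ s⟩)] with y h1 h2
    exact (hT y.1 h2.1).2.2.2.2 y.2 ⟨h1.2.1, h1.2.2.trans_lt hε⟩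
  · rintro d' u' V' hu' ⟨z', s⟩ ⟨hz', hs⟩
    obtain ⟨d, u, W, ε, F, Θ, O, κ, x, h, hε, hx, hxz⟩ := hnf _ (hu'.mapsTo hz')
    obtain ⟨N, τ, hN, hzN, hNV, hτx, hτ, hT⟩ := h.exists_transition hu' hz' hx hxz
    have hs' : s ∈ Set.Ico 0 ε := ⟨hs.1, hs.2.trans_lt hε⟩
    have hm := h.mfderivWithin_radialMap hu'.isOpen hN hzN hNV hτ (hτx ▸ hx)
      (fun y hy => (hT y hy).2.2.2.2) hδ hε hs
    intro a b hab
    have h1 := (hm a).symm.trans ((congrArg (fun e : E => e) hab).trans (hm b))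
    rw [hτx] at h1
    have h2 := h.injective _ (h.mem_of_mem_Ico hx hs') h1
    exact Prod.ext ((hT z' hzN).2.2.2.1 (Prod.mk.inj h2).1) (Prod.mk.inj h2).2
  · rintro d' u' V' hu' v w ⟨z', s⟩ ⟨hz', hs⟩
    obtain ⟨d, u, W, ε, F, Θ, O, κ, x, h, hε, hx, hxz⟩ := hnf _ (hu'.mapsTo hz')
    obtain ⟨N, τ, hN, hzN, hNV, hτx, hτ, hT⟩ := h.exists_transition hu' hz' hx hxz
    have hs' : s ∈ Set.Ico 0 ε := ⟨hs.1, hs.2.trans_lt hε⟩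
    have hτat : ContDiffAt ℝ ∞ τ z' := hτ.contDiffAt (hN.mem_nhds hzN)
    have hTat : ContDiffAt ℝ ∞ (fun y : Coord d' × ℝ => (τ y.1, y.2)) (z', s) :=
      (ContDiffAt.comp (z', s) hτat contDiffAt_fst).prodMk contDiffAt_snd
    have hdτ : ∀ v : Coord d', ContDiffAt ℝ ∞
        (fun y : Coord d' × ℝ => ((fderiv ℝ τ y.1 v, 0) : Coord d × ℝ)) (z', s) := fun v =>
      ((ContDiffAt.comp (z', s) (hτat.fderiv_right (m := ∞) (by simp)) contDiffAt_fst).clm_apply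
        contDiffAt_const).prodMk contDiffAt_const
    have hmem := h.isOpen_source.mem_nhds (h.mem_of_mem_Ico hx hs')
    have hβ : ContDiffAt ℝ ∞ (fun y : Coord d' × ℝ => pullForm g (F (τ y.1, y.2))
        (paramDeriv 𝓘(ℝ, E) F (τ y.1, y.2))) (z', s) := by
      refine ContDiffAt.comp (z', s) (g := fun y => pullForm g (F y) (paramDeriv 𝓘(ℝ, E) F y))
        (f := fun y : Coord d' × ℝ => (τ y.1, y.2)) ?_ hTat
      rw [hτx]
      exact (contDiffOn_pullForm_paramDeriv g h.isOpen_source h.smooth).contDiffAt hmem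
    have hκ : ContDiffAt ℝ ∞ (fun y : Coord d' × ℝ => (κ (τ y.1, y.2))⁻¹) (z', s) := by
      refine ContDiffAt.inv ?_ ?_
      · refine ContDiffAt.comp (z', s) (g := κ) (f := fun y : Coord d' × ℝ => (τ y.1, y.2)) ?_ hTat
        rw [hτx]
        exact h.smooth_factor.contDiffAt hmem
      · rw [hτx]
        exact (h.factor_pos _ (h.mem_of_mem_Ico hx hs')).ne'
    refine (hκ.mul ((hβ.clm_apply (hdτ v)).clm_apply (hdτ w))).contDiffWithinAt.congr_of_eventuallyEq
      ?_ ?_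
    · filter_upwards [self_mem_nhdsWithin,
        mem_nhdsWithin_of_mem_nhds ((hN.prod isOpen_univ).mem_nhds ⟨hzN, Set.mem_univ s⟩)]
        with y h1 h2
      exact hform hu' h hε h1.1 (hT y.1 h2.1).1 (hT y.1 h2.1).2.1 (hT y.1 h2.1).2.2.1 h1.2 v w
    · exact hform hu' h hε hz' (hT z' hzN).1 (hT z' hzN).2.1 (hT z' hzN).2.2.1 hs v w
  · intro d' u' V' hu' z' hz' s hs v ζ X hX
    obtain ⟨d, u, W, ε, F, Θ, O, κ, x, h, hε, hx, hxz⟩ := hnf _ (hu'.mapsTo hz')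
    obtain ⟨N, τ, hN, hzN, hNV, hτx, hτ, hT⟩ := h.exists_transition hu' hz' hx hxz
    have hs₀ : s ∈ Set.Icc 0 δ := ⟨hs.1.le, hs.2⟩
    have hs' : s ∈ Set.Ico 0 ε := ⟨hs.1.le, hs.2.trans_lt hε⟩
    have hm := h.mfderivWithin_radialMap hu'.isOpen hN hzN hNV hτ (hτx ▸ hx)
      (fun y hy => (hT y hy).2.2.2.2) hδ hε hs₀ (v, ζ)
    have hX' : (X : E) = paramDeriv 𝓘(ℝ, E) F (x, s) (fderiv ℝ τ z' v, ζ) := by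
      rw [← hτx]
      exact hX.trans hm
    have hF : radialMap g φ (u' z') s = F (x, s) := by
      rw [(hT z' hzN).2.2.2.2 s hs', hτx]
    have hL := (hT z' hzN).2.2.1
    rw [hτx] at hL
    rw [hform hu' h hε hz' hx hxz hL hs₀ v v]
    have h1 : g.inner (radialMap g φ (u' z') s) X X =
        pullForm g (F (x, s)) (paramDeriv 𝓘(ℝ, E) F (x, s)) (fderiv ℝ τ z' v, ζ)
          (fderiv ℝ τ z' v, ζ) := by
      rw [pullForm_apply, ← hX', ← hF]
      rfl
    rw [h1, hF, h.apply_eq _ (h.mem_of_mem_Ico hx hs'), h.metric x hx s ⟨hs.1, hs'.2⟩]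
    have h2 := (h.factor_pos _ (h.mem_of_mem_Ico hx hs')).ne'
    have h3 := hs.1.ne'
    field_simp

end Existence

/-! ### The hypersurface metric in given semigeodesic coordinates -/

section Semigeodesic

variable {E : Type*} [NormedAddCommGroup E] [NormedSpace ℝ E] [FiniteDimensional ℝ E]
  {M : Type*} [TopologicalSpace M] [ChartedSpace E M] [IsManifold 𝓘(ℝ, E) ∞ M]
  {g : Bundle.ContMDiffRiemannianMetric 𝓘(ℝ, E) ∞ E (fun x : M => TangentSpace 𝓘(ℝ, E) x)}
  {φ : M → ℝ} {d : ℕ} {u : Coord d → M} {V : Set (Coord d)} {δ : ℝ} {f : M → ℝ → M}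
  {B : ∀ q : M, ℝ → (bdryT (E := E) φ q →L[ℝ] bdryT (E := E) φ q →L[ℝ] ℝ)}

namespace IsSemigeodesic

set_option maxHeartbeats 1000000 in
/-- The metric on the hypersurface, multiplied by the conformal factor, is the limit of the
semigeodesic form of the metric. -/
theorem metric_zero (h : IsSemigeodesic φ g δ f B) (hφ : ContMDiff 𝓘(ℝ, E) 𝓘(ℝ, ℝ) ∞ φ)
    (hu : IsLocalCoord 𝓘(ℝ, E) (bdry φ) (bdryT φ) u V) {z : Coord d} (hz : z ∈ V) :
    ∃ n : E, 0 < innerE g (u z) n n ∧ ∀ (v : Coord d) (ζ : ℝ),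
      innerE g (u z) (paramDeriv 𝓘(ℝ, E) u z v + ζ • n) (paramDeriv 𝓘(ℝ, E) u z v + ζ • n) =
        dPhiE φ (u z) n * (ζ ^ 2 + B (u z) 0 (frame 𝓘(ℝ, E) (bdryT φ) u z v)
          (frame 𝓘(ℝ, E) (bdryT φ) u z v)) := by
  set G : Coord d × ℝ → M := fun zs => f (u zs.1) zs.2
  set S : Set (Coord d × ℝ) := V ×ˢ Set.Icc 0 δ
  have hG : ContMDiffOn 𝓘(ℝ, Coord d × ℝ) 𝓘(ℝ, E) ∞ G S := h.smooth d u V hu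
  have hS : UniqueDiffOn ℝ S := uniqueDiffOn_prod_Icc hu.isOpen h.pos
  have h0 : (0 : ℝ) ∈ Set.Icc 0 δ := ⟨le_refl _, h.pos.le⟩
  have hzS : (z, (0 : ℝ)) ∈ S := ⟨hz, h0⟩
  have hG0 : ∀ y ∈ V, G (y, 0) = u y := fun y hy => h.map_zero _ (hu.mapsTo hy)
  obtain ⟨D0, hD0⟩ : ∃ D0 : Coord d × ℝ →L[ℝ] E,
    D0 = mfderivWithin 𝓘(ℝ, Coord d × ℝ) 𝓘(ℝ, E) G S (z, 0) := ⟨_, rfl⟩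
  have hGd : HasMFDerivWithinAt 𝓘(ℝ, Coord d × ℝ) 𝓘(ℝ, E) G S (z, 0) D0 := by
    rw [hD0]
    exact ((hG _ hzS).mdifferentiableWithinAt (by simp)).hasMFDerivWithinAt
  have hpd : ∀ v : Coord d, paramDeriv 𝓘(ℝ, E) u z v = D0 (v, 0) := by
    intro v
    have h1 : HasFDerivWithinAt (fun y : Coord d => (y, (0 : ℝ)))
        (ContinuousLinearMap.inl ℝ (Coord d) ℝ) V z :=
      (ContinuousLinearMap.inl ℝ (Coord d) ℝ).hasFDerivWithinAt
    have hm : V ⊆ (fun y : Coord d => (y, (0 : ℝ))) ⁻¹' S := fun y hy => ⟨hy, h0⟩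
    have h2 : HasMFDerivWithinAt 𝓘(ℝ, Coord d) 𝓘(ℝ, E) (fun y : Coord d => G (y, 0)) V z
        (D0.comp (ContinuousLinearMap.inl ℝ (Coord d) ℝ)) :=
      HasMFDerivWithinAt.comp (I' := 𝓘(ℝ, Coord d × ℝ)) z hGd h1.hasMFDerivWithinAt hm
    have h3 := (h2.congr_of_eventuallyEq (f₁ := u) (Filter.eventually_of_mem
      self_mem_nhdsWithin fun y hy => (hG0 y hy).symm) (hG0 z hz).symm).hasMFDerivAt
      (hu.isOpen.mem_nhds hz)
    exact congrArg (fun L : Coord d →L[ℝ] E => L v) h3.mfderiv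
  set n : E := D0 (0, 1)
  have hsplit : ∀ (v : Coord d) (ζ : ℝ), paramDeriv 𝓘(ℝ, E) u z v + ζ • n = D0 (v, ζ) := by
    intro v ζ
    rw [hpd, ← map_smul, ← map_add]
    simp
  have hφG : HasDerivWithinAt (fun s => φ (G (z, s))) (dPhiE φ (u z) n) (Set.Icc 0 δ) 0 := by
    have h1 : HasMFDerivAt 𝓘(ℝ, E) 𝓘(ℝ, ℝ) φ (G (z, 0)) (dPhi φ (G (z, 0))) :=
      ((hφ _).mdifferentiableAt (by simp)).hasMFDerivAt
    have h2 := (HasMFDerivAt.comp_hasMFDerivWithinAt (I' := 𝓘(ℝ, E)) (z, (0 : ℝ)) h1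
      hGd).hasFDerivWithinAt
    have h3 : HasDerivWithinAt (fun s : ℝ => (z, s)) ((0 : Coord d), (1 : ℝ)) (Set.Icc 0 δ) 0 :=
      (hasDerivWithinAt_const (0 : ℝ) (Set.Icc 0 δ) z).prodMk (hasDerivWithinAt_id (0 : ℝ) _)
    have h4 := HasFDerivWithinAt.comp_hasDerivWithinAt (0 : ℝ) h2 h3
      (fun s hs => (⟨hz, hs⟩ : (z, s) ∈ S))
    rw [← hG0 z hz]
    exact h4
  have hφ0 : φ (G (z, 0)) = 0 := by rw [hG0 z hz]; exact hu.mapsTo hz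
  have hl : Set.Ioc 0 δ ∈ 𝓝[>] (0 : ℝ) := Ioc_mem_nhdsGT h.pos
  -- The metric `G` is singular at `s = 0`, but the ratio `φ / s` has a limit: the derivative of `φ`
  -- along `n = ∂f/∂s`.
  have hslope : Filter.Tendsto (fun s => φ (G (z, s)) / s) (𝓝[>] 0) (𝓝 (dPhiE φ (u z) n)) := by
    have h1 := (hasDerivWithinAt_iff_tendsto_slope.1 hφG).mono_left
      (nhdsWithin_le_iff.2 (Filter.mem_of_superset hl fun s hs =>
        (⟨⟨hs.1.le, hs.2⟩, hs.1.ne'⟩ : s ∈ Set.Icc 0 δ \ {0})))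
    refine h1.congr fun s => ?_
    rw [slope_def_field, hφ0, sub_zero, sub_zero]
  have hpath : Filter.Tendsto (fun s : ℝ => (z, s)) (𝓝[>] 0) (𝓝[S] (z, 0)) := by
    refine tendsto_nhdsWithin_iff.2 ⟨?_, Filter.mem_of_superset hl fun s hs =>
      (⟨hz, hs.1.le, hs.2⟩ : (z, s) ∈ S)⟩
    exact ((Continuous.prodMk_right z).tendsto 0).mono_left nhdsWithin_le_nhds
  have key : ∀ (v : Coord d) (ζ : ℝ), innerE g (u z) (D0 (v, ζ)) (D0 (v, ζ)) =
      dPhiE φ (u z) n * (ζ ^ 2 + B (u z) 0 (frame 𝓘(ℝ, E) (bdryT φ) u z v)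
        (frame 𝓘(ℝ, E) (bdryT φ) u z v)) := by
    intro v ζ
    -- The identity `metric` is available only for `s > 0`. After multiplication by `φ` both sides
    -- have limits as `s` decreases to `0`.
    have h1 := ((contDiffOn_innerE g hS hG (v, ζ) (v, ζ)).continuousOn _ hzS).tendsto.comp hpath
    have h2 := hslope.mul (tendsto_const_nhds (x := ζ ^ 2) |>.add
      (((h.smooth_form d u V hu v v).continuousOn _ hzS).tendsto.comp hpath))
    have h3 := tendsto_nhds_unique_of_eventuallyEq h1 h2 (by
      filter_upwards [hl] with s hs
      have h4 := h.metric d u V hu z hz s hs v ζ _ rfl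
      have h5 := (h.map_pos _ (hu.mapsTo hz) s hs).ne'
      have h6 := hs.1.ne'
      have h7 : innerE g (G (z, s)) (mfderivWithin 𝓘(ℝ, Coord d × ℝ) 𝓘(ℝ, E) G S (z, s) (v, ζ))
          (mfderivWithin 𝓘(ℝ, Coord d × ℝ) 𝓘(ℝ, E) G S (z, s) (v, ζ)) / φ (G (z, s)) =
          (ζ ^ 2 + B (u z) s (frame 𝓘(ℝ, E) (bdryT φ) u z v)
            (frame 𝓘(ℝ, E) (bdryT φ) u z v)) / s := h4
      have h8 := (div_eq_iff (show φ (G (z, s)) ≠ 0 from h5)).1 h7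
      refine h8.trans ?_
      simp only [Function.comp_apply]
      field_simp)
    have h9 : innerE g (u z) = innerE g (G (z, 0)) := by rw [hG0 z hz]
    rw [h9, hD0]
    exact h3
  refine ⟨n, ?_, fun v ζ => by rw [hsplit]; exact key v ζ⟩
  refine innerE_pos g _ _ fun h1 => ?_
  have h2 : D0 (0, 1) = D0 0 := h1.trans (_root_.map_zero D0).symm
  have h3 : Function.Injective D0 := by
    rw [hD0]
    exact h.immersion d u V hu (z, 0) hzS
  have h4 := h3 h2
  simp [Prod.ext_iff] at h4

/-- The vector `n` of `metric_zero` satisfies `‖n‖² = dφ(n)` and is orthogonal to the hypersurface,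
so it is the gradient of `φ` and the factor `dφ(n)` equals `‖dφ‖²`. Therefore `B` at `s = 0` does
not depend on the semigeodesic coordinates, and `K₀` is `‖dφ‖²` times the dual of the induced
metric. -/
theorem form_zero (h : IsSemigeodesic φ g δ f B) (hφ : ContMDiff 𝓘(ℝ, E) 𝓘(ℝ, ℝ) ∞ φ)
    (hu : IsLocalCoord 𝓘(ℝ, E) (bdry φ) (bdryT φ) u V) {z : Coord d} (hz : z ∈ V) :
    0 < coNormSq g (u z) (dPhi φ (u z)) ∧ ∀ v w : Coord d,
      pullForm g (u z) (paramDeriv 𝓘(ℝ, E) u z) v w = coNormSq g (u z) (dPhi φ (u z)) *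
        B (u z) 0 (frame 𝓘(ℝ, E) (bdryT φ) u z v) (frame 𝓘(ℝ, E) (bdryT φ) u z w) := by
  obtain ⟨n, hn, key⟩ := h.metric_zero hφ hu hz
  set b := fun v w : Coord d =>
    B (u z) 0 (frame 𝓘(ℝ, E) (bdryT φ) u z v) (frame 𝓘(ℝ, E) (bdryT φ) u z w)
  set P := paramDeriv 𝓘(ℝ, E) u z
  set κ := dPhiE φ (u z) n
  have hker : ∀ v, dPhiE φ (u z) (P v) = 0 := fun v => (hu.tangent z hz _).2 ⟨v, rfl⟩
  have hb0 : b 0 0 = 0 := by simp [b]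
  have hnn : innerE g (u z) n n = κ := by
    have h1 := key 0 1
    simp only [_root_.map_zero, zero_add, one_smul] at h1
    rw [h1]
    ring
  have hκ : 0 < κ := hnn ▸ hn
  have hvv : ∀ v, innerE g (u z) (P v) (P v) = κ * b v v := by
    intro v
    have h1 := key v 0
    simp only [zero_smul, add_zero] at h1
    rw [h1]
    ring
  have hcross : ∀ v, innerE g (u z) n (P v) = 0 := by
    intro v
    have h1 := key v 1
    simp only [one_smul, map_add, add_apply] at h1
    have h2 := innerE_symm g (u z) n (P v)
    have h3 : innerE g (u z) (P v) (P v) = κ * b v v := hvv v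
    change innerE g (u z) (P v) (P v) + innerE g (u z) n (P v) + (innerE g (u z) (P v) n +
      innerE g (u z) n n) = κ * (1 ^ 2 + b v v) at h1
    linarith
  -- The tangent space of the hypersurface and `n` span everything, and both functionals agree on
  -- them.
  have hdual : innerE g (u z) n = dPhiE φ (u z) := by
    ext X
    have h1 : dPhiE φ (u z) (X - (dPhiE φ (u z) X / κ) • n) = 0 := by
      rw [map_sub, map_smul, smul_eq_mul]
      change dPhiE φ (u z) X - dPhiE φ (u z) X / κ * κ = 0
      field_simp
      ring
    obtain ⟨v, hv⟩ : ∃ v : Coord d, P v = X - (dPhiE φ (u z) X / κ) • n :=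
      (hu.tangent z hz (X - (dPhiE φ (u z) X / κ) • n)).1 h1
    have h2 : X = P v + (dPhiE φ (u z) X / κ) • n := by
      rw [hv, sub_add_cancel]
    have h4 : innerE g (u z) n X = innerE g (u z) n (P v + (dPhiE φ (u z) X / κ) • n) :=
      congrArg _ h2
    rw [h4, map_add, map_smul, hcross, hnn, zero_add, smul_eq_mul]
    field_simp
  have hlam : coNormSq g (u z) (dPhi φ (u z)) = κ := by
    have h1 : (innerE g (u z)).inverse (dPhiE (E := E) φ (u z)) = n :=
      inverse_apply_of_posDef (innerE_pos g (u z)) hdual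
    change dPhiE (E := E) φ (u z) ((innerE g (u z)).inverse (dPhiE (E := E) φ (u z))) = κ
    rw [h1]
  have hbsymm : ∀ v w, b v w = b w v := fun v w =>
    h.symm _ (hu.mapsTo hz) 0 ⟨le_refl _, h.pos.le⟩ _ _
  refine ⟨hlam ▸ hκ, fun v w => ?_⟩
  rw [hlam, pullForm_apply]
  have h1 := hvv (v + w)
  have h2 : b (v + w) (v + w) = b v v + b w v + (b v w + b w w) := by
    simp only [b, map_add, add_apply]
  have h3 := innerE_symm g (u z) (P v) (P w)
  rw [h2, map_add, map_add, map_add, add_apply, add_apply, hvv, hvv, ← hbsymm v w, ← h3] at h1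
  change innerE g (u z) (P v) (P w) = κ * b v w
  linarith

/-- The coefficients of the averaged Hamiltonian in local coordinates. -/
theorem exists_forms (h : IsSemigeodesic φ g δ f B) (hφ : ContMDiff 𝓘(ℝ, E) 𝓘(ℝ, ℝ) ∞ φ)
    (hu : IsLocalCoord 𝓘(ℝ, E) (bdry φ) (bdryT φ) u V) :
    ∃ C₁ : Coord d → (Coord d →L[ℝ] ℝ) →L[ℝ] Coord d, ContDiffOn ℝ ∞ C₁ V ∧
      ∀ z ∈ V, ∀ w : Coord d →L[ℝ] ℝ,
        formK0 B (ofCoords 𝓘(ℝ, E) (bdryT φ) u (z, w)) = coNormSq g (u z) (dPhi φ (u z)) *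
          w ((pullForm g (u z) (paramDeriv 𝓘(ℝ, E) u z)).inverse w) ∧
        formK1 B (ofCoords 𝓘(ℝ, E) (bdryT φ) u (z, w)) = w (C₁ z w) := by
  set S : Set (Coord d × ℝ) := V ×ˢ Set.Icc 0 δ
  have hS : UniqueDiffOn ℝ S := uniqueDiffOn_prod_Icc hu.isOpen h.pos
  have h0 : (0 : ℝ) ∈ Set.Icc 0 δ := ⟨le_refl _, h.pos.le⟩
  set β : Coord d × ℝ → Coord d →L[ℝ] Coord d →L[ℝ] ℝ := fun y =>
    (ContinuousLinearMap.precomp ℝ (frame 𝓘(ℝ, E) (bdryT φ) u y.1)).comp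
      ((B (u y.1) y.2).comp (frame 𝓘(ℝ, E) (bdryT φ) u y.1))
  have hβ : ContDiffOn ℝ ∞ β S :=
    contDiffOn_clm_apply.2 fun a => contDiffOn_clm_apply.2 fun b => h.smooth_form d u V hu a b
  have hpos : ∀ y ∈ S, ∀ v, v ≠ 0 → 0 < β y v v := fun y hy v hv =>
    h.posDef _ (hu.mapsTo hy.1) _ hy.2 _ fun h1 =>
      hv (frame_injective hu hy.1 (h1.trans (_root_.map_zero _).symm))
  have hC := contDiffOn_inverse_of_posDef hβ hpos
  have hK : ∀ z ∈ V, ∀ s ∈ Set.Icc 0 δ, ∀ w : Coord d →L[ℝ] ℝ,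
      formK B (ofCoords 𝓘(ℝ, E) (bdryT φ) u (z, w)) s = w ((β (z, s)).inverse w) := by
    intro z hz s hs w
    have : T2Space (TangentSpace 𝓘(ℝ, E) (u z)) := inferInstanceAs (T2Space E)
    have : FiniteDimensional ℝ (TangentSpace 𝓘(ℝ, E) (u z)) :=
      inferInstanceAs (FiniteDimensional ℝ E)
    have h1 := dualForm_comp (W := bdryT (E := E) φ (u z)) (β := B (u z) s) (β' := β (z, s))
      (L := frame 𝓘(ℝ, E) (bdryT φ) u z) (fun v hv => h.posDef _ (hu.mapsTo hz) s hs v hv)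
      ⟨frame_injective hu hz, frame_surjective hu hz⟩ (fun a b => rfl)
      (w.comp (frame 𝓘(ℝ, E) (bdryT φ) u z).inverse)
    have h2 : (w.comp (frame 𝓘(ℝ, E) (bdryT φ) u z).inverse).comp
        (frame 𝓘(ℝ, E) (bdryT φ) u z) = w := by
      ext e
      simp only [ContinuousLinearMap.comp_apply]
      rw [frame_inverse_frame hu hz]
    rw [h2] at h1
    exact h1
  refine ⟨fun z => fderivWithin ℝ (fun y => (β y).inverse) S (z, 0) (0, 1), ?_, ?_⟩
  · have h1 := hC.fderivWithin hS (m := ∞) (by simp)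
    exact (h1.comp (contDiff_prodMk_left (0 : ℝ)).contDiffOn
      (fun z hz => (⟨hz, h0⟩ : (z, (0 : ℝ)) ∈ S))).clm_apply contDiffOn_const
  · intro z hz w
    have hzS : (z, (0 : ℝ)) ∈ S := ⟨hz, h0⟩
    constructor
    · obtain ⟨hlam, hform⟩ := h.form_zero hφ hu hz
      rw [formK0, hK z hz 0 h0, ← smul_eq_mul, ← map_smul]
      congr 1
      refine inverse_apply_of_posDef (hpos _ hzS) ?_
      ext v
      have h1 : pullForm g (u z) (paramDeriv 𝓘(ℝ, E) u z)
          ((pullForm g (u z) (paramDeriv 𝓘(ℝ, E) u z)).inverse w) v = w v := by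
        rw [apply_inverse_of_posDef (fun a ha => pullForm_pos g (hu.immersion z hz) a ha)]
      rw [hform] at h1
      rw [map_smul, smul_apply, smul_eq_mul]
      exact h1
    · have h1 : HasDerivWithinAt (formK B (ofCoords 𝓘(ℝ, E) (bdryT φ) u (z, w)))
          (w (fderivWithin ℝ (fun y => (β y).inverse) S (z, 0) (0, 1) w)) (Set.Icc 0 δ) 0 := by
        have h2 := ((hC _ hzS).differentiableWithinAt (by simp)).hasFDerivWithinAt
        have h3 : HasDerivWithinAt (fun s : ℝ => (z, s)) ((0 : Coord d), (1 : ℝ)) (Set.Icc 0 δ) 0 :=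
          (hasDerivWithinAt_const (0 : ℝ) (Set.Icc 0 δ) z).prodMk (hasDerivWithinAt_id (0 : ℝ) _)
        have h4 := HasFDerivWithinAt.comp_hasDerivWithinAt (0 : ℝ) h2 h3
          (fun s hs => (⟨hz, hs⟩ : (z, s) ∈ S))
        have h5 := (w.hasFDerivAt.comp_hasDerivWithinAt (0 : ℝ)
          (h4.clm_apply (hasDerivWithinAt_const (0 : ℝ) (Set.Icc 0 δ) w)))
        refine (h5.congr (fun s hs => hK z hz s hs w) (hK z hz 0 h0 w)).congr_deriv ?_
        simp
      have h2 : HasDerivWithinAt (formK B (ofCoords 𝓘(ℝ, E) (bdryT φ) u (z, w)))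
          (w (fderivWithin ℝ (fun y => (β y).inverse) S (z, 0) (0, 1) w)) (Set.Ici 0) 0 :=
        h1.mono_of_mem_nhdsWithin (Icc_mem_nhdsGE h.pos)
      exact h2.derivWithin (uniqueDiffOn_Ici (0 : ℝ) 0 (Set.self_mem_Ici))

end IsSemigeodesic

end Semigeodesic

/-! ### Perturbation of autonomous equations and of a sine function -/

section Perturbation

open scoped NNReal

/-- A cutoff equal to `1` near `K` gives a compactly supported `C¹` function, which is globally
Lipschitz and bounded. Solutions of the modified equation are then global and obey a Grönwall
estimate, and `ρ` is the distance a solution may move before the cutoff matters. -/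
theorem exists_lipschitz_extension {Y Z : Type*} [NormedAddCommGroup Y] [NormedSpace ℝ Y]
    [FiniteDimensional ℝ Y] [NormedAddCommGroup Z] [NormedSpace ℝ Z] {K U : Set Y}
    (hK : IsCompact K) (hU : IsOpen U) (hKU : K ⊆ U) {F : Y → Z} (hF : ContDiffOn ℝ 1 F U) :
    ∃ ρ > 0, ∃ (L b : ℝ≥0) (G : Y → Z), LipschitzWith L G ∧ (∀ y, ‖G y‖ ≤ b) ∧
      ∀ x ∈ K, ∀ y, dist y x < ρ → y ∈ U ∧ G y = F y := by
  obtain ⟨r, hr, hrU⟩ := hK.exists_cthickening_subset_open hU hKU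
  have hsub : Metric.cthickening (r / 2) K ⊆ interior (Metric.cthickening r K) :=
    (Metric.cthickening_subset_thickening' hr (half_lt_self hr) K).trans
      (interior_maximal (Metric.thickening_subset_cthickening r K) Metric.isOpen_thickening)
  obtain ⟨χ, hχ1, hχ0, -⟩ := exists_contMDiffMap_one_nhds_of_subset_interior (n := 1) 𝓘(ℝ, Y)
    Metric.isClosed_cthickening hsub
  have hχs : ContDiff ℝ 1 χ := χ.contMDiff.contDiff
  have hsupp : tsupport χ ⊆ Metric.cthickening r K := by
    refine closure_minimal (fun x hx => ?_) Metric.isClosed_cthickening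
    by_contra h
    exact hx (hχ0 x h)
  have hcs : HasCompactSupport χ :=
    hK.cthickening.of_isClosed_subset (isClosed_tsupport χ) hsupp
  have hG : ContDiff ℝ 1 (fun y => χ y • F y) := by
    rw [contDiff_iff_contDiffAt]
    intro x
    by_cases hx : x ∈ U
    · exact hχs.contDiffAt.smul (hF.contDiffAt (hU.mem_nhds hx))
    · have : (fun y => χ y • F y) =ᶠ[𝓝 x] fun _ => 0 := by
        filter_upwards [(isClosed_tsupport χ).isOpen_compl.mem_nhds
          (fun h => hx (hrU (hsupp h)))] with y hy
        rw [image_eq_zero_of_notMem_tsupport hy, zero_smul]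
      exact contDiffAt_const.congr_of_eventuallyEq this
  have hGs : HasCompactSupport (fun y => χ y • F y) := hcs.smul_right
  obtain ⟨L, hL⟩ := hG.lipschitzWith_of_hasCompactSupport hGs (by simp)
  obtain ⟨b, hb⟩ := hGs.exists_bound_of_continuous hG.continuous
  refine ⟨r / 2, half_pos hr, L, b.toNNReal, _, hL,
    fun y => (hb y).trans (Real.le_coe_toNNReal b), fun x hx y hy => ?_⟩
  have h1 : y ∈ Metric.cthickening (r / 2) K :=
    Metric.mem_cthickening_of_dist_le y x _ _ hx hy.le
  refine ⟨hrU (Metric.cthickening_mono (half_le_self hr.le) K h1), ?_⟩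
  have h2 : χ y = 1 := hχ1.self_of_nhdsSet y h1
  simp only [h2, one_smul]

theorem gronwallBound_zero_eq_mul (K ε x : ℝ) : gronwallBound 0 K ε x = ε * gronwallBound 0 K 1 x := by
  by_cases hK : K = 0
  · simp [hK, gronwallBound_K0]
  · simp only [gronwallBound_of_K_ne_0 hK]
    ring

/-- A solution of an autonomous equation persists under perturbations of size `μ`, with an error
of size `μ`, which also applies to functions along the solution. -/
theorem exists_perturbation {Y Z : Type*} [NormedAddCommGroup Y] [NormedSpace ℝ Y]
    [FiniteDimensional ℝ Y] [NormedAddCommGroup Z] [NormedSpace ℝ Z] {K : Set Y}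
    (hK : IsCompact K) {U : Set (Y × ℝ)} (hU : IsOpen U) (hKU : ∀ x ∈ K, (x, (0 : ℝ)) ∈ U)
    {v : Y × ℝ → Y} (hv : ContDiffOn ℝ 1 v U) {F : Y × ℝ → Z} (hF : ContDiffOn ℝ 1 F U)
    {T : ℝ} (hT : 0 ≤ T) :
    ∃ μ₀ > 0, ∃ C ≥ 0, ∀ μ ∈ Set.Icc 0 μ₀, ∀ y₀ : ℝ → Y,
      (∀ t ∈ Set.Icc 0 T, y₀ t ∈ K ∧ HasDerivWithinAt y₀ (v (y₀ t, 0)) (Set.Icc 0 T) t) →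
      ∃ y : ℝ → Y, y 0 = y₀ 0 ∧ ∀ t ∈ Set.Icc 0 T, (y t, μ) ∈ U ∧
        HasDerivWithinAt y (v (y t, μ)) (Set.Icc 0 T) t ∧ ‖y t - y₀ t‖ ≤ C * μ ∧
        ‖F (y t, μ) - F (y₀ t, 0)‖ ≤ C * μ := by
  obtain ⟨ρ, hρ, L, b, G, hL, hb, hG⟩ := exists_lipschitz_extension
    (hK.prod (isCompact_singleton (x := (0 : ℝ)))) hU
    (by rintro ⟨x, s⟩ ⟨hx, rfl⟩; exact hKU x hx) (hv.prodMk hF)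
  -- A defect of size `ε` in the equation causes an error of at most `E₀ ε` on `[0, T]`.
  set E₀ := gronwallBound 0 L 1 T
  have hE₀ : 0 ≤ E₀ := by
    have h1 : gronwallBound 0 (L : ℝ) 1 0 ≤ E₀ :=
      gronwallBound_mono le_rfl zero_le_one L.coe_nonneg hT
    rwa [gronwallBound_x0] at h1
  have hLE : 0 ≤ (L : ℝ) * E₀ := mul_nonneg L.coe_nonneg hE₀
  -- Replacing the parameter `0` by `μ` changes the field by at most `L μ`, the solution by at most
  -- `L E₀ μ`, and the pair of solution and parameter by at most `(L E₀ + 1) μ`. The choice of `μ₀`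
  -- keeps this below `ρ`.
  refine ⟨ρ / (2 * (L * E₀ + 1)), by positivity, (L + 1) * (L * E₀ + 1), by positivity, ?_⟩
  intro μ hμ y₀ hy₀
  have hμρ : (L * E₀ + 1) * μ < ρ := by
    have h1 := mul_le_mul_of_nonneg_left hμ.2 (by positivity : 0 ≤ (L : ℝ) * E₀ + 1)
    have h2 : (L * E₀ + 1) * (ρ / (2 * (L * E₀ + 1))) = ρ / 2 := by field_simp
    linarith
  set w : Y → Y := fun x => (G (x, μ)).1 with hw
  have hwL : LipschitzWith L w := by
    refine LipschitzWith.of_dist_le_mul fun x x' => ?_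
    refine (le_max_left _ _).trans ((hL.dist_le_mul (x, μ) (x', μ)).trans_eq ?_)
    rw [Prod.dist_eq, dist_self, max_eq_left dist_nonneg]
  have hwb : ∀ x, ‖w x‖ ≤ b := fun x => (norm_fst_le _).trans (hb _)
  obtain ⟨y, hy0, hy⟩ : ∃ y : ℝ → Y, y 0 = y₀ 0 ∧
      ∀ t ∈ Set.Icc 0 T, HasDerivWithinAt y (w (y t)) (Set.Icc 0 T) t := by
    have hPL : IsPicardLindelof (fun _ => w) (tmin := 0) (tmax := T) ⟨0, le_rfl, hT⟩ (y₀ 0)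
        (b * T.toNNReal) 0 b L := by
      refine ⟨fun t _ => hwL.lipschitzOnWith, fun x _ => continuousOn_const, fun t _ x _ => hwb x, ?_⟩
      simp [hT]
    exact hPL.exists_eq_forall_mem_Icc_hasDerivWithinAt₀
  have hv0 : ∀ t ∈ Set.Icc 0 T, G (y₀ t, 0) = (v (y₀ t, 0), F (y₀ t, 0)) := fun t ht =>
    (hG (y₀ t, 0) ⟨(hy₀ t ht).1, rfl⟩ _ (by rw [dist_self]; exact hρ)).2
  have hdist : ∀ t ∈ Set.Icc 0 T, dist (y t) (y₀ t) ≤ L * E₀ * μ := by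
    intro t ht
    have h1 := dist_le_of_approx_trajectories_ODE (v := fun _ => w) (K := L) (f := y) (g := y₀)
      (f' := fun t => w (y t)) (g' := fun t => v (y₀ t, 0)) (a := 0) (b := T) (εf := 0)
      (εg := L * μ) (δ := 0) (fun _ => hwL)
      (fun t ht => (hy t ht).continuousWithinAt)
      (fun t ht => (hy t ⟨ht.1, ht.2.le⟩).mono_of_mem_nhdsWithin (Icc_mem_nhdsGE_of_mem ht))
      (fun t _ => (dist_self _).le)
      (fun t ht => (hy₀ t ht).2.continuousWithinAt)
      (fun t ht => (hy₀ t ⟨ht.1, ht.2.le⟩).2.mono_of_mem_nhdsWithin (Icc_mem_nhdsGE_of_mem ht))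
      (fun t ht => by
        have h2 := hL.dist_le_mul (y₀ t, 0) (y₀ t, μ)
        rw [hv0 t ⟨ht.1, ht.2.le⟩] at h2
        refine (le_max_left _ _).trans (h2.trans_eq ?_)
        rw [Prod.dist_eq, dist_self, max_eq_right dist_nonneg, Real.dist_eq, zero_sub, abs_neg,
          abs_of_nonneg hμ.1])
      (by rw [hy0, dist_self]) t ht
    rw [zero_add, sub_zero, gronwallBound_zero_eq_mul] at h1
    have h2 : gronwallBound 0 (L : ℝ) 1 t ≤ E₀ :=
      gronwallBound_mono le_rfl zero_le_one L.coe_nonneg ht.2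
    exact h1.trans ((mul_le_mul_of_nonneg_left h2 (mul_nonneg L.coe_nonneg hμ.1)).trans_eq (by ring))
  refine ⟨y, hy0, fun t ht => ?_⟩
  have hd : dist (y t, μ) (y₀ t, (0 : ℝ)) ≤ (L * E₀ + 1) * μ := by
    rw [Prod.dist_eq, Real.dist_eq, sub_zero, abs_of_nonneg hμ.1]
    refine max_le ?_ ?_
    · linarith [hdist t ht, hμ.1]
    · linarith [mul_nonneg hLE hμ.1]
  obtain ⟨h1, h2⟩ := hG (y₀ t, 0) ⟨(hy₀ t ht).1, rfl⟩ (y t, μ) (hd.trans_lt hμρ)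
  have hLμ : 0 ≤ (L : ℝ) * ((L * E₀ + 1) * μ) :=
    mul_nonneg L.coe_nonneg (mul_nonneg (by positivity) hμ.1)
  have hLμ' : 0 ≤ (L * E₀ + 1) * μ := mul_nonneg (by positivity) hμ.1
  refine ⟨h1, ?_, ?_, ?_⟩
  · have h3 := hy t ht
    simp only [hw] at h3
    rwa [h2] at h3
  · rw [← dist_eq_norm]
    linarith [hdist t ht, hμ.1]
  · rw [← dist_eq_norm]
    have h3 := hL.dist_le_mul (y t, μ) (y₀ t, 0)
    rw [h2, hv0 t ht] at h3
    have h4 := (le_max_right _ _).trans h3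
    have h5 := mul_le_mul_of_nonneg_left hd L.coe_nonneg
    change dist (F (y t, μ)) (F (y₀ t, 0)) ≤ _ at h4
    have h6 : (L : ℝ) * dist (y t, μ) (y₀ t, (0 : ℝ)) ≤ L * ((L * E₀ + 1) * μ) := h5
    linarith

/-- The increment of a slow variable, up to second order. -/
theorem norm_increment_le {Z : Type*} [NormedAddCommGroup Z] [NormedSpace ℝ Z] {T μ c : ℝ}
    (hμ : 0 ≤ μ) {z F z₁ F₁ : ℝ → Z}
    (hz : ∀ t ∈ Set.Icc 0 T, HasDerivWithinAt z (μ • F t) (Set.Icc 0 T) t)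
    (hz₁ : ∀ t ∈ Set.Icc 0 T, HasDerivWithinAt z₁ (F₁ t) (Set.Icc 0 T) t)
    (h : ∀ t ∈ Set.Icc 0 T, ‖F t - F₁ t‖ ≤ c) {t : ℝ} (ht : t ∈ Set.Icc 0 T) :
    ‖z t - z 0 - μ • (z₁ t - z₁ 0)‖ ≤ μ * c * t := by
  have h1 := norm_image_sub_le_of_norm_deriv_le_segment' (f := fun t => z t - μ • z₁ t)
    (f' := fun t => μ • F t - μ • F₁ t) (C := μ * c) (a := 0) (b := T)
    (fun t ht => (hz t ht).sub ((hz₁ t ht).const_smul μ)) (fun t ht => by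
      rw [← smul_sub, norm_smul, Real.norm_of_nonneg hμ]
      exact mul_le_mul_of_nonneg_left (h t ⟨ht.1, ht.2.le⟩) hμ) t ht
  rw [sub_zero] at h1
  refine le_of_eq_of_le ?_ h1
  congr 1
  rw [smul_sub]
  abel

/-- The first zero of a perturbed sine function. -/
theorem exists_first_zero {X X' : ℝ → ℝ} {a ν κ T : ℝ} (ha : 0 < a) (hν : 0 < ν)
    (hT : 4 * Real.pi / (3 * ν) ≤ T) (hκ : κ < a / 2) (hκ' : κ ≤ a * ν / 4) (h0 : X 0 = 0)
    (hX : ∀ t ∈ Set.Icc 0 T, HasDerivWithinAt X (X' t) (Set.Icc 0 T) t)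
    (h : ∀ t ∈ Set.Icc 0 T, |X t - a * Real.sin (ν * t)| ≤ κ)
    (h' : ∀ t ∈ Set.Icc 0 T, |X' t - a * ν * Real.cos (ν * t)| ≤ κ) :
    ∃ τ ∈ Set.Ioc 0 T, X τ = 0 ∧ (∀ t ∈ Set.Ioo 0 τ, 0 < X t) ∧
      |τ - Real.pi / ν| ≤ 4 * κ / (a * ν) := by
  have hπ := Real.pi_pos
  -- Phases in steps of sixty degrees: the derivative is positive up to `t₁`, the function is
  -- positive on `[t₁, 2 t₁]`, and on `[2 t₁, 4 t₁]` the slope is at most `-a ν / 4`, with a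
  -- negative value at the end. So the first zero is the only one in the last interval.
  set t₁ := Real.pi / (3 * ν) with ht₁
  have ht₁ν : ν * t₁ = Real.pi / 3 := by rw [ht₁]; field_simp
  have ht₁p : 0 < t₁ := by positivity
  have hT4 : 4 * t₁ ≤ T := by
    refine le_trans (le_of_eq ?_) hT
    rw [ht₁]
    ring
  have hmid : Real.pi / ν = 3 * t₁ := by rw [ht₁]; field_simp
  have haν : 0 < a * ν := mul_pos ha hν
  have hcont : ContinuousOn X (Set.Icc 0 T) := fun t ht => (hX t ht).continuousWithinAt
  have hderiv : ∀ t ∈ Set.Ioo 0 T, HasDerivAt X (X' t) t := fun t ht =>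
    (hX t ⟨ht.1.le, ht.2.le⟩).hasDerivAt (Icc_mem_nhds ht.1 ht.2)
  have hcos1 : ∀ t ∈ Set.Icc 0 t₁, 1 / 2 ≤ Real.cos (ν * t) := by
    intro t ht
    rw [← Real.cos_pi_div_three]
    refine Real.cos_le_cos_of_nonneg_of_le_pi (by have := ht.1; positivity) (by linarith) ?_
    rw [← ht₁ν]
    exact mul_le_mul_of_nonneg_left ht.2 hν.le
  have hcos2 : ∀ t ∈ Set.Icc (2 * t₁) (4 * t₁), Real.cos (ν * t) ≤ -(1 / 2) := by
    intro t ht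
    have h1 : Real.cos (ν * t - Real.pi) = -Real.cos (ν * t) := Real.cos_sub_pi _
    have h2 : 1 / 2 ≤ Real.cos (ν * t - Real.pi) := by
      rw [← Real.cos_abs, ← Real.cos_pi_div_three]
      refine Real.cos_le_cos_of_nonneg_of_le_pi (abs_nonneg _) (by linarith) (abs_le.2 ⟨?_, ?_⟩)
      · linarith [mul_le_mul_of_nonneg_left ht.1 hν.le]
      · linarith [mul_le_mul_of_nonneg_left ht.2 hν.le]
    linarith
  have hsin : ∀ t ∈ Set.Icc t₁ (2 * t₁), 1 / 2 ≤ Real.sin (ν * t) := by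
    intro t ht
    have h1 : Real.cos (ν * t - Real.pi / 2) = Real.sin (ν * t) := Real.cos_sub_pi_div_two _
    rw [← h1, ← Real.cos_abs, ← Real.cos_pi_div_three]
    refine Real.cos_le_cos_of_nonneg_of_le_pi (abs_nonneg _) (by linarith) (abs_le.2 ⟨?_, ?_⟩)
    · linarith [mul_le_mul_of_nonneg_left ht.1 hν.le]
    · linarith [mul_le_mul_of_nonneg_left ht.2 hν.le]
  have hpos1 : ∀ t ∈ Set.Ioc 0 t₁, 0 < X t := by
    intro t ht
    have hmono : StrictMonoOn X (Set.Icc 0 t₁) := by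
      refine strictMonoOn_of_deriv_pos (convex_Icc _ _)
        (hcont.mono (Set.Icc_subset_Icc_right (by linarith))) fun s hs => ?_
      rw [interior_Icc] at hs
      rw [(hderiv s ⟨hs.1, by linarith [hs.2]⟩).deriv]
      have h1 := (abs_le.1 (h' s ⟨hs.1.le, by linarith [hs.2]⟩)).1
      have h2 := mul_le_mul_of_nonneg_left (hcos1 s ⟨hs.1.le, hs.2.le⟩) haν.le
      linarith
    rw [← h0]
    exact hmono ⟨le_rfl, ht₁p.le⟩ ⟨ht.1.le, ht.2⟩ ht.1
  have hpos2 : ∀ t ∈ Set.Icc t₁ (2 * t₁), 0 < X t := by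
    intro t ht
    have h1 := (abs_le.1 (h t ⟨by linarith [ht.1], by linarith [ht.2]⟩)).1
    have h2 := mul_le_mul_of_nonneg_left (hsin t ht) ha.le
    linarith
  have hd2 : ∀ s ∈ Set.Ioo (2 * t₁) (4 * t₁), X' s ≤ -(a * ν / 4) := by
    intro s hs
    have h1 := (abs_le.1 (h' s ⟨by linarith [hs.1], by linarith [hs.2]⟩)).2
    have h2 := mul_le_mul_of_nonneg_left (hcos2 s ⟨hs.1.le, hs.2.le⟩) haν.le
    linarith
  have hcont2 : ContinuousOn X (Set.Icc (2 * t₁) (4 * t₁)) :=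
    hcont.mono (Set.Icc_subset_Icc (by linarith) hT4)
  have hderiv2 : ∀ s ∈ Set.Ioo (2 * t₁) (4 * t₁), HasDerivAt X (X' s) s := fun s hs =>
    hderiv s ⟨by linarith [hs.1], by linarith [hs.2]⟩
  have hanti : StrictAntiOn X (Set.Icc (2 * t₁) (4 * t₁)) := by
    refine strictAntiOn_of_deriv_neg (convex_Icc _ _) hcont2 fun s hs => ?_
    rw [interior_Icc] at hs
    rw [(hderiv2 s hs).deriv]
    linarith [hd2 s hs]
  have hend : X (4 * t₁) < 0 := by
    have h1 := (abs_le.1 (h (4 * t₁) ⟨by linarith, hT4⟩)).2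
    have h2 : ν * (4 * t₁) = Real.pi / 3 + Real.pi := by rw [← ht₁ν]; rw [ht₁]; field_simp; ring
    rw [h2, Real.sin_add_pi, Real.sin_pi_div_three] at h1
    have h3 : 1 ≤ √3 := Real.one_le_sqrt.2 (by norm_num)
    have h4 := mul_le_mul_of_nonneg_left h3 ha.le
    linarith
  obtain ⟨τ, hτ, hXτ⟩ := intermediate_value_Icc' (by linarith) hcont2
    (show (0 : ℝ) ∈ Set.Icc (X (4 * t₁)) (X (2 * t₁)) from
      ⟨hend.le, (hpos2 (2 * t₁) ⟨by linarith, le_rfl⟩).le⟩)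
  refine ⟨τ, ⟨by linarith [hτ.1], by linarith [hτ.2]⟩, hXτ, ?_, ?_⟩
  · intro t ht
    rcases le_or_gt t t₁ with h1 | h1
    · exact hpos1 t ⟨ht.1, h1⟩
    · rcases le_or_gt t (2 * t₁) with h2 | h2
      · exact hpos2 t ⟨h1.le, h2⟩
      · rw [← hXτ]
        exact hanti ⟨h2.le, by linarith [hτ.2, ht.2]⟩ hτ ht.2
  · have hm : Real.pi / ν ∈ Set.Icc (2 * t₁) (4 * t₁) := by
      rw [hmid]
      exact ⟨by linarith, by linarith⟩
    have hXm : |X (Real.pi / ν)| ≤ κ := by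
      have h1 := h (Real.pi / ν) ⟨by linarith [hm.1], by linarith [hm.2]⟩
      rwa [mul_div_cancel₀ _ hν.ne', Real.sin_pi, mul_zero, sub_zero] at h1
    -- The slope bound turns the smallness of `X` at `π / ν` into a bound for the distance from `π /
    -- ν` to the zero.
    have key : ∀ s ∈ Set.Icc (2 * t₁) (4 * t₁), ∀ s' ∈ Set.Icc (2 * t₁) (4 * t₁), s ≤ s' →
        a * ν / 4 * (s' - s) ≤ X s - X s' := by
      intro s hs s' hs' hss
      have h1 := Convex.image_sub_le_mul_sub_of_deriv_le (convex_Icc (2 * t₁) (4 * t₁)) hcont2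
        (fun x hx => by
          rw [interior_Icc] at hx
          exact (hderiv2 x hx).differentiableAt.differentiableWithinAt) (C := -(a * ν / 4))
        (fun x hx => by
          rw [interior_Icc] at hx
          rw [(hderiv2 x hx).deriv]
          exact hd2 x hx) s hs s' hs' hss
      linarith
    have h3 := abs_le.1 hXm
    rw [le_div_iff₀ haν]
    rcases le_total τ (Real.pi / ν) with h1 | h1
    · have h2 := key τ hτ _ hm h1
      rw [abs_of_nonpos (by linarith)]
      rw [hXτ] at h2
      linarith
    · have h2 := key _ hm τ hτ h1
      rw [abs_of_nonneg (by linarith)]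
      rw [hXτ] at h2
      linarith

end Perturbation

/-! ### The scaled equations for large momenta -/

section ScaledSystem

variable {d : ℕ} {K : Phase d → ℝ} {D : Set (Coord d × ℝ)}
  {k : Coord d → (Coord d →L[ℝ] ℝ) →L[ℝ] Coord d} {l : Coord d → ℝ}

/-- A smooth function `K(z, r, m, η)` that equals `(⟨k(z) m, m⟩ + l(z) η²) / 2` for `r = 0`, with
positive definite `k(z)` and `l(z) > 0`. -/
structure IsQuadraticBase (K : Phase d → ℝ) (D : Set (Coord d × ℝ))
    (k : Coord d → (Coord d →L[ℝ] ℝ) →L[ℝ] Coord d) (l : Coord d → ℝ) : Prop where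
  isOpen : IsOpen D
  smooth : ContDiffOn ℝ ∞ K {x | (x.1, x.2.1) ∈ D}
  eq : ∀ z m η, (z, (0 : ℝ)) ∈ D → K (z, 0, m, η) = 1 / 2 * (m (k z m) + l z * η ^ 2)
  smooth_k : ContDiffOn ℝ ∞ k {z | (z, (0 : ℝ)) ∈ D}
  smooth_l : ContDiffOn ℝ ∞ l {z | (z, (0 : ℝ)) ∈ D}
  symm : ∀ z, (z, (0 : ℝ)) ∈ D → ∀ m m' : Coord d →L[ℝ] ℝ, m (k z m') = m' (k z m)
  k_pos : ∀ z, (z, (0 : ℝ)) ∈ D → ∀ m : Coord d →L[ℝ] ℝ, m ≠ 0 → 0 < m (k z m)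
  l_pos : ∀ z, (z, (0 : ℝ)) ∈ D → 0 < l z

/-- The derivative of the quadratic form `⟨k(z) m, m⟩` with respect to `z`. -/
def dForm (k : Coord d → (Coord d →L[ℝ] ℝ) →L[ℝ] Coord d) (z : Coord d) (m : Coord d →L[ℝ] ℝ) :
    Coord d →L[ℝ] ℝ := fderiv ℝ (fun z => m (k z m)) z

/-- The frequency `⟨k(z) P, P⟩ ^ (1/2) l(z) ^ (1/2)`. -/
def freq (k : Coord d → (Coord d →L[ℝ] ℝ) →L[ℝ] Coord d) (l : Coord d → ℝ) (z : Coord d)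
    (P : Coord d →L[ℝ] ℝ) : ℝ := √(l z * P (k z P))

/-- The leading term of the displacement during one oscillation. -/
def shift (k : Coord d → (Coord d →L[ℝ] ℝ) →L[ℝ] Coord d) (l : Coord d → ℝ) (z : Coord d)
    (P : Coord d →L[ℝ] ℝ) : Coord d × (Coord d →L[ℝ] ℝ) :=
  ((Real.pi / (freq k l z P * P (k z P))) • k z P,
    -(Real.pi / (2 * freq k l z P)) • ((P (k z P))⁻¹ • dForm k z P + (l z)⁻¹ • fderiv ℝ l z))

/-- The argument of the Hamiltonian in the scaled variables. -/
def scaledArg (y : Phase d × ℝ) : Phase d :=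
  (y.1.1, y.2 * y.1.2.1 ^ 2 / 2, y.1.2.1 • y.1.2.2.1, y.1.2.2.2)

/-- The vector field in the scaled variables, with parameter `μ`. -/
def scaledField (K : Phase d → ℝ) (y : Phase d × ℝ) : Phase d :=
  ((y.2 * y.1.2.1) • partM (fderiv ℝ K (scaledArg y)), partEta (fderiv ℝ K (scaledArg y)),
    -(y.2 • partZ (fderiv ℝ K (scaledArg y))),
    -(y.2 * (y.1.2.1 * partR (fderiv ℝ K (scaledArg y))) +
      y.1.2.2.1 (partM (fderiv ℝ K (scaledArg y)))))

/-- The rate of change of the slow variables and of `ξ`. -/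
def slowField (K : Phase d → ℝ) (y : Phase d × ℝ) : (Coord d × (Coord d →L[ℝ] ℝ)) × ℝ :=
  ((y.1.2.1 • partM (fderiv ℝ K (scaledArg y)), -partZ (fderiv ℝ K (scaledArg y))),
    partEta (fderiv ℝ K (scaledArg y)))

/-- The change from scaled to unscaled variables. -/
def unscale (ε : ℝ) (x : Phase d) : Phase d := (x.1, ε * x.2.1, ε⁻¹ • x.2.2.1, x.2.2.2)

theorem contDiff_scaledArg : ContDiff ℝ ∞ (scaledArg (d := d)) := by
  unfold scaledArg
  fun_prop

theorem foldPhase_unscale {ε : ℝ} (hε : ε ≠ 0) (x : Phase d) :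
    foldPhase (unscale ε x) = scaledArg (x, ε ^ 2) := by
  refine Prod.ext rfl (Prod.ext ?_ (Prod.ext ?_ rfl))
  · simp only [foldPhase, unscale, scaledArg]
    ring
  · simp only [foldPhase, unscale, scaledArg]
    rw [smul_smul, mul_assoc, mul_comm x.2.1, ← mul_assoc, mul_inv_cancel₀ hε, one_mul]

/-- With `t = ε s`, `ξ = ε X`, `p = ε⁻¹ P` the quantities `ξ p = X P` and `ξ² = ε² X²` contain `ε`
only through `μ = ε²`, and so does the field in the time `s`. The variables `z` and `P` acquire a
factor `μ`, while `X` and `η` keep rates of order one. -/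
theorem hasDerivWithinAt_unscale {ε : ℝ} (hε : 0 < ε) {T t : ℝ} {x : ℝ → Phase d}
    (hx : HasDerivWithinAt x (scaledField K (x (t / ε), ε ^ 2)) (Set.Icc 0 T) (t / ε)) :
    HasDerivWithinAt (fun t => unscale ε (x (t / ε))) (dblField K (unscale ε (x (t / ε))))
      (Set.Icc 0 (ε * T)) t := by
  have h1 : HasDerivWithinAt (fun t : ℝ => t / ε) ε⁻¹ (Set.Icc 0 (ε * T)) t := by
    simpa using (hasDerivWithinAt_id t (Set.Icc 0 (ε * T))).div_const ε
  have h2 : HasDerivWithinAt (fun t => x (t / ε))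
      (ε⁻¹ • scaledField K (x (t / ε), ε ^ 2)) (Set.Icc 0 (ε * T)) t :=
    HasDerivWithinAt.scomp (h := fun t : ℝ => t / ε) t hx h1 fun s hs =>
      ⟨div_nonneg hs.1 hε.le, (div_le_iff₀' hε).2 hs.2⟩
  have hs : HasDerivWithinAt (fun t => (x (t / ε)).2)
      (ε⁻¹ • scaledField K (x (t / ε), ε ^ 2)).2 (Set.Icc 0 (ε * T)) t := h2.snd
  have hs' : HasDerivWithinAt (fun t => (x (t / ε)).2.2)
      (ε⁻¹ • scaledField K (x (t / ε), ε ^ 2)).2.2 (Set.Icc 0 (ε * T)) t := hs.snd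
  have hX : HasDerivWithinAt (fun t => (x (t / ε)).2.1)
      (ε⁻¹ • scaledField K (x (t / ε), ε ^ 2)).2.1 (Set.Icc 0 (ε * T)) t := hs.fst
  have hP : HasDerivWithinAt (fun t => (x (t / ε)).2.2.1)
      (ε⁻¹ • scaledField K (x (t / ε), ε ^ 2)).2.2.1 (Set.Icc 0 (ε * T)) t := hs'.fst
  have hη : HasDerivWithinAt (fun t => (x (t / ε)).2.2.2)
      (ε⁻¹ • scaledField K (x (t / ε), ε ^ 2)).2.2.2 (Set.Icc 0 (ε * T)) t := hs'.snd
  have hz : HasDerivWithinAt (fun t => (x (t / ε)).1)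
      (ε⁻¹ • scaledField K (x (t / ε), ε ^ 2)).1 (Set.Icc 0 (ε * T)) t := h2.fst
  have h3 := hz.prodMk ((hX.const_mul ε).prodMk ((hP.const_smul ε⁻¹).prodMk hη))
  refine h3.congr_deriv ?_
  rw [dblField, foldPhase_unscale hε.ne']
  have hε' := hε.ne'
  refine Prod.ext ?_ (Prod.ext ?_ (Prod.ext ?_ ?_))
  · simp only [scaledField, unscale, Prod.smul_mk, smul_smul]
    congr 1
    field_simp
  · simp only [scaledField, Prod.smul_mk, smul_eq_mul]
    field_simp
  · simp only [scaledField, Prod.smul_mk, smul_neg, smul_smul]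
    rw [show ε⁻¹ * (ε⁻¹ * ε ^ 2) = 1 by field_simp, one_smul]
  · simp only [scaledField, unscale, Prod.smul_mk, smul_eq_mul, smul_apply]
    field_simp

namespace IsQuadraticBase

theorem isOpen_base (h : IsQuadraticBase K D k l) : IsOpen {z : Coord d | (z, (0 : ℝ)) ∈ D} :=
  h.isOpen.preimage (by fun_prop)

/-- Each derivative is taken along a line inside `{r = 0}`, where `K` is explicit. The
`r`-derivative is not determined there, but it enters the scaled field only with a factor `μ`. -/
theorem parts (h : IsQuadraticBase K D k l) {z : Coord d} (hz : (z, (0 : ℝ)) ∈ D)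
    (m : Coord d →L[ℝ] ℝ) (η : ℝ) :
    partM (fderiv ℝ K (z, 0, m, η)) = k z m ∧ partEta (fderiv ℝ K (z, 0, m, η)) = l z * η ∧
      partZ (fderiv ℝ K (z, 0, m, η)) = (1 / 2 : ℝ) • (dForm k z m + η ^ 2 • fderiv ℝ l z) := by
  have hopen : IsOpen {x : Phase d | (x.1, x.2.1) ∈ D} := h.isOpen.preimage (by fun_prop)
  have hd : HasFDerivAt K (fderiv ℝ K (z, 0, m, η)) (z, 0, m, η) :=
    ((h.smooth.contDiffAt (hopen.mem_nhds hz)).differentiableAt (by simp)).hasFDerivAt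
  refine ⟨?_, ?_, ?_⟩
  · refine dualVec_eq fun α => ?_
    change fderiv ℝ K (z, 0, m, η) (0, 0, α, 0) = _
    have h1 : HasDerivAt (fun t : ℝ => ((z, 0, m + t • α, η) : Phase d)) (0, 0, α, 0) 0 := by
      refine (hasDerivAt_const (0 : ℝ) z).prodMk ((hasDerivAt_const (0 : ℝ) (0 : ℝ)).prodMk
        (HasDerivAt.prodMk ?_ (hasDerivAt_const (0 : ℝ) η)))
      simpa using ((hasDerivAt_id (0 : ℝ)).smul_const α).const_add m
    have h2 : HasDerivAt (fun t : ℝ => K (z, 0, m + t • α, η))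
        (fderiv ℝ K (z, 0, m, η) (0, 0, α, 0)) 0 :=
      HasFDerivAt.comp_hasDerivAt (l := K) (0 : ℝ) (by simpa using hd) h1
    have h3 : HasDerivAt (fun t : ℝ => 1 / 2 * (m (k z m) + t * (2 * α (k z m)) +
        t ^ 2 * α (k z α) + l z * η ^ 2)) (α (k z m)) 0 := by
      have h4 := (((((hasDerivAt_id (0 : ℝ)).mul_const (2 * α (k z m))).const_add (m (k z m))).add
        (((hasDerivAt_id (0 : ℝ)).pow 2).mul_const (α (k z α)))).add_const (l z * η ^ 2)).const_mul
        (1 / 2 : ℝ)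
      simpa using h4
    refine h2.unique (h3.congr_of_eventuallyEq (Filter.Eventually.of_forall fun t => ?_))
    change K (z, 0, m + t • α, η) = _
    rw [h.eq z _ η hz]
    simp only [map_add, map_smul, add_apply, smul_apply, smul_eq_mul, h.symm z hz m α]
    ring
  · have h1 : HasDerivAt (fun t : ℝ => ((z, 0, m, η + t) : Phase d)) (0, 0, 0, 1) 0 :=
      (hasDerivAt_const (0 : ℝ) z).prodMk ((hasDerivAt_const (0 : ℝ) (0 : ℝ)).prodMk
        ((hasDerivAt_const (0 : ℝ) m).prodMk ((hasDerivAt_id (0 : ℝ)).const_add η)))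
    have h2 : HasDerivAt (fun t : ℝ => K (z, 0, m, η + t))
        (fderiv ℝ K (z, 0, m, η) (0, 0, 0, 1)) 0 :=
      HasFDerivAt.comp_hasDerivAt (l := K) (0 : ℝ) (by simpa using hd) h1
    have h3 : HasDerivAt (fun t : ℝ => 1 / 2 * (m (k z m) + l z * (η + t) ^ 2)) (l z * η) 0 := by
      have h4 := (((((hasDerivAt_id (0 : ℝ)).const_add η).pow 2).const_mul (l z)).const_add
        (m (k z m))).const_mul (1 / 2 : ℝ)
      refine h4.congr_deriv ?_
      simp
      ring
    exact h2.unique (h3.congr_of_eventuallyEq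
      (Filter.Eventually.of_forall fun t => h.eq z m (η + t) hz))
  · ext e
    have h1 : HasDerivAt (fun t : ℝ => z + t • e) e 0 := by
      simpa using ((hasDerivAt_id (0 : ℝ)).smul_const e).const_add z
    have h2 : HasDerivAt (fun t : ℝ => ((z + t • e, 0, m, η) : Phase d)) (e, 0, 0, 0) 0 :=
      h1.prodMk ((hasDerivAt_const (0 : ℝ) (0 : ℝ)).prodMk
        ((hasDerivAt_const (0 : ℝ) m).prodMk (hasDerivAt_const (0 : ℝ) η)))
    have h3 : HasDerivAt (fun t : ℝ => K (z + t • e, 0, m, η))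
        (fderiv ℝ K (z, 0, m, η) (e, 0, 0, 0)) 0 :=
      HasFDerivAt.comp_hasDerivAt (l := K) (0 : ℝ) (by simpa using hd) h2
    have hzn := h.isOpen_base.mem_nhds hz
    have hkd : DifferentiableAt ℝ (fun z => m (k z m)) z :=
      m.differentiableAt.comp z (((h.smooth_k.contDiffAt hzn).differentiableAt (by simp)).clm_apply
        (differentiableAt_const m))
    have hld : DifferentiableAt ℝ l z := (h.smooth_l.contDiffAt hzn).differentiableAt (by simp)
    have h4 : HasDerivAt (fun t : ℝ => m (k (z + t • e) m)) (dForm k z m e) 0 :=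
      HasFDerivAt.comp_hasDerivAt (l := fun z => m (k z m)) (0 : ℝ)
        (by rw [zero_smul, add_zero]; exact hkd.hasFDerivAt) h1
    have h5 : HasDerivAt (fun t : ℝ => l (z + t • e)) (fderiv ℝ l z e) 0 :=
      HasFDerivAt.comp_hasDerivAt (l := l) (0 : ℝ) (by simpa using hld.hasFDerivAt) h1
    have h6 := (h4.add (h5.mul_const (η ^ 2))).const_mul (1 / 2 : ℝ)
    have hev : ∀ᶠ t : ℝ in 𝓝 0, z + t • e ∈ {z : Coord d | (z, (0 : ℝ)) ∈ D} :=
      h1.continuousAt.eventually_mem (by simpa using hzn)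
    have h7 := h3.unique (h6.congr_of_eventuallyEq (hev.mono fun t ht => h.eq _ m η ht))
    rw [partZ]
    refine h7.trans ?_
    simp only [smul_apply, add_apply, smul_eq_mul]
    ring

theorem isOpen_scaled (h : IsQuadraticBase K D k l) :
    IsOpen {y : Phase d × ℝ | (y.1.1, y.2 * y.1.2.1 ^ 2 / 2) ∈ D} :=
  h.isOpen.preimage (by fun_prop)

theorem contDiffOn_fderiv (h : IsQuadraticBase K D k l) :
    ContDiffOn ℝ ∞ (fun y => fderiv ℝ K (scaledArg y))
      {y : Phase d × ℝ | (y.1.1, y.2 * y.1.2.1 ^ 2 / 2) ∈ D} := by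
  have hopen : IsOpen {x : Phase d | (x.1, x.2.1) ∈ D} := h.isOpen.preimage (by fun_prop)
  exact (h.smooth.fderiv_of_isOpen hopen (m := ∞) (by simp)).comp contDiff_scaledArg.contDiffOn
    fun y hy => hy

theorem contDiffOn_scaledField (h : IsQuadraticBase K D k l) :
    ContDiffOn ℝ ∞ (scaledField K)
      {y : Phase d × ℝ | (y.1.1, y.2 * y.1.2.1 ^ 2 / 2) ∈ D} := by
  have h1 := h.contDiffOn_fderiv
  have hM := contDiff_partM.comp_contDiffOn h1
  have hZ := contDiff_partZ.comp_contDiffOn h1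
  have hR : ContDiffOn ℝ ∞ (fun y => partR (fderiv ℝ K (scaledArg y))) _ :=
    h1.clm_apply contDiffOn_const
  have hη : ContDiffOn ℝ ∞ (fun y => partEta (fderiv ℝ K (scaledArg y))) _ :=
    h1.clm_apply contDiffOn_const
  have hμ : ContDiff ℝ ∞ fun y : Phase d × ℝ => y.2 := by fun_prop
  have hX : ContDiff ℝ ∞ fun y : Phase d × ℝ => y.1.2.1 := by fun_prop
  have hP : ContDiff ℝ ∞ fun y : Phase d × ℝ => y.1.2.2.1 := by fun_prop
  exact ((hμ.mul hX).contDiffOn.smul hM).prodMk (hη.prodMk ((hμ.contDiffOn.smul hZ).neg.prodMk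
    ((hμ.contDiffOn.mul (hX.contDiffOn.mul hR)).add (hP.contDiffOn.clm_apply hM)).neg))

theorem contDiffOn_slowField (h : IsQuadraticBase K D k l) :
    ContDiffOn ℝ ∞ (slowField K)
      {y : Phase d × ℝ | (y.1.1, y.2 * y.1.2.1 ^ 2 / 2) ∈ D} := by
  have h1 := h.contDiffOn_fderiv
  have hX : ContDiff ℝ ∞ fun y : Phase d × ℝ => y.1.2.1 := by fun_prop
  have hη : ContDiffOn ℝ ∞ (fun y => partEta (fderiv ℝ K (scaledArg y))) _ :=
    h1.clm_apply contDiffOn_const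
  exact ((hX.contDiffOn.smul (contDiff_partM.comp_contDiffOn h1)).prodMk
    (contDiff_partZ.comp_contDiffOn h1).neg).prodMk hη

end IsQuadraticBase

end ScaledSystem

/-! ### The unperturbed oscillation -/

section Oscillation

variable {d : ℕ} {K : Phase d → ℝ} {D : Set (Coord d × ℝ)}
  {k : Coord d → (Coord d →L[ℝ] ℝ) →L[ℝ] Coord d} {l : Coord d → ℝ}

/-- The solution of the scaled system for `μ = 0`. -/
def oscillation (a b ν : ℝ) (z : Coord d) (P : Coord d →L[ℝ] ℝ) (t : ℝ) : Phase d :=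
  (z, a * Real.sin (ν * t), P, b * Real.cos (ν * t))

/-- An antiderivative of the slow field along an oscillation. -/
def slowPrimitive (k : Coord d → (Coord d →L[ℝ] ℝ) →L[ℝ] Coord d) (l : Coord d → ℝ) (a b ν : ℝ)
    (z : Coord d) (P : Coord d →L[ℝ] ℝ) (t : ℝ) : Coord d × (Coord d →L[ℝ] ℝ) :=
  ((a ^ 2 * (t / 2 - Real.sin (2 * (ν * t)) / (4 * ν))) • k z P,
    -((1 / 2 : ℝ) • ((a ^ 2 * (t / 2 - Real.sin (2 * (ν * t)) / (4 * ν))) • dForm k z P +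
      (b ^ 2 * (t / 2 + Real.sin (2 * (ν * t)) / (4 * ν))) • fderiv ℝ l z)))

theorem dForm_smul (z : Coord d) (c : ℝ) (m : Coord d →L[ℝ] ℝ)
    (hk : DifferentiableAt ℝ (fun z => m (k z m)) z) :
    dForm k z (c • m) = c ^ 2 • dForm k z m := by
  rw [dForm, dForm, ← fderiv_const_smul hk]
  congr 1
  ext z
  simp only [map_smul, smul_apply, smul_eq_mul, Pi.smul_apply]
  ring

theorem hasDerivAt_oscillation (a b ν : ℝ) (z : Coord d) (P : Coord d →L[ℝ] ℝ) (t : ℝ) :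
    HasDerivAt (oscillation a b ν z P)
      (0, a * ν * Real.cos (ν * t), 0, -(b * ν * Real.sin (ν * t))) t := by
  have h1 : HasDerivAt (fun t : ℝ => ν * t) ν t := by
    simpa using (hasDerivAt_id t).const_mul ν
  refine (hasDerivAt_const t z).prodMk (((h1.sin.const_mul a).congr_deriv ?_).prodMk
    ((hasDerivAt_const t P).prodMk ((h1.cos.const_mul b).congr_deriv ?_)))
  · ring
  · ring

theorem hasDerivAt_slowPrimitive {a b ν : ℝ} (hν : ν ≠ 0) (z : Coord d) (P : Coord d →L[ℝ] ℝ)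
    (t : ℝ) : HasDerivAt (slowPrimitive k l a b ν z P)
      ((a * Real.sin (ν * t)) ^ 2 • k z P,
        -((1 / 2 : ℝ) • ((a * Real.sin (ν * t)) ^ 2 • dForm k z P +
          (b * Real.cos (ν * t)) ^ 2 • fderiv ℝ l z))) t := by
  have h1 : HasDerivAt (fun t : ℝ => 2 * (ν * t)) (2 * ν) t := by
    simpa using ((hasDerivAt_id t).const_mul ν).const_mul 2
  have h2 := h1.sin.div_const (4 * ν)
  have h3 := (hasDerivAt_id t).div_const 2
  have hS : HasDerivAt (fun t => a ^ 2 * (t / 2 - Real.sin (2 * (ν * t)) / (4 * ν)))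
      ((a * Real.sin (ν * t)) ^ 2) t := by
    refine ((h3.sub h2).const_mul (a ^ 2)).congr_deriv ?_
    rw [mul_pow, Real.sin_sq, Real.cos_two_mul]
    field_simp
    ring
  have hC : HasDerivAt (fun t => b ^ 2 * (t / 2 + Real.sin (2 * (ν * t)) / (4 * ν)))
      ((b * Real.cos (ν * t)) ^ 2) t := by
    refine ((h3.add h2).const_mul (b ^ 2)).congr_deriv ?_
    rw [mul_pow, Real.cos_two_mul]
    field_simp
    ring
  exact (hS.smul_const _).prodMk
    (((hS.smul_const _).add (hC.smul_const _)).const_smul (1 / 2 : ℝ)).neg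

namespace IsQuadraticBase

theorem slowField_oscillation (h : IsQuadraticBase K D k l) {z : Coord d}
    (hz : (z, (0 : ℝ)) ∈ D) (P : Coord d →L[ℝ] ℝ) (a b ν t : ℝ) :
    slowField K (oscillation a b ν z P t, 0) =
      (((a * Real.sin (ν * t)) ^ 2 • k z P,
        -((1 / 2 : ℝ) • ((a * Real.sin (ν * t)) ^ 2 • dForm k z P +
          (b * Real.cos (ν * t)) ^ 2 • fderiv ℝ l z))), l z * (b * Real.cos (ν * t))) := by
  have harg : scaledArg (oscillation a b ν z P t, 0) =
      (z, 0, (a * Real.sin (ν * t)) • P, b * Real.cos (ν * t)) := by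
    simp [scaledArg, oscillation]
  obtain ⟨h1, h2, h3⟩ := h.parts hz ((a * Real.sin (ν * t)) • P) (b * Real.cos (ν * t))
  have hk : DifferentiableAt ℝ (fun z => P (k z P)) z :=
    P.differentiableAt.comp z (((h.smooth_k.contDiffAt
      (h.isOpen_base.mem_nhds hz)).differentiableAt (by simp)).clm_apply (differentiableAt_const P))
  simp only [slowField, harg, h1, h2, h3, dForm_smul z _ P hk]
  rw [map_smul]
  simp only [oscillation, smul_smul, ← sq]

/-- For `μ = 0` the slow variables are frozen and `X' = l η`, `η' = -⟨k P, P⟩ X`. The hypotheses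
`h₁` and `h₂` match amplitudes and frequency. -/
theorem scaledField_oscillation (h : IsQuadraticBase K D k l) {z : Coord d}
    (hz : (z, (0 : ℝ)) ∈ D) (P : Coord d →L[ℝ] ℝ) {a b ν : ℝ} (h₁ : l z * b = a * ν)
    (h₂ : a * P (k z P) = b * ν) (t : ℝ) :
    scaledField K (oscillation a b ν z P t, 0) =
      (0, a * ν * Real.cos (ν * t), 0, -(b * ν * Real.sin (ν * t))) := by
  have harg : scaledArg (oscillation a b ν z P t, 0) =
      (z, 0, (a * Real.sin (ν * t)) • P, b * Real.cos (ν * t)) := by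
    simp [scaledArg, oscillation]
  obtain ⟨h1, h2, -⟩ := h.parts hz ((a * Real.sin (ν * t)) • P) (b * Real.cos (ν * t))
  simp only [scaledField, harg, h1, h2, map_smul, zero_mul, zero_smul, neg_zero, zero_add]
  refine Prod.ext rfl (Prod.ext ?_ (Prod.ext rfl ?_))
  · simp only [← h₁]
    ring
  · simp only [oscillation, smul_eq_mul, ← h₂]
    ring

/-- The amplitudes are those of energy `1`: `√(2 / l)` is the momentum `η` on `𝓢⁺`, and `√(2 / ⟨k P,
P⟩)` is the value of `X` at which `η = 0`. -/
theorem amplitudes (h : IsQuadraticBase K D k l) {z : Coord d} (hz : (z, (0 : ℝ)) ∈ D)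
    {P : Coord d →L[ℝ] ℝ} (hP : P ≠ 0) :
    0 < freq k l z P ∧ l z * √(2 / l z) = √(2 / P (k z P)) * freq k l z P ∧
      √(2 / P (k z P)) * P (k z P) = √(2 / l z) * freq k l z P := by
  have hl := h.l_pos z hz
  have hk := h.k_pos z hz P hP
  have hν : freq k l z P ^ 2 = l z * P (k z P) := Real.sq_sqrt (mul_pos hl hk).le
  have hν0 : 0 < freq k l z P := Real.sqrt_pos.2 (mul_pos hl hk)
  have ha := Real.sq_sqrt (div_nonneg zero_le_two hk.le)
  have hb := Real.sq_sqrt (div_nonneg zero_le_two hl.le)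
  refine ⟨hν0, ?_, ?_⟩
  · refine (sq_eq_sq₀ (by positivity) (by positivity)).1 ?_
    rw [mul_pow, mul_pow, ha, hb, hν]
    field_simp
  · refine (sq_eq_sq₀ (by positivity) (by positivity)).1 ?_
    rw [mul_pow, mul_pow, ha, hb, hν]
    field_simp

/-- Over a half period `sin²` and `cos²` both have mean `1 / 2`, and the periodic parts of the
primitive vanish at both ends. -/
theorem slowPrimitive_sub (h : IsQuadraticBase K D k l) {z : Coord d} (hz : (z, (0 : ℝ)) ∈ D)
    {P : Coord d →L[ℝ] ℝ} (hP : P ≠ 0) :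
    slowPrimitive k l √(2 / P (k z P)) √(2 / l z) (freq k l z P) z P (Real.pi / freq k l z P) -
      slowPrimitive k l √(2 / P (k z P)) √(2 / l z) (freq k l z P) z P 0 = shift k l z P := by
  have hl := h.l_pos z hz
  have hk := h.k_pos z hz P hP
  have hν := (h.amplitudes hz hP).1
  have ha := Real.sq_sqrt (div_nonneg zero_le_two hk.le)
  have hb := Real.sq_sqrt (div_nonneg zero_le_two hl.le)
  have h1 : freq k l z P * (Real.pi / freq k l z P) = Real.pi := mul_div_cancel₀ _ hν.ne'
  simp only [slowPrimitive, h1, ha, hb, Real.sin_two_pi, mul_zero, Real.sin_zero, zero_div,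
    sub_zero, add_zero, zero_smul, smul_zero, neg_zero, shift]
  refine Prod.ext ?_ ?_
  · simp only [Prod.fst_sub, sub_zero]
    congr 1
    field_simp
  · simp only [Prod.snd_sub, sub_zero, smul_add, smul_smul, neg_add]
    congr 2
    · refine (neg_smul _ _).symm.trans ?_
      congr 1
      field_simp
    · refine (neg_smul _ _).symm.trans ?_
      congr 1
      field_simp

end IsQuadraticBase

end Oscillation

/-! ### The first return and its displacement -/

section Return

variable {d : ℕ} {K : Phase d → ℝ} {D : Set (Coord d × ℝ)}
  {k : Coord d → (Coord d →L[ℝ] ℝ) →L[ℝ] Coord d} {l : Coord d → ℝ}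

namespace IsQuadraticBase

theorem continuousOn_form (h : IsQuadraticBase K D k l) :
    ContinuousOn (fun y : Coord d × (Coord d →L[ℝ] ℝ) => y.2 (k y.1 y.2))
      {y | (y.1, (0 : ℝ)) ∈ D} :=
  continuousOn_snd.clm_apply ((h.smooth_k.continuousOn.comp continuousOn_fst
    fun y hy => hy).clm_apply continuousOn_snd)

theorem continuousOn_l (h : IsQuadraticBase K D k l) :
    ContinuousOn (fun y : Coord d × (Coord d →L[ℝ] ℝ) => l y.1) {y | (y.1, (0 : ℝ)) ∈ D} :=
  h.smooth_l.continuousOn.comp continuousOn_fst fun y hy => hy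

/-- The amplitudes and the frequency are bounded, and bounded away from zero, on compact sets. -/
theorem exists_bound (h : IsQuadraticBase K D k l) {B : Set (Coord d)} (hB : IsCompact B)
    (hBD : ∀ z ∈ B, (z, (0 : ℝ)) ∈ D) :
    ∃ A > 0, ∀ z ∈ B, ∀ P : Coord d →L[ℝ] ℝ, ‖P‖ = 1 →
      √(2 / P (k z P)) ≤ A ∧ √(2 / l z) ≤ A ∧ (freq k l z P)⁻¹ ≤ A ∧ A⁻¹ ≤ √(2 / P (k z P)) ∧
      A⁻¹ ≤ √(2 / P (k z P)) * freq k l z P := by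
  set S : Set (Coord d × (Coord d →L[ℝ] ℝ)) := B ×ˢ Metric.sphere 0 1
  have hS : IsCompact S := hB.prod (isCompact_sphere _ _)
  have hk := h.continuousOn_form.mono (fun y hy => hBD y.1 hy.1 : S ⊆ _)
  have hl := h.continuousOn_l.mono (fun y hy => hBD y.1 hy.1 : S ⊆ _)
  have hP0 : ∀ y ∈ S, y.2 ≠ 0 := fun y hy => ne_zero_of_mem_unit_sphere ⟨y.2, hy.2⟩
  have hk0 : ∀ y ∈ S, 0 < y.2 (k y.1 y.2) := fun y hy => h.k_pos _ (hBD _ hy.1) _ (hP0 y hy)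
  have hl0 : ∀ y ∈ S, 0 < l y.1 := fun y hy => h.l_pos _ (hBD _ hy.1)
  have hν0 : ∀ y ∈ S, 0 < freq k l y.1 y.2 := fun y hy =>
    Real.sqrt_pos.2 (mul_pos (hl0 y hy) (hk0 y hy))
  have ha0 : ∀ y ∈ S, 0 < √(2 / y.2 (k y.1 y.2)) := fun y hy =>
    Real.sqrt_pos.2 (div_pos two_pos (hk0 y hy))
  have hν : ContinuousOn (fun y : Coord d × (Coord d →L[ℝ] ℝ) => freq k l y.1 y.2) S :=
    (hl.mul hk).sqrt
  have ha : ContinuousOn (fun y : Coord d × (Coord d →L[ℝ] ℝ) => √(2 / y.2 (k y.1 y.2))) S :=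
    (continuousOn_const.div hk fun y hy => (hk0 y hy).ne').sqrt
  have hb : ContinuousOn (fun y : Coord d × (Coord d →L[ℝ] ℝ) => √(2 / l y.1)) S :=
    (continuousOn_const.div hl fun y hy => (hl0 y hy).ne').sqrt
  obtain ⟨A₁, h₁⟩ := hS.exists_bound_of_continuousOn ha
  obtain ⟨A₂, h₂⟩ := hS.exists_bound_of_continuousOn hb
  obtain ⟨A₃, h₃⟩ := hS.exists_bound_of_continuousOn (hν.inv₀ fun y hy => (hν0 y hy).ne')
  obtain ⟨A₄, h₄⟩ := hS.exists_bound_of_continuousOn (ha.inv₀ fun y hy => (ha0 y hy).ne')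
  obtain ⟨A₅, h₅⟩ := hS.exists_bound_of_continuousOn ((ha.mul hν).inv₀ fun y hy =>
    (mul_pos (ha0 y hy) (hν0 y hy)).ne')
  set A := max 1 (max (max A₁ A₂) (max A₃ (max A₄ A₅))) with hA
  have hA0 : 0 < A := lt_of_lt_of_le one_pos (le_max_left _ _)
  have e₁ : A₁ ≤ A := by simp [hA]
  have e₂ : A₂ ≤ A := by simp [hA]
  have e₃ : A₃ ≤ A := by simp [hA]
  have e₄ : A₄ ≤ A := by simp [hA]
  have e₅ : A₅ ≤ A := by simp [hA]
  refine ⟨A, hA0, fun z hz P hP => ?_⟩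
  have hy : (z, P) ∈ S := ⟨hz, by simpa using hP⟩
  refine ⟨(le_abs_self _).trans ((h₁ _ hy).trans e₁), (le_abs_self _).trans ((h₂ _ hy).trans e₂),
    (le_abs_self _).trans ((h₃ _ hy).trans e₃), inv_le_of_inv_le₀ (ha0 _ hy)
    ((le_abs_self _).trans ((h₄ _ hy).trans e₄)), inv_le_of_inv_le₀ (mul_pos (ha0 _ hy) (hν0 _ hy))
    ((le_abs_self _).trans ((h₅ _ hy).trans e₅))⟩

set_option maxHeartbeats 1000000 in
/-- The first return to `X = 0` of the scaled system, and the displacement of the slow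
variables. -/
theorem exists_return_scaled (h : IsQuadraticBase K D k l) {B : Set (Coord d)} (hB : IsCompact B)
    (hBD : ∀ z ∈ B, (z, (0 : ℝ)) ∈ D) :
    ∃ μ₀ > 0, ∃ C : ℝ, ∀ μ ∈ Set.Icc 0 μ₀, ∀ z ∈ B, ∀ P : Coord d →L[ℝ] ℝ, ‖P‖ = 1 →
      ∃ τ > 0, ∃ y : ℝ → Phase d, y 0 = (z, 0, P, √(2 / l z)) ∧
        (∀ t ∈ Set.Icc 0 τ, ((y t).1, μ * (y t).2.1 ^ 2 / 2) ∈ D ∧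
          HasDerivWithinAt y (scaledField K (y t, μ)) (Set.Icc 0 τ) t) ∧
        (∀ t ∈ Set.Ioo 0 τ, 0 < (y t).2.1) ∧ (y τ).2.1 = 0 ∧
        ‖((y τ).1, (y τ).2.2.1) - (z, P) - μ • shift k l z P‖ ≤ C * μ ^ 2 := by
  obtain ⟨A, hA, hbd⟩ := h.exists_bound hB hBD
  -- Since `A` bounds `ν⁻¹`, this time contains the phases up to `4 π / 3` required by
  -- `exists_first_zero`, for every frequency.
  set T := 4 * Real.pi / 3 * A
  have hT : 0 ≤ T := by have := Real.pi_pos; positivity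
  set Kc : Set (Phase d) := B ×ˢ Metric.closedBall 0 A ×ˢ Metric.sphere 0 1 ×ˢ Metric.closedBall 0 A
  have hKc : IsCompact Kc := hB.prod ((isCompact_closedBall _ _).prod
    ((isCompact_sphere _ _).prod (isCompact_closedBall _ _)))
  have hKU : ∀ x ∈ Kc, (x, (0 : ℝ)) ∈ {y : Phase d × ℝ | (y.1.1, y.2 * y.1.2.1 ^ 2 / 2) ∈ D} := by
    intro x hx
    simpa using hBD x.1 hx.1
  obtain ⟨μ₀, hμ₀, C, hC, hpert⟩ := exists_perturbation hKc h.isOpen_scaled hKU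
    (h.contDiffOn_scaledField.of_le (by simp)) (h.contDiffOn_slowField.of_le (by simp)) hT
  obtain ⟨CF, hCF⟩ := hKc.exists_bound_of_continuousOn (f := fun x => slowField K (x, 0))
    (h.contDiffOn_slowField.continuousOn.comp (Continuous.prodMk_left (0 : ℝ)).continuousOn hKU)
  -- The second bound makes the deviation `C μ` small compared with `A⁻¹`, a lower bound for `a` and
  -- `a ν`, as `exists_first_zero` requires. In the final constant, `C T` stems from the deviation
  -- of the slow rates and `CF (4 C A)` from the change of the return time.
  refine ⟨min μ₀ (1 / (4 * A * (C + 1))), lt_min hμ₀ (by positivity),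
    C * T + CF * (4 * C * A), ?_⟩
  intro μ hμ z hz P hP
  have hzD := hBD z hz
  have hP0 : P ≠ 0 := by
    rintro rfl
    simp at hP
  obtain ⟨b₁, b₂, b₃, b₄, b₅⟩ := hbd z hz P hP
  obtain ⟨hν, h₁, h₂⟩ := h.amplitudes hzD hP0
  have hprim := h.slowPrimitive_sub hzD hP0
  set a := √(2 / P (k z P))
  set b := √(2 / l z)
  set ν := freq k l z P
  have ha : 0 < a := lt_of_lt_of_le (inv_pos.2 hA) b₄
  have hb : 0 ≤ b := Real.sqrt_nonneg _
  have hTν : 4 * Real.pi / (3 * ν) ≤ T := by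
    have := mul_le_mul_of_nonneg_left b₃ (by have := Real.pi_pos; positivity :
      0 ≤ 4 * Real.pi / 3)
    refine le_trans (le_of_eq ?_) this
    field_simp
  have hosc : ∀ t, oscillation a b ν z P t ∈ Kc := by
    intro t
    refine ⟨hz, ?_, mem_sphere_zero_iff_norm.2 hP, ?_⟩
    · rw [mem_closedBall_zero_iff, oscillation, Real.norm_eq_abs, abs_mul, abs_of_pos ha]
      nlinarith [Real.abs_sin_le_one (ν * t), abs_nonneg (Real.sin (ν * t))]
    · rw [mem_closedBall_zero_iff, oscillation, Real.norm_eq_abs, abs_mul, abs_of_nonneg hb]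
      nlinarith [Real.abs_cos_le_one (ν * t), abs_nonneg (Real.cos (ν * t))]
  obtain ⟨y, hy0, hy⟩ := hpert μ ⟨hμ.1, hμ.2.trans (min_le_left _ _)⟩ (oscillation a b ν z P)
    fun t ht => ⟨hosc t, by
      rw [h.scaledField_oscillation hzD P h₁ h₂]
      exact (hasDerivAt_oscillation a b ν z P t).hasDerivWithinAt⟩
  have hslow := fun t => h.slowField_oscillation hzD P a b ν t
  have hκ : C * μ ≤ A⁻¹ / 4 := by
    have h1 := hμ.2.trans (min_le_right _ _)
    have h2 : (C + 1) * μ ≤ A⁻¹ / 4 := by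
      refine (mul_le_mul_of_nonneg_left h1 (by linarith)).trans (le_of_eq ?_)
      field_simp
    linarith [hμ.1]
  have hA' : 0 < A⁻¹ := inv_pos.2 hA
  obtain ⟨τ, hτ, hXτ, hpos, hτν⟩ := exists_first_zero (X := fun t => (y t).2.1)
    (X' := fun t => partEta (fderiv ℝ K (scaledArg (y t, μ)))) (a := a) (ν := ν) (κ := C * μ)
    (T := T) ha hν hTν (by linarith) (by linarith) (by rw [hy0]; simp [oscillation])
    (fun t ht => by
      have h3 : HasDerivWithinAt (fun t => (y t).2) (scaledField K (y t, μ)).2 (Set.Icc 0 T) t :=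
        (hy t ht).2.1.snd
      exact h3.fst)
    (fun t ht => by
      have h3 := (hy t ht).2.2.1
      exact ((norm_fst_le _).trans (norm_snd_le _)).trans h3)
    (fun t ht => by
      have h3 := (norm_snd_le _).trans (hy t ht).2.2.2
      rw [hslow] at h3
      have h4 : l z * (b * Real.cos (ν * t)) = a * ν * Real.cos (ν * t) := by rw [← h₁]; ring
      change |partEta (fderiv ℝ K (scaledArg (y t, μ))) - l z * (b * Real.cos (ν * t))| ≤ _ at h3
      rwa [h4] at h3)
  have hsub : Set.Icc 0 τ ⊆ Set.Icc 0 T := Set.Icc_subset_Icc_right hτ.2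
  refine ⟨τ, hτ.1, y, by rw [hy0]; simp [oscillation],
    fun t ht => ⟨(hy t (hsub ht)).1, (hy t (hsub ht)).2.1.mono hsub⟩, hpos, hXτ, ?_⟩
  -- The slow variables carry a factor `μ` and their rates deviate from those along the oscillation
  -- by `C μ`, so replacing one by the other costs second order.
  have hinc := norm_increment_le (T := T) (μ := μ) (c := C * μ) hμ.1
    (z := fun t => ((y t).1, (y t).2.2.1)) (F := fun t => (slowField K (y t, μ)).1)
    (z₁ := slowPrimitive k l a b ν z P)
    (F₁ := fun t => (slowField K (oscillation a b ν z P t, 0)).1)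
    (fun t ht => by
      have h3 : HasDerivWithinAt (fun t => (y t).2) (scaledField K (y t, μ)).2 (Set.Icc 0 T) t :=
        (hy t ht).2.1.snd
      have h4 : HasDerivWithinAt (fun t => (y t).2.2) (scaledField K (y t, μ)).2.2
        (Set.Icc 0 T) t := h3.snd
      have h5 : HasDerivWithinAt (fun t => (y t).2.2.1) (scaledField K (y t, μ)).2.2.1
        (Set.Icc 0 T) t := h4.fst
      have h6 : HasDerivWithinAt (fun t => (y t).1) (scaledField K (y t, μ)).1
        (Set.Icc 0 T) t := (hy t ht).2.1.fst
      refine (h6.prodMk h5).congr_deriv ?_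
      simp only [scaledField, slowField, Prod.smul_mk, smul_smul, smul_neg])
    (fun t ht => by
      rw [hslow]
      exact (hasDerivAt_slowPrimitive hν.ne' z P t).hasDerivWithinAt)
    (fun t ht => (norm_fst_le _).trans (hy t ht).2.2.2) ⟨hτ.1.le, hτ.2⟩
  have hm : Real.pi / ν ∈ Set.Icc 0 T := by
    have hπ := Real.pi_pos
    refine ⟨by positivity, le_trans ?_ hTν⟩
    rw [div_le_div_iff₀ hν (by positivity)]
    nlinarith [mul_pos hπ hν]
  -- Moving the end from `τ` to `π / ν` changes the primitive by `O(μ)`, and the displacement has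
  -- another factor `μ`.
  have hmv : ‖slowPrimitive k l a b ν z P τ - slowPrimitive k l a b ν z P (Real.pi / ν)‖ ≤
      CF * |τ - Real.pi / ν| := by
    refine (convex_univ).norm_image_sub_le_of_norm_hasDerivWithin_le
      (f' := fun t => (slowField K (oscillation a b ν z P t, 0)).1) (fun t _ => ?_)
      (fun t _ => (norm_fst_le _).trans (hCF _ (hosc t))) (Set.mem_univ _) (Set.mem_univ _)
    rw [hslow]
    exact (hasDerivAt_slowPrimitive hν.ne' z P t).hasDerivWithinAt
  have hCF0 : 0 ≤ CF := (norm_nonneg _).trans (hCF _ (hosc 0))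
  have hτ' : |τ - Real.pi / ν| ≤ 4 * C * A * μ := by
    refine hτν.trans ?_
    have h5 : (a * ν)⁻¹ ≤ A := inv_le_of_inv_le₀ hA b₅
    rw [div_eq_mul_inv]
    have h6 := mul_le_mul_of_nonneg_left h5 (by have := hμ.1; positivity : 0 ≤ 4 * (C * μ))
    linarith
  have hy0' : ((y 0).1, (y 0).2.2.1) = (z, P) := by rw [hy0]; rfl
  simp only [hy0'] at hinc
  have hsplit : ((y τ).1, (y τ).2.2.1) - (z, P) - μ • shift k l z P =
      (((y τ).1, (y τ).2.2.1) - (z, P) - μ • (slowPrimitive k l a b ν z P τ -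
        slowPrimitive k l a b ν z P 0)) + μ • (slowPrimitive k l a b ν z P τ -
          slowPrimitive k l a b ν z P (Real.pi / ν)) := by
    rw [← hprim, smul_sub, smul_sub, smul_sub]
    abel
  rw [hsplit]
  refine (norm_add_le _ _).trans ?_
  rw [norm_smul, Real.norm_of_nonneg hμ.1]
  have h7 : μ * (C * μ) * τ ≤ μ * (C * μ) * T :=
    mul_le_mul_of_nonneg_left hτ.2 (by have := hμ.1; positivity)
  have h8 : μ * ‖slowPrimitive k l a b ν z P τ - slowPrimitive k l a b ν z P (Real.pi / ν)‖ ≤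
      μ * (CF * (4 * C * A * μ)) :=
    mul_le_mul_of_nonneg_left (hmv.trans (mul_le_mul_of_nonneg_left hτ' hCF0)) hμ.1
  have h9 := hinc.trans h7
  linarith

/-- The first return to `ξ = 0`. -/
theorem exists_return (h : IsQuadraticBase K D k l) {B : Set (Coord d)} (hB : IsCompact B)
    (hBD : ∀ z ∈ B, (z, (0 : ℝ)) ∈ D) :
    ∃ ε₀ > 0, ∃ C : ℝ, ∀ ε, 0 < ε → ε ≤ ε₀ → ∀ z ∈ B, ∀ P : Coord d →L[ℝ] ℝ, ‖P‖ = 1 →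
      ∃ τ > 0, ∃ y : ℝ → Phase d, y 0 = (z, 0, ε⁻¹ • P, √(2 / l z)) ∧
        (∀ t ∈ Set.Icc 0 τ, ((y t).1, (y t).2.1 ^ 2 / 2) ∈ D ∧
          HasDerivWithinAt y (dblField K (y t)) (Set.Icc 0 τ) t) ∧
        (∀ t ∈ Set.Ioo 0 τ, 0 < (y t).2.1) ∧ (y τ).2.1 = 0 ∧
        ‖((y τ).1, ε • (y τ).2.2.1) - (z, P) - ε ^ 2 • shift k l z P‖ ≤ C * ε ^ 4 := by
  obtain ⟨μ₀, hμ₀, C, hret⟩ := h.exists_return_scaled hB hBD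
  refine ⟨√μ₀, Real.sqrt_pos.2 hμ₀, C, fun ε hε hεμ z hz P hP => ?_⟩
  have hμ : ε ^ 2 ≤ μ₀ := (Real.le_sqrt hε.le hμ₀.le).1 hεμ
  obtain ⟨τ, hτ, y, hy0, hy, hpos, hyτ, hsh⟩ := hret (ε ^ 2) ⟨sq_nonneg ε, hμ⟩ z hz P hP
  have hετ : ε * τ / ε = τ := by field_simp
  have hmem : ∀ t ∈ Set.Icc 0 (ε * τ), t / ε ∈ Set.Icc 0 τ := fun t ht =>
    ⟨div_nonneg ht.1 hε.le, (div_le_iff₀' hε).2 ht.2⟩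
  refine ⟨ε * τ, mul_pos hε hτ, fun t => unscale ε (y (t / ε)), ?_, fun t ht => ⟨?_, ?_⟩, ?_, ?_, ?_⟩
  · simp [hy0, unscale]
  · have h1 := (hy _ (hmem t ht)).1
    simp only [unscale]
    rwa [mul_pow]
  · exact hasDerivWithinAt_unscale hε (hy _ (hmem t ht)).2
  · intro t ht
    exact mul_pos hε (hpos _ ⟨div_pos ht.1 hε, (div_lt_iff₀' hε).2 ht.2⟩)
  · simp only [unscale, hετ, hyτ, mul_zero]
  · simp only [unscale, hετ, smul_smul, mul_inv_cancel₀ hε.ne', one_smul]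
    calc _ ≤ C * (ε ^ 2) ^ 2 := hsh
      _ = C * ε ^ 4 := by ring

end IsQuadraticBase

end Return

/-! ### Hamiltonian fields under sums and scaling of the momentum -/

section HamiltonField

variable {F : Type*} [NormedAddCommGroup F] [NormedSpace ℝ F] [FiniteDimensional ℝ F]

theorem hamField_add {f g : F × (F →L[ℝ] ℝ) → ℝ} {y : F × (F →L[ℝ] ℝ)}
    (hf : DifferentiableAt ℝ f y) (hg : DifferentiableAt ℝ g y) :
    hamField (fun y => f y + g y) y = hamField f y + hamField g y := by
  rw [hamField, fderiv_fun_add hf hg, hamField, hamField]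
  refine Prod.ext ?_ ?_
  · simp only [ContinuousLinearMap.add_comp, map_add, Prod.fst_add]
  · simp only [ContinuousLinearMap.add_comp, Prod.snd_add, neg_add]

/-- Only the derivative in the momentum picks up the inner factor `ε`. For homogeneous Hamiltonians
`c` is the power of `ε` given by the degree. -/
theorem hamField_scale {f g : F × (F →L[ℝ] ℝ) → ℝ} {z : F} {w : F →L[ℝ] ℝ} {c ε : ℝ}
    (hf : DifferentiableAt ℝ f (z, ε • w))
    (hg : ∀ᶠ y in 𝓝 (z, w), g y = c * f (y.1, ε • y.2)) :
    hamField g (z, w) = ((c * ε) • (hamField f (z, ε • w)).1, c • (hamField f (z, ε • w)).2) := by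
  have h1 : HasFDerivAt (fun y : F × (F →L[ℝ] ℝ) => (y.1, ε • y.2))
      ((ContinuousLinearMap.fst ℝ F (F →L[ℝ] ℝ)).prod
        (ε • ContinuousLinearMap.snd ℝ F (F →L[ℝ] ℝ))) (z, w) :=
    (ContinuousLinearMap.fst ℝ F (F →L[ℝ] ℝ)).hasFDerivAt.prodMk
      (ε • ContinuousLinearMap.snd ℝ F (F →L[ℝ] ℝ)).hasFDerivAt
  have h2 := (HasFDerivAt.comp (g := f) (z, w) hf.hasFDerivAt h1).const_mul c
  have h3 := (h2.congr_of_eventuallyEq hg).fderiv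
  rw [hamField, h3, hamField]
  refine Prod.ext ?_ ?_
  · refine dualVec_eq fun α => ?_
    rw [map_smul, apply_dualVec]
    simp only [ContinuousLinearMap.comp_apply, smul_apply, ContinuousLinearMap.prod_apply,
      ContinuousLinearMap.inr_apply, ContinuousLinearMap.coe_fst', ContinuousLinearMap.coe_snd',
      smul_eq_mul]
    rw [show ((0 : F), ε • α) = ε • (0, α) by simp, map_smul, smul_eq_mul, mul_assoc]
  · ext e
    simp

end HamiltonField

/-! ### The flow of the averaged Hamiltonian at large momenta -/

section SlowFlow

variable {d : ℕ} {K : Phase d → ℝ} {D : Set (Coord d × ℝ)}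
  {k : Coord d → (Coord d →L[ℝ] ℝ) →L[ℝ] Coord d} {l : Coord d → ℝ}
  {C₁ : Coord d → (Coord d →L[ℝ] ℝ) →L[ℝ] Coord d}

/-- The leading term of the averaged Hamiltonian. -/
def leadN (k : Coord d → (Coord d →L[ℝ] ℝ) →L[ℝ] Coord d) (l : Coord d → ℝ)
    (y : Coord d × (Coord d →L[ℝ] ℝ)) : ℝ := -(l y.1 * y.2 (k y.1 y.2)) ^ (-(1 / 2) : ℝ)

/-- The correction term of the averaged Hamiltonian. -/
def corrN (k : Coord d → (Coord d →L[ℝ] ℝ) →L[ℝ] Coord d) (l : Coord d → ℝ)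
    (C₁ : Coord d → (Coord d →L[ℝ] ℝ) →L[ℝ] Coord d) (y : Coord d × (Coord d →L[ℝ] ℝ)) : ℝ :=
  3 / 8 * (y.2 (C₁ y.1 y.2) * (l y.1 * y.2 (k y.1 y.2)) ^ (-(5 / 2) : ℝ))

namespace IsQuadraticBase

theorem isOpen_ne_zero (h : IsQuadraticBase K D k l) :
    IsOpen {y : Coord d × (Coord d →L[ℝ] ℝ) | (y.1, (0 : ℝ)) ∈ D ∧ y.2 ≠ 0} :=
  (h.isOpen_base.preimage continuous_fst).inter (isOpen_ne_fun continuous_snd continuous_const)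

theorem form_pos (h : IsQuadraticBase K D k l) {y : Coord d × (Coord d →L[ℝ] ℝ)}
    (hy : (y.1, (0 : ℝ)) ∈ D ∧ y.2 ≠ 0) : 0 < l y.1 * y.2 (k y.1 y.2) :=
  mul_pos (h.l_pos _ hy.1) (h.k_pos _ hy.1 _ hy.2)

theorem contDiffOn_form (h : IsQuadraticBase K D k l) :
    ContDiffOn ℝ ∞ (fun y : Coord d × (Coord d →L[ℝ] ℝ) => l y.1 * y.2 (k y.1 y.2))
      {y | (y.1, (0 : ℝ)) ∈ D ∧ y.2 ≠ 0} :=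
  (h.smooth_l.comp contDiffOn_fst fun _ hy => hy.1).mul (contDiffOn_snd.clm_apply
    ((h.smooth_k.comp contDiffOn_fst fun _ hy => hy.1).clm_apply contDiffOn_snd))

theorem contDiffOn_leadN (h : IsQuadraticBase K D k l) :
    ContDiffOn ℝ ∞ (leadN k l) {y | (y.1, (0 : ℝ)) ∈ D ∧ y.2 ≠ 0} :=
  (h.contDiffOn_form.rpow_const_of_ne fun _ hy => (h.form_pos hy).ne').neg

theorem contDiffOn_corrN (h : IsQuadraticBase K D k l)
    (hC : ContDiffOn ℝ ∞ C₁ {z | (z, (0 : ℝ)) ∈ D}) :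
    ContDiffOn ℝ ∞ (corrN k l C₁) {y | (y.1, (0 : ℝ)) ∈ D ∧ y.2 ≠ 0} :=
  contDiffOn_const.mul ((contDiffOn_snd.clm_apply ((hC.comp contDiffOn_fst
    fun _ hy => hy.1).clm_apply contDiffOn_snd)).mul
      (h.contDiffOn_form.rpow_const_of_ne fun _ hy => (h.form_pos hy).ne'))

theorem contDiffOn_hamField {f : Coord d × (Coord d →L[ℝ] ℝ) → ℝ}
    {R : Set (Coord d × (Coord d →L[ℝ] ℝ))} (hR : IsOpen R) (hf : ContDiffOn ℝ ∞ f R) :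
    ContDiffOn ℝ 1 (hamField f) R := fun y hy =>
  (contDiffAt_hamField ((hf.contDiffAt (hR.mem_nhds hy)).of_le
    (WithTop.coe_le_coe.2 le_top))).contDiffWithinAt

theorem leadN_scale (h : IsQuadraticBase K D k l) {y : Coord d × (Coord d →L[ℝ] ℝ)}
    (hy : (y.1, (0 : ℝ)) ∈ D ∧ y.2 ≠ 0) {ε : ℝ} (hε : 0 < ε) :
    leadN k l y = ε * leadN k l (y.1, ε • y.2) := by
  have hQ := h.form_pos hy
  simp only [leadN, map_smul, smul_apply, smul_eq_mul]
  rw [show l y.1 * (ε * (ε * y.2 (k y.1 y.2))) = ε ^ 2 * (l y.1 * y.2 (k y.1 y.2)) by ring,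
    Real.mul_rpow (by positivity) hQ.le, ← Real.rpow_natCast_mul hε.le]
  norm_num [Real.rpow_neg_one]
  field_simp

/-- The degree in the momentum is `2 - 5 = -3`, two less than for the leading term. Hence the
correction changes the flow in the variables `(z, ε p)` only at order `ε⁴`. -/
theorem corrN_scale (h : IsQuadraticBase K D k l) {y : Coord d × (Coord d →L[ℝ] ℝ)}
    (hy : (y.1, (0 : ℝ)) ∈ D ∧ y.2 ≠ 0) {ε : ℝ} (hε : 0 < ε) :
    corrN k l C₁ y = ε ^ 3 * corrN k l C₁ (y.1, ε • y.2) := by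
  have hQ := h.form_pos hy
  simp only [corrN, map_smul, smul_apply, smul_eq_mul]
  rw [show l y.1 * (ε * (ε * y.2 (k y.1 y.2))) = ε ^ 2 * (l y.1 * y.2 (k y.1 y.2)) by ring,
    Real.mul_rpow (by positivity) hQ.le, ← Real.rpow_natCast_mul hε.le]
  have h1 : ε ^ (((2 : ℕ) : ℝ) * -(5 / 2)) = (ε ^ 5)⁻¹ := by
    rw [show ((2 : ℕ) : ℝ) * -(5 / 2) = -((5 : ℕ) : ℝ) by norm_num, Real.rpow_neg hε.le,
      Real.rpow_natCast]
  rw [h1]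
  field_simp

/-- The frozen oscillator of frequency `ν` has energy `ν J`, where `J` is its action. At energy `1`
the slow variables follow on average the field `J X_ν`, with `J = 1 / ν`, during the half period `π
/ ν`. The displacement `π ν⁻² X_ν` is `π` times the Hamiltonian field of `-1/ν`, and `ν² = l ⟨k P,
P⟩`. The proof checks the identity by direct differentiation. -/
theorem pi_smul_hamField_leadN (h : IsQuadraticBase K D k l) {z : Coord d}
    (hz : (z, (0 : ℝ)) ∈ D) {P : Coord d →L[ℝ] ℝ} (hP : P ≠ 0) :
    Real.pi • hamField (leadN k l) (z, P) = shift k l z P := by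
  have hzn := h.isOpen_base.mem_nhds hz
  have hl := h.l_pos z hz
  have hk := h.k_pos z hz P hP
  have hQ : 0 < l z * P (k z P) := mul_pos hl hk
  have hν := (h.amplitudes hz hP).1
  have hνQ : freq k l z P ^ 2 = l z * P (k z P) := Real.sq_sqrt hQ.le
  have hkd := ((h.smooth_k.contDiffAt hzn).differentiableAt (by simp)).hasFDerivAt
  have hld := ((h.smooth_l.contDiffAt hzn).differentiableAt (by simp)).hasFDerivAt
  have hdF : ∀ e, dForm k z P e = P (fderiv ℝ k z e P) := by
    intro e
    have h1 := P.hasFDerivAt.comp z (hkd.clm_apply (hasFDerivAt_const P z))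
    have h2 : dForm k z P = _ := h1.fderiv
    rw [h2]
    simp
  have hfst : HasFDerivAt (fun y : Coord d × (Coord d →L[ℝ] ℝ) => y.1)
      (ContinuousLinearMap.fst ℝ (Coord d) (Coord d →L[ℝ] ℝ)) (z, P) :=
    (ContinuousLinearMap.fst ℝ (Coord d) (Coord d →L[ℝ] ℝ)).hasFDerivAt
  have hsnd : HasFDerivAt (fun y : Coord d × (Coord d →L[ℝ] ℝ) => y.2)
      (ContinuousLinearMap.snd ℝ (Coord d) (Coord d →L[ℝ] ℝ)) (z, P) :=
    (ContinuousLinearMap.snd ℝ (Coord d) (Coord d →L[ℝ] ℝ)).hasFDerivAt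
  have hl1 := HasFDerivAt.comp (g := l) (z, P) hld hfst
  have hk1 := HasFDerivAt.comp (g := k) (z, P) hkd hfst
  have hq := hl1.mul (hsnd.clm_apply (hk1.clm_apply hsnd))
  have hN := (hq.rpow_const (p := -(1 / 2)) (Or.inl hQ.ne')).neg
  have hN' : HasFDerivAt (leadN k l) _ (z, P) := hN
  have hpow : (l z * P (k z P)) ^ (-(1 / 2) - 1 : ℝ) = (freq k l z P * (l z * P (k z P)))⁻¹ := by
    rw [Real.rpow_sub_one hQ.ne', Real.rpow_neg hQ.le, ← Real.sqrt_eq_rpow, mul_inv]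
    rfl
  have hpow' : (l z * P (k z P)) ^ (-3 / 2 : ℝ) = (freq k l z P * (l z * P (k z P)))⁻¹ := by
    rw [← hpow]
    norm_num
  have happ : ∀ e α, fderiv ℝ (leadN k l) (z, P) (e, α) =
      1 / 2 * (freq k l z P * (l z * P (k z P)))⁻¹ * (l z * (2 * α (k z P) + dForm k z P e) +
        P (k z P) * fderiv ℝ l z e) := by
    intro e α
    rw [hN'.fderiv, hdF]
    simp [h.symm z hz P α]
    ring_nf
    rw [hpow']
    ring
  refine Prod.ext ?_ ?_
  · simp only [Prod.smul_fst, hamField, shift]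
    rw [← map_smul]
    refine dualVec_eq fun α => ?_
    simp only [smul_apply, ContinuousLinearMap.comp_apply, ContinuousLinearMap.inr_apply, happ,
      map_zero, map_smul, smul_eq_mul]
    field_simp
    ring
  · simp only [Prod.smul_snd, hamField, shift]
    ext e
    simp only [smul_apply, neg_apply, add_apply, ContinuousLinearMap.comp_apply,
      ContinuousLinearMap.inl_apply, happ, zero_apply, smul_eq_mul]
    field_simp
    ring

/-- The flow of the averaged Hamiltonian during the time `π`. -/
theorem exists_slowFlow (h : IsQuadraticBase K D k l)
    (hC : ContDiffOn ℝ ∞ C₁ {z | (z, (0 : ℝ)) ∈ D}) {B : Set (Coord d)} (hB : IsCompact B)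
    (hBD : ∀ z ∈ B, (z, (0 : ℝ)) ∈ D) :
    ∃ ε₀ > 0, ∃ C : ℝ, ∀ ε, 0 < ε → ε ≤ ε₀ → ∀ z ∈ B, ∀ P : Coord d →L[ℝ] ℝ, ‖P‖ = 1 →
      ∃ y : ℝ → Coord d × (Coord d →L[ℝ] ℝ), y 0 = (z, ε⁻¹ • P) ∧
        (∀ t ∈ Set.Icc 0 Real.pi, (((y t).1, (0 : ℝ)) ∈ D ∧ (y t).2 ≠ 0) ∧
          HasDerivWithinAt y (hamField (fun y => leadN k l y + corrN k l C₁ y) (y t))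
            (Set.Icc 0 Real.pi) t) ∧
        ‖((y Real.pi).1, ε • (y Real.pi).2) - (z, P) - ε ^ 2 • shift k l z P‖ ≤ C * ε ^ 4 := by
  set R : Set (Coord d × (Coord d →L[ℝ] ℝ)) := {y | (y.1, (0 : ℝ)) ∈ D ∧ y.2 ≠ 0}
  have hR : IsOpen R := h.isOpen_ne_zero
  have hN₀ := h.contDiffOn_leadN
  have hN₁ := h.contDiffOn_corrN hC
  have hH₀ := contDiffOn_hamField hR hN₀
  have hH₁ := contDiffOn_hamField hR hN₁
  -- In the variables `(z, ε p)` the averaged Hamiltonian field is `ε² W(·, ε²)`, by the degrees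
  -- `-1` and `-3` of the two terms.
  set W : (Coord d × (Coord d →L[ℝ] ℝ)) × ℝ → Coord d × (Coord d →L[ℝ] ℝ) := fun x =>
    hamField (leadN k l) x.1 + x.2 • hamField (corrN k l C₁) x.1
  have hW : ContDiffOn ℝ 1 W (R ×ˢ Set.univ) :=
    (hH₀.comp contDiffOn_fst fun _ hx => hx.1).add
      (contDiffOn_snd.smul (hH₁.comp contDiffOn_fst fun _ hx => hx.1))
  set S : Set (Coord d × (Coord d →L[ℝ] ℝ)) := B ×ˢ Metric.sphere 0 1
  have hS : IsCompact S := hB.prod (isCompact_sphere _ _)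
  -- The field `μ W` vanishes for `μ = 0`, so the unperturbed solutions are constant, and along the
  -- perturbed one `W` stays within `O(μ)` of its unperturbed initial value.
  obtain ⟨μ₀, hμ₀, C, hC0, hpert⟩ := exists_perturbation hS (hR.prod isOpen_univ)
    (fun x hx => ⟨⟨hBD _ hx.1, ne_zero_of_mem_unit_sphere ⟨x.2, hx.2⟩⟩, Set.mem_univ _⟩)
    (contDiffOn_snd.smul hW) hW Real.pi_pos.le
  refine ⟨√μ₀, Real.sqrt_pos.2 hμ₀, C * Real.pi, fun ε hε hεμ z hz P hP => ?_⟩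
  have hμ : ε ^ 2 ∈ Set.Icc 0 μ₀ := ⟨sq_nonneg ε, (Real.le_sqrt hε.le hμ₀.le).1 hεμ⟩
  have hP0 : P ≠ 0 := by
    rintro rfl
    simp at hP
  obtain ⟨x, hx0, hx⟩ := hpert (ε ^ 2) hμ (fun _ => (z, P)) fun t _ =>
    ⟨⟨hz, by simpa using hP⟩,
      (hasDerivWithinAt_const t _ _).congr_deriv (zero_smul ℝ (W ((z, P), 0))).symm⟩
  have hinc := norm_increment_le (T := Real.pi) (c := C * ε ^ 2) hμ.1 (z := x)
    (F := fun t => W (x t, ε ^ 2)) (z₁ := fun t => t • W ((z, P), 0)) (F₁ := fun _ => W ((z, P), 0))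
    (fun t ht => (hx t ht).2.1) (fun t _ => by
      simpa using ((hasDerivAt_id t).smul_const (W ((z, P), 0))).hasDerivWithinAt)
    (fun t ht => (hx t ht).2.2.2) ⟨Real.pi_pos.le, le_rfl⟩
  have hsh : Real.pi • W ((z, P), 0) = shift k l z P := by
    simp only [W, zero_smul, add_zero]
    exact h.pi_smul_hamField_leadN (hBD z hz) hP0
  rw [zero_smul, sub_zero, hsh, hx0] at hinc
  have hε' := hε.ne'
  refine ⟨fun t => ((x t).1, ε⁻¹ • (x t).2), ?_, fun t ht => ?_, ?_⟩
  · change ((x 0).1, ε⁻¹ • (x 0).2) = _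
    rw [hx0]
  · obtain ⟨⟨hxR, -⟩, hxd, -⟩ := hx t ht
    have hR' : ((x t).1, ε⁻¹ • (x t).2) ∈ R := ⟨hxR.1, smul_ne_zero (inv_ne_zero hε') hxR.2⟩
    refine ⟨hR', ?_⟩
    have h1 : HasDerivWithinAt (fun t => (x t).1) (ε ^ 2 • W (x t, ε ^ 2)).1 (Set.Icc 0 Real.pi) t :=
      hxd.fst
    have h2 : HasDerivWithinAt (fun t => (x t).2) (ε ^ 2 • W (x t, ε ^ 2)).2 (Set.Icc 0 Real.pi) t :=
      hxd.snd
    refine (h1.prodMk (h2.const_smul ε⁻¹)).congr_deriv ?_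
    have hεx : ε • ε⁻¹ • (x t).2 = (x t).2 := by rw [smul_smul, mul_inv_cancel₀ hε', one_smul]
    have hd : ∀ {f : Coord d × (Coord d →L[ℝ] ℝ) → ℝ}, ContDiffOn ℝ ∞ f R → ∀ y ∈ R,
        DifferentiableAt ℝ f y := fun hf y hy =>
      (hf.contDiffAt (hR.mem_nhds hy)).differentiableAt (by simp)
    rw [hamField_add (hd hN₀ _ hR') (hd hN₁ _ hR'),
      hamField_scale (f := leadN k l) (c := ε) (ε := ε) (by rw [hεx]; exact hd hN₀ _ hxR)
        (Filter.eventually_of_mem (hR.mem_nhds hR') fun y hy => h.leadN_scale hy hε),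
      hamField_scale (f := corrN k l C₁) (c := ε ^ 3) (ε := ε) (by rw [hεx]; exact hd hN₁ _ hxR)
        (Filter.eventually_of_mem (hR.mem_nhds hR') fun y hy => h.corrN_scale hy hε), hεx]
    refine Prod.ext ?_ ?_
    · simp only [W, Prod.smul_fst, Prod.fst_add, smul_add, smul_smul]
      congr 2 <;> ring
    · simp only [W, Prod.smul_snd, Prod.snd_add, smul_add, smul_smul]
      congr 2 <;> field_simp
  · simp only [smul_smul, mul_inv_cancel₀ hε', one_smul]
    calc _ ≤ ε ^ 2 * (C * ε ^ 2) * Real.pi := hinc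
      _ = C * Real.pi * ε ^ 4 := by ring

end IsQuadraticBase

end SlowFlow

/-- At a return to `ξ = 0` conservation of energy determines `η` up to sign, which places the end
point on one of the two components of the section. -/
theorem energy_eq {d : ℕ} {K : Phase d → ℝ} {D : Set (Coord d × ℝ)} (hD : IsOpen D)
    (hK : ContDiffOn ℝ ∞ K {x | (x.1, x.2.1) ∈ D}) {τ : ℝ} (hτ : 0 ≤ τ) {y : ℝ → Phase d}
    (hy : ∀ t ∈ Set.Icc 0 τ, ((y t).1, (y t).2.1 ^ 2 / 2) ∈ D ∧
      HasDerivWithinAt y (dblField K (y t)) (Set.Icc 0 τ) t) :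
    K (foldPhase (y τ)) = K (foldPhase (y 0)) := by
  have hopen : IsOpen {x : Phase d | (x.1, x.2.1) ∈ D} := hD.preimage (by fun_prop)
  have hd : ∀ t ∈ Set.Icc 0 τ,
      HasDerivWithinAt (fun t => K (foldPhase (y t))) 0 (Set.Icc 0 τ) t := by
    intro t ht
    obtain ⟨hyD, hyt⟩ := hy t ht
    obtain ⟨L, hL, hLv⟩ := hasFDerivAt_foldPhase (y t)
    have hKd : HasFDerivAt K (fderiv ℝ K (foldPhase (y t))) (foldPhase (y t)) :=
      ((hK.contDiffAt (hopen.mem_nhds (show foldPhase (y t) ∈ {x : Phase d | (x.1, x.2.1) ∈ D}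
        from hyD))).differentiableAt (by simp)).hasFDerivAt
    have h1 := HasFDerivAt.comp_hasDerivWithinAt (l := K) t hKd
      (HasFDerivAt.comp_hasDerivWithinAt (l := foldPhase) t hL hyt)
    refine h1.congr_deriv ?_
    rw [hLv, apply_eq_parts]
    simp only [dblField, add_apply, smul_apply, neg_apply, map_smul, smul_eq_mul]
    ring
  exact constant_of_has_deriv_right_zero (fun t ht => (hd t ht).continuousWithinAt)
    (fun t ht => (hd t ⟨ht.1, ht.2.le⟩).mono_of_mem_nhdsWithin (Icc_mem_nhdsGE_of_mem ht)) τ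
    ⟨hτ, le_rfl⟩

/-! ### Both maps over a chart: existence, uniqueness, leading terms -/

section Local

variable {E : Type*} [NormedAddCommGroup E] [NormedSpace ℝ E] [FiniteDimensional ℝ E]
  {M : Type*} [TopologicalSpace M] [ChartedSpace E M] [IsManifold 𝓘(ℝ, E) ∞ M]
  {g : Bundle.ContMDiffRiemannianMetric 𝓘(ℝ, E) ∞ E (fun x : M => TangentSpace 𝓘(ℝ, E) x)}
  {φ : M → ℝ} {d : ℕ} {u : Coord d → M} {V : Set (Coord d)}
  {Ψ : Coord d × ℝ → M} {Θ : M → Coord d × ℝ} {D : Set (Coord d × ℝ)} {O : Set M}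

/-- The dual of the metric of the hypersurface in local coordinates. -/
def dualMetric
    (g : Bundle.ContMDiffRiemannianMetric 𝓘(ℝ, E) ∞ E (fun x : M => TangentSpace 𝓘(ℝ, E) x))
    (u : Coord d → M) (z : Coord d) : (Coord d →L[ℝ] ℝ) →L[ℝ] Coord d :=
  (pullForm g (u z) (paramDeriv 𝓘(ℝ, E) u z)).inverse

/-- The squared norm of `dφ` along the hypersurface in local coordinates. -/
def conormal
    (g : Bundle.ContMDiffRiemannianMetric 𝓘(ℝ, E) ∞ E (fun x : M => TangentSpace 𝓘(ℝ, E) x))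
    (φ : M → ℝ) (u : Coord d → M) (z : Coord d) : ℝ := coNormSq g (u z) (dPhi φ (u z))

theorem frame_form_symm_pos (hu : IsLocalCoord 𝓘(ℝ, E) (bdry φ) (bdryT φ) u V) {z : Coord d}
    (hz : z ∈ V) : (∀ m m' : Coord d →L[ℝ] ℝ, m (dualMetric g u z m') = m' (dualMetric g u z m)) ∧
      ∀ m : Coord d →L[ℝ] ℝ, m ≠ 0 → 0 < m (dualMetric g u z m) := by
  have hpos : ∀ a, a ≠ 0 → 0 < pullForm g (u z) (paramDeriv 𝓘(ℝ, E) u z) a a := fun a ha =>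
    pullForm_pos g (hu.immersion z hz) a ha
  have hinv : ∀ m : Coord d →L[ℝ] ℝ,
      pullForm g (u z) (paramDeriv 𝓘(ℝ, E) u z) (dualMetric g u z m) = m :=
    apply_inverse_of_posDef hpos
  have hsymm : ∀ a b, pullForm g (u z) (paramDeriv 𝓘(ℝ, E) u z) a b =
      pullForm g (u z) (paramDeriv 𝓘(ℝ, E) u z) b a := fun a b => innerE_symm g _ _ _
  constructor
  · intro m m'
    have h1 := hsymm (dualMetric g u z m) (dualMetric g u z m')
    rwa [hinv, hinv] at h1
  · intro m hm
    have h1 := hpos (dualMetric g u z m) (fun h0 => hm (by rw [← hinv m, h0, map_zero]))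
    rwa [hinv] at h1

namespace IsAdapted

theorem isQuadraticBase (h : IsAdapted g φ u V Ψ Θ D O) :
    IsQuadraticBase (chartK g Ψ) D (dualMetric g u) (conormal g φ u) where
  isOpen := h.isOpen_source
  smooth := h.contDiffOn_chartK g
  eq z m η hz := by
    rw [(h.chartK_base hz m η).1, conormal, h.coNormSq_dPhi hz]
    rfl
  smooth_k := contDiffOn_inverse_of_posDef (contDiffOn_pullForm_paramDeriv g h.isOpen_base
    (h.coord.smooth.mono fun z hz => h.mem_base hz))
    fun z hz a ha => pullForm_pos g (h.coord.immersion z (h.mem_base hz)) a ha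
  smooth_l := by
    have h1 : ContDiffOn ℝ ∞ (fun z => 2 * chartK g Ψ (z, 0, 0, 1)) {z | (z, (0 : ℝ)) ∈ D} :=
      contDiffOn_const.mul ((h.contDiffOn_chartK g).comp
        (by fun_prop : ContDiff ℝ ∞ fun z : Coord d => ((z, 0, 0, 1) : Phase d)).contDiffOn
        fun z hz => hz)
    exact h1.congr fun z hz => h.coNormSq_dPhi hz
  symm z hz := (frame_form_symm_pos h.coord (h.mem_base hz)).1
  k_pos z hz := (frame_form_symm_pos h.coord (h.mem_base hz)).2
  l_pos z hz := by
    rw [conormal, h.coNormSq_dPhi hz]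
    linarith [(h.chartK_base hz 0 0).2]

theorem sectionPoint_ofCoords' (h : IsAdapted g φ u V Ψ Θ D O) {z : Coord d}
    (hz : (z, (0 : ℝ)) ∈ D) (σ : ℝ) (w : Coord d →L[ℝ] ℝ) :
    sectionPoint φ g σ (ofCoords 𝓘(ℝ, E) (bdryT φ) u (z, w)) =
      dblPoint φ Ψ (z, 0, w, σ * √(2 / conormal g φ u z)) := by
  rw [h.sectionPoint_ofCoords hz, conormal, h.coNormSq_dPhi hz]

theorem eq_ofCoords_of_sectionPoint (h : IsAdapted g φ u V Ψ Θ D O) {z : Coord d}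
    (hz : (z, (0 : ℝ)) ∈ D) {w : Coord d →L[ℝ] ℝ} {η σ : ℝ} {b : BdryCotangent (E := E) φ}
    (hb : dblPoint φ Ψ (z, 0, w, η) = sectionPoint φ g σ b) :
    b = ofCoords 𝓘(ℝ, E) (bdryT φ) u (z, w) := by
  have hbase : b.1 = u z := by
    have h1 : (Ψ (fold ((splitLast d).symm (z, 0)))) = b.1 :=
      congrArg (fun c : DblCotangent (E := E) φ => c.1.1) hb
    rw [fold_splitLast_symm] at h1
    rw [← h1, ← h.apply_base hz]
    norm_num
  obtain ⟨w', hw' | hw'⟩ := exists_eq_ofCoords h.coord b hbase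
  · rw [hw', h.sectionPoint_ofCoords' hz] at hb
    have h0 : ((0 : ℝ)) ^ 2 / 2 = 0 := by norm_num
    have h2 := h.dblPoint_injOn h.smooth_phi (x := (z, 0, w, η)) (by simpa using hz)
      (x' := (z, 0, w', σ * √(2 / conormal g φ u z))) (by simpa using hz) hb
    have h3 : w = w' := congrArg (fun x : Phase d => x.2.2.1) h2
    rw [hw', h3]
  · exact absurd (h.mem_base hz) hw'

theorem dblPoint_xi (x : Phase d) : (dblPoint (E := E) φ Ψ x).1.2 = x.2.1 := by
  change (splitLast d ((splitLast d).symm (x.1, x.2.1))).2 = x.2.1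
  rw [ContinuousLinearEquiv.apply_symm_apply]

/-- The billiard map near infinity: existence, uniqueness, and leading terms. -/
theorem exists_billiardMap [T2Space M] (h : IsAdapted g φ u V Ψ Θ D O) {B : Set (Coord d)}
    (hB : IsCompact B) (hBD : ∀ z ∈ B, (z, (0 : ℝ)) ∈ D) :
    ∃ ε₀ > 0, ∃ C : ℝ, ∀ ε, 0 < ε → ε ≤ ε₀ → ∀ z ∈ B, ∀ P : Coord d →L[ℝ] ℝ, ‖P‖ = 1 →
      ∃ z₁ w₁, z₁ ∈ V ∧
        IsBilliardMap φ g (ofCoords 𝓘(ℝ, E) (bdryT φ) u (z, ε⁻¹ • P))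
          (ofCoords 𝓘(ℝ, E) (bdryT φ) u (z₁, w₁)) ∧
        (∀ b, IsBilliardMap φ g (ofCoords 𝓘(ℝ, E) (bdryT φ) u (z, ε⁻¹ • P)) b →
          b = ofCoords 𝓘(ℝ, E) (bdryT φ) u (z₁, w₁)) ∧
        ‖(z₁, ε • w₁) - (z, P) - ε ^ 2 • shift (dualMetric g u) (conormal g φ u) z P‖ ≤
          C * ε ^ 4 := by
  have hq := h.isQuadraticBase
  obtain ⟨ε₀, hε₀, C, hret⟩ := hq.exists_return hB hBD
  refine ⟨ε₀, hε₀, C, fun ε hε hεε z hz P hP => ?_⟩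
  have hzD := hBD z hz
  obtain ⟨τ, hτ, y, hy0, hy, hpos, hyτ, hsh⟩ := hret ε hε hεε z hz P hP
  have hτmem : τ ∈ Set.Icc 0 τ := ⟨hτ.le, le_rfl⟩
  have hyτ' : y τ = ((y τ).1, 0, (y τ).2.2.1, (y τ).2.2.2) :=
    Prod.ext rfl (Prod.ext hyτ rfl)
  have hz₁ : ((y τ).1, (0 : ℝ)) ∈ D := by
    have h1 := (hy τ hτmem).1
    rw [hyτ] at h1
    simpa using h1
  have hfold : ∀ (z' : Coord d) (w' : Coord d →L[ℝ] ℝ) (η : ℝ), (z', (0 : ℝ)) ∈ D →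
      chartK g Ψ (foldPhase (z', 0, w', η)) = 1 / 2 * (conormal g φ u z' * η ^ 2) := by
    intro z' w' η hz'
    have h1 : foldPhase (z', 0, w', η) = (z', 0, 0, η) := by simp [foldPhase]
    rw [h1, hq.eq z' 0 η hz']
    simp
  have hstart : chartK g Ψ (foldPhase (y 0)) = 1 := by
    have h1 := hq.l_pos z hzD
    rw [hy0, hfold z _ _ hzD, Real.sq_sqrt (by positivity)]
    field_simp
  have hend : chartK g Ψ (foldPhase (y τ)) = 1 :=
    (energy_eq hq.isOpen hq.smooth hτ.le hy).trans hstart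
  -- For `ξ = 0` the energy is `l η² / 2`, whatever the momentum along `Γ`.
  have hη : (y τ).2.2.2 = √(2 / conormal g φ u (y τ).1) ∨
      (y τ).2.2.2 = -√(2 / conormal g φ u (y τ).1) := by
    have h1 := hq.l_pos _ hz₁
    rw [hyτ', hfold _ _ _ hz₁] at hend
    refine sq_eq_sq_iff_eq_or_eq_neg.1 ?_
    rw [Real.sq_sqrt (by positivity)]
    field_simp
    linarith
  have htraj := h.isHamiltonianTrajectory h.smooth_phi (fun t ht => (hy t ht).1)
    (fun t ht => (hy t ht).2)
  have hc0 : dblPoint φ Ψ (y 0) =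
      sectionPoint φ g 1 (ofCoords 𝓘(ℝ, E) (bdryT φ) u (z, ε⁻¹ • P)) := by
    rw [h.sectionPoint_ofCoords' hzD, one_mul, hy0]
  have hcτ : dblPoint φ Ψ (y τ) ∈ poincareSection φ g := by
    have hD := (hy τ hτmem).1
    refine ⟨?_, ?_, ?_⟩
    · change (dblPoint φ Ψ (y τ)).1.2 ^ 2 = 2 * φ (Ψ (fold ((splitLast d).symm _)))
      rw [fold_splitLast_symm, dblPoint_xi, h.apply_eq _ hD]
      ring
    · rw [dblPoint_xi, hyτ]
    · rw [h.regularizedH_dblPoint g h.smooth_phi hD, hend]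
  refine ⟨(y τ).1, (y τ).2.2.1, h.mem_base hz₁, ⟨h.coord.mapsTo (h.mem_base hzD),
    h.coord.mapsTo (h.mem_base hz₁), τ, fun t => dblPoint φ Ψ (y t), hτ, htraj, hc0, ?_, ?_⟩, ?_, hsh⟩
  · rw [h.sectionPoint_ofCoords' hz₁, h.sectionPoint_ofCoords' hz₁, one_mul, neg_one_mul]
    rcases hη with h1 | h1
    · exact Or.inl (congrArg _ (hyτ'.trans (by rw [← h1])))
    · exact Or.inr (congrArg _ (hyτ'.trans (by rw [← h1])))
  · intro t ht hmem
    have h1 := hmem.2.1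
    rw [dblPoint_xi] at h1
    exact (hpos t ht).ne' h1
  · rintro b ⟨-, -, τ', c, hτ', hc, hc', hcb, hcs⟩
    -- A competing trajectory coincides with the constructed one as long as both are defined.
    have hagree : ∀ s, 0 ≤ s → s ≤ τ → s ≤ τ' → c s = dblPoint φ Ψ (y s) := by
      intro s hs hsτ hsτ'
      exact h.eq_dblPoint h.smooth_phi hs
        (fun t ht => (hy t ⟨ht.1, ht.2.trans hsτ⟩).1)
        (fun t ht => (hy t ⟨ht.1, ht.2.trans hsτ⟩).2.mono (Set.Icc_subset_Icc_right hsτ))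
        (hc.mono (Set.Icc_subset_Icc_right hsτ')) (hc'.trans hc0.symm) s ⟨hs, le_rfl⟩
    -- An earlier end contradicts `ξ > 0` before the return; a later one would meet the section in
    -- between.
    have hττ : τ' = τ := by
      rcases lt_trichotomy τ' τ with h1 | h1 | h1
      · have h2 := hagree τ' hτ'.le h1.le le_rfl
        have h3 : (c τ').1.2 = 0 := by
          rcases hcb with h4 | h4 <;> rw [h4] <;> rfl
        rw [h2, dblPoint_xi] at h3
        exact absurd h3 (hpos τ' ⟨hτ', h1⟩).ne'
      · exact h1
      · exact absurd (hagree τ hτ.le le_rfl h1.le ▸ hcτ) (hcs τ ⟨hτ, h1⟩)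
    subst hττ
    have h2 := hagree τ' hτ'.le le_rfl le_rfl
    rw [hyτ'] at h2
    rcases hcb with h3 | h3
    · exact h.eq_ofCoords_of_sectionPoint hz₁ (h2.symm.trans h3)
    · exact h.eq_ofCoords_of_sectionPoint hz₁ (h2.symm.trans h3)

/-- The flow of the averaged Hamiltonian near infinity: existence, uniqueness, and leading
terms. -/
theorem exists_flow [T2Space M] (h : IsAdapted g φ u V Ψ Θ D O) {δ : ℝ} {f : M → ℝ → M}
    {B : ∀ q : M, ℝ → (bdryT (E := E) φ q →L[ℝ] bdryT (E := E) φ q →L[ℝ] ℝ)}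
    (hs : IsSemigeodesic φ g δ f B) {S : Set (Coord d)}
    (hS : IsCompact S) (hSD : ∀ z ∈ S, (z, (0 : ℝ)) ∈ D) :
    ∃ ε₀ > 0, ∃ C : ℝ, ∀ ε, 0 < ε → ε ≤ ε₀ → ∀ z ∈ S, ∀ P : Coord d →L[ℝ] ℝ, ‖P‖ = 1 →
      ∃ z₁ w₁, z₁ ∈ V ∧
        IsFlow 𝓘(ℝ, E) (bdry φ) (bdryT φ) (averagedN B) Real.pi
          (ofCoords 𝓘(ℝ, E) (bdryT φ) u (z, ε⁻¹ • P)) (ofCoords 𝓘(ℝ, E) (bdryT φ) u (z₁, w₁)) ∧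
        (∀ b, IsFlow 𝓘(ℝ, E) (bdry φ) (bdryT φ) (averagedN B) Real.pi
          (ofCoords 𝓘(ℝ, E) (bdryT φ) u (z, ε⁻¹ • P)) b →
          b = ofCoords 𝓘(ℝ, E) (bdryT φ) u (z₁, w₁)) ∧
        ‖(z₁, ε • w₁) - (z, P) - ε ^ 2 • shift (dualMetric g u) (conormal g φ u) z P‖ ≤
          C * ε ^ 4 := by
  have hq := h.isQuadraticBase
  obtain ⟨C₁, hC₁, hform⟩ := hs.exists_forms h.smooth_phi h.coord
  have hC₁' : ContDiffOn ℝ ∞ C₁ {z | (z, (0 : ℝ)) ∈ D} := hC₁.mono fun z hz => h.mem_base hz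
  obtain ⟨ε₀, hε₀, C, hflow⟩ := hq.exists_slowFlow hC₁' hS hSD
  set R : Set (Coord d × (Coord d →L[ℝ] ℝ)) := {y | (y.1, (0 : ℝ)) ∈ D ∧ y.2 ≠ 0}
  have hR : IsOpen R := hq.isOpen_ne_zero
  -- Through `exists_forms`, `K₀` has the coefficients of the oscillator. This is what links the
  -- flow of `N` to the displacement of the billiard map.
  have hN : ∀ y ∈ R, averagedN B (ofCoords 𝓘(ℝ, E) (bdryT φ) u y) =
      leadN (dualMetric g u) (conormal g φ u) y + corrN (dualMetric g u) (conormal g φ u) C₁ y := by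
    intro y hy
    obtain ⟨h1, h2⟩ := hform y.1 (h.mem_base hy.1) y.2
    rw [averagedN, h1, h2]
    rfl
  have hsm := (hq.contDiffOn_leadN.add (hq.contDiffOn_corrN hC₁')).congr hN
  refine ⟨ε₀, hε₀, C, fun ε hε hεε z hz P hP => ?_⟩
  obtain ⟨y, hy0, hy, hsh⟩ := hflow ε hε hεε z hz P hP
  have hπ : Real.pi ∈ Set.Icc 0 Real.pi := ⟨Real.pi_pos.le, le_rfl⟩
  have hH : ∀ t ∈ Set.Icc 0 Real.pi,
      HamiltonAt (fun zw => averagedN B (ofCoords 𝓘(ℝ, E) (bdryT φ) u zw)) (Set.Icc 0 Real.pi)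
        (fun t => (y t).1) (fun t => (y t).2) t := by
    intro t ht
    obtain ⟨hyR, hyd⟩ := hy t ht
    have hRn : R ∈ 𝓝 (y t) := hR.mem_nhds hyR
    refine hamiltonAt_of_hasDerivWithinAt ((hsm.contDiffAt hRn).differentiableAt (by simp)) ?_
    refine hyd.congr_deriv ?_
    rw [hamField, hamField, Filter.EventuallyEq.fderiv_eq (Filter.eventually_of_mem hRn hN)]
  have h0 : ofCoords 𝓘(ℝ, E) (bdryT φ) u ((y 0).1, (y 0).2) =
      ofCoords 𝓘(ℝ, E) (bdryT φ) u (z, ε⁻¹ • P) := by rw [hy0]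
  refine ⟨(y Real.pi).1, (y Real.pi).2, h.mem_base (hy _ hπ).1.1,
    ⟨fun t => ofCoords 𝓘(ℝ, E) (bdryT φ) u ((y t).1, (y t).2),
      isHamiltonianTrajectory_of_hamiltonAt h.coord (fun t ht => h.mem_base (hy t ht).1.1) hH,
      h0, rfl⟩, ?_, hsh⟩
  rintro b ⟨c, hc, hc0, rfl⟩
  exact eq_of_isHamiltonianTrajectory h.coord hR (fun y hy => h.mem_base hy.1)
    (hsm.of_le (WithTop.coe_le_coe.2 le_top)) Real.pi_pos.le hc (fun t ht => (hy t ht).1) hH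
    (hc0.trans h0.symm) _ hπ

end IsAdapted

end Local

/-! ### Estimates in the norm of `T*Γ` and their uniformity -/

section Asymptotics

variable {E : Type*} [NormedAddCommGroup E] [NormedSpace ℝ E] [FiniteDimensional ℝ E]
  {M : Type*} [TopologicalSpace M] [ChartedSpace E M] [IsManifold 𝓘(ℝ, E) ∞ M]
  {g : Bundle.ContMDiffRiemannianMetric 𝓘(ℝ, E) ∞ E (fun x : M => TangentSpace 𝓘(ℝ, E) x)}
  {φ : M → ℝ} {d : ℕ} {u : Coord d → M} {V : Set (Coord d)}
  {B : ∀ q : M, ℝ → (bdryT (E := E) φ q →L[ℝ] bdryT (E := E) φ q →L[ℝ] ℝ)}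

/-- The norm of a boundary covector is bounded by the norm of its coordinates. -/
theorem exists_bdryNorm_le (hu : IsLocalCoord 𝓘(ℝ, E) (bdry φ) (bdryT φ) u V) {S : Set (Coord d)}
    (hS : IsCompact S) (hSV : S ⊆ V) :
    ∃ c > 0, ∀ z ∈ S, ∀ w : Coord d →L[ℝ] ℝ,
      bdryNorm φ g (ofCoords 𝓘(ℝ, E) (bdryT φ) u (z, w)) ≤ c * ‖w‖ := by
  have hcont : ContinuousOn (fun y : Coord d × Coord d =>
      pullForm g (u y.1) (paramDeriv 𝓘(ℝ, E) u y.1) y.2 y.2)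
      (S ×ˢ Metric.sphere (0 : Coord d) 1) :=
    ((((contDiffOn_pullForm_paramDeriv g hu.isOpen hu.smooth).continuousOn.mono hSV).comp
      continuousOn_fst fun y hy => hy.1).clm_apply continuousOn_snd).clm_apply continuousOn_snd
  -- The minimum of the metric over unit vectors at points of the compact set; homogeneity extends
  -- the bound to all vectors.
  obtain ⟨m, hm, hle⟩ := (hS.prod (isCompact_sphere (0 : Coord d) 1)).exists_forall_le' hcont
    (a := 0) fun y hy => pullForm_pos g (hu.immersion y.1 (hSV hy.1)) y.2
      (Metric.ne_of_mem_sphere hy.2 one_ne_zero)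
  have hle' : ∀ z ∈ S, ∀ e : Coord d,
      m * ‖e‖ ^ 2 ≤ pullForm g (u z) (paramDeriv 𝓘(ℝ, E) u z) e e := by
    intro z hz e
    rcases eq_or_ne e 0 with rfl | he
    · simp
    · have hn : ‖e‖ ≠ 0 := norm_ne_zero_iff.2 he
      have h1 := hle (z, ‖e‖⁻¹ • e) ⟨hz, by simp [norm_smul, hn]⟩
      simp only [map_smul, smul_apply, smul_eq_mul] at h1
      have h2 : 0 < ‖e‖ ^ 2 := by positivity
      calc m * ‖e‖ ^ 2 ≤ (‖e‖⁻¹ * (‖e‖⁻¹ *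
            pullForm g (u z) (paramDeriv 𝓘(ℝ, E) u z) e e)) * ‖e‖ ^ 2 := by gcongr
        _ = _ := by field_simp
  refine ⟨(√m)⁻¹, by positivity, fun z hz w => ?_⟩
  have hzV := hSV hz
  refine Real.sSup_le ?_ (by positivity)
  rintro r ⟨v, hv, rfl⟩
  obtain ⟨e, rfl⟩ := frame_surjective hu hzV v
  have h1 : m * ‖e‖ ^ 2 ≤ 1 := by
    refine (hle' z hz e).trans (le_trans (le_of_eq ?_) hv)
    rw [frame_apply hu hzV]
    rfl
  have h2 : ‖e‖ ≤ (√m)⁻¹ := by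
    rw [← Real.sqrt_inv]
    refine Real.le_sqrt_of_sq_le ?_
    rw [← one_div, le_div_iff₀ hm]
    linarith
  have h3 : (ofCoords 𝓘(ℝ, E) (bdryT φ) u (z, w)).2 (frame 𝓘(ℝ, E) (bdryT φ) u z e) = w e := by
    change w ((frame 𝓘(ℝ, E) (bdryT φ) u z).inverse _) = w e
    rw [frame_inverse_frame hu hzV]
  rw [h3]
  calc w e ≤ ‖w e‖ := Real.le_norm_self _
    _ ≤ ‖w‖ * ‖e‖ := w.le_opNorm e
    _ ≤ ‖w‖ * (√m)⁻¹ := by gcongr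
    _ = _ := mul_comm _ _

namespace IsAdapted

variable {Ψ : Coord d × ℝ → M} {Θ : M → Coord d × ℝ} {D : Set (Coord d × ℝ)} {O : Set M}

/-- The averaged Hamiltonian up to terms of the third order. -/
theorem exists_averagedN_le (h : IsAdapted g φ u V Ψ Θ D O) {δ : ℝ} {f : M → ℝ → M}
    (hs : IsSemigeodesic φ g δ f B) {S : Set (Coord d)}
    (hS : IsCompact S) (hSD : ∀ z ∈ S, (z, (0 : ℝ)) ∈ D) :
    ∃ C : ℝ, ∀ z ∈ S, ∀ w : Coord d →L[ℝ] ℝ, w ≠ 0 →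
      |averagedN B (ofCoords 𝓘(ℝ, E) (bdryT φ) u (z, w)) +
        formK0 B (ofCoords 𝓘(ℝ, E) (bdryT φ) u (z, w)) ^ (-(1 / 2) : ℝ)| ≤ C * ‖w‖⁻¹ ^ 3 := by
  have hq := h.isQuadraticBase
  obtain ⟨C₁, hC₁, hform⟩ := hs.exists_forms h.smooth_phi h.coord
  have hC₁' : ContDiffOn ℝ ∞ C₁ {z | (z, (0 : ℝ)) ∈ D} := hC₁.mono fun z hz => h.mem_base hz
  obtain ⟨C, hC⟩ := (hS.prod (isCompact_sphere (0 : Coord d →L[ℝ] ℝ) 1)).exists_bound_of_continuousOn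
    ((hq.contDiffOn_corrN hC₁').continuousOn.mono fun y hy =>
      ⟨hSD _ hy.1, Metric.ne_of_mem_sphere hy.2 one_ne_zero⟩)
  refine ⟨C, fun z hz w hw => ?_⟩
  have hn : 0 < ‖w‖ := norm_pos_iff.2 hw
  have hsph : (z, ‖w‖⁻¹ • w) ∈ S ×ˢ Metric.sphere (0 : Coord d →L[ℝ] ℝ) 1 :=
    ⟨hz, by simp [norm_smul, hn.ne']⟩
  obtain ⟨h1, h2⟩ := hform z (h.mem_base (hSD z hz)) w
  have h3 : averagedN B (ofCoords 𝓘(ℝ, E) (bdryT φ) u (z, w)) +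
      formK0 B (ofCoords 𝓘(ℝ, E) (bdryT φ) u (z, w)) ^ (-(1 / 2) : ℝ) =
      corrN (dualMetric g u) (conormal g φ u) C₁ (z, w) := by
    rw [averagedN, neg_add_eq_sub, sub_add_cancel, h1, h2]
    rfl
  rw [h3, hq.corrN_scale (y := (z, w)) ⟨hSD z hz, hw⟩ (inv_pos.2 hn), abs_mul,
    abs_of_pos (by positivity), mul_comm]
  gcongr
  exact hC _ hsph

end IsAdapted

/-- The billiard map and the flow of the averaged Hamiltonian are defined at the covectors over
`u z` of norm at least `δ⁻¹`, and have there the same leading terms. -/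
def HasAsymptotics
    (g : Bundle.ContMDiffRiemannianMetric 𝓘(ℝ, E) ∞ E (fun x : M => TangentSpace 𝓘(ℝ, E) x))
    (B : ∀ q : M, ℝ → (bdryT (E := E) φ q →L[ℝ] bdryT (E := E) φ q →L[ℝ] ℝ))
    (u : Coord d → M) (V : Set (Coord d)) (δ : ℝ) (z : Coord d) : Prop :=
  0 < δ → ∀ a : BdryCotangent (E := E) φ, a.1 = u z → δ⁻¹ ≤ bdryNorm φ g a →
    |averagedN B a + formK0 B a ^ (-(1 / 2) : ℝ)| ≤ δ⁻¹ / bdryNorm φ g a ^ 3 ∧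
    ∃ z₁ ∈ V, ∃ z₂ ∈ V, ∃ w₁ w₂ : Coord d →L[ℝ] ℝ,
      IsBilliardMap φ g a (ofCoords 𝓘(ℝ, E) (bdryT φ) u (z₁, w₁)) ∧
      (∀ b, IsBilliardMap φ g a b → b = ofCoords 𝓘(ℝ, E) (bdryT φ) u (z₁, w₁)) ∧
      IsFlow 𝓘(ℝ, E) (bdry φ) (bdryT φ) (averagedN B) Real.pi a
        (ofCoords 𝓘(ℝ, E) (bdryT φ) u (z₂, w₂)) ∧
      (∀ b, IsFlow 𝓘(ℝ, E) (bdry φ) (bdryT φ) (averagedN B) Real.pi a b →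
        b = ofCoords 𝓘(ℝ, E) (bdryT φ) u (z₂, w₂)) ∧
      ‖z₁ - z₂‖ ≤ δ⁻¹ / bdryNorm φ g a ^ 4 ∧ ‖w₁ - w₂‖ ≤ δ⁻¹ / bdryNorm φ g a ^ 3

/-- With `δ⁻¹` as threshold and also as constant in the estimates, the property depends
monotonically on one parameter, as `exists_pos_of_isCompact` needs. -/
theorem HasAsymptotics.mono {δ δ' : ℝ} {z : Coord d} (h : HasAsymptotics g B u V δ z)
    (hδ : δ' ≤ δ) : HasAsymptotics g B u V δ' z := by
  intro h0 a ha hδa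
  have hinv : δ⁻¹ ≤ δ'⁻¹ := inv_anti₀ h0 hδ
  have hn : 0 < bdryNorm φ g a := (inv_pos.2 h0).trans_le hδa
  have hle : ∀ n : ℕ, δ⁻¹ / bdryNorm φ g a ^ n ≤ δ'⁻¹ / bdryNorm φ g a ^ n := fun n => by gcongr
  obtain ⟨h1, z₁, hz₁, z₂, hz₂, w₁, w₂, h2, h3, h4, h5, h6, h7⟩ :=
    h (h0.trans_le hδ) a ha (hinv.trans hδa)
  exact ⟨h1.trans (hle 3), z₁, hz₁, z₂, hz₂, w₁, w₂, h2, h3, h4, h5, h6.trans (hle 4),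
    h7.trans (hle 3)⟩

/-- With `ε = ‖w‖⁻¹` both maps displace `(z, ε w)` by the same term of order `ε²` up to `O(ε⁴)`, and
returning from `ε w` to `w` costs one power of `ε`. The upper bound of the invariant norm by `‖w‖`
then replaces powers of `ε` by powers of the inverse norm. -/
theorem IsSemigeodesic.eventually_hasAsymptotics [T2Space M] {δ : ℝ} {f : M → ℝ → M}
    (hs : IsSemigeodesic φ g δ f B) (hφ : ContMDiff 𝓘(ℝ, E) 𝓘(ℝ, ℝ) ∞ φ)
    (hu : IsLocalCoord 𝓘(ℝ, E) (bdry φ) (bdryT φ) u V) {z₀ : Coord d} (hz₀ : z₀ ∈ V)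
    (hq : dPhi (E := E) φ (u z₀) ≠ 0) :
    ∃ ε > 0, ∀ᶠ z in 𝓝 z₀, HasAsymptotics g B u V ε z := by
  obtain ⟨Ψ, Θ, D, O, hA, hzD⟩ := hu.exists_isAdapted (g := g) hφ hz₀ hq
  obtain ⟨r, hr, hrD⟩ := Metric.nhds_basis_closedBall.mem_iff.1 (hA.isOpen_base.mem_nhds hzD)
  have hS : IsCompact (Metric.closedBall z₀ r) := isCompact_closedBall z₀ r
  obtain ⟨c, hc, hnorm⟩ := exists_bdryNorm_le (g := g) hu hS fun z hz => hA.mem_base (hrD hz)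
  obtain ⟨C₀, hN⟩ := hA.exists_averagedN_le hs hS fun z hz => hrD hz
  obtain ⟨ε₁, hε₁, C₁, hT⟩ := hA.exists_billiardMap hS fun z hz => hrD hz
  obtain ⟨ε₂, hε₂, C₂, hF⟩ := hA.exists_flow hs hS fun z hz => hrD hz
  -- `L` dominates the constants of the three estimates, so that `ε⁻¹ ≥ L` can serve as constant in
  -- all of them. The other two bounds on `ε` bring `‖w‖⁻¹` below the thresholds of the two maps.
  set L : ℝ := max 1 (max (|C₀| * c ^ 3) (max ((|C₁| + |C₂|) * c ^ 4) ((|C₁| + |C₂|) * c ^ 3)))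
  set ε : ℝ := min L⁻¹ (min (ε₁ / c) (ε₂ / c))
  have hL : 0 < L := lt_of_lt_of_le one_pos (le_max_left _ _)
  have hε : 0 < ε := by positivity
  have hLε : L ≤ ε⁻¹ := by
    rw [← inv_inv L]
    exact inv_anti₀ hε (min_le_left _ _)
  refine ⟨ε, hε, Filter.eventually_of_mem (Metric.closedBall_mem_nhds z₀ hr) ?_⟩
  intro z hz _ a ha hεa
  obtain ⟨w, rfl | hw⟩ := exists_eq_ofCoords hu a ha
  swap
  · exact absurd (hA.mem_base (hrD hz)) hw
  set ρ : ℝ := bdryNorm φ g (ofCoords 𝓘(ℝ, E) (bdryT φ) u (z, w))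
  have hρ : 0 < ρ := (inv_pos.2 hε).trans_le hεa
  have hρw : ρ ≤ c * ‖w‖ := hnorm z hz w
  have hwpos : 0 < ‖w‖ := by
    by_contra hcon
    have := norm_nonneg w
    nlinarith
  have hw0 : w ≠ 0 := norm_pos_iff.1 hwpos
  have hwρ : ‖w‖⁻¹ ≤ c / ρ := by
    rw [inv_eq_one_div, div_le_div_iff₀ hwpos hρ]
    linarith
  have hcρ : c / ρ ≤ c * ε := by
    rw [div_eq_mul_inv]
    gcongr
    exact inv_le_of_inv_le₀ hε hεa
  have hw1 : ‖w‖⁻¹ ≤ ε₁ := by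
    refine (hwρ.trans hcρ).trans ?_
    rw [mul_comm, ← le_div_iff₀ hc]
    exact (min_le_right _ _).trans (min_le_left _ _)
  have hw2 : ‖w‖⁻¹ ≤ ε₂ := by
    refine (hwρ.trans hcρ).trans ?_
    rw [mul_comm, ← le_div_iff₀ hc]
    exact (min_le_right _ _).trans (min_le_right _ _)
  have hwinv : 0 < ‖w‖⁻¹ := inv_pos.2 hwpos
  have hP : ‖‖w‖⁻¹ • w‖ = 1 := by simp [norm_smul, hwpos.ne']
  have hpow : ∀ (A : ℝ) (n : ℕ), 0 ≤ A → A * c ^ n ≤ L → A * ‖w‖⁻¹ ^ n ≤ ε⁻¹ / ρ ^ n := by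
    intro A n hA hAL
    calc A * ‖w‖⁻¹ ^ n ≤ A * (c / ρ) ^ n := by gcongr
      _ = A * c ^ n / ρ ^ n := by rw [div_pow]; ring
      _ ≤ ε⁻¹ / ρ ^ n := by gcongr; exact hAL.trans hLε
  have hL0 : |C₀| * c ^ 3 ≤ L := (le_max_left _ _).trans (le_max_right _ _)
  have hL4 : (|C₁| + |C₂|) * c ^ 4 ≤ L :=
    (le_max_left _ _).trans ((le_max_right _ _).trans (le_max_right _ _))
  have hL3 : (|C₁| + |C₂|) * c ^ 3 ≤ L :=
    (le_max_right _ _).trans ((le_max_right _ _).trans (le_max_right _ _))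
  obtain ⟨z₁, w₁, hz₁, hb, hbu, h1⟩ := hT _ hwinv hw1 z hz _ hP
  obtain ⟨z₂, w₂, hz₂, hf, hfu, h2⟩ := hF _ hwinv hw2 z hz _ hP
  have hww : (‖w‖⁻¹)⁻¹ • ‖w‖⁻¹ • w = w := inv_smul_smul₀ hwinv.ne' w
  rw [hww] at hb hbu hf hfu
  have hdiff : ‖(z₁ - z₂, ‖w‖⁻¹ • (w₁ - w₂))‖ ≤ (|C₁| + |C₂|) * ‖w‖⁻¹ ^ 4 := by
    -- Subtracting the two expansions removes the initial point and the common leading term.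
    have h3 : ((z₁ - z₂, ‖w‖⁻¹ • (w₁ - w₂)) : Coord d × (Coord d →L[ℝ] ℝ)) =
        ((z₁, ‖w‖⁻¹ • w₁) - (z, ‖w‖⁻¹ • w) - ‖w‖⁻¹ ^ 2 •
          shift (dualMetric g u) (conormal g φ u) z (‖w‖⁻¹ • w)) -
        ((z₂, ‖w‖⁻¹ • w₂) - (z, ‖w‖⁻¹ • w) - ‖w‖⁻¹ ^ 2 •
          shift (dualMetric g u) (conormal g φ u) z (‖w‖⁻¹ • w)) := by
      rw [sub_sub_sub_cancel_right, sub_sub_sub_cancel_right, Prod.mk_sub_mk, smul_sub]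
    rw [h3]
    refine (norm_sub_le _ _).trans ?_
    rw [add_mul]
    refine add_le_add (h1.trans ?_) (h2.trans ?_)
    · gcongr; exact le_abs_self _
    · gcongr; exact le_abs_self _
  refine ⟨?_, z₁, hz₁, z₂, hz₂, w₁, w₂, hb, hbu, hf, hfu, ?_, ?_⟩
  · refine (hN z hz w hw0).trans (le_trans ?_ (hpow _ 3 (abs_nonneg C₀) hL0))
    gcongr
    exact le_abs_self _
  · exact ((norm_fst_le _).trans hdiff).trans (hpow _ 4 (by positivity) hL4)
  · refine le_trans ?_ (hpow _ 3 (by positivity) hL3)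
    have h3 := (norm_snd_le _).trans hdiff
    change ‖‖w‖⁻¹ • (w₁ - w₂)‖ ≤ _ at h3
    rw [norm_smul, Real.norm_of_nonneg hwinv.le] at h3
    refine le_of_mul_le_mul_left (h3.trans (le_of_eq ?_)) hwinv
    ring

/-- On the whole hypersurface the maps are defined for large covectors. -/
theorem IsSemigeodesic.exists_unique_maps [T2Space M] {δ : ℝ} {f : M → ℝ → M}
    (hs : IsSemigeodesic φ g δ f B) (hφ : ContMDiff 𝓘(ℝ, E) 𝓘(ℝ, ℝ) ∞ φ)
    (hreg : ∀ q ∈ bdry φ, dPhi (E := E) φ q ≠ 0) (hcomp : IsCompact (bdry φ)) :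
    ∃ ε > 0, ∀ a : BdryCotangent (E := E) φ, a.1 ∈ bdry φ → ε⁻¹ ≤ bdryNorm φ g a →
      (∃! b, IsBilliardMap φ g a b) ∧
      (∃! b, IsFlow 𝓘(ℝ, E) (bdry φ) (bdryT φ) (averagedN B) Real.pi a b) ∧
      |averagedN B a + formK0 B a ^ (-(1 / 2) : ℝ)| ≤ ε⁻¹ / bdryNorm φ g a ^ 3 := by
  have hloc : ∀ q ∈ bdry φ, ∃ ε > 0, ∀ᶠ q' in 𝓝[bdry φ] q,
      ∃ (d : ℕ) (u : Coord d → M) (V : Set (Coord d)) (z : Coord d),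
        u z = q' ∧ HasAsymptotics g B u V ε z := by
    intro q hq
    obtain ⟨d, u, V, z₀, hu, hz₀, rfl⟩ := exists_isLocalCoord hφ hq (hreg q hq)
    obtain ⟨ε, hε, h⟩ := hs.eventually_hasAsymptotics hφ hu hz₀ (hreg _ hq)
    -- Local parametrizations are open onto their image, so a statement near `z₀` becomes one near
    -- `u z₀` in `Γ`.
    obtain ⟨W, hW, hWo, hzW⟩ := eventually_nhds_iff.1 (h.and (hu.isOpen.mem_nhds hz₀))
    obtain ⟨O, hO, hOW⟩ := hu.openMap W (fun z hz => (hW z hz).2) hWo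
    have hqO : u z₀ ∈ bdry φ ∩ O := hOW ▸ Set.mem_image_of_mem u hzW
    refine ⟨ε, hε, ?_⟩
    filter_upwards [mem_nhdsWithin_of_mem_nhds (hO.mem_nhds hqO.2), self_mem_nhdsWithin]
      with q' hq' hq''
    obtain ⟨z, hz, rfl⟩ : q' ∈ u '' W := hOW ▸ ⟨hq'', hq'⟩
    exact ⟨d, u, V, z, rfl, (hW z hz).1⟩
  obtain ⟨ε, hε, h⟩ := exists_pos_of_isCompact hcomp
    (p := fun ε q => ∃ (d : ℕ) (u : Coord d → M) (V : Set (Coord d)) (z : Coord d),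
      u z = q ∧ HasAsymptotics g B u V ε z)
    (fun ε ε' q ⟨d, u, V, z, hz, h⟩ hε => ⟨d, u, V, z, hz, h.mono hε⟩) hloc
  refine ⟨ε, hε, fun a ha hεa => ?_⟩
  obtain ⟨d, u, V, z, hz, h⟩ := h a.1 ha
  obtain ⟨h1, z₁, -, z₂, -, w₁, w₂, h2, h3, h4, h5, -⟩ := h hε a hz.symm hεa
  exact ⟨⟨_, h2, h3⟩, ⟨_, h4, h5⟩, h1⟩

end Asymptotics

end Billiard

end

/-! ### Assembly of the theorem -/

theorem mainTheorem3
    {E : Type*} [NormedAddCommGroup E] [NormedSpace ℝ E] [FiniteDimensional ℝ E]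
    {M : Type*} [TopologicalSpace M] [T2Space M] [SigmaCompactSpace M]
    [ChartedSpace E M] [IsManifold 𝓘(ℝ, E) ∞ M]
    (g : Bundle.ContMDiffRiemannianMetric 𝓘(ℝ, E) ∞ E (fun x : M => TangentSpace 𝓘(ℝ, E) x))
    (φ : M → ℝ) (hφ : ContMDiff 𝓘(ℝ, E) 𝓘(ℝ, ℝ) ∞ φ)
    (hreg : ∀ q ∈ Billiard.bdry φ, Billiard.dPhi (E := E) φ q ≠ 0)
    (hcomp : IsCompact (Billiard.bdry φ)) :
    -- semigeodesic coordinates exist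
    (∃ δ f B, Billiard.IsSemigeodesic φ g δ f B) ∧
    -- and for the Hamiltonian `N` that they define:
    ∀ δ f B, Billiard.IsSemigeodesic φ g δ f B →
      -- the maps `T` and `Φ_N^π` are well defined for `‖p‖ ≥ ε⁻¹`
      (∃ ε₀ > 0, ∀ ε, 0 < ε → ε ≤ ε₀ → ∀ a : Billiard.BdryCotangent (E := E) φ,
        a.1 ∈ Billiard.bdry φ → ε⁻¹ ≤ Billiard.bdryNorm φ g a →
          (∃! b, Billiard.IsBilliardMap φ g a b) ∧
          (∃! b, Billiard.IsFlow 𝓘(ℝ, E) (Billiard.bdry φ) (Billiard.bdryT φ)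
            (Billiard.averagedN B) Real.pi a b)) ∧
      -- `N = -K₀^(-1/2) + O(‖p‖⁻³)`
      (∃ ε > 0, ∃ C : ℝ, ∀ a : Billiard.BdryCotangent (E := E) φ,
        a.1 ∈ Billiard.bdry φ → ε⁻¹ ≤ Billiard.bdryNorm φ g a →
          |Billiard.averagedN B a + Billiard.formK0 B a ^ (-(1 / 2) : ℝ)| ≤
            C / Billiard.bdryNorm φ g a ^ 3) ∧
      -- `T = Φ_N^π + (O(‖p‖⁻⁴), O(‖p‖⁻³))`, uniformly on compact subsets of the domain of any
      -- local coordinates on `Γ`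
      (∀ (d : ℕ) (u : EuclideanSpace ℝ (Fin d) → M) (V K : Set (EuclideanSpace ℝ (Fin d))),
        Billiard.IsLocalCoord 𝓘(ℝ, E) (Billiard.bdry φ) (Billiard.bdryT φ) u V →
        IsCompact K → K ⊆ V →
        ∃ ε > 0, ∃ C : ℝ, ∀ (a b b' : Billiard.BdryCotangent (E := E) φ),
          a.1 ∈ u '' K → ε⁻¹ ≤ Billiard.bdryNorm φ g a →
          Billiard.IsBilliardMap φ g a b →
          Billiard.IsFlow 𝓘(ℝ, E) (Billiard.bdry φ) (Billiard.bdryT φ)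
            (Billiard.averagedN B) Real.pi a b' →
          ∃ z ∈ V, ∃ z' ∈ V, ∃ w w' : EuclideanSpace ℝ (Fin d) →L[ℝ] ℝ,
            b = Billiard.ofCoords 𝓘(ℝ, E) (Billiard.bdryT φ) u (z, w) ∧
            b' = Billiard.ofCoords 𝓘(ℝ, E) (Billiard.bdryT φ) u (z', w') ∧
            ‖z - z'‖ ≤ C / Billiard.bdryNorm φ g a ^ 4 ∧
            ‖w - w'‖ ≤ C / Billiard.bdryNorm φ g a ^ 3) := by
  refine ⟨Billiard.exists_isSemigeodesic hφ hreg hcomp, fun δ f B hs => ?_⟩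
  obtain ⟨ε₀, hε₀, h₀⟩ := hs.exists_unique_maps hφ hreg hcomp
  refine ⟨⟨ε₀, hε₀, fun ε hε hεε a ha hεa => ?_⟩, ⟨ε₀, hε₀, ε₀⁻¹, fun a ha hεa =>
    (h₀ a ha hεa).2.2⟩, fun d u V K hu hK hKV => ?_⟩
  · have h := h₀ a ha ((inv_anti₀ hε hεε).trans hεa)
    exact ⟨h.1, h.2.1⟩
  -- In the prescribed coordinates the estimates hold near each point of `K`, and compactness makes
  -- them uniform. Uniqueness of the images then identifies the given `b` and `b'` with the points
  -- of the estimates.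
  · obtain ⟨ε, hε, h⟩ := Billiard.exists_pos_of_isCompact hK
      (p := Billiard.HasAsymptotics g B u V) (fun _ _ _ h hε => h.mono hε) fun z hz => by
        obtain ⟨ε, hε, h⟩ := hs.eventually_hasAsymptotics hφ hu (hKV hz)
          (hreg _ (hu.mapsTo (hKV hz)))
        exact ⟨ε, hε, h.filter_mono nhdsWithin_le_nhds⟩
    refine ⟨ε, hε, ε⁻¹, ?_⟩
    rintro a b b' ⟨z, hz, hza⟩ hεa hb hb'
    obtain ⟨-, z₁, hz₁, z₂, hz₂, w₁, w₂, -, h1, -, h2, h3, h4⟩ := h z hz hε a hza.symm hεa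
    exact ⟨z₁, hz₁, z₂, hz₂, w₁, w₂, h1 b hb, h2 b' hb', h3, h4⟩
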